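/- Let $\Bbbk$ be an algebraically closed field and let $A$ be a basic, connected, non-simple, self-injective, finite dimensional $\Bbbk$-algebra with a primitive decomposition $1=e_1+\dots+e_n$. Let $\nu$ be its Nakayama permutation: the socle of $Ae_i$ is isomorphic to the top of $Ae_{\nu(i)}$. Let $\mathscr{C}_A$ be the $2$-category with one object whose $1$-morphisms are the projective functors on finite dimensional $A$-modules (direct summands of finite direct sums of the identity functor and of the functor $(A\otimes_\Bbbk A)\otimes_A-$) and whose $2$-morphisms are natural transformations. Let $\mathrm F_{ij}$ be the $1$-morphism $(Ae_i\otimes_\Bbbk e_jA)\otimes_A-$ and let $\mathcal L_i$ be the left cell of $\mathrm F_{ii}$. For a finitary $2$-representation $\mathbf N$ of $\mathscr{C}_A$ write $X\to Y$ for indecomposable objects $X,Y$ if $Y$ is a direct summand of $\mathrm F\,X$ for some $1$-morphism $\mathrm F$. The diagram of $\mathbf N$ is the Hasse diagram of the poset of equivalence classes of indecomposable objects for this preorder. In the decorated diagram, an edge between $\rho$ and $\tau$ with $\rho\to\tau$ is decorated by the set of all (isomorphism classes of) indecomposable $1$-morphisms $\mathrm F$ such that, for some $X\in\rho$, the object $\mathrm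 F\,X$ has a direct summand in $\tau$. Let $\Gamma$ be a finite bipartite graph with upper vertices $V$, lower vertices $W$ and edges $\Gamma_1\subset V\times W$, and let $\eta:\Gamma_1\to\{1,\dots,n\}$ satisfy $\eta(v_1,w)=\eta(v_2,w)$ whenever $(v_1,w),(v_2,w)\in\Gamma_1$. Let $\theta:W\to\{1,\dots,n\}$ be any function with $\theta(w)=\eta(v,w)$ for all $(v,w)\in\Gamma_1$ (its value at an isolated $w$ is arbitrary; such a function exists). Let $\boldsymbol\Gamma$ be the quiver with vertex set $V\sqcup W$ and one arrow $v\to w$ for each $(v,w)\in\Gamma_1$, and let $\mathcal P$ be a small category equivalent to the category of finitely generated projective $\Bbbk\boldsymbol\Gamma$-modules, with indecomposable objects $P_x$, $x\in V\sqcup W$, where $\mathrm{Hom}(P_x,P_y)$ has as basis the paths from $y$ to $x$. Let $\overline{\mathbf M}$ be the abelianization of the inflation $\mathbf P^{\boxtimes\mathcal P}$ of the principal $2$-representation $\mathbf P$ of $\mathscr{C}_A$. Let $L_{0,x}$ and $L_{i,j,x}$ be the simple tops of the projective objects of $\overline{\mathbf M}$ given by $\mathbb 1\boxtimes P_x$ and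 $\mathrm F_{ij}\boxtimes P_x$, where $\mathbb 1$ is the identity $1$-morphism. Then there exist, for all $i$, all $x\in V\sqcup W$ and all $(v,w)\in\Gamma_1$, non-split short exact sequences $$0\to L_{0,x}\to\nabla(i,x)\to L_{i,\nu(i),x}\to 0,\qquad 0\to L_{0,w}\to N_{(v,w)}\to L_{0,v}\to 0 .$$ For $v\in V$ let $0\to X\to Y\to Z\to 0$ be the direct sum, over all $w$ with $(v,w)\in\Gamma_1$, of the sequences for $\nabla(\eta(v,w),w)$; let $0\to X\to N_v\to L_{0,v}\to 0$ be the pullback of the direct sum of the sequences for $N_{(v,w)}$, over the same $w$, along the diagonal embedding of $L_{0,v}$; and let $0\to N_v\to M_v\to Z\to 0$ be the pushout of $0\to X\to Y\to Z\to 0$ along $X\to N_v$. Let $\mathcal X$ be the additive closure in $\overline{\mathbf M}$ of all $M_v$, $v\in V$, and of all $\mathrm F_{ji}\,L_{i,\nu(i),w}$ with $w\in W$, $i=\theta(w)$ and $j\in\{1,\dots,n\}$. Then, for every choice of these objects and sequences: (i) $\mathcal X$ is stable under the action of $\mathscr{C}_A$, and the restriction of the action to $\mathcal X$ is a finitary $2$-representation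 $\mathbf N$ of $\mathscr{C}_A$. (ii) The diagram of $\mathbf N$ is $\Gamma$: there is an isomorphism of graphs under which $v\in V$ corresponds to the class of $M_v$, and $w\in W$ corresponds to the class of $\mathrm F_{j\theta(w)}\,L_{\theta(w),\nu(\theta(w)),w}$ for each $j$. In particular these objects are indecomposable in $\mathcal X$. (iii) For every $(v,w)\in\Gamma_1$ the class of $v$ lies before the class of $w$ (in the order $\to$), and the corresponding edge of the decorated diagram is decorated by $\mathcal L_{\eta(v,w)}$. -/

import Mathlib

open CategoryTheory TensorProduct
open scoped ModuleCat

universe u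
noncomputable section

namespace ProjFunctors

section AddClosure
variable {C : Type*} [Category* C] [Preadditive C]

/-- `addClosure S` : objects that are direct summands of finite direct sums of objects in `S`. -/
def addClosure (S : ObjectProperty C) : ObjectProperty C := fun X =>
  ∃ (ι : Type) (_ : Fintype ι) (Y : ι → C) (p : ∀ s, X ⟶ Y s) (q : ∀ s, Y s ⟶ X),
    (∀ s, S (Y s)) ∧ ∑ s, p s ≫ q s = 𝟙 X

theorem le_addClosure (S : ObjectProperty C) {X : C} (h : S X) : addClosure S X :=
  ⟨Unit, inferInstance, fun _ => X, fun _ => 𝟙 X, fun _ => 𝟙 X, fun _ => h, by simp⟩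

theorem addClosure_of_sum {S : ObjectProperty C} {X : C} (ι : Type) [Fintype ι] (Y : ι → C)
    (p : ∀ s, X ⟶ Y s) (q : ∀ s, Y s ⟶ X) (h : ∀ s, addClosure S (Y s))
    (e : ∑ s, p s ≫ q s = 𝟙 X) : addClosure S X := by
  choose κ hκ Z a b hZ hab using h
  refine ⟨Σ s, κ s, inferInstance, fun t => Z t.1 t.2, fun t => p t.1 ≫ a t.1 t.2,
    fun t => b t.1 t.2 ≫ q t.1, fun t => hZ t.1 t.2, ?_⟩
  rw [Fintype.sum_sigma, ← e]
  refine Finset.sum_congr rfl fun s _ => ?_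
  have h := congrArg (fun x => p s ≫ x ≫ q s) (hab s)
  simpa [Preadditive.comp_sum, Preadditive.sum_comp] using h

end AddClosure

section ProjectiveFunctors

variable (k : Type u) [Field k] (A : Type u) [Ring A] [Algebra k A] [FiniteDimensional k A]

instance finite_of_fg (N : FGModuleCat.{u} A) : Module.Finite k N :=
  Module.Finite.trans A N

/-- The functor `N ↦ A ⊗ₖ N ≅ (A ⊗ₖ A) ⊗_A N`. -/
def freeFunctor : FGModuleCat.{u} A ⥤ FGModuleCat.{u} A where
  obj N := FGModuleCat.of A (A ⊗[k] N)
  map f := FGModuleCat.ofHom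
    (TensorProduct.AlgebraTensorModule.map LinearMap.id (f.hom.hom.restrictScalars k))
  map_id _ := FGModuleCat.hom_ext (TensorProduct.AlgebraTensorModule.ext fun _ _ => rfl)
  map_comp _ _ := FGModuleCat.hom_ext (TensorProduct.AlgebraTensorModule.ext fun _ _ => rfl)

/-- The subspace `f N` of an `A`-module `N`. -/
abbrev cutModule (f : A) (N : FGModuleCat.{u} A) : Submodule k N :=
  LinearMap.range (Algebra.lsmul k k N f)

variable {A} in
/-- The restriction `f N → f N'` of an `A`-linear map `N → N'`. -/
def cutMap (f : A) {N N' : FGModuleCat.{u} A} (g : N ⟶ N') :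
    cutModule k A f N →ₗ[k] cutModule k A f N' :=
  (g.hom.hom.restrictScalars k).restrict (by
    rintro _ ⟨y, rfl⟩
    exact ⟨g.hom.hom y, by simp⟩)

instance finite_tensor (e f : A) (N : FGModuleCat.{u} A) :
    Module.Finite A (Submodule.span A {e} ⊗[k] cutModule k A f N) :=
  Module.Finite.of_restrictScalars_finite k A _

/-- The functor `N ↦ Ae ⊗ₖ fN ≅ (Ae ⊗ₖ fA) ⊗_A N`. -/
def tensorFunctor (e f : A) : FGModuleCat.{u} A ⥤ FGModuleCat.{u} A where
  obj N := FGModuleCat.of A (Submodule.span A {e} ⊗[k] cutModule k A f N)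
  map g := FGModuleCat.ofHom
    (TensorProduct.AlgebraTensorModule.map LinearMap.id (cutMap k f g))
  map_id _ := FGModuleCat.hom_ext (TensorProduct.AlgebraTensorModule.ext fun _ _ => rfl)
  map_comp _ _ := FGModuleCat.hom_ext (TensorProduct.AlgebraTensorModule.ext fun _ _ => rfl)

/-- Projective functors: direct summands of finite direct sums of copies of the identity functor
and of the functor of tensoring with the bimodule `A ⊗ₖ A`. -/
def isProjective : ObjectProperty (FGModuleCat.{u} A ⥤ FGModuleCat.{u} A) :=
  addClosure fun F => F = 𝟭 _ ∨ F = freeFunctor k A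

instance : (freeFunctor k A).Additive where
  map_add {_ _ f g} := FGModuleCat.hom_ext (TensorProduct.AlgebraTensorModule.ext fun a n =>
    TensorProduct.tmul_add a (f.hom.hom n) (g.hom.hom n))

instance : (freeFunctor k A).Linear k where
  map_smul {X Y} f r := FGModuleCat.hom_ext (TensorProduct.AlgebraTensorModule.ext fun a n => by
    change a ⊗ₜ[k] (algebraMap k A r • f.hom.hom n) = (algebraMap k A r) • (a ⊗ₜ[k] (f.hom.hom n))
    rw [TensorProduct.smul_tmul']
    change a ⊗ₜ[k] (r • f.hom.hom n) = _
    rw [TensorProduct.tmul_smul, TensorProduct.smul_tmul', Algebra.smul_def, smul_eq_mul])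

variable {k A}

theorem map_eq_sum {F : FGModuleCat.{u} A ⥤ FGModuleCat.{u} A} {ι : Type} [Fintype ι]
    {Y : ι → FGModuleCat.{u} A ⥤ FGModuleCat.{u} A} {p : ∀ s, F ⟶ Y s} {q : ∀ s, Y s ⟶ F}
    (h : ∑ s, p s ≫ q s = 𝟙 F) {M N : FGModuleCat.{u} A} (f : M ⟶ N) :
    F.map f = ∑ s, (p s).app M ≫ (Y s).map f ≫ (q s).app N := by
  have h1 : F.map f = F.map f ≫ (∑ s, p s ≫ q s).app N := by rw [h]; simp
  rw [h1, NatTrans.app_sum, Preadditive.comp_sum]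
  simp

theorem isProjective.additive {F : FGModuleCat.{u} A ⥤ FGModuleCat.{u} A}
    (hF : isProjective k A F) : F.Additive := by
  obtain ⟨ι, _, Y, p, q, hY, h⟩ := hF
  have : ∀ s, (Y s).Additive := fun s => by
    rcases hY s with h | h <;> rw [h] <;> infer_instance
  exact ⟨fun {X Z f g} => by
    rw [map_eq_sum h, map_eq_sum h f, map_eq_sum h g, ← Finset.sum_add_distrib]
    simp only [Functor.map_add, Preadditive.add_comp, Preadditive.comp_add]⟩

theorem isProjective.linear {F : FGModuleCat.{u} A ⥤ FGModuleCat.{u} A}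
    (hF : isProjective k A F) : F.Linear k := by
  obtain ⟨ι, _, Y, p, q, hY, h⟩ := hF
  have : ∀ s, (Y s).Linear k := fun s => by
    rcases hY s with h | h <;> rw [h] <;> infer_instance
  exact ⟨fun {X Z} f r => by
    rw [map_eq_sum h, map_eq_sum h f, Finset.smul_sum]
    simp only [Functor.map_smul, Linear.smul_comp, Linear.comp_smul]⟩

theorem algebraMap_smul_tensor (r : k) (N : FGModuleCat.{u} A) (x : A ⊗[k] N) :
    algebraMap k A r • x = r • x := algebraMap_smul A r x

/-- The map `A ⊗ N → N` given by a linear form on `A`. -/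
def contract (φ : A →ₗ[k] k) (N : FGModuleCat.{u} A) : A ⊗[k] N →ₗ[k] N :=
  TensorProduct.lift ((LinearMap.lsmul k N).comp φ)

/-- `contract`, for the `k`-structure underlying the `A`-module `A ⊗ N`. -/
def contract' (φ : A →ₗ[k] k) (N : FGModuleCat.{u} A) : (freeFunctor k A).obj N →ₗ[k] N where
  toFun := contract φ N
  map_add' := map_add (contract φ N)
  map_smul' r x := (congrArg (contract φ N) (algebraMap_smul_tensor r N x)).trans
    (map_smul (contract φ N) r (show A ⊗[k] N from x))

/-- The map `N → A ⊗ N` given by an element of `A`. -/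
def expand (b : A) (N : FGModuleCat.{u} A) : N →ₗ[k] (freeFunctor k A).obj N where
  toFun n := (b ⊗ₜ[k] n : A ⊗[k] N)
  map_add' := TensorProduct.tmul_add b
  map_smul' r x := (TensorProduct.tmul_smul r b x).trans
    (algebraMap_smul_tensor r N (b ⊗ₜ[k] x)).symm

theorem contract_natural (φ : A →ₗ[k] k) {N N' : FGModuleCat.{u} A} (f : N ⟶ N')
    (x : A ⊗[k] N) :
    contract φ N' (((freeFunctor k A).map f).hom.hom x) = f.hom.hom (contract φ N x) := by
  change (contract φ N' ∘ₗ (TensorProduct.map LinearMap.id (f.hom.hom.restrictScalars k))) x =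
    ((f.hom.hom.restrictScalars k) ∘ₗ contract φ N) x
  refine LinearMap.congr_fun (TensorProduct.ext' fun a n => ?_) x
  simp [contract]

theorem expand_contract {ι : Type} [Fintype ι] (b : Module.Basis ι k A) (N : FGModuleCat.{u} A)
    (x : A ⊗[k] N) : ∑ s, (b s) ⊗ₜ[k] contract (b.coord s) N x = x := by
  induction x using TensorProduct.induction_on with
  | zero => simp
  | add x y hx hy => simp [TensorProduct.tmul_add, Finset.sum_add_distrib, hx, hy]
  | tmul a n =>
    have : ∀ s, contract (b.coord s) N (a ⊗ₜ[k] n) = b.repr a s • n := fun s => by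
      simp [contract]
    simp_rw [this, TensorProduct.tmul_smul, TensorProduct.smul_tmul', ← TensorProduct.sum_tmul,
      b.sum_repr]

theorem freeFunctor_comp : isProjective k A (freeFunctor k A ⋙ freeFunctor k A) := by
  let b := Module.finBasis k A
  refine ⟨Fin (Module.finrank k A), inferInstance, fun _ => freeFunctor k A,
    fun s => { app := fun N => FGModuleCat.ofHom
                 (TensorProduct.AlgebraTensorModule.map LinearMap.id (contract' (b.coord s) N))
               naturality := ?_ },
    fun s => { app := fun N => FGModuleCat.ofHom
                 (TensorProduct.AlgebraTensorModule.map LinearMap.id (expand (b s) N))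
               naturality := ?_ }, fun _ => Or.inr rfl, ?_⟩
  · intro X Y f
    exact FGModuleCat.hom_ext (TensorProduct.AlgebraTensorModule.ext fun a n =>
      congrArg (fun y => a ⊗ₜ[k] y) (contract_natural (b.coord s) f n))
  · intro X Y f
    exact FGModuleCat.hom_ext (TensorProduct.AlgebraTensorModule.ext fun a n => rfl)
  · ext N : 2
    rw [NatTrans.app_sum]
    refine FGModuleCat.hom_ext (TensorProduct.AlgebraTensorModule.ext fun a n => ?_)
    have h := congrArg (fun y : (freeFunctor k A).obj N => a ⊗ₜ[k] y) (expand_contract b N n)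
    refine Eq.trans ?_ h
    refine Eq.trans ?_ (TensorProduct.tmul_sum a Finset.univ
      (fun s => (expand (b s) N (contract (b.coord s) N n)))).symm
    exact map_sum (AddMonoidHom.mk' (fun g : (freeFunctor k A ⋙ freeFunctor k A).obj N ⟶
      (freeFunctor k A ⋙ freeFunctor k A).obj N => g.hom.hom (a ⊗ₜ[k] n)) (fun _ _ => rfl)) _ _

theorem isProjective_id : isProjective k A (𝟭 _) := le_addClosure _ (Or.inl rfl)

theorem isProjective_free : isProjective k A (freeFunctor k A) := le_addClosure _ (Or.inr rfl)

theorem isProjective.comp {F G : FGModuleCat.{u} A ⥤ FGModuleCat.{u} A}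
    (hG : isProjective k A G) (hF : isProjective k A F) : isProjective k A (G ⋙ F) := by
  obtain ⟨ι, _, Y, p, q, hY, h⟩ := hF
  refine addClosure_of_sum ι (fun s => G ⋙ Y s) (fun s => Functor.whiskerLeft G (p s))
    (fun s => Functor.whiskerLeft G (q s)) (fun s => ?_) ?_
  · obtain ⟨κ, _, Z, a, b, hZ, h'⟩ := hG
    have : (Y s).Additive := by rcases hY s with h | h <;> rw [h] <;> infer_instance
    refine addClosure_of_sum κ (fun t => Z t ⋙ Y s) (fun t => Functor.whiskerRight (a t) (Y s))
      (fun t => Functor.whiskerRight (b t) (Y s)) (fun t => ?_) ?_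
    · rcases hY s with h | h <;> rcases hZ t with h' | h' <;> rw [h, h']
      · exact isProjective_id
      · exact isProjective_free
      · exact isProjective_free
      · exact freeFunctor_comp
    · ext N : 2
      have := congrArg (fun x => (Y s).map (x.app N)) h'
      simpa [NatTrans.app_sum, Functor.map_sum] using this
  · ext N : 2
    have := congrArg (fun x => x.app (G.obj N)) h
    simpa [NatTrans.app_sum] using this

theorem isProjective_tensor {e f : A} (he : IsIdempotentElem e) (hf : IsIdempotentElem f) :
    isProjective k A (tensorFunctor k A e f) := by
  have h1 : ∀ a : A, a * e ∈ Submodule.span A {e} := fun a =>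
    Submodule.smul_mem _ a (Submodule.mem_span_singleton_self e)
  refine ⟨Unit, inferInstance, fun _ => freeFunctor k A,
    fun _ => { app := fun N => FGModuleCat.ofHom
                 (TensorProduct.AlgebraTensorModule.map (Submodule.subtype _)
                   (Submodule.subtype (cutModule k A f N)))
               naturality := ?_ },
    fun _ => { app := fun N => FGModuleCat.ofHom
                 (TensorProduct.AlgebraTensorModule.map
                   ((LinearMap.toSpanSingleton A A e).codRestrict _ h1)
                   (Algebra.lsmul k k N f).rangeRestrict)
               naturality := ?_ }, fun _ => Or.inr rfl, ?_⟩
  · intro X Y g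
    exact FGModuleCat.hom_ext (TensorProduct.AlgebraTensorModule.ext fun a n => rfl)
  · intro X Y g
    refine FGModuleCat.hom_ext (TensorProduct.AlgebraTensorModule.ext fun a n => ?_)
    refine congrArg (fun y => _ ⊗ₜ[k] y) (Subtype.ext ?_)
    exact (map_smul g.hom.hom f n).symm
  · rw [Fintype.sum_unique]
    ext N : 2
    refine FGModuleCat.hom_ext (TensorProduct.AlgebraTensorModule.ext ?_)
    rintro ⟨a, ha⟩ ⟨_, n, rfl⟩
    obtain ⟨c, rfl⟩ := Submodule.mem_span_singleton.1 ha
    refine congrArg₂ (fun x y => x ⊗ₜ[k] y) (Subtype.ext ?_) (Subtype.ext ?_)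
    · change (c * e) * e = c * e
      rw [mul_assoc, he.eq]
    · change f • (f • n) = f • n
      rw [smul_smul, hf.eq]

end ProjectiveFunctors

section LinEnd
variable (k : Type*) [Field k] (M : Type*) [Category* M] [Preadditive M] [Linear k M]

/-- `k`-linear endofunctors. -/
def isLin : ObjectProperty (M ⥤ M) := fun F => F.Additive ∧ F.Linear k

/-- The category of `k`-linear endofunctors of `M`. -/
abbrev LinEnd := (isLin k M).FullSubcategory

variable {k M}

instance (F : LinEnd k M) : F.obj.Additive := F.property.1
instance (F : LinEnd k M) : F.obj.Linear k := F.property.2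

namespace LinEnd

variable (k M) in
/-- The identity functor. -/
def one : LinEnd k M := ⟨𝟭 M, inferInstance, inferInstance⟩

/-- The composite `F ∘ G`. -/
def comp (F G : LinEnd k M) : LinEnd k M := ⟨G.obj ⋙ F.obj, inferInstance, inferInstance⟩

/-- Horizontal composition `α ∘ β : F ∘ G ⟶ F' ∘ G'`. -/
def hcomp {F F' G G' : LinEnd k M} (α : F ⟶ F') (β : G ⟶ G') : comp F G ⟶ comp F' G' :=
  ObjectProperty.homMk (β.hom ◫ α.hom)

theorem ext' {F G : LinEnd k M} (h : F.obj = G.obj) : F = G := by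
  cases F; cases G; cases h; rfl

theorem hom_heq {F F' G G' : LinEnd k M} (hF : F = F') (hG : G = G') (α : F ⟶ G) (α' : F' ⟶ G')
    (h : ∀ X, HEq (α.hom.app X) (α'.hom.app X)) : HEq α α' := by
  subst hF hG
  refine heq_of_eq (ObjectProperty.hom_ext _ (NatTrans.ext (funext fun X => eq_of_heq (h X))))

end LinEnd
end LinEnd

section Tensor

/-- The objects `X ⊠ P` of the tensor product of two `k`-linear categories. -/
structure TensorCat (k C D : Type*) where
  /-- the first tensor factor -/
  fst : C
  /-- the second tensor factor -/
  snd : D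

variable (k : Type*) [Field k] (C D : Type*) [Category* C] [Preadditive C] [Linear k C]
  [Category* D] [Preadditive D] [Linear k D]

variable {C D} in
/-- Factorwise composition of tensors of morphisms. -/
def tensorComp (X Y Z : TensorCat k C D) :
    (X.fst ⟶ Y.fst) ⊗[k] (X.snd ⟶ Y.snd) →ₗ[k] (Y.fst ⟶ Z.fst) ⊗[k] (Y.snd ⟶ Z.snd) →ₗ[k]
      (X.fst ⟶ Z.fst) ⊗[k] (X.snd ⟶ Z.snd) :=
  TensorProduct.map₂ (Linear.comp (S := k) X.fst Y.fst Z.fst)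
    (Linear.comp (S := k) X.snd Y.snd Z.snd)

@[simp]
theorem tensorComp_tmul (X Y Z : TensorCat k C D) (f : X.fst ⟶ Y.fst) (g : X.snd ⟶ Y.snd)
    (f' : Y.fst ⟶ Z.fst) (g' : Y.snd ⟶ Z.snd) :
    tensorComp k X Y Z (f ⊗ₜ g) (f' ⊗ₜ g') = (f ≫ f') ⊗ₜ (g ≫ g') := by
  simp [tensorComp]

/-- `Hom(X ⊠ P, Y ⊠ Q) = Hom(X, Y) ⊗ₖ Hom(P, Q)`, with factorwise composition. -/
instance : Category (TensorCat k C D) where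
  Hom X Y := (X.fst ⟶ Y.fst) ⊗[k] (X.snd ⟶ Y.snd)
  id X := 𝟙 X.fst ⊗ₜ 𝟙 X.snd
  comp {X Y Z} f g := tensorComp k X Y Z f g
  id_comp {X Y} f := by
    induction f using TensorProduct.induction_on with
    | zero => exact map_zero _
    | add x y hx hy => rw [map_add, hx, hy]
    | tmul a n => simp
  comp_id {X Y} f := by
    induction f using TensorProduct.induction_on with
    | zero => rw [map_zero, LinearMap.zero_apply]
    | add x y hx hy => rw [map_add, LinearMap.add_apply, hx, hy]
    | tmul a n => simp
  assoc {W X Y Z} f g h := by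
    induction f using TensorProduct.induction_on with
    | zero => simp only [map_zero, LinearMap.zero_apply]
    | add x y hx hy => simp only [map_add, LinearMap.add_apply, hx, hy]
    | tmul a n =>
      induction g using TensorProduct.induction_on with
      | zero => simp only [map_zero, LinearMap.zero_apply]
      | add x y hx hy => simp only [map_add, LinearMap.add_apply, hx, hy]
      | tmul b m =>
        induction h using TensorProduct.induction_on with
        | zero => simp only [map_zero]
        | add x y hx hy => simp only [map_add, hx, hy]
        | tmul c l => simp

instance (X Y : TensorCat k C D) : AddCommGroup (X ⟶ Y) :=
  inferInstanceAs (AddCommGroup ((X.fst ⟶ Y.fst) ⊗[k] (X.snd ⟶ Y.snd)))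

instance (X Y : TensorCat k C D) : Module k (X ⟶ Y) :=
  inferInstanceAs (Module k ((X.fst ⟶ Y.fst) ⊗[k] (X.snd ⟶ Y.snd)))

/-- Composition as a bilinear map. -/
def TensorCat.compHom (X Y Z : TensorCat k C D) : (X ⟶ Y) →ₗ[k] (Y ⟶ Z) →ₗ[k] (X ⟶ Z) :=
  tensorComp k X Y Z

theorem TensorCat.comp_eq {X Y Z : TensorCat k C D} (f : X ⟶ Y) (g : Y ⟶ Z) :
    f ≫ g = compHom k C D X Y Z f g := rfl

instance : Preadditive (TensorCat k C D) where
  add_comp X Y Z f f' g := by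
    simp only [TensorCat.comp_eq, map_add, LinearMap.add_apply]
  comp_add X Y Z f g g' := by
    simp only [TensorCat.comp_eq, map_add]

instance : Linear k (TensorCat k C D) where
  smul_comp X Y Z r f g := by
    simp only [TensorCat.comp_eq, map_smul, LinearMap.smul_apply]
  comp_smul X Y Z f r g := by
    simp only [TensorCat.comp_eq, map_smul]

variable {k C D}

/-- The morphism `f ⊠ g`. -/
def TensorCat.mkHom (X Y : TensorCat k C D) (f : X.fst ⟶ Y.fst) (g : X.snd ⟶ Y.snd) : X ⟶ Y :=
  f ⊗ₜ[k] g

theorem TensorCat.mkHom_comp (X Y Z : TensorCat k C D) (f : X.fst ⟶ Y.fst) (g : X.snd ⟶ Y.snd)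
    (f' : Y.fst ⟶ Z.fst) (g' : Y.snd ⟶ Z.snd) :
    mkHom X Y f g ≫ mkHom Y Z f' g' = mkHom X Z (f ≫ f') (g ≫ g') :=
  tensorComp_tmul k C D X Y Z f g f' g'

theorem TensorCat.hom_induction {X Y : TensorCat k C D} {P : (X ⟶ Y) → Prop} (f : X ⟶ Y)
    (h0 : P 0) (h1 : ∀ a b, P (mkHom X Y a b)) (h2 : ∀ a b, P a → P b → P (a + b)) : P f :=
  TensorProduct.induction_on f h0 h1 h2

/-- The object `F(X) ⊠ P` for an object `X ⊠ P`. -/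
def tensorObj (F : LinEnd k C) (X : TensorCat k C D) : TensorCat k C D :=
  ⟨F.obj.obj X.fst, X.snd⟩

/-- The action of a functor on morphisms of the first factor. -/
def tensorMap (F : LinEnd k C) (X Y : TensorCat k C D) :
    (X ⟶ Y) →ₗ[k] (tensorObj F X ⟶ tensorObj F Y) :=
  LinearMap.rTensor _ (F.obj.mapLinearMap k)

theorem tensorMap_mkHom (F : LinEnd k C) (X Y : TensorCat k C D) (f : X.fst ⟶ Y.fst)
    (g : X.snd ⟶ Y.snd) : tensorMap F X Y (TensorCat.mkHom X Y f g) =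
      TensorCat.mkHom (tensorObj F X) (tensorObj F Y) (F.obj.map f) g :=
  rfl

/-- The functor `F ⊠ Id`. -/
def tensorFun (F : LinEnd k C) : TensorCat k C D ⥤ TensorCat k C D where
  obj := tensorObj F
  map := fun {X Y} f => tensorMap F X Y f
  map_id := fun X =>
    congrArg (TensorCat.mkHom (tensorObj F X) (tensorObj F X) · (𝟙 X.snd)) (F.obj.map_id X.fst)
  map_comp := fun {X Y Z} f g => by
    induction f using TensorCat.hom_induction with
    | h0 => simp only [map_zero, Limits.zero_comp]
    | h2 a b ha hb => simp only [map_add, Preadditive.add_comp, ha, hb]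
    | h1 a b => ?_
    induction g using TensorCat.hom_induction with
    | h0 => simp only [map_zero, Limits.comp_zero]
    | h2 a b ha hb => simp only [map_add, Preadditive.comp_add, ha, hb]
    | h1 c d => ?_
    rw [TensorCat.mkHom_comp, tensorMap_mkHom, tensorMap_mkHom, tensorMap_mkHom,
      Functor.map_comp]
    exact (TensorCat.mkHom_comp (tensorObj F X) (tensorObj F Y) (tensorObj F Z)
      (F.obj.map a) b (F.obj.map c) d).symm

/-- The components `α ⊠ id` of a natural transformation. -/
def tensorApp {F G : LinEnd k C} (α : F ⟶ G) (X : TensorCat k C D) :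
    tensorObj F X ⟶ tensorObj G X :=
  TensorCat.mkHom (tensorObj F X) (tensorObj G X) (α.hom.app X.fst) (𝟙 X.snd)

theorem tensorApp_naturality {F G : LinEnd k C} (α : F ⟶ G) {X Y : TensorCat k C D}
    (f : X ⟶ Y) : tensorMap F X Y f ≫ tensorApp α Y = tensorApp α X ≫ tensorMap G X Y f := by
  induction f using TensorCat.hom_induction with
  | h0 => simp only [map_zero, Limits.zero_comp, Limits.comp_zero]
  | h2 a b ha hb =>
    simp only [map_add, Preadditive.comp_add, Preadditive.add_comp, ha, hb]
  | h1 a b => ?_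
  refine (TensorCat.mkHom_comp (tensorObj F X) (tensorObj F Y) (tensorObj G Y)
    (F.obj.map a) b (α.hom.app Y.fst) (𝟙 Y.snd)).trans
    (Eq.trans ?_ (TensorCat.mkHom_comp (tensorObj F X) (tensorObj G X) (tensorObj G Y)
      (α.hom.app X.fst) (𝟙 X.snd) (G.obj.map a) b).symm)
  congr 1
  · exact α.hom.naturality a
  · exact (Category.comp_id b).trans (Category.id_comp b).symm

theorem tensorApp_comp {F G H : LinEnd k C} (α : F ⟶ G) (β : G ⟶ H) (X : TensorCat k C D) :
    tensorApp (α ≫ β) X = tensorApp α X ≫ tensorApp β X :=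
  (congrArg (TensorCat.mkHom (tensorObj F X) (tensorObj H X) ((α ≫ β).hom.app X.fst))
    (Category.comp_id (𝟙 X.snd)).symm).trans
    (TensorCat.mkHom_comp (tensorObj F X) (tensorObj G X) (tensorObj H X)
      (α.hom.app X.fst) (𝟙 X.snd) (β.hom.app X.fst) (𝟙 X.snd)).symm

variable (k C D) in
/-- `F ↦ F ⊠ Id`. -/
def tensorLift : LinEnd k C ⥤ LinEnd k (TensorCat k C D) where
  obj F := ⟨tensorFun F, ⟨fun {X Y f g} => map_add (tensorMap F X Y) f g⟩,
    ⟨fun {X Y} f r => map_smul (tensorMap F X Y) r f⟩⟩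
  map {F G} α := ObjectProperty.homMk
    { app := fun X => tensorApp α X
      naturality := fun _ _ f => tensorApp_naturality α f }
  map_id F := rfl
  map_comp {F G H} α β :=
    ObjectProperty.hom_ext _ (NatTrans.ext (funext fun X => tensorApp_comp α β X))

end Tensor

section Mat

variable {k : Type*} [Field k] {C : Type*} [Category* C] [Preadditive C] [Linear k C]

instance : Linear k (Mat_ C) where
  homModule M N :=
    { smul := fun r f i j => r • f i j
      one_smul := fun f => by ext i j; exact one_smul k (f i j)
      mul_smul := fun r s f => by ext i j; exact mul_smul r s (f i j)
      smul_zero := fun r => by ext i j; exact smul_zero r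
      smul_add := fun r f g => by ext i j; exact smul_add r (f i j) (g i j)
      add_smul := fun r s f => by ext i j; exact add_smul r s (f i j)
      zero_smul := fun f => by ext i j; exact zero_smul k (f i j) }
  smul_comp M N K r f g := by
    ext i j
    change ∑ l, (r • f i l) ≫ g l j = r • ∑ l, f i l ≫ g l j
    simp [Finset.smul_sum]
  comp_smul M N K f r g := by
    ext i j
    change ∑ l, f i l ≫ (r • g l j) = r • ∑ l, f i l ≫ g l j
    simp [Finset.smul_sum]

theorem matSmul_apply {M N : Mat_ C} (r : k) (f : M ⟶ N) (i j) : (r • f) i j = r • f i j := rfl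

variable (k C) in
/-- The extension of functors to additive envelopes. -/
def matLift : LinEnd k C ⥤ LinEnd k (Mat_ C) where
  obj F := ⟨F.obj.mapMat_, ⟨fun {M N f g} => by ext i j; exact F.obj.map_add⟩,
    ⟨fun {M N} f r => by ext i j; exact F.obj.map_smul r (f i j)⟩⟩
  map {F G} α := ObjectProperty.homMk
    { app := fun M i j => F.obj.map ((𝟙 M : M ⟶ M) i j) ≫ α.hom.app (M.X j)
      naturality := fun M N f => by
        ext i j
        change ∑ l, F.obj.map (f i l) ≫ F.obj.map ((𝟙 N : N ⟶ N) l j) ≫ α.hom.app (N.X j) =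
          ∑ l, (F.obj.map ((𝟙 M : M ⟶ M) i l) ≫ α.hom.app (M.X l)) ≫ G.obj.map (f l j)
        simp_rw [Category.assoc, ← α.hom.naturality, ← Category.assoc, ← F.obj.map_comp,
          ← Preadditive.sum_comp, ← F.obj.map_sum]
        have h1 : ∑ l, f i l ≫ (𝟙 N : N ⟶ N) l j = f i j :=
          congrFun (congrFun (Category.comp_id f) i) j
        have h2 : ∑ l, (𝟙 M : M ⟶ M) i l ≫ f l j = f i j :=
          congrFun (congrFun (Category.id_comp f) i) j
        rw [h1, h2] }
  map_id F := by
    refine ObjectProperty.hom_ext _ (NatTrans.ext (funext fun M => ?_))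
    refine Eq.trans ?_ (F.obj.mapMat_.map_id M)
    ext i j
    exact Category.comp_id _
  map_comp {F G H} α β := by
    refine ObjectProperty.hom_ext _ (NatTrans.ext (funext fun M => ?_))
    ext i j
    change _ = ∑ l, (F.obj.map ((𝟙 M : M ⟶ M) i l) ≫ α.hom.app (M.X l)) ≫
      (G.obj.map ((𝟙 M : M ⟶ M) l j) ≫ β.hom.app (M.X j))
    simp_rw [Category.assoc, ← α.hom.naturality_assoc, ← F.obj.map_comp_assoc,
      ← Preadditive.sum_comp, ← F.obj.map_sum]
    have h2 : ∑ l, (𝟙 M : M ⟶ M) i l ≫ (𝟙 M : M ⟶ M) l j = (𝟙 M : M ⟶ M) i j :=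
          congrFun (congrFun (Category.id_comp (𝟙 M)) i) j
    rw [h2]
    rfl

end Mat

section Abelianization

variable (k : Type*) [Field k] (D : Type*) [Category* D] [Preadditive D] [Linear k D]

section
variable {D}

instance (X Y : Arrow D) : Zero (X ⟶ Y) := ⟨Arrow.homMk 0 0 (by simp)⟩
instance (X Y : Arrow D) : Add (X ⟶ Y) :=
  ⟨fun f g => Arrow.homMk (f.left + g.left) (f.right + g.right) (by simp)⟩
instance (X Y : Arrow D) : Neg (X ⟶ Y) :=
  ⟨fun f => Arrow.homMk (-f.left) (-f.right) (by simp)⟩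
instance (X Y : Arrow D) : Sub (X ⟶ Y) :=
  ⟨fun f g => Arrow.homMk (f.left - g.left) (f.right - g.right) (by simp)⟩

/-- Componentwise addition of commutative squares. -/
instance (X Y : Arrow D) : AddCommGroup (X ⟶ Y) :=
  { add_assoc := fun f g h => Arrow.hom_ext _ _ (add_assoc _ _ _) (add_assoc _ _ _)
    zero_add := fun f => Arrow.hom_ext _ _ (zero_add _) (zero_add _)
    add_zero := fun f => Arrow.hom_ext _ _ (add_zero _) (add_zero _)
    add_comm := fun f g => Arrow.hom_ext _ _ (add_comm _ _) (add_comm _ _)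
    neg_add_cancel := fun f => Arrow.hom_ext _ _ (neg_add_cancel _) (neg_add_cancel _)
    sub_eq_add_neg := fun f g => Arrow.hom_ext _ _ (sub_eq_add_neg _ _) (sub_eq_add_neg _ _)
    nsmul := nsmulRec
    zsmul := zsmulRec }

instance : Preadditive (Arrow D) where
  add_comp _ _ _ _ _ _ :=
    Arrow.hom_ext _ _ (Preadditive.add_comp _ _ _ _ _ _) (Preadditive.add_comp _ _ _ _ _ _)
  comp_add _ _ _ _ _ _ :=
    Arrow.hom_ext _ _ (Preadditive.comp_add _ _ _ _ _ _) (Preadditive.comp_add _ _ _ _ _ _)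

instance : Linear k (Arrow D) where
  homModule X Y :=
    { smul := fun r f => Arrow.homMk (r • f.left) (r • f.right) (by simp)
      one_smul := fun f => Arrow.hom_ext _ _ (one_smul _ _) (one_smul _ _)
      mul_smul := fun r s f => Arrow.hom_ext _ _ (mul_smul _ _ _) (mul_smul _ _ _)
      smul_zero := fun r => Arrow.hom_ext _ _ (smul_zero _) (smul_zero _)
      smul_add := fun r f g => Arrow.hom_ext _ _ (smul_add _ _ _) (smul_add _ _ _)
      add_smul := fun r s f => Arrow.hom_ext _ _ (add_smul _ _ _) (add_smul _ _ _)
      zero_smul := fun f => Arrow.hom_ext _ _ (zero_smul _ _) (zero_smul _ _) }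
  smul_comp _ _ _ _ _ _ :=
    Arrow.hom_ext _ _ (Linear.smul_comp _ _ _ _ _ _) (Linear.smul_comp _ _ _ _ _ _)
  comp_smul _ _ _ _ _ _ :=
    Arrow.hom_ext _ _ (Linear.comp_smul _ _ _ _ _ _) (Linear.comp_smul _ _ _ _ _ _)

end

/-- Two commutative squares from `X₁ ⟶ X₀` to `Y₁ ⟶ Y₀` are identified if the difference of their
components `X₀ ⟶ Y₀` factors through `Y₁ ⟶ Y₀`. -/
def homotopic : HomRel (Arrow D) := fun X Y f g =>
  ∃ h : X.right ⟶ Y.left, f.right - g.right = h ≫ Y.hom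

instance : Congruence (homotopic D) where
  equivalence :=
    { refl := fun f => ⟨0, by simp⟩
      symm := fun ⟨h, e⟩ => ⟨-h, by rw [Preadditive.neg_comp, ← e, neg_sub]⟩
      trans := fun ⟨h, e⟩ ⟨h', e'⟩ => ⟨h + h', by
        rw [Preadditive.add_comp, ← e, ← e', sub_add_sub_cancel]⟩ }
  comp_left := fun {X Y Z} f g g' ⟨h, e⟩ => ⟨f.right ≫ h, by
    rw [Category.assoc, ← e, Preadditive.comp_sub]; rfl⟩
  comp_right := fun {X Y Z f f'} g ⟨h, e⟩ => ⟨h ≫ g.left, by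
    have hw : g.left ≫ Z.hom = Y.hom ≫ g.right := Arrow.w g
    rw [Category.assoc, hw, ← Category.assoc, ← e, Preadditive.sub_comp]; rfl⟩

/-- The diagrammatic abelianization of `D`: the object given by `X₁ ⟶ X₀` is the formal cokernel
of this morphism. -/
abbrev AbCat := CategoryTheory.Quotient (homotopic D)

theorem homotopic_add ⦃X Y : Arrow D⦄ (f₁ f₂ g₁ g₂ : X ⟶ Y) (hf : homotopic D f₁ f₂)
    (hg : homotopic D g₁ g₂) : homotopic D (f₁ + g₁) (f₂ + g₂) := by
  obtain ⟨h, e⟩ := hf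
  obtain ⟨h', e'⟩ := hg
  refine ⟨h + h', ?_⟩
  rw [Preadditive.add_comp, ← e, ← e']
  exact add_sub_add_comm _ _ _ _

theorem homotopic_smul (r : k) ⦃X Y : Arrow D⦄ (f g : X ⟶ Y) (hf : homotopic D f g) :
    homotopic D (r • f) (r • g) := by
  obtain ⟨h, e⟩ := hf
  refine ⟨r • h, ?_⟩
  rw [Linear.smul_comp, ← e]
  exact (smul_sub r _ _).symm

instance : Preadditive (AbCat D) := CategoryTheory.Quotient.preadditive _ (homotopic_add D)

instance : (CategoryTheory.Quotient.functor (homotopic D)).Additive :=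
  CategoryTheory.Quotient.functor_additive _ (homotopic_add D)

instance : Linear k (AbCat D) := CategoryTheory.Quotient.linear k _ (homotopic_smul k D)

instance : (CategoryTheory.Quotient.functor (homotopic D)).Linear k :=
  CategoryTheory.Quotient.linear_functor k _ (homotopic_smul k D)

variable {D}

/-- The embedding of `D` into its abelianization on objects: `X` is the cokernel of
`0 : X ⟶ X`. -/
def abelianize (X : D) : AbCat D := ⟨Arrow.mk (0 : X ⟶ X)⟩

variable {k} in
/-- The componentwise application of a natural transformation. -/
def arrowApp {F G : LinEnd k D} (α : F ⟶ G) (X : Arrow D) :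
    F.obj.mapArrow.obj X ⟶ G.obj.mapArrow.obj X :=
  Arrow.homMk (α.hom.app X.left) (α.hom.app X.right) (α.hom.naturality X.hom).symm

variable (D)

/-- The componentwise extension of functors to the abelianization. -/
def abelianLift : LinEnd k D ⥤ LinEnd k (AbCat D) where
  obj F := ⟨CategoryTheory.Quotient.lift _ (F.obj.mapArrow ⋙ CategoryTheory.Quotient.functor _) (by
      rintro X Y f g ⟨h, e⟩
      refine CategoryTheory.Quotient.sound _ ⟨F.obj.map h, ?_⟩
      change F.obj.map f.right - F.obj.map g.right = F.obj.map h ≫ F.obj.map Y.hom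
      rw [← Functor.map_sub, ← Functor.map_comp, e]),
    ⟨by
      rintro ⟨X⟩ ⟨Y⟩ ⟨f⟩ ⟨g⟩
      exact congrArg (CategoryTheory.Quotient.functor (homotopic D)).map
        (show F.obj.mapArrow.map (f + g) = F.obj.mapArrow.map f + F.obj.mapArrow.map g from
          Arrow.hom_ext _ _ (F.obj.map_add (f := f.left)) (F.obj.map_add (f := f.right)))⟩,
    ⟨by
      rintro ⟨X⟩ ⟨Y⟩ ⟨f⟩ r
      exact congrArg (CategoryTheory.Quotient.functor (homotopic D)).map
        (show F.obj.mapArrow.map (r • f) = r • F.obj.mapArrow.map f from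
          Arrow.hom_ext _ _ (F.obj.map_smul r f.left) (F.obj.map_smul r f.right))⟩⟩
  map {F G} α := ObjectProperty.homMk
    { app := fun X => (CategoryTheory.Quotient.functor (homotopic D)).map (arrowApp α X.as)
      naturality := by
        rintro ⟨X⟩ ⟨Y⟩ ⟨f⟩
        exact congrArg (CategoryTheory.Quotient.functor (homotopic D)).map
          (show F.obj.mapArrow.map f ≫ arrowApp α Y = arrowApp α X ≫ G.obj.mapArrow.map f from
            Arrow.hom_ext _ _ (α.hom.naturality f.left) (α.hom.naturality f.right)) }
  map_id F := rfl
  map_comp α β := rfl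

end Abelianization

section Strict

/-- A `k`-linear functor between categories of linear endofunctors is strict if it strictly
preserves identity functors, composition and horizontal composition. -/
structure IsStrict {k : Type*} [Field k] {M N : Type*} [Category* M] [Preadditive M] [Linear k M]
    [Category* N] [Preadditive N] [Linear k N] (T : LinEnd k M ⥤ LinEnd k N) : Prop where
  additive : T.Additive
  linear : T.Linear k
  obj_one : T.obj (LinEnd.one k M) = LinEnd.one k N
  obj_comp : ∀ F G : LinEnd k M, T.obj (F.comp G) = (T.obj F).comp (T.obj G)
  map_hcomp : ∀ {F F' G G' : LinEnd k M} (α : F ⟶ F') (β : G ⟶ G'),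
    HEq (T.map (LinEnd.hcomp α β)) (LinEnd.hcomp (T.map α) (T.map β))

variable (k : Type*) [Field k] (C D : Type*) [Category* C] [Preadditive C] [Linear k C]
  [Category* D] [Preadditive D] [Linear k D]

theorem tensorLift_one : (tensorLift k C D).obj (LinEnd.one k C) =
    LinEnd.one k (TensorCat k C D) :=
  LinEnd.ext' (Functor.hext (fun X => rfl) (fun X Y f => heq_of_eq (by
    induction f using TensorCat.hom_induction with
    | h0 => simp only [Functor.map_zero]; rfl
    | h2 a b ha hb => simp only [Functor.map_add, ha, hb]; rfl
    | h1 a b => rfl)))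

theorem tensorLift_comp (F G : LinEnd k C) : (tensorLift k C D).obj (F.comp G) =
    ((tensorLift k C D).obj F).comp ((tensorLift k C D).obj G) :=
  LinEnd.ext' (Functor.hext (fun X => rfl) (fun X Y f => heq_of_eq (by
    induction f using TensorCat.hom_induction with
    | h0 => simp only [Functor.map_zero]; rfl
    | h2 a b ha hb => simp only [Functor.map_add, ha, hb]; rfl
    | h1 a b => rfl)))

theorem tensorLift_strict : IsStrict (tensorLift k C D) where
  additive := ⟨fun {F G f g} => ObjectProperty.hom_ext _ (NatTrans.ext (funext fun X =>
    TensorProduct.add_tmul (f.hom.app X.fst) (g.hom.app X.fst) (𝟙 X.snd)))⟩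
  linear := ⟨fun {F G} f r => ObjectProperty.hom_ext _ (NatTrans.ext (funext fun X => rfl))⟩
  obj_one := tensorLift_one k C D
  obj_comp := tensorLift_comp k C D
  map_hcomp {F F' G G'} α β := by
    refine LinEnd.hom_heq (tensorLift_comp _ _ _ _ _) (tensorLift_comp _ _ _ _ _) _ _
      (fun X => heq_of_eq ?_)
    exact (congrArg (TensorCat.mkHom (tensorObj (F.comp G) X) (tensorObj (F'.comp G') X)
        ((LinEnd.hcomp α β).hom.app X.fst)) (Category.comp_id (𝟙 X.snd)).symm).trans
      (TensorCat.mkHom_comp (tensorObj F (tensorObj G X))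
        (tensorObj F' (tensorObj G X)) (tensorObj F' (tensorObj G' X))
        (α.hom.app (G.obj.obj X.fst)) (𝟙 X.snd) (F'.obj.map (β.hom.app X.fst)) (𝟙 X.snd)).symm

theorem matLift_comp (F G : LinEnd k C) : (matLift k C).obj (F.comp G) =
    ((matLift k C).obj F).comp ((matLift k C).obj G) :=
  LinEnd.ext' (Functor.hext (fun X => rfl) (fun X Y f => heq_of_eq rfl))

variable {C} in
theorem matLift_aux {F F' G G' : C ⥤ C} [F.Additive] (α : F ⟶ F') (β : G ⟶ G') {ι : Type}
    [Fintype ι] (X : ι → C) (i j : ι) (u : ∀ l, G.obj (X i) ⟶ G.obj (X l))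
    (v : ∀ l, X l ⟶ X j) (w : X i ⟶ X j) (h : ∑ l, u l ≫ G.map (v l) = G.map w) :
    F.map (G.map w) ≫ (α.app (G.obj (X j)) ≫ F'.map (β.app (X j))) =
      ∑ l, (F.map (u l) ≫ α.app (G.obj (X l))) ≫ F'.map (G.map (v l) ≫ β.app (X j)) := by
  have h3 : ∀ l, (F.map (u l) ≫ α.app (G.obj (X l))) ≫ F'.map (G.map (v l) ≫ β.app (X j)) =
      F.map (u l ≫ G.map (v l)) ≫ (α.app (G.obj (X j)) ≫ F'.map (β.app (X j))) := by
    intro l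
    rw [Functor.map_comp, Functor.map_comp, Category.assoc, Category.assoc,
      ← α.naturality_assoc]
  simp_rw [h3, ← Preadditive.sum_comp, ← Functor.map_sum, h]

theorem matLift_strict : IsStrict (matLift k C) where
  additive := ⟨fun {F G f g} => ObjectProperty.hom_ext _ (NatTrans.ext (funext fun X => by
    ext i j
    exact Preadditive.comp_add _ _ _ _ _ _))⟩
  linear := ⟨fun {F G} f r => ObjectProperty.hom_ext _ (NatTrans.ext (funext fun X => by
    ext i j
    exact Linear.comp_smul _ _ _ _ _ _))⟩
  obj_one := LinEnd.ext' (Functor.hext (fun X => rfl) (fun X Y f => heq_of_eq rfl))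
  obj_comp := matLift_comp k C
  map_hcomp {F F' G G'} α β := by
    refine LinEnd.hom_heq (matLift_comp _ _ _ _) (matLift_comp _ _ _ _) _ _
      (fun X => heq_of_eq ?_)
    ext i j
    exact matLift_aux α.hom β.hom X.X i j
      (fun l => (𝟙 (G.obj.mapMat_.obj X) : G.obj.mapMat_.obj X ⟶ G.obj.mapMat_.obj X) i l)
      (fun l => (𝟙 X : X ⟶ X) l j) ((𝟙 X : X ⟶ X) i j)
      (congrFun (congrFun (Category.id_comp (G.obj.mapMat_.map (𝟙 X))) i) j)

theorem abelianLift_strict : IsStrict (abelianLift k D) where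
  additive := ⟨fun {F G f g} => ObjectProperty.hom_ext _ (NatTrans.ext (funext fun X =>
    congrArg (CategoryTheory.Quotient.functor (homotopic D)).map
      (show arrowApp (f + g) X.as = arrowApp f X.as + arrowApp g X.as from
        Arrow.hom_ext _ _ rfl rfl)))⟩
  linear := ⟨fun {F G} f r => ObjectProperty.hom_ext _ (NatTrans.ext (funext fun X =>
    congrArg (CategoryTheory.Quotient.functor (homotopic D)).map
      (show arrowApp (r • f) X.as = r • arrowApp f X.as from
        Arrow.hom_ext _ _ rfl rfl)))⟩
  obj_one := LinEnd.ext' (Functor.hext (fun X => rfl) (by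
    rintro ⟨X⟩ ⟨Y⟩ ⟨f⟩; exact HEq.rfl))
  obj_comp F G := LinEnd.ext' (Functor.hext (fun X => rfl) (by
    rintro ⟨X⟩ ⟨Y⟩ ⟨f⟩; exact HEq.rfl))
  map_hcomp {F F' G G'} α β := by
    have key : ∀ F G : LinEnd k D, (abelianLift k D).obj (F.comp G) =
        ((abelianLift k D).obj F).comp ((abelianLift k D).obj G) := fun F G =>
      LinEnd.ext' (Functor.hext (fun X => rfl) (by
        rintro ⟨X⟩ ⟨Y⟩ ⟨f⟩; exact HEq.rfl))
    exact LinEnd.hom_heq (key _ _) (key _ _) _ _ (fun X => HEq.rfl)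

end Strict


section TwoRepresentations

variable (k : Type u) [Field k] (A : Type u) [Ring A] [Algebra k A] [FiniteDimensional k A]

/-- The endomorphism category `𝒞_A(i, i)` of the unique object of the `2`-category `𝒞_A`: its
objects (the `1`-morphisms of `𝒞_A`) are the projective functors on finite dimensional
`A`-modules, its morphisms (the `2`-morphisms of `𝒞_A`) are the natural transformations. -/
abbrev ProjCat := (isProjective k A).FullSubcategory

namespace ProjCat

variable {k A}

instance (F : ProjCat k A) : F.obj.Additive := F.property.additive
instance (F : ProjCat k A) : F.obj.Linear k := F.property.linear

variable (k A) in
/-- The identity `1`-morphism. -/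
def one : ProjCat k A := ⟨𝟭 _, isProjective_id⟩

/-- The composite `F ∘ G` of `1`-morphisms. -/
def comp (F G : ProjCat k A) : ProjCat k A := ⟨G.obj ⋙ F.obj, G.property.comp F.property⟩

/-- The horizontal composition `α ∘ β : F ∘ G ⟶ F' ∘ G'` of `2`-morphisms. -/
def hcomp {F F' G G' : ProjCat k A} (α : F ⟶ F') (β : G ⟶ G') : comp F G ⟶ comp F' G' :=
  ObjectProperty.homMk (β.hom ◫ α.hom)

end ProjCat

/-- A (`k`-linear, strict) `2`-representation of `𝒞_A` on the category `M`: a strict `2`-functor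
from `𝒞_A` which sends the unique object to `M`, the `1`-morphisms to `k`-linear (in particular
additive) functors and the `2`-morphisms to natural transformations. -/
structure TwoRep (M : Type*) [Category* M] [Preadditive M] [Linear k M] where
  /-- the action of `1`-morphisms and `2`-morphisms -/
  act : ProjCat k A ⥤ LinEnd k M
  additive : act.Additive
  linear : act.Linear k
  act_one : act.obj (ProjCat.one k A) = LinEnd.one k M
  act_comp : ∀ F G : ProjCat k A, act.obj (F.comp G) = (act.obj F).comp (act.obj G)
  act_hcomp : ∀ {F F' G G' : ProjCat k A} (α : F ⟶ F') (β : G ⟶ G'),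
    HEq (act.map (ProjCat.hcomp α β)) (LinEnd.hcomp (act.map α) (act.map β))

namespace TwoRep

variable {k A} {M : Type*} [Category* M] [Preadditive M] [Linear k M]

/-- The object `F X`. -/
abbrev app (ρ : TwoRep k A M) (F : ProjCat k A) (X : M) : M := (ρ.act.obj F).obj.obj X

theorem map_heq {C D : Type*} [Category* C] [Category* D] (T : C ⥤ D) {X X' Y Y' : C}
    (hX : X = X') (hY : Y = Y') {f : X ⟶ Y} {f' : X' ⟶ Y'} (h : HEq f f') :
    HEq (T.map f) (T.map f') := by
  subst hX hY; rw [eq_of_heq h]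

/-- Transport of a `2`-representation along a strict functor. -/
def lift {N : Type*} [Category* N] [Preadditive N] [Linear k N] (ρ : TwoRep k A M)
    (T : LinEnd k M ⥤ LinEnd k N) (hT : IsStrict T) : TwoRep k A N where
  act := ρ.act ⋙ T
  additive := by
    have := ρ.additive
    have := hT.additive
    infer_instance
  linear := by
    have := ρ.linear
    have := hT.linear
    infer_instance
  act_one := (congrArg T.obj ρ.act_one).trans hT.obj_one
  act_comp F G := (congrArg T.obj (ρ.act_comp F G)).trans (hT.obj_comp _ _)
  act_hcomp α β := (map_heq T (ρ.act_comp _ _) (ρ.act_comp _ _) (ρ.act_hcomp α β)).trans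
    (hT.map_hcomp _ _)

variable (k A) in
/-- The principal `2`-representation: `𝒞_A` acts on `𝒞_A(i, i)` by composition from the left. -/
def principal : TwoRep k A (ProjCat k A) where
  act :=
    { obj := fun F => ⟨{ obj := fun G => F.comp G
                         map := fun β => ObjectProperty.homMk (Functor.whiskerRight β.hom F.obj)
                         map_id := fun G => by ext; simp [ProjCat.comp]
                         map_comp := fun β γ => by ext; simp [ProjCat.comp] },
        ⟨fun {G H β γ} => ObjectProperty.hom_ext _ (NatTrans.ext (funext fun N =>
          F.obj.map_add))⟩,
        ⟨fun {G H} β r => ObjectProperty.hom_ext _ (NatTrans.ext (funext fun N =>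
          F.obj.map_smul r (β.hom.app N)))⟩⟩
      map := fun {F F'} α => ObjectProperty.homMk
        { app := fun G => ObjectProperty.homMk (Functor.whiskerLeft G.obj α.hom)
          naturality := fun G H β => ObjectProperty.hom_ext _ (NatTrans.ext (funext fun N =>
            α.hom.naturality (β.hom.app N))) }
      map_id := fun F => rfl
      map_comp := fun α β => rfl }
  additive := ⟨rfl⟩
  linear := ⟨fun _ _ => rfl⟩
  act_one := rfl
  act_comp F G := rfl
  act_hcomp α β := HEq.rfl

/-- The inflation `ρ^{⊠ P}`: the action on the additive envelope of the tensor product of `M`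
and `P` through the first factor. -/
def inflation (ρ : TwoRep k A M) (P : Type*) [Category* P] [Preadditive P] [Linear k P] :
    TwoRep k A (Mat_ (TensorCat k M P)) :=
  (ρ.lift (tensorLift k M P) (tensorLift_strict k M P)).lift
    (matLift k (TensorCat k M P)) (matLift_strict k (TensorCat k M P))

/-- The abelianization: the componentwise action on the diagrammatic abelianization of `M`. -/
def abelianization (ρ : TwoRep k A M) : TwoRep k A (AbCat M) :=
  ρ.lift (abelianLift k M) (abelianLift_strict k M)

/-- A full subcategory is stable under the action. -/
def IsStable (ρ : TwoRep k A M) (S : ObjectProperty M) : Prop :=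
  ∀ (F : ProjCat k A) (X : M), S X → S (ρ.app F X)

/-- The restriction of a functor to a stable full subcategory. -/
def restrictObj {S : ObjectProperty M} (F : LinEnd k M) (h : ∀ X, S X → S (F.obj.obj X)) :
    LinEnd k S.FullSubcategory :=
  ⟨S.lift (S.ι ⋙ F.obj) (fun X => h X.obj X.property),
    ⟨ObjectProperty.hom_ext _ F.obj.map_add⟩,
    ⟨fun f r => ObjectProperty.hom_ext _ (F.obj.map_smul r f.hom)⟩⟩

/-- The restriction of a natural transformation to a stable full subcategory. -/
def restrictMap {S : ObjectProperty M} {F G : LinEnd k M} (hF : ∀ X, S X → S (F.obj.obj X))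
    (hG : ∀ X, S X → S (G.obj.obj X)) (α : F ⟶ G) : restrictObj F hF ⟶ restrictObj G hG :=
  ObjectProperty.homMk
    { app := fun X => ObjectProperty.homMk (α.hom.app X.obj)
      naturality := fun _ _ f => ObjectProperty.hom_ext _ (α.hom.naturality f.hom) }

theorem restrictObj_congr {S : ObjectProperty M} {F F' : LinEnd k M} (e : F = F')
    (h : ∀ X, S X → S (F.obj.obj X)) (h' : ∀ X, S X → S (F'.obj.obj X)) :
    restrictObj F h = restrictObj F' h' := by
  subst e; rfl

theorem restrictMap_heq {S : ObjectProperty M} {F F' G G' : LinEnd k M} (eF : F = F')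
    (eG : G = G') (hF : ∀ X, S X → S (F.obj.obj X)) (hF' : ∀ X, S X → S (F'.obj.obj X))
    (hG : ∀ X, S X → S (G.obj.obj X)) (hG' : ∀ X, S X → S (G'.obj.obj X))
    {α : F ⟶ G} {α' : F' ⟶ G'} (h : HEq α α') :
    HEq (restrictMap hF hG α) (restrictMap hF' hG' α') := by
  subst eF eG; rw [eq_of_heq h]

/-- The `2`-representation on a stable full subcategory. -/
def restrict (ρ : TwoRep k A M) (S : ObjectProperty M) (hS : ρ.IsStable S) :
    TwoRep k A S.FullSubcategory where
  act :=
    { obj := fun F => restrictObj (ρ.act.obj F) (hS F)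
      map := fun {F G} α => restrictMap (hS F) (hS G) (ρ.act.map α)
      map_id := fun F => (congrArg (restrictMap (hS F) (hS F)) (ρ.act.map_id F)).trans rfl
      map_comp := fun {F _ H} α β =>
        (congrArg (restrictMap (hS F) (hS H)) (ρ.act.map_comp α β)).trans rfl }
  additive := by
    have := ρ.additive
    exact ⟨fun {F G f g} => by
      change restrictMap _ _ (ρ.act.map (f + g)) = _
      rw [Functor.map_add]; rfl⟩
  linear := by
    have := ρ.linear
    exact ⟨fun {F G} f r => by
      change restrictMap _ _ (ρ.act.map (r • f)) = _
      rw [Functor.map_smul]; rfl⟩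
  act_one := restrictObj_congr ρ.act_one (hS _) (fun _ h => h)
  act_comp F G := restrictObj_congr (ρ.act_comp F G) (hS _)
    (fun X h => hS F _ (hS G X h))
  act_hcomp {F F' G G'} α β := restrictMap_heq (ρ.act_comp F G) (ρ.act_comp F' G') (hS _)
    (fun X h => hS F _ (hS G X h)) (hS _) (fun X h => hS F' _ (hS G' X h)) (ρ.act_hcomp α β)

end TwoRep

end TwoRepresentations

section Diagrams

/-- `Y` is a direct summand of `X` (in an idempotent split category). -/
def IsSummand {C : Type*} [Category* C] (Y X : C) : Prop := Nonempty (Retract Y X)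

/-- Indecomposable objects: non-zero objects which are not isomorphic to a direct sum of two
non-zero objects. -/
def IsIndec {C : Type*} [Category* C] [Preadditive C] (X : C) : Prop :=
  ¬ Limits.IsZero X ∧ ∀ ⦃Y Z : C⦄ (i₁ : Y ⟶ X) (i₂ : Z ⟶ X) (p₁ : X ⟶ Y) (p₂ : X ⟶ Z),
    i₁ ≫ p₁ = 𝟙 Y → i₂ ≫ p₂ = 𝟙 Z → p₁ ≫ i₁ + p₂ ≫ i₂ = 𝟙 X →
      Limits.IsZero Y ∨ Limits.IsZero Z

/-- Finitary `k`-linear categories: additive, idempotent split, Krull-Schmidt, with finitely many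
isomorphism classes of indecomposable objects and finite dimensional spaces of morphisms. -/
structure IsFinitary (k : Type*) [Field k] (C : Type*) [Category* C] [Preadditive C]
    [Linear k C] : Prop where
  additive : Limits.HasFiniteBiproducts C
  idempotent_split : IsIdempotentComplete C
  krull_schmidt : ∀ X : C, ∃ (ι : Type) (_ : Finite ι) (Y : ι → C) (b : Limits.Bicone Y),
    (∀ s, IsLocalRing (End (Y s))) ∧ Nonempty b.IsBilimit ∧ Nonempty (b.pt ≅ X)
  finite_indec : ∃ (m : ℕ) (Y : Fin m → C), ∀ X : C, IsIndec X → ∃ s, Nonempty (X ≅ Y s)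
  finite_hom : ∀ X Y : C, Module.Finite k (X ⟶ Y)

variable {k : Type u} [Field k] {A : Type u} [Ring A] [Algebra k A] [FiniteDimensional k A]

/-- The left cell of an indecomposable `1`-morphism `G`, as a set of indecomposable
`1`-morphisms closed under isomorphism: `F` belongs to it if and only if `F` is a direct summand
of `H ∘ G` and `G` is a direct summand of `H' ∘ F` for some `1`-morphisms `H` and `H'`. -/
def leftCell (G : ProjCat k A) : Set (ProjCat k A) :=
  {F | IsIndec F ∧ (∃ H : ProjCat k A, IsSummand F (H.comp G)) ∧
    ∃ H' : ProjCat k A, IsSummand G (H'.comp F)}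

namespace TwoRep

variable {M : Type*} [Category* M] [Preadditive M] [Linear k M] (ρ : TwoRep k A M)

/-- The indecomposable objects of a `2`-representation. -/
def Ind (_ : TwoRep k A M) := {X : M // IsIndec X}

/-- The action preorder: `X ≤ Y` means `X → Y`, that is, `Y` is a direct summand of `F X` for
some `1`-morphism `F`. -/
instance : Preorder ρ.Ind where
  le X Y := ∃ F : ProjCat k A, IsSummand Y.1 (ρ.app F X.1)
  le_refl X := ⟨ProjCat.one k A, by
    rw [TwoRep.app, ρ.act_one]
    exact ⟨Retract.refl X.1⟩⟩
  le_trans X Y Z := by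
    rintro ⟨F, ⟨r⟩⟩ ⟨G, ⟨s⟩⟩
    refine ⟨G.comp F, ?_⟩
    rw [TwoRep.app, ρ.act_comp]
    exact ⟨s.trans (r.map (ρ.act.obj G).obj)⟩

/-- The equivalence classes of indecomposable objects with respect to `X → Y → X`. (Isomorphic
objects are equivalent.) -/
abbrev Vertex := Antisymmetrization ρ.Ind (· ≤ ·)

/-- The equivalence class of an indecomposable object. -/
abbrev vertex (X : ρ.Ind) : ρ.Vertex := toAntisymmetrization (· ≤ ·) X

/-- The diagram: the Hasse diagram of the poset of equivalence classes. -/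
def diagram : SimpleGraph ρ.Vertex := SimpleGraph.hasse ρ.Vertex

/-- The decoration `Θ_{τ,σ}` of an edge between `σ` and `τ`, where `σ → τ`: the set of all
indecomposable `1`-morphisms `F` such that, for some `X` in `σ`, the object `F X` has a direct
summand in `τ`. -/
def decoration (σ τ : ρ.Vertex) : Set (ProjCat k A) :=
  {F | IsIndec F ∧ ∃ X Y : ρ.Ind, ρ.vertex X = σ ∧ ρ.vertex Y = τ ∧
    IsSummand Y.1 (ρ.app F X.1)}

end TwoRep

end Diagrams

section Algebra

/-- Connected algebras: non-zero, with no central idempotents other than `0` and `1`. -/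
def IsConnectedAlgebra (A : Type*) [Ring A] : Prop :=
  Nontrivial A ∧ ∀ c : A, IsIdempotentElem c → (∀ a, c * a = a * c) → c = 0 ∨ c = 1

/-- `1 = e₁ + ... + eₙ` is a decomposition of the unit of a basic algebra into pairwise orthogonal
primitive idempotents: `A eᵢ` is not isomorphic to `A eⱼ` if `i ≠ j`. -/
structure IsBasicDecomposition {A : Type*} [Ring A] {n : ℕ} (e : Fin n → A) : Prop
    extends CompleteOrthogonalIdempotents e where
  ne_zero : ∀ i, e i ≠ 0
  primitive : ∀ i (f g : A), IsIdempotentElem f → IsIdempotentElem g → f * g = 0 → g * f = 0 →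
    f + g = e i → f = 0 ∨ g = 0
  basic : ∀ i j, Nonempty (Submodule.span A {e i} ≃ₗ[A] Submodule.span A {e j}) → i = j

/-- `ν` is the Nakayama permutation of a basic self-injective algebra: the (simple) socle of `A eᵢ`
is isomorphic to the top of `A e_{ν(i)}`, that is, there is a non-zero element in
`e_{ν(i)} A eᵢ` which is annihilated by the radical. -/
def IsNakayamaPermutation {A : Type*} [Ring A] {n : ℕ} (e : Fin n → A)
    (ν : Equiv.Perm (Fin n)) : Prop :=
  ∀ i, ∃ s : A, s ≠ 0 ∧ e (ν i) * s * e i = s ∧ ∀ r ∈ Ring.jacobson A, r * s = 0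

end Algebra

section Construction

/-- The quiver of a bipartite graph with upper vertices `V`, lower vertices `W` and edges `E`:
there is one arrow `v ⟶ w` for every edge `(v, w)`. -/
def BipQuiver {V W : Type*} (_ : V → W → Prop) := V ⊕ W

instance {V W : Type*} (E : V → W → Prop) : Quiver (BipQuiver E) where
  Hom x y := match x, y with
    | Sum.inl v, Sum.inr w => PLift (E v w)
    | _, _ => PEmpty

/-- The bipartite graph with upper vertices `V`, lower vertices `W` and edges `E`. -/
def bipGraph {V W : Type*} (E : V → W → Prop) : SimpleGraph (V ⊕ W) :=
  SimpleGraph.fromRel fun x y => ∃ v w, x = Sum.inl v ∧ y = Sum.inr w ∧ E v w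

variable (k : Type u) [Field k] (A : Type u) [Ring A] [Algebra k A] [FiniteDimensional k A]
variable {V W : Type*} (E : V → W → Prop)

/-- A small category equivalent to the category of (finitely generated) projective modules over
the path algebra of the quiver: its objects are formal direct sums of vertices `x`, which stand
for the indecomposable projective modules `P_x`, and `Hom(P_x, P_y)` is the space with basis the
paths from `y` to `x`. -/
abbrev PathProj := Mat_ (CategoryTheory.Free k (Paths (BipQuiver E))ᵒᵖ)

/-- The indecomposable projective module `P_x`. -/
def pathProj (x : V ⊕ W) : PathProj k E :=
  (Mat_.embedding _).obj
    (CategoryTheory.Free.of k (Opposite.op ((Paths.of (BipQuiver E)).obj x)))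

/-- The inflation of the principal `2`-representation by projective modules over the path
algebra. -/
def inflatedPrincipal : TwoRep k A (Mat_ (TensorCat k (ProjCat k A) (PathProj k E))) :=
  (TwoRep.principal k A).inflation (PathProj k E)

/-- The underlying category of the abelianization of `inflatedPrincipal`. -/
abbrev Ambient := AbCat (Mat_ (TensorCat k (ProjCat k A) (PathProj k E)))

/-- The abelianization of `inflatedPrincipal`. -/
def ambient : TwoRep k A (Ambient k A E) := (inflatedPrincipal k A E).abelianization

variable {k A}

/-- The projective object of the abelianization given by `F ⊠ P_x`. -/
def ambientProj (F : ProjCat k A) (x : V ⊕ W) : Ambient k A E :=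
  abelianize ((Mat_.embedding (TensorCat k (ProjCat k A) (PathProj k E))).obj
    ⟨F, pathProj k E x⟩)

/-- `L` is a simple top of the projective object `F ⊠ P_x`. -/
def IsTop (L : Ambient k A E) (F : ProjCat k A) (x : V ⊕ W) : Prop :=
  Simple L ∧ ∃ π : ambientProj E F x ⟶ L, Epi π

/-- `0 ⟶ X ⟶ Y ⟶ Z ⟶ 0` is a short exact sequence. -/
def IsSES {C : Type*} [Category* C] [Preadditive C] {X Y Z : C} (i : X ⟶ Y) (p : Y ⟶ Z) : Prop :=
  ∃ h : i ≫ p = 0, (ShortComplex.mk i p h).ShortExact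

variable {n : ℕ} {e : Fin n → A}

variable (k) in
/-- The indecomposable `1`-morphism `F_{ij}` given by tensoring with `A eᵢ ⊗ₖ eⱼ A`. -/
def projMor (he : IsBasicDecomposition e) (i j : Fin n) : ProjCat k A :=
  ⟨tensorFunctor k A (e i) (e j), isProjective_tensor (he.idem i) (he.idem j)⟩

/-- The objects entering the construction of the `2`-representation. -/
structure GluingData (k : Type u) [Field k] {A : Type u} [Ring A] [Algebra k A]
    [FiniteDimensional k A] {n : ℕ} {e : Fin n → A} (he : IsBasicDecomposition e)
    (ν : Equiv.Perm (Fin n)) {V W : Type*} (E : V → W → Prop) (η : ∀ v w, E v w → Fin n) where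
  /-- the simple objects `L_{0,x}` -/
  L₀ : V ⊕ W → Ambient k A E
  /-- the simple objects `L_{i,j,x}` -/
  L : Fin n → Fin n → V ⊕ W → Ambient k A E
  isTop_L₀ : ∀ x, IsTop E (L₀ x) (ProjCat.one k A) x
  isTop_L : ∀ i j x, IsTop E (L i j x) (projMor k he i j) x
  /-- the non-split extension `∇(i,x)` of `L_{i,ν(i),x}` by `L_{0,x}` -/
  nabla : Fin n → V ⊕ W → Ambient k A E
  /-- `L_{0,x} ⟶ ∇(i,x)` -/
  nablaι : ∀ i x, L₀ x ⟶ nabla i x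
  /-- `∇(i,x) ⟶ L_{i,ν(i),x}` -/
  nablaπ : ∀ i x, nabla i x ⟶ L i (ν i) x
  nabla_exact : ∀ i x, IsSES (nablaι i x) (nablaπ i x)
  nabla_nonsplit : ∀ i x, ¬ IsSplitEpi (nablaπ i x)
  /-- the non-split extension `N_{(v,w)}` of `L_{0,v}` by `L_{0,w}` -/
  Nedge : ∀ v w, E v w → Ambient k A E
  /-- `L_{0,w} ⟶ N_{(v,w)}` -/
  Nedgeι : ∀ v w h, L₀ (Sum.inr w) ⟶ Nedge v w h
  /-- `N_{(v,w)} ⟶ L_{0,v}` -/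
  Nedgeπ : ∀ v w h, Nedge v w h ⟶ L₀ (Sum.inl v)
  Nedge_exact : ∀ v w h, IsSES (Nedgeι v w h) (Nedgeπ v w h)
  Nedge_nonsplit : ∀ v w h, ¬ IsSplitEpi (Nedgeπ v w h)
  /-- the direct sum `X` of all `L_{0,w}`, where `(v,w)` is an edge -/
  X : ∀ v, Limits.Bicone fun w : {w // E v w} => L₀ (Sum.inr w.1)
  /-- the direct sum `Y` of all `∇(η(v,w),w)`, where `(v,w)` is an edge -/
  Y : ∀ v, Limits.Bicone fun w : {w // E v w} => nabla (η v w.1 w.2) (Sum.inr w.1)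
  /-- the direct sum `Z` of all `L_{i,ν(i),w}`, where `(v,w)` is an edge and `i = η(v,w)` -/
  Z : ∀ v, Limits.Bicone fun w : {w // E v w} =>
    L (η v w.1 w.2) (ν (η v w.1 w.2)) (Sum.inr w.1)
  isBilimit_X : ∀ v, Nonempty (X v).IsBilimit
  isBilimit_Y : ∀ v, Nonempty (Y v).IsBilimit
  isBilimit_Z : ∀ v, Nonempty (Z v).IsBilimit
  /-- the direct sum `X ⟶ Y` of the morphisms `L_{0,w} ⟶ ∇(η(v,w),w)` -/
  XY : ∀ v, (X v).pt ⟶ (Y v).pt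
  /-- the direct sum `Y ⟶ Z` of the morphisms `∇(i,w) ⟶ L_{i,ν(i),w}` -/
  YZ : ∀ v, (Y v).pt ⟶ (Z v).pt
  XY_π : ∀ v w, XY v ≫ (Y v).π w = (X v).π w ≫ nablaι _ _
  YZ_π : ∀ v w, YZ v ≫ (Z v).π w = (Y v).π w ≫ nablaπ _ _
  /-- the extension `N_v` of `L_{0,v}` by `X` obtained from the direct sum of all `N_{(v,w)}`,
  where `(v,w)` is an edge, by pulling back along the diagonal embedding of `L_{0,v}` -/
  N : V → Ambient k A E
  /-- `X ⟶ N_v` -/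
  Nι : ∀ v, (X v).pt ⟶ N v
  /-- `N_v ⟶ L_{0,v}` -/
  Nπ : ∀ v, N v ⟶ L₀ (Sum.inl v)
  N_exact : ∀ v, IsSES (Nι v) (Nπ v)
  /-- the components of the morphism from `N_v` to the direct sum of all `N_{(v,w)}` -/
  Nproj : ∀ v (w : {w // E v w}), N v ⟶ Nedge v w.1 w.2
  Nι_proj : ∀ v w, Nι v ≫ Nproj v w = (X v).π w ≫ Nedgeι v w.1 w.2
  Nproj_π : ∀ v w, Nproj v w ≫ Nedgeπ v w.1 w.2 = Nπ v
  /-- the extension `M_v` of `Z` by `N_v` which is the image of `0 ⟶ X ⟶ Y ⟶ Z ⟶ 0` under the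
  morphism `X ⟶ N_v` -/
  M : V → Ambient k A E
  /-- `N_v ⟶ M_v` -/
  Mι : ∀ v, N v ⟶ M v
  /-- `M_v ⟶ Z` -/
  Mπ : ∀ v, M v ⟶ (Z v).pt
  M_exact : ∀ v, IsSES (Mι v) (Mπ v)
  /-- `Y ⟶ M_v` -/
  YM : ∀ v, (Y v).pt ⟶ M v
  XY_YM : ∀ v, XY v ≫ YM v = Nι v ≫ Mι v
  YM_π : ∀ v, YM v ≫ Mπ v = YZ v

namespace GluingData

variable {he : IsBasicDecomposition e} {ν : Equiv.Perm (Fin n)} {E}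
  {η : ∀ v w, E v w → Fin n} (c : GluingData k he ν E η) (θ : W → Fin n)

/-- The objects `Q_{j,w} = F_{ji} L_{i,ν(i),w}`, where `i = θ(w)`. -/
def Q (j : Fin n) (w : W) : Ambient k A E :=
  (ambient k A E).app (projMor k he j (θ w)) (c.L (θ w) (ν (θ w)) (Sum.inr w))

/-- The additive closure of all `M_v` and all `Q_{j,w}`. -/
def 𝒳 : ObjectProperty (Ambient k A E) :=
  addClosure fun X => (∃ v, X = c.M v) ∨ ∃ j w, X = c.Q θ j w

end GluingData

end Construction

end ProjFunctors

end

open ProjFunctors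

/-! The indecomposable 1-morphisms are the identity and the F_{ij}, and F_{ab}F_{cd} is a sum of
copies of F_{ad}. The identity is none of the F_{ij}, because A is connected and not simple.
Self-injectivity gives adjunctions: a linear form that does not vanish on the socle of Ae_i pairs
e_{ν(i)}A perfectly with Ae_i, and the Casimir element of this pairing makes F_{bν(i)} left adjoint
to F_{ib} (`DualBases.adjointPair`). Hence every F_{ij} acts exactly on the abelianization, and
Hom(G ⊠ P_x, F_{ij}X) = Hom(F_{jν(i)}G ⊠ P_x, X).

The abelianization is the category of finitely generated modules over the endomorphism algebra of a
generator, and the 𝟙 ⊠ P_x and F_{ij} ⊠ P_x are pairwise non-isomorphic local projectives that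
detect all objects (`isProjectiveFamily_indProj`). With the adjunction they determine the action on
simple objects. The functor F_{ij} kills every object without composition factors L_{j,d,x}, in
particular all L_{0,x}. The object F_{ji}L_{i,ν(i),x} is a non-zero quotient of the local projective
F_{jν(i)} ⊠ P_x (`epi_topMap`), so it is indecomposable. Finally Hom(𝟙 ⊠ P_x, F_{ii}L_{i,ν(i),x}) is
one-dimensional. The extension ∇(i,x) is then found as a quotient of F_{ii}L_{i,ν(i),x}, and
N_{(v,w)} as a quotient of 𝟙 ⊠ P_v, both by `IsProjectiveFamily.exists_nonsplit`.

Endomorphisms of M_v are scalars (`GluingData.isLocalRing_end_M`). The map 𝟙 ⊠ P_v → N_v reaches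
every L_{0,w}, since the N_{(v,w)} do not split and the w are distinct. So an endomorphism that
kills this map kills N_v and factors through Z. It then vanishes, because no L_{i,ν(i),w} embeds in
M_v: the ∇ do not split.

For the action, exactness gives F_{ab}M_v ≅ F_{ab}Z, and F_{ab} keeps from Z exactly the
L_{i,ν(i),w} with i = η(v,w) = b, turning them into Q_{a,w} = F_{aθ(w)}L_{θ(w),ν(θ(w)),w}. From v
one therefore reaches precisely its neighbours w, and precisely through the F_{aη(v,w)}, which form
the left cell. From Q_{j,w} one reaches the Q_{a,w} and nothing else. Compatibility of η makes
Q_{a,w} independent of v. The resulting poset has no chain of three elements, so its strict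
relations are its covering relations and its Hasse diagram is Γ. -/

noncomputable section
namespace ProjFunctors

/-! ### Fitting's lemma and local finite dimensional algebras. -/

section LocalAlgebra
variable {k R : Type*} [Field k] [Ring R] [Algebra k R] [FiniteDimensional k R]

/-- In a finite dimensional algebra, some polynomial in `a` is an idempotent `e` such that
`a` is invertible modulo `1 - e` and nilpotent modulo `e`. -/
theorem exists_idempotent_of_finiteDimensional (k : Type*) {R : Type*} [Field k] [Ring R]
    [Algebra k R] [FiniteDimensional k R] (a : R) :
    ∃ (b : R) (m : ℕ), IsIdempotentElem (b * a) ∧ Commute b a ∧ a ^ m * (b * a) = a ^ m := by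
  have hint : IsIntegral k a := Algebra.IsIntegral.isIntegral a
  set p := minpoly k a with hp
  have hp0 : p ≠ 0 := minpoly.ne_zero hint
  -- The minimal polynomial is `X ^ m * q` with `q` prime to `X`. If `u * X ^ (m + 1) + w * q = 1`,
  -- then `b = u(a) * a ^ m` gives `b * a = 1 - w(a) * q(a)`; the product of these two complementary
  -- elements contains `a ^ m * q(a) = 0`.
  obtain ⟨q, hpq, hq⟩ := Polynomial.exists_eq_pow_rootMultiplicity_mul_and_not_dvd p hp0 0
  set m := p.rootMultiplicity 0
  rw [map_zero, sub_zero] at hpq hq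
  have hcop : IsCoprime (Polynomial.X ^ (m + 1)) q :=
    ((Polynomial.prime_X.coprime_iff_not_dvd).2 hq).pow_left
  obtain ⟨u, w, huw⟩ := hcop
  have h0 : Polynomial.aeval a (Polynomial.X ^ m * q) = 0 := by
    rw [← hpq]; exact minpoly.aeval k a
  refine ⟨Polynomial.aeval a (u * Polynomial.X ^ m), m, ?_, ?_, ?_⟩
  · have h1 : (Polynomial.aeval a (u * Polynomial.X ^ m)) * a =
        Polynomial.aeval a (u * Polynomial.X ^ (m + 1)) := by
      rw [pow_succ, ← mul_assoc, map_mul _ _ Polynomial.X, Polynomial.aeval_X]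
    rw [h1]
    have h2 : u * Polynomial.X ^ (m + 1) = 1 - w * q := by rw [← huw]; ring
    have h3 : (u * Polynomial.X ^ (m + 1)) * (u * Polynomial.X ^ (m + 1)) =
        u * Polynomial.X ^ (m + 1) - (u * Polynomial.X * w) * (Polynomial.X ^ m * q) := by
      linear_combination (u * Polynomial.X ^ (m + 1)) * huw
    rw [IsIdempotentElem, ← map_mul, h3, map_sub, map_mul _ (u * Polynomial.X * w), h0, mul_zero,
      sub_zero]
  · have := Polynomial.aeval_X (R := k) a
    conv_rhs => rw [← this]
    exact (Commute.all (u * Polynomial.X ^ m) Polynomial.X).map (Polynomial.aeval a)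
  · have h1 : a ^ m * ((Polynomial.aeval a (u * Polynomial.X ^ m)) * a) =
        Polynomial.aeval a (Polynomial.X ^ m * (u * Polynomial.X ^ (m + 1))) := by
      rw [map_mul, map_mul, map_mul, map_pow, map_pow, Polynomial.aeval_X, mul_assoc, pow_succ]
    have h3 : Polynomial.X ^ m * (u * Polynomial.X ^ (m + 1)) =
        Polynomial.X ^ m - w * (Polynomial.X ^ m * q) := by
      linear_combination Polynomial.X ^ m * huw
    rw [h1, h3, map_sub, map_mul, h0, mul_zero, sub_zero, map_pow, Polynomial.aeval_X]

/-- Fitting's lemma: the idempotent `b * a`, on whose part `a` is invertible, is either `0` or `1`.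
-/
theorem isUnit_or_isNilpotent_of_idempotents (k : Type*) {R : Type*} [Field k] [Ring R]
    [Algebra k R] [FiniteDimensional k R] (h : ∀ e : R, IsIdempotentElem e → e = 0 ∨ e = 1)
    (a : R) : IsUnit a ∨ IsNilpotent a := by
  obtain ⟨b, m, h1, h2, h3⟩ := exists_idempotent_of_finiteDimensional k a
  rcases h _ h1 with h | h
  · exact Or.inr ⟨m, by rw [← h3, h, mul_zero]⟩
  · exact Or.inl ⟨⟨a, b, h2.eq ▸ h, h⟩, rfl⟩

theorem isLocalRing_of_isUnit_or_isNilpotent {R : Type*} [Ring R] [Nontrivial R]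
    (h : ∀ a : R, IsUnit a ∨ IsNilpotent a) : IsLocalRing R where
  isUnit_or_isUnit_of_add_one {a b} hab := by
    rcases h a with h | h
    · exact Or.inl h
    · exact Or.inr (by rw [eq_sub_of_add_eq' hab]; exact h.isUnit_one_sub)

theorem isLocalRing_of_idempotents (k : Type*) {R : Type*} [Field k] [Ring R]
    [Algebra k R] [FiniteDimensional k R] [Nontrivial R]
    (h : ∀ e : R, IsIdempotentElem e → e = 0 ∨ e = 1) : IsLocalRing R :=
  isLocalRing_of_isUnit_or_isNilpotent (isUnit_or_isNilpotent_of_idempotents k h)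

theorem idempotent_of_isLocalRing {R : Type*} [Ring R] [IsLocalRing R] {e : R}
    (he : IsIdempotentElem e) : e = 0 ∨ e = 1 := by
  rcases IsLocalRing.isUnit_or_isUnit_of_add_one (add_sub_cancel e 1) with h | h
  · exact Or.inr ((IsIdempotentElem.iff_eq_one_of_isUnit h).1 he)
  · have := (IsIdempotentElem.iff_eq_one_of_isUnit h).1 he.one_sub
    exact Or.inl (by simpa using this)

theorem isUnit_or_isNilpotent (k : Type*) {R : Type*} [Field k] [Ring R]
    [Algebra k R] [FiniteDimensional k R] [IsLocalRing R] (a : R) : IsUnit a ∨ IsNilpotent a :=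
  isUnit_or_isNilpotent_of_idempotents k (fun _ => idempotent_of_isLocalRing) a

/-- For a spectral value `c` the element `c - a` is not a unit, hence nilpotent. -/
theorem exists_isNilpotent_sub [IsAlgClosed k] [IsLocalRing R] (a : R) :
    ∃ c : k, IsNilpotent (a - algebraMap k R c) := by
  obtain ⟨c, hc⟩ := spectrum.nonempty_of_isAlgClosed_of_finiteDimensional k a
  refine ⟨c, ?_⟩
  rcases isUnit_or_isNilpotent k (algebraMap k R c - a) with h | h
  · exact absurd h hc
  · rw [← neg_sub]; exact h.neg

end LocalAlgebra

/-! ### Krull-Schmidt arguments in preadditive categories. -/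

section KrullSchmidt
variable {C : Type*} [Category* C] [Preadditive C]

theorem isIndec_of_isLocalRing {X : C} (h : IsLocalRing (End X)) : IsIndec X := by
  refine ⟨fun hz => ?_, fun Y Z i₁ i₂ p₁ p₂ h₁ h₂ h₃ => ?_⟩
  · exact zero_ne_one (α := End X) (hz.eq_of_src _ _)
  · have e : IsIdempotentElem (End.of (p₁ ≫ i₁)) := by
      change (p₁ ≫ i₁) ≫ (p₁ ≫ i₁) = p₁ ≫ i₁
      rw [Category.assoc, reassoc_of% h₁]
    rcases idempotent_of_isLocalRing e with h | h
    · left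
      replace h : p₁ ≫ i₁ = 0 := h
      rw [Limits.IsZero.iff_id_eq_zero]
      calc 𝟙 Y = (i₁ ≫ p₁) ≫ (i₁ ≫ p₁) := by rw [h₁, Category.comp_id]
        _ = i₁ ≫ (p₁ ≫ i₁) ≫ p₁ := by simp only [Category.assoc]
        _ = 0 := by rw [h]; simp
    · right
      replace h : p₁ ≫ i₁ = 𝟙 X := h
      rw [h, add_eq_left] at h₃
      rw [Limits.IsZero.iff_id_eq_zero]
      calc 𝟙 Z = (i₂ ≫ p₂) ≫ (i₂ ≫ p₂) := by rw [h₂, Category.comp_id]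
        _ = i₂ ≫ (p₂ ≫ i₂) ≫ p₂ := by simp only [Category.assoc]
        _ = 0 := by rw [h₃]; simp

theorem IsIndec.of_iso {X Y : C} (e : X ≅ Y) (h : IsIndec X) : IsIndec Y := by
  refine ⟨fun hz => h.1 (hz.of_iso e), fun U Z i₁ i₂ p₁ p₂ h₁ h₂ h₃ => ?_⟩
  refine h.2 (i₁ ≫ e.inv) (i₂ ≫ e.inv) (e.hom ≫ p₁) (e.hom ≫ p₂) (by simpa) (by simpa) ?_
  have := congrArg (fun f => e.hom ≫ f ≫ e.inv) h₃
  simpa using this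

/-- A form of locality that passes through fully faithful functors and projective lifts, since it
only mentions isomorphisms. -/
theorem isLocalRing_end_iff {X : C} : IsLocalRing (End X) ↔ 𝟙 X ≠ 0 ∧
    ∀ f g : X ⟶ X, f + g = 𝟙 X → IsIso f ∨ IsIso g := by
  constructor
  · intro h
    refine ⟨one_ne_zero (α := End X), fun f g hfg => ?_⟩
    rw [← isUnit_iff_isIso, ← isUnit_iff_isIso]
    exact IsLocalRing.isUnit_or_isUnit_of_add_one (R := End X) hfg
  · rintro ⟨h0, h⟩
    have : Nontrivial (End X) := ⟨𝟙 X, 0, h0⟩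
    refine ⟨fun {f g} hfg => ?_⟩
    rw [isUnit_iff_isIso, isUnit_iff_isIso]
    exact h f g hfg

theorem isLocalRing_end_of_fullyFaithful {D : Type*} [Category* D] [Preadditive D] (F : C ⥤ D)
    [F.Additive] (hF : F.FullyFaithful) {X : C} (h : IsLocalRing (End X)) :
    IsLocalRing (End (F.obj X)) := by
  rw [isLocalRing_end_iff] at h ⊢
  refine ⟨fun h0 => h.1 (hF.map_injective (by simpa using h0)), fun f g hfg => ?_⟩
  obtain ⟨f, rfl⟩ := hF.map_surjective f
  obtain ⟨g, rfl⟩ := hF.map_surjective g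
  rcases h.2 f g (hF.map_injective (by simpa using hfg)) with h | h
  · exact Or.inl inferInstance
  · exact Or.inr inferInstance

theorem isLocalRing_end_of_fullyFaithful' {D : Type*} [Category* D] [Preadditive D] (F : C ⥤ D)
    [F.Additive] (hF : F.FullyFaithful) {X : C} (h : IsLocalRing (End (F.obj X))) :
    IsLocalRing (End X) := by
  rw [isLocalRing_end_iff] at h ⊢
  refine ⟨fun h0 => h.1 (by rw [← F.map_id, h0, F.map_zero]), fun f g hfg => ?_⟩
  rcases h.2 (F.map f) (F.map g) (by rw [← F.map_add, hfg, F.map_id]) with h | h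
  · exact Or.inl (hF.isIso_of_isIso_map f)
  · exact Or.inr (hF.isIso_of_isIso_map g)

/-- A quotient of a projective object with local endomorphism ring has local endomorphism ring. -/
theorem isLocalRing_end_of_epi {P Q : C} [Projective P] (h : IsLocalRing (End P)) (π : P ⟶ Q)
    [Epi π] (hQ : 𝟙 Q ≠ 0) (hepi : ∀ f : Q ⟶ Q, Epi f → IsIso f) : IsLocalRing (End Q) := by
  rw [isLocalRing_end_iff] at h ⊢
  refine ⟨hQ, fun f g hfg => ?_⟩
  -- If `f'` lifts `f`, then `𝟙 P - f'` lifts `g`. One of the two lifts is invertible, so `f` or `g`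
  -- is an epimorphism, and `hepi` finishes.
  let f' := Projective.factorThru (π ≫ f) π
  have hf' : f' ≫ π = π ≫ f := Projective.factorThru_comp _ _
  rcases h.2 f' (𝟙 P - f') (by abel) with h | h
  · left
    apply hepi
    have : Epi (π ≫ f) := by rw [← hf']; infer_instance
    exact epi_of_epi π f
  · right
    apply hepi
    have hg : (𝟙 P - f') ≫ π = π ≫ g := by
      rw [Preadditive.sub_comp, hf', eq_sub_of_add_eq' hfg, Preadditive.comp_sub]
      simp
    have : Epi (π ≫ g) := by rw [← hg]; infer_instance
    exact epi_of_epi π g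

theorem exists_isIso_of_sum {X : C} (h : IsLocalRing (End X)) {ι : Type*} (s : Finset ι)
    (f : ι → (X ⟶ X)) (hf : IsIso (∑ i ∈ s, f i)) : ∃ i ∈ s, IsIso (f i) := by
  classical
  induction s using Finset.induction_on with
  | empty =>
    rw [Finset.sum_empty] at hf
    have := (isUnit_iff_isIso (X := X) (0 : X ⟶ X)).2 hf
    exact absurd this (not_isUnit_zero (M₀ := End X))
  | insert a s ha ih =>
    rw [Finset.sum_insert ha] at hf
    have := (isUnit_iff_isIso (X := X) (f a + ∑ i ∈ s, f i)).2 hf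
    rcases IsLocalRing.isUnit_or_isUnit_of_isUnit_add (R := End X) this with h' | h'
    · exact ⟨a, Finset.mem_insert_self _ _, (isUnit_iff_isIso _).1 h'⟩
    · obtain ⟨i, hi, h''⟩ := ih ((isUnit_iff_isIso _).1 h')
      exact ⟨i, Finset.mem_insert_of_mem hi, h''⟩

/-- The identity of `X` is a sum of endomorphisms through members of `S`, and in a local ring one
summand is invertible. This takes the place of uniqueness of Krull-Schmidt decompositions in all
later arguments. -/
theorem exists_retract_of_addClosure {S : ObjectProperty C} {X : C} (h : IsLocalRing (End X))
    (hX : addClosure S X) : ∃ Y, S Y ∧ Nonempty (Retract X Y) := by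
  obtain ⟨ι, _, Y, p, q, hY, hpq⟩ := hX
  obtain ⟨s, -, hs⟩ := exists_isIso_of_sum h Finset.univ (fun s => p s ≫ q s)
    (by rw [hpq]; infer_instance)
  exact ⟨Y s, hY s, ⟨⟨p s, q s ≫ inv (p s ≫ q s), by
    rw [← Category.assoc, IsIso.hom_inv_id]⟩⟩⟩

/-- A non-zero retract of an object with local endomorphism ring is isomorphic to it. -/
theorem nonempty_iso_of_retract {X Y : C} (hX : ¬ Limits.IsZero X) (hY : IsLocalRing (End Y))
    (r : Retract X Y) : Nonempty (X ≅ Y) := by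
  have e : IsIdempotentElem (End.of (r.r ≫ r.i)) := by
    change (r.r ≫ r.i) ≫ (r.r ≫ r.i) = r.r ≫ r.i
    simp
  rcases idempotent_of_isLocalRing e with h | h
  · refine absurd ((Limits.IsZero.iff_id_eq_zero X).2 ?_) hX
    replace h : r.r ≫ r.i = 0 := h
    calc 𝟙 X = (r.i ≫ r.r) ≫ (r.i ≫ r.r) := by simp
      _ = r.i ≫ (r.r ≫ r.i) ≫ r.r := by simp only [Category.assoc]
      _ = 0 := by rw [h]; simp
  · exact ⟨⟨r.i, r.r, r.retract, h⟩⟩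

theorem addClosure_of_retract {S : ObjectProperty C} {X Y : C} (r : Retract X Y)
    (h : addClosure S Y) : addClosure S X :=
  addClosure_of_sum Unit (fun _ => Y) (fun _ => r.i) (fun _ => r.r) (fun _ => h) (by simp)

theorem addClosure_of_iso {S : ObjectProperty C} {X Y : C} (e : X ≅ Y)
    (h : addClosure S Y) : addClosure S X :=
  addClosure_of_retract ⟨e.hom, e.inv, e.hom_inv_id⟩ h

theorem addClosure_mono {S T : ObjectProperty C} (h : ∀ X, S X → addClosure T X) {X : C}
    (hX : addClosure S X) : addClosure T X := by
  obtain ⟨ι, _, Y, p, q, hY, hpq⟩ := hX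
  exact addClosure_of_sum ι Y p q (fun s => h _ (hY s)) hpq

theorem addClosure_map {D : Type*} [Category* D] [Preadditive D] (F : C ⥤ D) [F.Additive]
    {S : ObjectProperty C} {T : ObjectProperty D} (h : ∀ X, S X → addClosure T (F.obj X)) {X : C}
    (hX : addClosure S X) : addClosure T (F.obj X) := by
  obtain ⟨ι, _, Y, p, q, hY, hpq⟩ := hX
  refine addClosure_of_sum ι (fun s => F.obj (Y s)) (fun s => F.map (p s)) (fun s => F.map (q s))
    (fun s => h _ (hY s)) ?_
  rw [← F.map_id, ← hpq, F.map_sum]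
  simp only [F.map_comp]

theorem isIdempotentComplete_of_retract {C : Type*} [Category* C] [IsIdempotentComplete C]
    (S : ObjectProperty C)
    (h : ∀ X Y, Retract X Y → S Y → S X) : IsIdempotentComplete S.FullSubcategory where
  idempotents_split X p hp := by
    obtain ⟨Y, i, e, h1, h2⟩ := IsIdempotentComplete.idempotents_split X.obj p.hom
      (congrArg (·.hom) hp)
    exact ⟨⟨Y, h Y X.obj ⟨i, e, h1⟩ X.property⟩, ObjectProperty.homMk i, ObjectProperty.homMk e,
      ObjectProperty.hom_ext _ h1, ObjectProperty.hom_ext _ h2⟩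

theorem hasFiniteBiproducts_addClosure [Limits.HasFiniteBiproducts C] (S : ObjectProperty C) :
    Limits.HasFiniteBiproducts (addClosure S).FullSubcategory where
  out n := ⟨fun F => by
    let b := Limits.biproduct.bicone (fun j => (F j).obj)
    have hb : ∑ j, b.π j ≫ b.ι j = 𝟙 b.pt := Limits.biproduct.total
    have hS : addClosure S b.pt :=
      addClosure_of_sum (Fin n) (fun j => (F j).obj) b.π b.ι (fun j => (F j).property) hb
    let b' : Limits.Bicone F :=
      { pt := ⟨b.pt, hS⟩
        π := fun j => ObjectProperty.homMk (b.π j)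
        ι := fun j => ObjectProperty.homMk (b.ι j)
        ι_π := fun j j' => ObjectProperty.hom_ext _ (by
          change b.ι j ≫ b.π j' = _
          rw [b.ι_π]
          split_ifs with h
          · subst h; rfl
          · rfl) }
    refine ⟨⟨b', Limits.isBilimitOfTotal b' (ObjectProperty.hom_ext _ ?_)⟩⟩
    refine Eq.trans ?_ hb
    exact map_sum (AddMonoidHom.mk' (fun g : b'.pt ⟶ b'.pt => g.hom) (fun _ _ => rfl)) _ _⟩

variable {k : Type*} [Field k] [Linear k C] [IsIdempotentComplete C]

/-- Since idempotents split, an idempotent endomorphism and its complement cut `X` into two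
summands, so indecomposability leaves only `0` and `1`. -/
theorem isLocalRing_end_of_isIndec (k : Type*) [Field k] [Linear k C] {X : C}
    [Module.Finite k (X ⟶ X)] (h : IsIndec X) : IsLocalRing (End X) := by
  have : FiniteDimensional k (End X) := ‹Module.Finite k (X ⟶ X)›
  have : Nontrivial (End X) := ⟨0, 1, fun h0 => h.1 ((Limits.IsZero.iff_id_eq_zero X).2 h0.symm)⟩
  refine isLocalRing_of_idempotents k fun e he => ?_
  obtain ⟨Y, i, p, h1, h2⟩ := IsIdempotentComplete.idempotents_split X e he
  obtain ⟨Z, j, q, h3, h4⟩ := IsIdempotentComplete.idempotents_split X (1 - e) he.one_sub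
  rcases h.2 i j p q h1 h3 (by rw [h2, h4]; exact add_sub_cancel _ _) with hz | hz
  · left; rw [← h2, hz.eq_of_tgt p 0, Limits.zero_comp]
  · right
    rw [hz.eq_of_tgt q 0, Limits.zero_comp] at h4
    exact (sub_eq_zero.1 h4.symm).symm

/-- Krull-Schmidt decompositions. -/
theorem exists_krullSchmidt (k : Type*) [Field k] [Linear k C]
    (hf : ∀ X Y : C, Module.Finite k (X ⟶ Y)) (X : C) :
    ∃ (ι : Type) (_ : Finite ι) (Y : ι → C) (b : Limits.Bicone Y),
      (∀ s, IsLocalRing (End (Y s))) ∧ Nonempty b.IsBilimit ∧ Nonempty (b.pt ≅ X) := by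
  suffices H : ∃ (ι : Type) (_ : Fintype ι) (_ : DecidableEq ι) (Y : ι → C) (i : ∀ s, Y s ⟶ X)
      (p : ∀ s, X ⟶ Y s), (∀ s, IsLocalRing (End (Y s))) ∧ (∀ s, i s ≫ p s = 𝟙 _) ∧
      (∀ s t, s ≠ t → i s ≫ p t = 0) ∧ ∑ s, p s ≫ i s = 𝟙 X by
    obtain ⟨ι, _, _, Y, i, p, h0, h1, h2, h3⟩ := H
    let b : Limits.Bicone Y :=
      { pt := X, π := p, ι := i
        ι_π := fun s t => by
          split_ifs with h
          · subst h; exact h1 s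
          · exact h2 s t h }
    exact ⟨ι, inferInstance, Y, b, h0, ⟨Limits.isBilimitOfTotal b h3⟩, ⟨Iso.refl _⟩⟩
  -- The dimension of the endomorphism algebra strictly drops on passing to a proper summand.
  induction hn : Module.finrank k (X ⟶ X) using Nat.strong_induction_on generalizing X with
  | _ n ih =>
  by_cases hX : IsIndec X
  · exact ⟨Unit, inferInstance, inferInstance, fun _ => X, fun _ => 𝟙 X, fun _ => 𝟙 X,
      fun _ => isLocalRing_end_of_isIndec k hX, by simp, fun s t h => absurd rfl h, by simp⟩
  rw [IsIndec, not_and_or, not_not] at hX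
  rcases hX with hX | hX
  · exact ⟨Empty, inferInstance, inferInstance, Empty.elim, fun s => s.elim, fun s => s.elim,
      fun s => s.elim, fun s => s.elim, fun s => s.elim, hX.eq_of_src _ _⟩
  push Not at hX
  obtain ⟨Y, Z, i₁, i₂, p₁, p₂, h₁, h₂, h₃, hY, hZ⟩ := hX
  have h12 : i₁ ≫ p₂ = 0 := by
    have := congrArg (fun f => i₁ ≫ f ≫ p₂) h₃
    simpa [reassoc_of% h₁, h₂] using this
  have h21 : i₂ ≫ p₁ = 0 := by
    have := congrArg (fun f => i₂ ≫ f ≫ p₁) h₃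
    simpa [reassoc_of% h₂, h₁] using this
  -- The map `f ↦ p₁ ≫ f ≫ i₁` embeds the endomorphisms of `Y` in those of `X`. It misses `𝟙 X`: its
  -- values vanish between `i₂` and `p₂`, whereas `i₂ ≫ p₂` is the identity of a non-zero object.
  have key : ∀ {Y Z : C} (i₁ : Y ⟶ X) (i₂ : Z ⟶ X) (p₁ : X ⟶ Y) (p₂ : X ⟶ Z),
      i₁ ≫ p₁ = 𝟙 Y → i₂ ≫ p₂ = 𝟙 Z → i₂ ≫ p₁ = 0 → ¬ Limits.IsZero Z →
      Module.finrank k (Y ⟶ Y) < n := by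
    intro Y Z i₁ i₂ p₁ p₂ h₁ h₂ h21 hZ
    rw [← hn]
    let φ : (Y ⟶ Y) →ₗ[k] (X ⟶ X) :=
      (Linear.leftComp k X p₁).comp (Linear.rightComp k Y i₁)
    have hφ : ∀ f, φ f = p₁ ≫ f ≫ i₁ := fun f => rfl
    have hinj : Function.Injective φ := fun f g h => by
      have := congrArg (fun f => i₁ ≫ f ≫ p₁) h
      simpa [hφ, reassoc_of% h₁, h₁] using this
    have := hf X X
    have := hf Y Y
    rw [← LinearMap.finrank_range_of_inj hinj]
    refine Submodule.finrank_lt (fun htop => hZ ?_)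
    obtain ⟨f, hfe⟩ := LinearMap.range_eq_top.1 htop (𝟙 X)
    rw [Limits.IsZero.iff_id_eq_zero, ← h₂]
    have := congrArg (fun f => i₂ ≫ f ≫ p₂) hfe
    simp only [hφ, Category.assoc, Category.id_comp, reassoc_of% h21, Limits.zero_comp] at this
    exact this.symm
  obtain ⟨ι, _, _, U, i, p, a0, a1, a2, a3⟩ := ih _ (key i₁ i₂ p₁ p₂ h₁ h₂ h21 hZ) Y rfl
  obtain ⟨κ, _, _, V, j, q, b0, b1, b2, b3⟩ := ih _ (key i₂ i₁ p₂ p₁ h₂ h₁ h12 hY) Z rfl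
  refine ⟨ι ⊕ κ, inferInstance, inferInstance, Sum.elim U V,
    Sum.rec (fun s => i s ≫ i₁) (fun s => j s ≫ i₂),
    Sum.rec (fun s => p₁ ≫ p s) (fun s => p₂ ≫ q s), ?_, ?_, ?_, ?_⟩
  · rintro (s | s)
    · exact a0 s
    · exact b0 s
  · rintro (s | s)
    · simpa [reassoc_of% h₁] using a1 s
    · simpa [reassoc_of% h₂] using b1 s
  · rintro (s | s) (t | t) hst
    · change (i s ≫ i₁) ≫ (p₁ ≫ p t) = (0 : U s ⟶ U t)
      simpa [reassoc_of% h₁] using a2 s t (fun h => hst (by rw [h]))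
    · change (i s ≫ i₁) ≫ (p₂ ≫ q t) = (0 : U s ⟶ V t)
      simp [reassoc_of% h12]
    · change (j s ≫ i₂) ≫ (p₁ ≫ p t) = (0 : V s ⟶ U t)
      simp [reassoc_of% h21]
    · change (j s ≫ i₂) ≫ (p₂ ≫ q t) = (0 : V s ⟶ V t)
      simpa [reassoc_of% h₂] using b2 s t (fun h => hst (by rw [h]))
  · rw [Fintype.sum_sum_type]
    refine Eq.trans ?_ h₃
    congr 1
    · have := congrArg (fun f => p₁ ≫ f ≫ i₁) a3
      simpa [Preadditive.sum_comp, Preadditive.comp_sum] using this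
    · have := congrArg (fun f => p₂ ≫ f ≫ i₂) b3
      simpa [Preadditive.sum_comp, Preadditive.comp_sum] using this

end KrullSchmidt

/-! ### The abelianization as a module category. -/

section AbCat
variable {D : Type*} [Category* D] [Preadditive D]

/-- The embedding of a category into its abelianization. -/
def abelianizeFunctor (D : Type*) [Category* D] [Preadditive D] : D ⥤ AbCat D where
  obj X := abelianize X
  map {X Y} f := (CategoryTheory.Quotient.functor (homotopic D)).map
    (Arrow.homMk f f (by simp) : Arrow.mk (0 : X ⟶ X) ⟶ Arrow.mk (0 : Y ⟶ Y))
  map_id X := (CategoryTheory.Quotient.functor (homotopic D)).map_id (Arrow.mk (0 : X ⟶ X))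
  map_comp {X Y Z} f g := (CategoryTheory.Quotient.functor (homotopic D)).map_comp
    (Arrow.homMk f f (by simp) : Arrow.mk (0 : X ⟶ X) ⟶ Arrow.mk (0 : Y ⟶ Y))
    (Arrow.homMk g g (by simp) : Arrow.mk (0 : Y ⟶ Y) ⟶ Arrow.mk (0 : Z ⟶ Z))

theorem abMap_eq_iff {X Y : Arrow D} (f g : X ⟶ Y) :
    (CategoryTheory.Quotient.functor (homotopic D)).map f =
      (CategoryTheory.Quotient.functor (homotopic D)).map g ↔
      ∃ h : X.right ⟶ Y.left, f.right - g.right = h ≫ Y.hom :=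
  CategoryTheory.Quotient.functor_map_eq_iff _ f g

theorem abMap_eq_zero_iff {X Y : Arrow D} (f : X ⟶ Y) :
    (CategoryTheory.Quotient.functor (homotopic D)).map f = 0 ↔
      ∃ h : X.right ⟶ Y.left, f.right = h ≫ Y.hom := by
  rw [← Functor.map_zero (CategoryTheory.Quotient.functor (homotopic D)) X Y, abMap_eq_iff]
  refine exists_congr fun h => ?_
  change f.right - 0 = _ ↔ _
  rw [sub_zero]

instance : (abelianizeFunctor D).Additive where
  map_add {X Y f g} := by
    change _ = (CategoryTheory.Quotient.functor (homotopic D)).map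
      (Arrow.homMk f f (by simp) : Arrow.mk (0 : X ⟶ X) ⟶ Arrow.mk (0 : Y ⟶ Y)) +
      (CategoryTheory.Quotient.functor (homotopic D)).map
      (Arrow.homMk g g (by simp) : Arrow.mk (0 : X ⟶ X) ⟶ Arrow.mk (0 : Y ⟶ Y))
    rw [← (CategoryTheory.Quotient.functor (homotopic D)).map_add]
    rfl

instance {k : Type*} [Field k] [Linear k D] : (abelianizeFunctor D).Linear k where
  map_smul {X Y} f r := by
    change _ = r • (CategoryTheory.Quotient.functor (homotopic D)).map
      (Arrow.homMk f f (by simp) : Arrow.mk (0 : X ⟶ X) ⟶ Arrow.mk (0 : Y ⟶ Y))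
    rw [← (CategoryTheory.Quotient.functor (homotopic D)).map_smul]
    rfl

/-- The presenting epimorphism of an object of the abelianization. -/
def cover (X : AbCat D) : (abelianizeFunctor D).obj X.as.right ⟶ X :=
  (CategoryTheory.Quotient.functor (homotopic D)).map
    (Arrow.homMk 0 (𝟙 _) (by simp) : Arrow.mk (0 : X.as.right ⟶ X.as.right) ⟶ X.as)

/-- With `exists_map_cover` and `cover_desc` this makes `cover X` a cokernel of the arrow presenting
`X`, with objects of `D` projective relative to covers. Everything later about the abelianization is
deduced from these facts. -/
theorem map_cover_eq_zero_iff {d : D} {X : AbCat D} (f : d ⟶ X.as.right) :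
    (abelianizeFunctor D).map f ≫ cover X = 0 ↔ ∃ h : d ⟶ X.as.left, f = h ≫ X.as.hom := by
  change (CategoryTheory.Quotient.functor (homotopic D)).map
    (Arrow.homMk f f (by simp) : Arrow.mk (0 : d ⟶ d) ⟶ Arrow.mk (0 : X.as.right ⟶ X.as.right)) ≫
    (CategoryTheory.Quotient.functor (homotopic D)).map
    (Arrow.homMk 0 (𝟙 _) (by simp) : Arrow.mk (0 : X.as.right ⟶ X.as.right) ⟶ X.as) = 0 ↔ _
  rw [← Functor.map_comp, abMap_eq_zero_iff]
  change (∃ h : d ⟶ X.as.left, f ≫ 𝟙 _ = h ≫ X.as.hom) ↔ _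
  rw [Category.comp_id]

theorem exists_map_cover {d : D} {X : AbCat D} (g : (abelianizeFunctor D).obj d ⟶ X) :
    ∃ f : d ⟶ X.as.right, (abelianizeFunctor D).map f ≫ cover X = g := by
  obtain ⟨g, rfl⟩ := (CategoryTheory.Quotient.functor (homotopic D)).map_surjective
    (X := Arrow.mk (0 : d ⟶ d)) (Y := X.as) g
  refine ⟨g.right, ?_⟩
  change (CategoryTheory.Quotient.functor (homotopic D)).map
    (Arrow.homMk _ _ (by simp) : Arrow.mk (0 : d ⟶ d) ⟶ Arrow.mk (0 : X.as.right ⟶ X.as.right)) ≫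
    (CategoryTheory.Quotient.functor (homotopic D)).map
    (Arrow.homMk 0 (𝟙 _) (by simp) : Arrow.mk (0 : X.as.right ⟶ X.as.right) ⟶ X.as) = _
  rw [← Functor.map_comp, abMap_eq_iff]
  refine ⟨0, ?_⟩
  change g.right ≫ 𝟙 _ - g.right = _
  simp

theorem cover_desc {X Y : AbCat D} (g : (abelianizeFunctor D).obj X.as.right ⟶ Y)
    (hg : (abelianizeFunctor D).map X.as.hom ≫ g = 0) : ∃ h : X ⟶ Y, cover X ≫ h = g := by
  obtain ⟨f, rfl⟩ := exists_map_cover g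
  rw [← Category.assoc, ← Functor.map_comp, map_cover_eq_zero_iff] at hg
  obtain ⟨h, hh⟩ := hg
  refine ⟨(CategoryTheory.Quotient.functor (homotopic D)).map
    (Arrow.homMk h f hh.symm : X.as ⟶ Y.as), ?_⟩
  change (CategoryTheory.Quotient.functor (homotopic D)).map
    (Arrow.homMk 0 (𝟙 _) (by simp) : Arrow.mk (0 : X.as.right ⟶ X.as.right) ⟶ X.as) ≫ _ =
    (CategoryTheory.Quotient.functor (homotopic D)).map
    (Arrow.homMk f f (by simp) : Arrow.mk (0 : X.as.right ⟶ X.as.right) ⟶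
      Arrow.mk (0 : Y.as.right ⟶ Y.as.right)) ≫
    (CategoryTheory.Quotient.functor (homotopic D)).map
    (Arrow.homMk 0 (𝟙 _) (by simp) : Arrow.mk (0 : Y.as.right ⟶ Y.as.right) ⟶ Y.as)
  rw [← Functor.map_comp, ← Functor.map_comp, abMap_eq_iff]
  refine ⟨0, ?_⟩
  change 𝟙 _ ≫ f - f ≫ 𝟙 _ = _
  simp

instance (X : AbCat D) : Epi (cover X) where
  left_cancellation {Y} g h e := by
    obtain ⟨g, rfl⟩ := (CategoryTheory.Quotient.functor (homotopic D)).map_surjective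
      (X := X.as) (Y := Y.as) g
    obtain ⟨h, rfl⟩ := (CategoryTheory.Quotient.functor (homotopic D)).map_surjective
      (X := X.as) (Y := Y.as) h
    have e' : (CategoryTheory.Quotient.functor (homotopic D)).map
        ((Arrow.homMk 0 (𝟙 _) (by simp) : Arrow.mk (0 : X.as.right ⟶ X.as.right) ⟶ X.as) ≫ g) =
        (CategoryTheory.Quotient.functor (homotopic D)).map
        ((Arrow.homMk 0 (𝟙 _) (by simp) : Arrow.mk (0 : X.as.right ⟶ X.as.right) ⟶ X.as) ≫ h) := by
      rw [Functor.map_comp, Functor.map_comp]; exact e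
    rw [abMap_eq_iff] at e'
    obtain ⟨t, ht⟩ := e'
    refine (abMap_eq_iff g h).2 ⟨t, ?_⟩
    change 𝟙 _ ≫ g.right - 𝟙 _ ≫ h.right = _ at ht
    simpa using ht

/-- The embedding into the abelianization is fully faithful. -/
def abelianizeFullyFaithful (D : Type*) [Category* D] [Preadditive D] :
    (abelianizeFunctor D).FullyFaithful := by
  have hfaith : (abelianizeFunctor D).Faithful := ⟨fun {X Y f g} h => by
    obtain ⟨t, ht⟩ := (abMap_eq_iff _ _).1 h
    change f - g = t ≫ 0 at ht
    rw [Limits.comp_zero] at ht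
    exact sub_eq_zero.1 ht⟩
  have hfull : (abelianizeFunctor D).Full := ⟨fun {X Y} g => by
    obtain ⟨g, rfl⟩ := (CategoryTheory.Quotient.functor (homotopic D)).map_surjective
      (X := Arrow.mk (0 : X ⟶ X)) (Y := Arrow.mk (0 : Y ⟶ Y)) g
    refine ⟨g.right, (abMap_eq_iff _ _).2 ⟨0, ?_⟩⟩
    change g.right - g.right = _
    simp⟩
  exact Functor.FullyFaithful.ofFullyFaithful _

instance : (abelianizeFunctor D).Full := (abelianizeFullyFaithful D).full
instance : (abelianizeFunctor D).Faithful := (abelianizeFullyFaithful D).faithful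

/-- Precomposition with the cover of `X` is injective, and its target is a quotient of a space of
morphisms in `D`. -/
theorem finite_hom_abCat (k : Type*) [Field k] [Linear k D]
    (hf : ∀ X Y : D, Module.Finite k (X ⟶ Y)) (X Y : AbCat D) : Module.Finite k (X ⟶ Y) := by
  let φ : (X ⟶ Y) →ₗ[k] ((abelianizeFunctor D).obj X.as.right ⟶ Y) := Linear.leftComp k Y (cover X)
  have hφ : Function.Injective φ := fun f g h => (cancel_epi (cover X)).1 h
  let ψ : (X.as.right ⟶ Y.as.right) →ₗ[k] ((abelianizeFunctor D).obj X.as.right ⟶ Y) :=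
    (Linear.rightComp k _ (cover Y)).comp ((abelianizeFunctor D).mapLinearMap k)
  have hψ : Function.Surjective ψ := fun g => exists_map_cover g
  have := hf X.as.right Y.as.right
  have := Module.Finite.of_surjective ψ hψ
  exact Module.Finite.of_injective φ hφ

/-- Every object is a direct summand of a finite direct sum of copies of `P`. -/
def IsAddGenerator (P : D) : Prop :=
  ∀ X : D, ∃ (ι : Type) (_ : Fintype ι) (p : ι → (X ⟶ P)) (q : ι → (P ⟶ X)),
    ∑ s, p s ≫ q s = 𝟙 X

theorem isAddGenerator_of_addClosure {P : D} (h : ∀ X : D, addClosure (· = P) X) :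
    IsAddGenerator P := fun X => by
  obtain ⟨ι, _, Y, p, q, hY, hpq⟩ := h X
  obtain rfl : Y = fun _ => P := funext hY
  exact ⟨ι, inferInstance, p, q, hpq⟩

theorem eq_of_comp_eq {P : D} (hP : IsAddGenerator P) {X Y : AbCat D} {f g : X ⟶ Y}
    (h : ∀ t : (abelianizeFunctor D).obj P ⟶ X, t ≫ f = t ≫ g) : f = g := by
  rw [← cancel_epi (cover X)]
  obtain ⟨ι, _, p, q, hpq⟩ := hP X.as.right
  have e : ∑ s, (abelianizeFunctor D).map (p s) ≫ (abelianizeFunctor D).map (q s) = 𝟙 _ := by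
    rw [← CategoryTheory.Functor.map_id, ← hpq, Functor.map_sum]; simp only [Functor.map_comp]
  rw [← Category.id_comp (cover X ≫ f), ← Category.id_comp (cover X ≫ g), ← e,
    Preadditive.sum_comp, Preadditive.sum_comp]
  refine Finset.sum_congr rfl fun s _ => ?_
  have := h ((abelianizeFunctor D).map (q s) ≫ cover X)
  simp only [Category.assoc] at this ⊢
  rw [this]

/-- The endomorphism algebra of a generator. -/
abbrev GenRing (P : D) := (End ((abelianizeFunctor D).obj P))ᵐᵒᵖ

/-- Morphisms from a generator, as modules over its endomorphism algebra. -/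
abbrev genFunctor (P : D) : AbCat D ⥤ ModuleCat (GenRing P) :=
  preadditiveCoyonedaObj ((abelianizeFunctor D).obj P)

theorem genFunctor_faithful {P : D} (hP : IsAddGenerator P) : (genFunctor P).Faithful where
  map_injective {X Y _ _} h := eq_of_comp_eq hP fun t =>
    congrArg (fun φ : (genFunctor P).obj X ⟶ (genFunctor P).obj Y => φ.hom t) h

/-- A linear map between the modules of morphisms from `P` prescribes values on `P`. Writing
`X.as.right` as a summand of copies of `P` extends the prescription to the cover of `X`, and
linearity makes it vanish on relations, so it descends to `X`. -/
theorem genFunctor_full {P : D} (hP : IsAddGenerator P) : (genFunctor P).Full where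
  map_surjective {X Y} φ := by
    let G := abelianizeFunctor D
    let ψ : (G.obj P ⟶ X) → (G.obj P ⟶ Y) := fun t => φ.hom t
    have hadd : ∀ a b, ψ (a + b) = ψ a + ψ b := fun a b => map_add φ.hom a b
    have hsmul : ∀ (r : G.obj P ⟶ G.obj P) a, ψ (r ≫ a) = r ≫ ψ a := fun r a =>
      map_smul φ.hom (MulOpposite.op (α := End ((abelianizeFunctor D).obj P)) r) a
    have hsum : ∀ {ι : Type} (s : Finset ι) (a : ι → (G.obj P ⟶ X)),
        ψ (∑ i ∈ s, a i) = ∑ i ∈ s, ψ (a i) := fun s a =>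
      map_sum (AddMonoidHom.mk' ψ hadd) a s
    obtain ⟨ι, _, p, q, hpq⟩ := hP X.as.right
    obtain ⟨κ, _, p', q', hpq'⟩ := hP X.as.left
    -- Each `t ≫ p s` is an endomorphism of `P`, so it can be moved inside `ψ`; then the
    -- decomposition of the identity is summed.
    have key : ∀ t : P ⟶ X.as.right, ∑ s, G.map t ≫ G.map (p s) ≫ ψ (G.map (q s) ≫ cover X) =
        ψ (G.map t ≫ cover X) := fun t => by
      have e : G.map t ≫ cover X = ∑ s, (G.map t ≫ G.map (p s)) ≫ G.map (q s) ≫ cover X := by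
        have := congrArg (fun f => G.map (t ≫ f) ≫ cover X) hpq
        simp only [Category.comp_id] at this
        rw [← this, Preadditive.comp_sum, Functor.map_sum, Preadditive.sum_comp]
        simp only [Functor.map_comp, Category.assoc]
      rw [e, hsum]
      refine Finset.sum_congr rfl fun s _ => ?_
      rw [hsmul, Category.assoc]
    obtain ⟨f, hf⟩ := cover_desc (X := X) (Y := Y)
      (∑ s, G.map (p s) ≫ ψ (G.map (q s) ≫ cover X)) (by
        have e : G.map X.as.hom = ∑ t, G.map (p' t) ≫ G.map (q' t ≫ X.as.hom) := by
          have := congrArg (fun f => G.map (f ≫ X.as.hom)) hpq'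
          simp only [Category.id_comp] at this
          rw [← this, Preadditive.sum_comp, Functor.map_sum]
          simp only [Functor.map_comp, Category.assoc]
        change G.map X.as.hom ≫ _ = 0
        rw [e, Preadditive.sum_comp]
        refine Finset.sum_eq_zero fun t _ => ?_
        rw [Category.assoc, Preadditive.comp_sum, key, (map_cover_eq_zero_iff _).2 ⟨q' t, rfl⟩]
        rw [show ψ 0 = 0 from map_zero φ.hom, Limits.comp_zero])
    refine ⟨f, ModuleCat.hom_ext (LinearMap.ext fun t => ?_)⟩
    obtain ⟨t, rfl⟩ := exists_map_cover t
    change ((abelianizeFunctor D).map t ≫ cover X) ≫ f = ψ (G.map t ≫ cover X)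
    rw [Category.assoc, hf, Preadditive.comp_sum, key]

theorem finite_genFunctor_obj (k : Type*) [Field k] [Linear k D]
    (hf : ∀ X Y : D, Module.Finite k (X ⟶ Y)) (P : D) (X : AbCat D) :
    Module.Finite (GenRing P) ((genFunctor P).obj X) := by
  have h1 : Module.Finite k ((abelianizeFunctor D).obj P ⟶ X) := finite_hom_abCat k hf _ _
  have h2 : IsScalarTower k (GenRing P) ((abelianizeFunctor D).obj P ⟶ X) :=
    ⟨fun c r f => Linear.smul_comp _ _ _ c r.unop f⟩
  exact Module.Finite.of_restrictScalars_finite k (GenRing P) ((abelianizeFunctor D).obj P ⟶ X)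

theorem isNoetherianRing_genRing (k : Type*) [Field k] [Linear k D]
    (hf : ∀ X Y : D, Module.Finite k (X ⟶ Y)) (P : D) : IsNoetherianRing (GenRing P) := by
  have h1 : Module.Finite k (End ((abelianizeFunctor D).obj P)) := finite_hom_abCat k hf _ _
  have h2 : Module.Finite k (GenRing P) := Module.Finite.equiv (MulOpposite.opLinearEquiv k)
  exact isNoetherian_of_tower k inferInstance

/-- A finite presentation of `N` is a matrix over the endomorphism algebra of `P`, hence an arrow
between sums of copies of `P`; the object given by this arrow is sent to `N`. -/
theorem genFunctor_essSurj [Limits.HasFiniteBiproducts D] (P : D) (N : ModuleCat (GenRing P))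
    [IsNoetherianRing (GenRing P)] [Module.Finite (GenRing P) N] :
    ∃ X, Nonempty ((genFunctor P).obj X ≅ N) := by
  let G := abelianizeFunctor D
  obtain ⟨m, g, hg⟩ := Module.Finite.exists_fin' (GenRing P) N
  obtain ⟨r, κ, hκ⟩ := Submodule.fg_iff_exists_fin_generating_family.1
    (IsNoetherian.noetherian (LinearMap.ker g))
  let u : Fin r → Fin m → (P ⟶ P) := fun t s =>
    (abelianizeFullyFaithful D).preimage (κ t s).unop
  have hu : ∀ t s, G.map (u t s) = (κ t s).unop := fun t s =>
    (abelianizeFullyFaithful D).map_preimage _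
  let d : (⨁ fun _ : Fin r => P) ⟶ (⨁ fun _ : Fin m => P) := Limits.biproduct.matrix u
  let X : AbCat D := ⟨Arrow.mk d⟩
  let c : G.obj (⨁ fun _ : Fin m => P) ⟶ X := cover X
  let h : (Fin m → GenRing P) →ₗ[GenRing P] (G.obj P ⟶ X) :=
    Fintype.linearCombination (GenRing P)
      (fun s => G.map (Limits.biproduct.ι (fun _ : Fin m => P) s) ≫ c)
  have hh : ∀ b : Fin m → GenRing P, h b =
      ∑ s, (b s).unop ≫ G.map (Limits.biproduct.ι (fun _ : Fin m => P) s) ≫ c := fun b => rfl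
  have hh' : ∀ f : P ⟶ (⨁ fun _ : Fin m => P), h (fun s => MulOpposite.op (G.map (f ≫ Limits.biproduct.π _ s))) =
      G.map f ≫ c := fun f => by
    rw [hh]
    have := congrArg (fun t => G.map (f ≫ t) ≫ c)
      (Limits.biproduct.total (f := fun _ : Fin m => P))
    simp only [Category.comp_id] at this
    rw [← this, Preadditive.comp_sum, Functor.map_sum, Preadditive.sum_comp]
    simp
  have hsurj : Function.Surjective h := fun t => by
    obtain ⟨f, rfl⟩ := exists_map_cover t
    exact ⟨_, hh' f⟩
  -- Both kernels are spanned by the relations `κ j`: a tuple dies in the formal cokernel exactly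
  -- when it factors through `d`, and then it is a combination of the rows of `u`.
  have hker : LinearMap.ker h = LinearMap.ker g := by
    apply le_antisymm
    · intro b hb
      let f : P ⟶ (⨁ fun _ : Fin m => P) := Limits.biproduct.lift fun s =>
        (abelianizeFullyFaithful D).preimage (b s).unop
      have hfb : (fun s => MulOpposite.op (G.map (f ≫ Limits.biproduct.π _ s))) = b := by
        funext s
        simp only [f, Limits.biproduct.lift_π]
        rw [Functor.FullyFaithful.map_preimage]
        rfl
      have h0 : G.map f ≫ c = 0 := by rw [← hh', hfb]; exact hb
      obtain ⟨t, ht⟩ := (map_cover_eq_zero_iff (X := X) f).1 h0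
      have : b = ∑ j, (MulOpposite.op (G.map (t ≫ Limits.biproduct.π _ j)) : GenRing P) • κ j := by
        rw [← hfb]
        funext s
        rw [Finset.sum_apply]
        apply MulOpposite.unop_injective
        rw [Finset.unop_sum]
        change G.map (f ≫ _) = ∑ j, G.map (t ≫ Limits.biproduct.π _ j) ≫ (κ j s).unop
        rw [ht]
        change G.map ((t ≫ d) ≫ _) = _
        simp only [d, Category.assoc, Limits.biproduct.matrix_π]
        simp only [Limits.biproduct.desc_eq, Preadditive.comp_sum, Functor.map_sum,
          Functor.map_comp, hu]
        simp
      rw [this]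
      refine Submodule.sum_mem _ fun j _ => Submodule.smul_mem _ _ ?_
      rw [← hκ]; exact Submodule.subset_span ⟨j, rfl⟩
    · rw [← hκ, Submodule.span_le]
      rintro _ ⟨j, rfl⟩
      change h (κ j) = 0
      have : κ j = fun s => MulOpposite.op
          (G.map ((Limits.biproduct.ι (fun _ : Fin r => P) j ≫ d) ≫ Limits.biproduct.π _ s)) := by
        funext s
        simp [d, hu]
      rw [this, hh']
      exact (map_cover_eq_zero_iff (X := X) _).2 ⟨_, rfl⟩
  refine ⟨X, ⟨LinearEquiv.toModuleIso ?_⟩⟩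
  exact ((LinearMap.quotKerEquivOfSurjective h hsurj).symm.trans
    (Submodule.quotEquivOfEq _ _ hker)).trans (LinearMap.quotKerEquivOfSurjective g hg)

/-- The functor `genFunctor`, with values in finitely generated modules. -/
def genFunctorFG (P : D)
    (h : ∀ X : AbCat D, Module.Finite (GenRing P) ((genFunctor P).obj X)) :
    AbCat D ⥤ FGModuleCat (GenRing P) :=
  (ModuleCat.isFG (GenRing P)).lift (genFunctor P) h

theorem genFunctorFG_isEquivalence [Limits.HasFiniteBiproducts D] {P : D} (hP : IsAddGenerator P)
    [IsNoetherianRing (GenRing P)]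
    (h : ∀ X : AbCat D, Module.Finite (GenRing P) ((genFunctor P).obj X)) :
    (genFunctorFG P h).IsEquivalence := by
  have := genFunctor_faithful hP
  have := genFunctor_full hP
  have h1 : (genFunctorFG P h).Faithful := ⟨fun {X Y f g} e =>
    (genFunctor P).map_injective (congrArg (·.hom) e)⟩
  have h2 : (genFunctorFG P h).Full := ⟨fun {X Y} f => by
    obtain ⟨g, hg⟩ := (genFunctor P).map_surjective f.hom
    exact ⟨g, ObjectProperty.hom_ext _ hg⟩⟩
  have h3 : (genFunctorFG P h).EssSurj := ⟨fun N => by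
    have : Module.Finite (GenRing P) N.obj := N.property
    obtain ⟨X, ⟨e⟩⟩ := genFunctor_essSurj P N.obj
    exact ⟨X, ⟨(ModuleCat.isFG (GenRing P)).isoMk e⟩⟩⟩
  exact {}

/-- The abelianization of a Hom-finite category with an additive generator is abelian. -/
theorem nonempty_abelian [Limits.HasFiniteBiproducts D] {P : D} (hP : IsAddGenerator P)
    (k : Type*) [Field k] [Linear k D] (hf : ∀ X Y : D, Module.Finite k (X ⟶ Y)) :
    ∃ a : Abelian (AbCat D), a.toPreadditive = (inferInstance : Preadditive (AbCat D)) := by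
  have := isNoetherianRing_genRing k hf P
  have h := finite_genFunctor_obj k hf P
  have := genFunctorFG_isEquivalence hP h
  have := Adjunction.hasLimitsOfShape_of_equivalence (J := Discrete Limits.WalkingPair)
    (genFunctorFG P h)
  have : Limits.HasFiniteProducts (AbCat D) := ⟨fun n =>
    Adjunction.hasLimitsOfShape_of_equivalence (genFunctorFG P h)⟩
  exact ⟨abelianOfEquivalence (genFunctorFG P h), rfl⟩

/-- Epimorphisms of finitely generated modules are surjective, so morphisms from `P` lift; `d` is a
summand of copies of `P`. -/
theorem projective_abelianize [Limits.HasFiniteBiproducts D] {P : D} (hP : IsAddGenerator P)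
    (k : Type*) [Field k] [Linear k D] (hf : ∀ X Y : D, Module.Finite k (X ⟶ Y)) (d : D) :
    Projective ((abelianizeFunctor D).obj d) := by
  have := isNoetherianRing_genRing k hf P
  have h := finite_genFunctor_obj k hf P
  have := genFunctorFG_isEquivalence hP h
  refine ⟨fun {Y X} g f _ => ?_⟩
  have hs : ∀ t : (abelianizeFunctor D).obj P ⟶ X, ∃ s, s ≫ f = t := by
    have h1 : Epi ((genFunctorFG P h).map f) := inferInstance
    have h2 : Epi ((forget₂ (FGModuleCat (GenRing P)) (ModuleCat (GenRing P))).map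
      ((genFunctorFG P h).map f)) := inferInstance
    exact (ModuleCat.epi_iff_surjective _).1 h2
  choose s hs using hs
  obtain ⟨ι, _, p, q, hpq⟩ := hP d
  refine ⟨∑ i, (abelianizeFunctor D).map (p i) ≫ s ((abelianizeFunctor D).map (q i) ≫ g), ?_⟩
  rw [Preadditive.sum_comp]
  have := congrArg (fun t => (abelianizeFunctor D).map t ≫ g) hpq
  simp only [Functor.map_sum, Functor.map_comp, Preadditive.sum_comp,
    CategoryTheory.Functor.map_id, Category.id_comp, Category.assoc] at this
  simp only [Category.assoc, hs, this]

end AbCat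

/-! ### Basic algebras: corners, radical, socle, Nakayama permutation and dual bases. -/

section BasicAlgebra
variable {k : Type u} [Field k] {A : Type u} [Ring A] [Algebra k A]
    {n : ℕ} {e : Fin n → A}

theorem IsBasicDecomposition.mul_self (he : IsBasicDecomposition e) (i : Fin n) :
    e i * e i = e i := he.idem i

theorem IsBasicDecomposition.mul_ne (he : IsBasicDecomposition e) {i j : Fin n} (h : i ≠ j) :
    e i * e j = 0 := he.ortho h

/-- Elements of a corner of a basic algebra are invertible in the corner or nilpotent. -/
theorem corner_unit_or_nilpotent (k : Type u) [Field k] [Algebra k A] [FiniteDimensional k A]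
    (he : IsBasicDecomposition e) (i : Fin n) {x : A}
    (h1 : e i * x = x) (h2 : x * e i = x) :
    IsNilpotent x ∨ ∃ y, e i * y = y ∧ y * e i = y ∧ x * y = e i ∧ y * x = e i := by
  obtain ⟨b, m, hi, hc, hm⟩ := exists_idempotent_of_finiteDimensional k x
  have g1 : (b * x) * e i = b * x := by rw [mul_assoc, h2]
  have g2 : e i * (b * x) = b * x := by rw [hc.eq, ← mul_assoc, h1]
  rcases he.primitive i (b * x) (e i - b * x) hi
    (by rw [IsIdempotentElem, mul_sub, sub_mul, sub_mul, he.mul_self, g1, g2, hi.eq]; simp)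
    (by rw [mul_sub, g1, hi.eq, sub_self]) (by rw [sub_mul, g2, hi.eq, sub_self])
    (add_sub_cancel _ _) with h | h
  · left; exact ⟨m, by rw [← hm, h, mul_zero]⟩
  · right
    have h' : b * x = e i := (sub_eq_zero.1 h).symm
    refine ⟨e i * b * e i, ?_, ?_, ?_, ?_⟩
    · simp only [← mul_assoc, he.mul_self]
    · simp only [mul_assoc, he.mul_self]
    · rw [← mul_assoc, ← mul_assoc, h2, ← hc.eq, h', he.mul_self]
    · rw [mul_assoc, mul_assoc, h1, h', he.mul_self]

/-- Right multiplications by `x` and `y` are inverse isomorphisms between `A eᵢ` and `A eⱼ`. -/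
theorem eq_of_inverse (he : IsBasicDecomposition e) {i j : Fin n} {x y : A}
    (hx' : x * e j = x) (hy' : y * e i = y)
    (hxy : x * y = e i) (hyx : y * x = e j) : i = j := by
  have key : ∀ {i j : Fin n} {x : A}, x * e j = x → ∀ a ∈ Submodule.span A {e i},
      a * x ∈ Submodule.span A {e j} := by
    intro i j x hx' a _
    exact Submodule.mem_span_singleton.2 ⟨a * x, by rw [smul_eq_mul, mul_assoc, hx']⟩
  have mem : ∀ {i : Fin n}, ∀ a ∈ Submodule.span A {e i}, a * e i = a := by
    intro i a ha
    obtain ⟨c, rfl⟩ := Submodule.mem_span_singleton.1 ha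
    rw [smul_eq_mul, mul_assoc, he.mul_self]
  refine he.basic i j ⟨LinearEquiv.ofLinearMap
    ((LinearMap.toSpanSingleton A A x).restrict (key hx'))
    ((LinearMap.toSpanSingleton A A y).restrict (key hy')) ?_ ?_⟩
  · ext a
    change (a : A) * y * x = a
    rw [mul_assoc, hyx, mem a a.2]
  · ext a
    change (a : A) * x * y = a
    rw [mul_assoc, hxy, mem a a.2]

/-- If `x * y` is not nilpotent, it has an inverse `z` in its corner. Then `y * z * x` is a non-zero
idempotent below the primitive `e j`, so it equals `e j`, and `x` and `y * z` are mutually inverse.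
-/
theorem eq_of_not_isNilpotent (k : Type u) [Field k] [Algebra k A] [FiniteDimensional k A]
    (he : IsBasicDecomposition e) {i j : Fin n} {x y : A}
    (hx : e i * x = x) (hx' : x * e j = x) (hy : e j * y = y) (hy' : y * e i = y)
    (h : ¬ IsNilpotent (x * y)) : i = j := by
  rcases corner_unit_or_nilpotent k he i (x := x * y) (by rw [← mul_assoc, hx])
    (by rw [mul_assoc, hy']) with h' | ⟨z, z1, z2, z3, -⟩
  · exact absurd h' h
  have w1 : x * (y * z) = e i := by rw [← mul_assoc, z3]
  have w2 : e j * (y * z) = y * z := by rw [← mul_assoc, hy]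
  have w3 : y * z * e i = y * z := by rw [mul_assoc, z2]
  have hid : IsIdempotentElem (y * z * x) := by
    rw [IsIdempotentElem, mul_assoc (y * z), ← mul_assoc x, w1, hx]
  have g1 : e j * (y * z * x) = y * z * x := by rw [← mul_assoc, w2]
  have g2 : y * z * x * e j = y * z * x := by rw [mul_assoc, hx']
  rcases he.primitive j (y * z * x) (e j - y * z * x) hid
    (by rw [IsIdempotentElem, mul_sub, sub_mul, sub_mul, he.mul_self, g1, g2, hid.eq]; simp)
    (by rw [mul_sub, g2, hid.eq, sub_self]) (by rw [sub_mul, g1, hid.eq, sub_self])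
    (add_sub_cancel _ _) with h0 | h0
  · exfalso
    have : x = 0 := by
      calc x = e i * x := hx.symm
        _ = x * (y * z * x) := by rw [← w1]; simp only [mul_assoc]
        _ = 0 := by rw [h0, mul_zero]
    exact h (by rw [this, zero_mul]; exact IsNilpotent.zero)
  · exact eq_of_inverse he hx' w3 w1 (sub_eq_zero.1 h0).symm

/-- Since `x = x * f`, powers of `y * x` are governed by powers of `f * y * x`. So every `y * x` is
nilpotent and `1 + y * x` is invertible. -/
theorem mem_jacobson_of_isNilpotent {x f : A} (hx : x * f = x)
    (h : ∀ y, IsNilpotent (f * y * x)) : x ∈ Ring.jacobson A := by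
  rw [← Ideal.jacobson_bot, Ideal.mem_jacobson_iff]
  intro y
  obtain ⟨m, hm⟩ := h y
  have hn : IsNilpotent (y * x) := by
    refine ⟨m + 1, ?_⟩
    have : ∀ m : ℕ, (y * x) ^ (m + 1) = y * x * (f * y * x) ^ m := by
      intro m
      induction m with
      | zero => simp
      | succ m ih =>
        have h2 : y * x * (f * y * x) = y * x * (y * x) := by
          rw [mul_assoc f, ← mul_assoc (y * x) f, mul_assoc y x f, hx]
        rw [pow_succ', ih, pow_succ' (f * y * x), ← mul_assoc, ← mul_assoc (y * x) (f * y * x), h2]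
    rw [this, hm, mul_zero]
  obtain ⟨u, hu⟩ := hn.isUnit_one_add
  refine ⟨(↑u⁻¹ : A), ?_⟩
  rw [Ideal.mem_bot, sub_eq_zero, mul_assoc]
  calc (↑u⁻¹ : A) * (y * x) + ↑u⁻¹ = ↑u⁻¹ * (1 + y * x) := by rw [mul_add, mul_one, add_comm]
    _ = 1 := by rw [← hu]; exact u.inv_mul

/-- A non-nilpotent product of `x` with an element of the opposite corner would force `i = j`. -/
theorem corner_mem_jacobson_of_ne (k : Type u) [Field k] [Algebra k A] [FiniteDimensional k A]
    (he : IsBasicDecomposition e) {i j : Fin n} (hij : i ≠ j) {x : A}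
    (hx : e i * x = x) (hx' : x * e j = x) : x ∈ Ring.jacobson A := by
  refine mem_jacobson_of_isNilpotent hx' fun y => ?_
  by_contra h
  refine hij (eq_of_not_isNilpotent k he (i := j) (j := i) (x := e j * y * e i) (y := x)
    ?_ ?_ hx hx' ?_).symm
  · simp only [← mul_assoc, he.mul_self]
  · simp only [mul_assoc, he.mul_self]
  · rwa [mul_assoc, mul_assoc, hx, ← mul_assoc]

theorem corner_mem_jacobson_of_isNilpotent (k : Type u) [Field k] [Algebra k A]
    [FiniteDimensional k A]
    (he : IsBasicDecomposition e) {i : Fin n} {x : A}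
    (hx : e i * x = x) (hx' : x * e i = x) (hn : IsNilpotent x) : x ∈ Ring.jacobson A := by
  refine mem_jacobson_of_isNilpotent hx' fun y => ?_
  rcases corner_unit_or_nilpotent k he i (x := e i * y * x)
    (by simp only [← mul_assoc, he.mul_self])
    (by rw [mul_assoc, hx']) with h | ⟨z, z1, z2, z3, z4⟩
  · exact h
  · exfalso
    obtain ⟨m, hm⟩ := hn
    -- If `e i * y * x` were invertible in the corner, then `z * (e i * y)` would be a left inverse
    -- of `x` there, which is impossible for nilpotent `x`.
    have : ∀ m : ℕ, (z * (e i * y)) ^ m * x ^ m * e i = e i := by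
      intro m
      have comm : ∀ m : ℕ, x * x ^ m * e i = x * (x ^ m * e i) := fun m => mul_assoc _ _ _
      have z4' : z * (e i * y) * x = e i := by rw [mul_assoc]; exact z4
      induction m with
      | zero => simp
      | succ m ih =>
        rw [pow_succ, pow_succ']
        calc (z * (e i * y)) ^ m * (z * (e i * y)) * (x * x ^ m) * e i
            = (z * (e i * y)) ^ m * ((z * (e i * y)) * x) * x ^ m * e i := by
              simp only [mul_assoc]
          _ = (z * (e i * y)) ^ m * (e i * x ^ m * e i) := by
              rw [z4']; simp only [mul_assoc]
          _ = (z * (e i * y)) ^ m * (x ^ m * e i) := by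
              congr 1
              cases m with
              | zero => simp [he.mul_self]
              | succ m => rw [pow_succ']; simp only [← mul_assoc, hx]
          _ = e i := by rw [← mul_assoc, ih]
    exact he.ne_zero i (by rw [← this m, hm]; simp)

/-- Corners of a basic algebra over an algebraically closed field are spanned by the
idempotent and the radical. -/
theorem corner_decomposition [IsAlgClosed k] [FiniteDimensional k A]
    (he : IsBasicDecomposition e) (i : Fin n) {x : A}
    (hx : e i * x = x) (hx' : x * e i = x) :
    ∃ (c : k) (r : A), r ∈ Ring.jacobson A ∧ e i * r = r ∧ r * e i = r ∧ x = c • e i + r := by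
  have hnt : Nontrivial A := ⟨⟨e i, 0, he.ne_zero i⟩⟩
  by_cases hn : IsNilpotent x
  · exact ⟨0, x, corner_mem_jacobson_of_isNilpotent k he hx hx' hn, hx, hx', by simp⟩
  -- The spectrum is taken in `A`, where `0` may occur only because of the complement of `e i`; so a
  -- non-zero spectral value is needed. If there were none, the minimal polynomial would be a power
  -- of `X` and `x` nilpotent.
  obtain ⟨m, hm⟩ : ∃ c : k, c ≠ 0 ∧ ¬ IsUnit (algebraMap k A c - x) := by
    by_contra hcon
    push Not at hcon
    have : ∀ c ∈ spectrum k x, c = 0 := fun c hc => by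
      by_contra h0
      exact hc (hcon c h0)
    apply hn
    have hint : IsIntegral k x := Algebra.IsIntegral.isIntegral x
    have hsplit := IsAlgClosed.splits (minpoly k x)
    have hroot : ∀ a ∈ (minpoly k x).roots, a = 0 := fun a ha => by
      apply this
      rw [spectrum.mem_iff]
      intro hu
      obtain ⟨q, hq⟩ := Polynomial.dvd_iff_isRoot.2 (Polynomial.isRoot_of_mem_roots ha)
      have h0 : Polynomial.aeval x q = 0 := by
        have h1 := minpoly.aeval k x
        rw [hq, map_mul, map_sub, Polynomial.aeval_X, Polynomial.aeval_C] at h1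
        rw [← neg_sub] at hu
        exact (hu.neg.mul_right_eq_zero).1 (by rwa [neg_neg])
      have hq0 : q ≠ 0 := fun h => minpoly.ne_zero hint (by rw [hq, h, mul_zero])
      have := minpoly.degree_le_of_ne_zero k x hq0 h0
      rw [hq, Polynomial.degree_mul, Polynomial.degree_X_sub_C,
        Polynomial.degree_eq_natDegree hq0] at this
      norm_cast at this
      omega
    have hp : minpoly k x = Polynomial.X ^ (minpoly k x).roots.card := by
      have h1 := hsplit.eq_prod_roots_of_monic (minpoly.monic hint)
      rw [Multiset.eq_replicate_of_mem hroot] at h1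
      simpa using h1
    refine ⟨(minpoly k x).roots.card, ?_⟩
    have h1 := minpoly.aeval k x
    rw [hp] at h1
    simpa using h1
  have h3 : IsNilpotent (x - m • e i) := by
    rcases corner_unit_or_nilpotent k he i (x := x - m • e i)
      (by rw [mul_sub, hx, mul_smul_comm, he.mul_self])
      (by rw [sub_mul, hx', smul_mul_assoc, he.mul_self]) with h | ⟨z, z1, z2, z3, z4⟩
    · exact h
    · refine absurd ?_ hm.2
      have d1 : algebraMap k A m - x = m • (1 - e i) - (x - m • e i) := by
        rw [Algebra.algebraMap_eq_smul_one, smul_sub]; abel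
      have o1 : (1 - e i) * (1 - e i) = 1 - e i := by
        rw [mul_sub, sub_mul, sub_mul, he.mul_self]; simp
      have o2 : (1 - e i) * z = 0 := by rw [sub_mul, z1]; simp
      have o3 : z * (1 - e i) = 0 := by rw [mul_sub, z2]; simp
      have o4 : (x - m • e i) * (1 - e i) = 0 := by
        rw [mul_sub, mul_one, sub_mul, hx', smul_mul_assoc, he.mul_self]; simp
      have o5 : (1 - e i) * (x - m • e i) = 0 := by
        rw [sub_mul, mul_sub (e i), hx, mul_smul_comm, he.mul_self]; simp
      generalize x - m • e i = w at *
      -- Blockwise inverse: `m - x` acts as `m` on the complement of `e i` and as `-(x - m • e i)`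
      -- on the corner. This is where `m ≠ 0` is used.
      refine ⟨⟨algebraMap k A m - x, m⁻¹ • (1 - e i) - z, ?_, ?_⟩, rfl⟩
      · rw [d1, sub_mul, mul_sub, mul_sub, z3, smul_mul_smul_comm, smul_mul_assoc, o2,
          mul_smul_comm, o4, mul_inv_cancel₀ hm.1, o1]
        simp
      · rw [d1, sub_mul, mul_sub, mul_sub, z4, smul_mul_smul_comm, mul_smul_comm, o3,
          smul_mul_assoc, o5, inv_mul_cancel₀ hm.1, o1]
        simp
  have r1 : e i * (x - m • e i) = x - m • e i := by
    rw [mul_sub, hx, mul_smul_comm, he.mul_self]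
  have r2 : (x - m • e i) * e i = x - m • e i := by
    rw [sub_mul, hx', smul_mul_assoc, he.mul_self]
  exact ⟨m, x - m • e i, corner_mem_jacobson_of_isNilpotent k he r1 r2 h3, r1, r2, by abel⟩

theorem jacobson_pow_eq_zero (k A : Type u) [Field k] [Ring A] [Algebra k A]
    [FiniteDimensional k A] : ∃ m : ℕ, (Ring.jacobson A) ^ m = ⊥ := by
  have : IsArtinianRing A := isArtinian_of_tower k inferInstance
  exact IsSemiprimaryRing.isNilpotent

/-- A socle element: a non-zero element of `e m * A * e i` annihilated by the radical. -/
def IsSocleElt (e : Fin n → A) (m i : Fin n) (t : A) : Prop :=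
  t ≠ 0 ∧ e m * t = t ∧ t * e i = t ∧ ∀ r ∈ Ring.jacobson A, r * t = 0

/-- Modulo the radical `a * e m` is a multiple of `e m`, and the radical kills `t`. So `t` spans a
one-dimensional left ideal. -/
theorem IsSocleElt.exists_smul [IsAlgClosed k] [FiniteDimensional k A]
    (he : IsBasicDecomposition e) {m i : Fin n} {t : A} (ht : IsSocleElt e m i t) (a : A) :
    ∃ (c : k) (r : A), r ∈ Ring.jacobson A ∧ a * e m = c • e m + r ∧ a * t = c • t := by
  obtain ⟨c, r, hr, h1, h2, h3⟩ := corner_decomposition (k := k) he m (x := e m * a * e m)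
    (by simp only [← mul_assoc, he.mul_self]) (by simp only [mul_assoc, he.mul_self])
  have hJ : ∑ j ∈ Finset.univ.erase m, e j * a * e m ∈ Ring.jacobson A :=
    Submodule.sum_mem _ fun j hj => corner_mem_jacobson_of_ne k he (Finset.ne_of_mem_erase hj)
      (by simp only [← mul_assoc, he.mul_self]) (by simp only [mul_assoc, he.mul_self])
  have hsum : a * e m = c • e m + (r + ∑ j ∈ Finset.univ.erase m, e j * a * e m) := by
    rw [← add_assoc, ← h3, Finset.add_sum_erase _ (fun j => e j * a * e m) (Finset.mem_univ m),
      ← Finset.sum_mul, ← Finset.sum_mul, he.complete, one_mul]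
  refine ⟨c, _, Submodule.add_mem _ hr hJ, hsum, ?_⟩
  conv_lhs => rw [← ht.2.1, ← mul_assoc, hsum, add_mul, ht.2.2.2 _ (Submodule.add_mem _ hr hJ),
    add_zero, smul_mul_assoc, ht.2.1]

/-- The left ideal generated by `p` contains a simple one, which the radical annihilates; some `e m`
does not kill a generator of it. -/
theorem exists_isSocleElt [FiniteDimensional k A] (he : IsBasicDecomposition e) (i : Fin n)
    (p : A) (hp : p ≠ 0) (hpe : p * e i = p) : ∃ (m : Fin n) (a : A), IsSocleElt e m i (a * p) := by
  have : IsArtinianRing A := isArtinian_of_tower k inferInstance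
  obtain ⟨S, hS, hSle⟩ := (IsAtomic.eq_bot_or_exists_atom_le (Submodule.span A {p})).resolve_left
    (by simpa using hp)
  have hsimple : IsSimpleModule A S := isSimpleModule_iff_isAtom.2 hS
  obtain ⟨s, hs, hs0⟩ := Submodule.exists_mem_ne_zero_of_ne_bot hS.1
  obtain ⟨b, rfl⟩ := Submodule.mem_span_singleton.1 (hSle hs)
  obtain ⟨m, hm⟩ : ∃ m, e m * (b • p) ≠ 0 := by
    by_contra hcon
    push Not at hcon
    apply hs0
    rw [← one_mul (b • p), ← he.complete, Finset.sum_mul]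
    exact Finset.sum_eq_zero fun m _ => hcon m
  have e1 : e m * b * p = e m * (b • p) := by rw [smul_eq_mul, mul_assoc]
  refine ⟨m, e m * b, by rwa [e1], ?_, by rw [mul_assoc, hpe], fun r hr => ?_⟩
  · simp only [← mul_assoc, he.mul_self]
  · rw [e1]
    have hmem : e m * (b • p) ∈ S := S.smul_mem _ hs
    have := IsSemisimpleModule.jacobson_le_annihilator A S hr
    exact congrArg Subtype.val (Module.mem_annihilator.1 this ⟨_, hmem⟩)

/-- The annihilator condition makes `a * t ↦ a * t'` well defined; injectivity extends it to `A`,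
and endomorphisms of the regular module are right multiplications. -/
theorem exists_mul_eq_of_injective (hinj : Module.Injective A A) {t t' : A}
    (h : ∀ a : A, a * t = 0 → a * t' = 0) : ∃ b, t * b = t' := by
  let f := LinearMap.toSpanSingleton A A t
  let g := LinearMap.toSpanSingleton A A t'
  obtain ⟨φ, hφ⟩ := hinj.out ((LinearMap.ker f).liftQ f le_rfl)
    (LinearMap.ker_eq_bot.1 (Submodule.ker_liftQ_eq_bot _ _ _ le_rfl))
    ((LinearMap.ker f).liftQ g fun a ha => h a ha)
  have : φ ((1 : A) • t) = (1 : A) • t' := hφ (Submodule.Quotient.mk 1)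
  refine ⟨φ 1, ?_⟩
  rw [← smul_eq_mul, ← map_smul]
  simpa using this

/-- Injectivity makes the socle of `A eᵢ` simple. Otherwise `A t` and `A t'` are independent, and
the projection onto the first extends to a right multiplication that fixes `t` and kills `t'`. -/
theorem IsSocleElt.exists_smul_eq [IsAlgClosed k] [FiniteDimensional k A]
    (hinj : Module.Injective A A) (he : IsBasicDecomposition e) {m m' i : Fin n} {t t' : A}
    (ht : IsSocleElt e m i t) (ht' : IsSocleElt e m' i t') : m = m' ∧ ∃ c : k, t' = c • t := by
  obtain ⟨c, hc⟩ : ∃ c : k, t' = c • t := by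
    by_contra hcon
    push Not at hcon
    have hdis : ∀ x y : A, x * t + y * t' = 0 → x * t = 0 := by
      intro x y hxy
      obtain ⟨c, -, -, -, hc⟩ := ht.exists_smul (k := k) he x
      obtain ⟨d, -, -, -, hd⟩ := ht'.exists_smul (k := k) he y
      rw [hc, hd] at hxy
      by_cases hd0 : d = 0
      · rw [hc]; simpa [hd0] using hxy
      · refine absurd ?_ (hcon (-(d⁻¹ * c)))
        have : d • t' = -(c • t) := eq_neg_of_add_eq_zero_right hxy
        rw [← inv_smul_smul₀ hd0 t', this, smul_neg, smul_smul, neg_smul]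
    have : ∃ b, t * b = t ∧ t' * b = 0 := by
      let f : (Submodule.span A {t} × Submodule.span A {t'}) →ₗ[A] A :=
        LinearMap.coprod (Submodule.subtype _) (Submodule.subtype _)
      let g : (Submodule.span A {t} × Submodule.span A {t'}) →ₗ[A] A :=
        (Submodule.subtype _).comp (LinearMap.fst A _ _)
      have hf : Function.Injective f := by
        rw [← LinearMap.ker_eq_bot, Submodule.eq_bot_iff]
        rintro ⟨⟨x, hx⟩, ⟨y, hy⟩⟩ hxy
        obtain ⟨x, rfl⟩ := Submodule.mem_span_singleton.1 hx
        obtain ⟨y, rfl⟩ := Submodule.mem_span_singleton.1 hy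
        have h0 : x * t + y * t' = 0 := hxy
        have h1 := hdis x y h0
        rw [h1, zero_add] at h0
        exact Prod.ext (Subtype.ext h1) (Subtype.ext h0)
      obtain ⟨φ, hφ⟩ := hinj.out f hf g
      have e1 := hφ (⟨t, Submodule.mem_span_singleton_self t⟩, 0)
      have e2 := hφ (0, ⟨t', Submodule.mem_span_singleton_self t'⟩)
      simp only [f, g, LinearMap.coprod_apply, LinearMap.comp_apply, LinearMap.fst_apply,
        Submodule.subtype_apply, Submodule.coe_zero, add_zero, zero_add] at e1 e2
      refine ⟨φ 1, ?_, ?_⟩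
      · rw [← smul_eq_mul, ← map_smul, smul_eq_mul, mul_one, e1]
      · rw [← smul_eq_mul, ← map_smul, smul_eq_mul, mul_one, e2]
    obtain ⟨b, hb, hb'⟩ := this
    have k1 : t * (e i * b * e i) = t := by
      rw [← mul_assoc, ← mul_assoc, ht.2.2.1, hb, ht.2.2.1]
    have k2 : t' * (e i * b * e i) = 0 := by
      rw [← mul_assoc, ← mul_assoc, ht'.2.2.1, hb', zero_mul]
    -- Fixing `t` excludes nilpotency and killing `t'` excludes invertibility in the corner.
    rcases corner_unit_or_nilpotent k he i (x := e i * b * e i)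
      (by simp only [← mul_assoc, he.mul_self]) (by simp only [mul_assoc, he.mul_self]) with
      ⟨N, hN⟩ | ⟨z, z1, z2, z3, z4⟩
    · have : ∀ N : ℕ, t * (e i * b * e i) ^ N = t := by
        intro N
        induction N with
        | zero => simp
        | succ N ih => rw [pow_succ, ← mul_assoc, ih, k1]
      exact ht.1 (by rw [← this N, hN, mul_zero])
    · apply ht'.1
      rw [← ht'.2.2.1, ← z3, ← mul_assoc, k2, zero_mul]
  refine ⟨?_, c, hc⟩
  by_contra hne
  apply ht'.1
  rw [← ht'.2.1, hc, ← ht.2.1, mul_smul_comm, ← mul_assoc, he.mul_ne (Ne.symm hne), zero_mul,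
    smul_zero]

/-- Injectivity carries `t` to `t'` and back by right multiplications. Their product fixes `t`, so
it is not nilpotent, which forces `i = j`. This is injectivity of the Nakayama map. -/
theorem IsSocleElt.index_eq [IsAlgClosed k] [FiniteDimensional k A]
    (hinj : Module.Injective A A) (he : IsBasicDecomposition e) {m i j : Fin n} {t t' : A}
    (ht : IsSocleElt e m i t) (ht' : IsSocleElt e m j t') : i = j := by
  have key : ∀ {i j : Fin n} {t t' : A}, IsSocleElt e m i t → IsSocleElt e m j t' →
      ∃ b, e i * b = b ∧ b * e j = b ∧ t * b = t' := by
    intro i j t t' ht ht'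
    obtain ⟨b, hb⟩ := exists_mul_eq_of_injective hinj (t := t) (t' := t') (fun a ha => by
      obtain ⟨c, r, hr, h1, h2⟩ := ht.exists_smul (k := k) he a
      rw [ha] at h2
      have hc : c = 0 := (smul_eq_zero.1 h2.symm).resolve_right ht.1
      rw [← ht'.2.1, ← mul_assoc, h1, hc, zero_smul, zero_add, ht'.2.2.2 r hr])
    refine ⟨e i * b * e j, ?_, ?_, ?_⟩
    · simp only [← mul_assoc, he.mul_self]
    · simp only [mul_assoc, he.mul_self]
    · rw [← mul_assoc, ← mul_assoc, ht.2.2.1, hb, ht'.2.2.1]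
  obtain ⟨b, b1, b2, b3⟩ := key ht ht'
  obtain ⟨b', c1, c2, c3⟩ := key ht' ht
  refine eq_of_not_isNilpotent k he b1 b2 c1 c2 ?_
  rintro ⟨N, hN⟩
  have : ∀ N : ℕ, t * (b * b') ^ N = t := by
    intro N
    induction N with
    | zero => simp
    | succ N ih => rw [pow_succ, ← mul_assoc, ih, ← mul_assoc, b3, c3]
  exact ht.1 (by rw [← this N, hN, mul_zero])

/-- The Nakayama permutation of a basic self-injective algebra. -/
theorem exists_nakayama [IsAlgClosed k] [FiniteDimensional k A]
    (hinj : Module.Injective A A) (he : IsBasicDecomposition e) :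
    ∃ (ν : Equiv.Perm (Fin n)) (s : Fin n → A), (∀ i, IsSocleElt e (ν i) i (s i)) ∧
      ∀ i p, p ≠ 0 → p * e i = p → ∃ a, a * p = s i := by
  have h := fun i => exists_isSocleElt (k := k) he i (e i) (he.ne_zero i) (he.mul_self i)
  choose ν a ha using h
  have hν : Function.Injective ν := fun i j hij =>
    IsSocleElt.index_eq (k := k) hinj he (ha i) (hij ▸ ha j)
  refine ⟨Equiv.ofBijective ν (Finite.injective_iff_bijective.1 hν), fun i => a i * e i, ha,
    fun i p hp hpe => ?_⟩
  -- A socle element below `p` is proportional to the chosen one, by simplicity of the socle.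
  obtain ⟨m, b, hb⟩ := exists_isSocleElt (k := k) he i p hp hpe
  obtain ⟨-, c, hc⟩ := IsSocleElt.exists_smul_eq (k := k) hinj he hb (ha i)
  exact ⟨c • b, by rw [smul_mul_assoc, ← hc]⟩

/-- Dual bases of `A eᵢ` and `e_{ν(i)} A` with respect to the pairing given by a linear form. -/
structure DualBases (k : Type u) [Field k] [Algebra k A] (e : Fin n → A) (ν : Equiv.Perm (Fin n))
    (i : Fin n) where
  /-- the linear form -/
  form : A →ₗ[k] k
  form_corner : ∀ a, form (e (ν i) * a * e i) = form a
  /-- the number of basis elements -/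
  num : ℕ
  /-- the basis of `A eᵢ` -/
  x : Fin num → A
  /-- the dual basis of `e_{ν(i)} A` -/
  y : Fin num → A
  x_mul : ∀ t, x t * e i = x t
  mul_y : ∀ t, e (ν i) * y t = y t
  sum_x : ∀ p, p * e i = p → ∑ t, form (y t * p) • x t = p
  sum_y : ∀ q, e (ν i) * q = q → ∑ t, form (q * x t) • y t = q

/-- The pairing `(q, p) ↦ form (q * p)`, with a form equal to `1` at the socle element `s i`, is
perfect: every non-zero `p` in `A eᵢ` has a multiple equal to `s i`, and a dimension count gives
non-degeneracy on the other side. -/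
theorem nonempty_dualBases [FiniteDimensional k A] (he : IsBasicDecomposition e)
    (ν : Equiv.Perm (Fin n)) (s : Fin n → A) (hs : ∀ i, IsSocleElt e (ν i) i (s i))
    (hess : ∀ i p, p ≠ 0 → p * e i = p → ∃ a, a * p = s i) (i : Fin n) :
    Nonempty (DualBases k e ν i) := by
  let X : Fin n → Submodule k A := fun i => LinearMap.range (LinearMap.mulRight k (e i))
  let Y : Fin n → Submodule k A := fun i => LinearMap.range (LinearMap.mulLeft k (e i))
  have hX : ∀ {i p}, p ∈ X i ↔ p * e i = p := fun {i p} =>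
    ⟨by rintro ⟨q, rfl⟩; simp [mul_assoc, he.mul_self], fun h => ⟨p, h⟩⟩
  have hY : ∀ {i p}, p ∈ Y i ↔ e i * p = p := fun {i p} =>
    ⟨by rintro ⟨q, rfl⟩; simp [← mul_assoc, he.mul_self], fun h => ⟨p, h⟩⟩
  have hl : ∀ i, ∃ l : A →ₗ[k] k, l (s i) = 1 := fun i => by
    by_contra hcon
    push Not at hcon
    refine (hs i).1 ((Module.forall_dual_apply_eq_zero_iff k (s i)).1 fun l => ?_)
    by_contra h0
    exact hcon ((l (s i))⁻¹ • l) (by simp [h0])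
  choose l hl using hl
  let form : Fin n → A →ₗ[k] k := fun i =>
    (l i).comp ((LinearMap.mulLeft k (e (ν i))).comp (LinearMap.mulRight k (e i)))
  have hform : ∀ i a, form i a = l i (e (ν i) * (a * e i)) := fun i a => rfl
  let T : ∀ i, X i →ₗ[k] Module.Dual k (Y (ν i)) := fun i =>
    LinearMap.mk₂ k (fun (p : X i) (q : Y (ν i)) => form i ((q : A) * p))
      (fun _ _ _ => by simp [mul_add]) (fun _ _ _ => by simp)
      (fun _ _ _ => by simp [add_mul]) (fun _ _ _ => by simp)
  have hT : ∀ i p q, T i p q = form i ((q : A) * p) := fun _ _ _ => rfl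
  have hTinj : ∀ i, Function.Injective (T i) := fun i => by
    rw [injective_iff_map_eq_zero]
    rintro ⟨p, hp⟩ h0
    by_contra hne
    obtain ⟨a, ha⟩ := hess i p (fun h => hne (Subtype.ext h)) (hX.1 hp)
    have := LinearMap.congr_fun h0 ⟨e (ν i) * a, hY.2 (by rw [← mul_assoc, he.mul_self])⟩
    replace this : l i (e (ν i) * (e (ν i) * a * p * e i)) = 0 := this
    rw [mul_assoc (e (ν i)) a, ha, (hs i).2.1, (hs i).2.2.1, (hs i).2.1, hl] at this
    exact one_ne_zero this
  have hle : ∀ i, Module.finrank k (X i) ≤ Module.finrank k (Y (ν i)) := fun i => by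
    have := LinearMap.finrank_le_finrank_of_injective (hTinj i)
    rwa [Subspace.dual_finrank_eq] at this
  have hsumX : ∑ i, Module.finrank k (X i) = Module.finrank k A := by
    rw [← Module.finrank_pi_fintype]
    refine LinearEquiv.finrank_eq (LinearEquiv.ofLinearMap (LinearMap.lsum k (fun i => X i) k
      (fun i => (X i).subtype)) (LinearMap.pi fun i => (LinearMap.mulRight k (e i)).rangeRestrict)
      ?_ ?_)
    · ext a
      simp [← Finset.mul_sum, he.complete]
    · ext i ⟨p, hp⟩ j
      have hp' := hX.1 hp
      simp only [LinearMap.comp_apply, LinearMap.lsum_apply, LinearMap.sum_apply,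
        LinearMap.single_apply, LinearMap.proj_apply, LinearMap.pi_apply, LinearMap.id_apply]
      rw [Finset.sum_eq_single i (fun b _ hb => by simp [Pi.single_eq_of_ne hb]) (by simp)]
      rw [Pi.single_eq_same]
      change p * e j = _
      by_cases hij : j = i
      · subst hij; simp [hp']
      · rw [Pi.single_eq_of_ne hij, ← hp', mul_assoc, he.mul_ne (Ne.symm hij)]; simp
  have hsumY : ∑ i, Module.finrank k (Y i) = Module.finrank k A := by
    rw [← Module.finrank_pi_fintype]
    refine LinearEquiv.finrank_eq (LinearEquiv.ofLinearMap (LinearMap.lsum k (fun i => Y i) k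
      (fun i => (Y i).subtype)) (LinearMap.pi fun i => (LinearMap.mulLeft k (e i)).rangeRestrict)
      ?_ ?_)
    · ext a
      simp [← Finset.sum_mul, he.complete]
    · ext i ⟨p, hp⟩ j
      have hp' := hY.1 hp
      simp only [LinearMap.comp_apply, LinearMap.lsum_apply, LinearMap.sum_apply,
        LinearMap.single_apply, LinearMap.proj_apply, LinearMap.pi_apply, LinearMap.id_apply]
      rw [Finset.sum_eq_single i (fun b _ hb => by simp [Pi.single_eq_of_ne hb]) (by simp)]
      rw [Pi.single_eq_same]
      change e j * p = _
      by_cases hij : j = i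
      · subst hij; simp [hp']
      · rw [Pi.single_eq_of_ne hij, ← hp', ← mul_assoc, he.mul_ne hij]; simp
  -- The inequalities `hle` are summed over `i`. Both sums are the dimension of `A`, because `ν` is
  -- a permutation, so each inequality is an equality.
  have heq : Module.finrank k (X i) = Module.finrank k (Y (ν i)) := by
    have h1 : ∑ i, Module.finrank k (X i) = ∑ i, Module.finrank k (Y (ν i)) := by
      rw [Equiv.sum_comp ν (fun i => Module.finrank k (Y i)), hsumX, hsumY]
    exact (Finset.sum_eq_sum_iff_of_le fun i _ => hle i).1 h1 i (Finset.mem_univ i)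
  let TE : X i ≃ₗ[k] Module.Dual k (Y (ν i)) :=
    LinearMap.linearEquivOfInjective (T i) (hTinj i) (by rw [heq, Subspace.dual_finrank_eq])
  have hTE : ∀ p, TE p = T i p := fun p => rfl
  let b := Module.finBasis k (X i)
  let c := b.map TE
  let y := c.dualBasis.map (Module.evalEquiv k (Y (ν i))).symm
  refine ⟨⟨form i, fun a => ?_, _, fun t => (b t : A), fun t => (y t : A), fun t => hX.1 (b t).2,
    fun t => hY.1 (y t).2, fun p hp => ?_, fun q hq => ?_⟩⟩
  · rw [hform, hform]
    congr 1
    simp only [mul_assoc, he.mul_self]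
    simp only [← mul_assoc, he.mul_self]
  · have h1 := b.sum_repr ⟨p, hX.2 hp⟩
    have h2 : ∀ t, form i (y t * p) = b.repr ⟨p, hX.2 hp⟩ t := fun t => by
      have h3 : (Module.evalEquiv k (Y (ν i)) (y t)) (TE ⟨p, hX.2 hp⟩) =
          form i (y t * p) := rfl
      rw [← h3]
      simp [y, c]
    simp only [h2]
    have := congrArg Subtype.val h1
    rw [AddSubmonoidClass.coe_finsetSum] at this
    exact this
  · have h1 := y.sum_repr ⟨q, hY.2 hq⟩
    have h2 : ∀ t, form i (q * b t) = y.repr ⟨q, hY.2 hq⟩ t := fun t => by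
      have h3 : c t ⟨q, hY.2 hq⟩ = form i (q * b t) := by
        simp [c, hTE, hT]
      rw [← h3]
      simp [y]
    simp only [h2]
    have := congrArg Subtype.val h1
    rw [AddSubmonoidClass.coe_finsetSum] at this
    exact this

theorem DualBases.form_mul (he : IsBasicDecomposition e) (d : DualBases k e ν i) (a : A) :
    d.form (e (ν i) * a) = d.form a := by
  rw [← d.form_corner (e (ν i) * a), ← d.form_corner a, ← mul_assoc (e (ν i)), he.mul_self]

theorem DualBases.form_mul' (he : IsBasicDecomposition e) (d : DualBases k e ν i) (a : A) :
    d.form (a * e i) = d.form a := by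
  rw [← d.form_corner (a * e i), ← d.form_corner a, mul_assoc, mul_assoc, he.mul_self, mul_assoc]

end BasicAlgebra

/-! ### Natural transformations out of the functor A ⊗ -. -/

section FreeFunctor
variable {k : Type u} [Field k] {A : Type u} [Ring A] [Algebra k A] [FiniteDimensional k A]

/-- The value of a natural transformation at an element. -/
def ev {F G : FGModuleCat.{u} A ⥤ FGModuleCat.{u} A} (α : F ⟶ G) (N : FGModuleCat.{u} A)
    (x : F.obj N) : G.obj N := (α.app N).hom.hom x

/-- The value of a morphism of modules. -/
def act {M N : FGModuleCat.{u} A} (f : M ⟶ N) (x : M) : N := f.hom.hom x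

theorem act_comp {M N K : FGModuleCat.{u} A} (f : M ⟶ N) (g : N ⟶ K) (x : M) :
    act (f ≫ g) x = act g (act f x) := rfl

theorem act_smul {M N : FGModuleCat.{u} A} (f : M ⟶ N) (a : A) (x : M) :
    act f (a • x) = a • act f x := map_smul f.hom.hom a x

theorem act_add {M N : FGModuleCat.{u} A} (f : M ⟶ N) (x y : M) :
    act f (x + y) = act f x + act f y := map_add f.hom.hom x y

theorem act_sum {M N : FGModuleCat.{u} A} {ι : Type*} (s : Finset ι) (f : M ⟶ N) (x : ι → M) :
    act f (∑ i ∈ s, x i) = ∑ i ∈ s, act f (x i) := map_sum f.hom.hom x s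

theorem hom_ext_act {M N : FGModuleCat.{u} A} {f g : M ⟶ N} (h : ∀ x, act f x = act g x) :
    f = g := FGModuleCat.hom_ext (LinearMap.ext h)

/-- The morphism from the regular module given by an element. -/
def fromReg {N : FGModuleCat.{u} A} (n : N) : FGModuleCat.of A A ⟶ N :=
  FGModuleCat.ofHom (LinearMap.toSpanSingleton A N n)

theorem act_fromReg {N : FGModuleCat.{u} A} (n : N) (a : A) : act (fromReg n) a = a • n := rfl

theorem ev_map {F G : FGModuleCat.{u} A ⥤ FGModuleCat.{u} A} (α : F ⟶ G)
    {M N : FGModuleCat.{u} A} (f : M ⟶ N) (x : F.obj M) :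
    ev α N (act (F.map f) x) = act (G.map f) (ev α M x) := by
  change act (F.map f ≫ α.app N) x = _
  rw [α.naturality]; rfl

theorem ev_smul {F G : FGModuleCat.{u} A ⥤ FGModuleCat.{u} A} (α : F ⟶ G) (N : FGModuleCat.{u} A)
    (a : A) (x : F.obj N) : ev α N (a • x) = a • ev α N x := map_smul (α.app N).hom.hom a x

theorem ev_add {F G : FGModuleCat.{u} A ⥤ FGModuleCat.{u} A} (α : F ⟶ G) (N : FGModuleCat.{u} A)
    (x y : F.obj N) : ev α N (x + y) = ev α N x + ev α N y := map_add (α.app N).hom.hom x y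

theorem ev_zero {F G : FGModuleCat.{u} A ⥤ FGModuleCat.{u} A} (α : F ⟶ G)
    (N : FGModuleCat.{u} A) : ev α N 0 = 0 := map_zero (α.app N).hom.hom

theorem ev_sum {F G : FGModuleCat.{u} A ⥤ FGModuleCat.{u} A} (α : F ⟶ G) (N : FGModuleCat.{u} A)
    {ι : Type*} (s : Finset ι) (x : ι → F.obj N) :
    ev α N (∑ i ∈ s, x i) = ∑ i ∈ s, ev α N (x i) := map_sum (α.app N).hom.hom x s

theorem sum_ev {F G : FGModuleCat.{u} A ⥤ FGModuleCat.{u} A} {ι : Type*} (s : Finset ι)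
    (α : ι → (F ⟶ G)) (N : FGModuleCat.{u} A) (x : F.obj N) :
    ev (∑ i ∈ s, α i) N x = ∑ i ∈ s, ev (α i) N x := by
  induction s using Finset.cons_induction with
  | empty => rfl
  | cons a s ha ih => rw [Finset.sum_cons, Finset.sum_cons, ← ih]; rfl

theorem ev_ext {F G : FGModuleCat.{u} A ⥤ FGModuleCat.{u} A} {α β : F ⟶ G}
    (h : ∀ N x, ev α N x = ev β N x) : α = β :=
  NatTrans.ext (funext fun N => FGModuleCat.hom_ext (LinearMap.ext (h N)))

theorem smul_expand (a b : A) (N : FGModuleCat.{u} A) (n : N) :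
    a • expand (k := k) b N n = expand (k := k) (a * b) N n := rfl

theorem expand_eq_smul (a : A) (N : FGModuleCat.{u} A) (n : N) :
    expand (k := k) a N n = a • expand (k := k) 1 N n := by rw [smul_expand, mul_one]

theorem contract'_expand (φ : A →ₗ[k] k) (a : A) (N : FGModuleCat.{u} A) (n : N) :
    contract' φ N (expand a N n) = φ a • n := by
  change contract φ N (a ⊗ₜ n) = _
  simp [contract]

theorem expand_add (a b : A) (N : FGModuleCat.{u} A) (n : N) :
    expand (k := k) (a + b) N n = expand (k := k) a N n + expand (k := k) b N n :=
  TensorProduct.add_tmul a b n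

theorem expand_smul (r : k) (a : A) (N : FGModuleCat.{u} A) (n : N) :
    expand (k := k) (r • a) N n = r • expand (k := k) a N n :=
  (algebraMap_smul_tensor r N (a ⊗ₜ[k] n)).symm ▸ rfl

theorem expand_smul' (r : k) (a : A) (N : FGModuleCat.{u} A) (n : N) :
    expand (k := k) (r • a) N n = expand (k := k) a N (r • n) := by
  rw [expand_smul, map_smul]

theorem expand_induction {N : FGModuleCat.{u} A} {P : (freeFunctor k A).obj N → Prop}
    (x : (freeFunctor k A).obj N) (h0 : P 0) (h1 : ∀ a n, P (expand a N n))
    (h2 : ∀ x y, P x → P y → P (x + y)) : P x :=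
  TensorProduct.induction_on x h0 h1 h2

/-- The elements `1 ⊗ n` generate `A ⊗ K N` over `A`. -/
theorem free_ext {K G : FGModuleCat.{u} A ⥤ FGModuleCat.{u} A} {α β : K ⋙ freeFunctor k A ⟶ G}
    (h : ∀ N n, ev α N (expand (k := k) 1 (K.obj N) n) = ev β N (expand (k := k) 1 (K.obj N) n)) :
    α = β := by
  refine ev_ext fun N x => ?_
  induction x using expand_induction with
  | h0 => rw [ev_zero, ev_zero]
  | h1 a n =>
    have := congrArg (fun y => a • y) (h N n)
    simp only [← ev_smul] at this
    rw [expand_eq_smul]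
    exact this
  | h2 x y hx hy => rw [ev_add, ev_add, hx, hy]

theorem free_ext' {G : FGModuleCat.{u} A ⥤ FGModuleCat.{u} A} {α β : freeFunctor k A ⟶ G}
    (h : ∀ N n, ev α N (expand (k := k) 1 N n) = ev β N (expand (k := k) 1 N n)) :
    α = β := free_ext (K := 𝟭 _) h

theorem free_free_ext {G : FGModuleCat.{u} A ⥤ FGModuleCat.{u} A}
    {α β : freeFunctor k A ⋙ freeFunctor k A ⟶ G}
    (h : ∀ N b n, ev α N (expand (k := k) 1 _ (expand (k := k) b N n)) =
      ev β N (expand (k := k) 1 _ (expand (k := k) b N n))) : α = β := by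
  refine free_ext fun N x => ?_
  induction x using expand_induction with
  | h0 => rw [map_zero, ev_zero, ev_zero]
  | h1 a n => exact h N a n
  | h2 x y hx hy => rw [map_add, ev_add, ev_add, hx, hy]

/-- The natural transformation out of `K ⋙ T` given by a natural family of linear maps. -/
def freeDesc {K G : FGModuleCat.{u} A ⥤ FGModuleCat.{u} A} (f : ∀ N, K.obj N →ₗ[k] G.obj N)
    (hf : ∀ {M N : FGModuleCat.{u} A} (g : M ⟶ N) (x : K.obj M),
      f N (act (K.map g) x) = act (G.map g) (f M x)) : K ⋙ freeFunctor k A ⟶ G where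
  app N := FGModuleCat.ofHom (TensorProduct.AlgebraTensorModule.lift
    (LinearMap.toSpanSingleton A (K.obj N →ₗ[k] G.obj N) (f N)))
  naturality M N g := FGModuleCat.hom_ext (TensorProduct.AlgebraTensorModule.ext fun a n => by
    change a • f N (act (K.map g) n) = act (G.map g) (a • f M n)
    rw [hf, act_smul])

end FreeFunctor

/-! ### Explicit 2-morphisms between the identity, A ⊗ - and A ⊗ A ⊗ -. -/

section TwoMorphisms
variable {k : Type u} [Field k] {A : Type u} [Ring A] [Algebra k A] [FiniteDimensional k A]

/-- The value of a `2`-morphism at an element. -/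
def pev {F G : ProjCat k A} (α : F ⟶ G) (N : FGModuleCat.{u} A) (x : F.obj.obj N) : G.obj.obj N :=
  ev α.hom N x

section pev
variable {F G H : ProjCat k A}

theorem pev_ext {α β : F ⟶ G} (h : ∀ N x, pev α N x = pev β N x) : α = β :=
  ObjectProperty.hom_ext _ (ev_ext h)

theorem pev_comp (α : F ⟶ G) (β : G ⟶ H) (N : FGModuleCat.{u} A) (x : F.obj.obj N) :
    pev (α ≫ β) N x = pev β N (pev α N x) := rfl

theorem pev_id (N : FGModuleCat.{u} A) (x : F.obj.obj N) : pev (𝟙 F) N x = x := rfl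

theorem pev_smul (α : F ⟶ G) (N : FGModuleCat.{u} A) (a : A) (x : F.obj.obj N) :
    pev α N (a • x) = a • pev α N x := ev_smul α.hom N a x

theorem pev_ksmul (α : F ⟶ G) (N : FGModuleCat.{u} A) (r : k) (x : F.obj.obj N) :
    pev α N (r • x) = r • pev α N x := pev_smul α N (algebraMap k A r) x

theorem pev_add (α : F ⟶ G) (N : FGModuleCat.{u} A) (x y : F.obj.obj N) :
    pev α N (x + y) = pev α N x + pev α N y := ev_add α.hom N x y

theorem pev_sum (α : F ⟶ G) (N : FGModuleCat.{u} A) {ι : Type*} (s : Finset ι)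
    (x : ι → F.obj.obj N) : pev α N (∑ i ∈ s, x i) = ∑ i ∈ s, pev α N (x i) :=
  ev_sum α.hom N s x

theorem add_pev (α β : F ⟶ G) (N : FGModuleCat.{u} A) (x : F.obj.obj N) :
    pev (α + β) N x = pev α N x + pev β N x := rfl

theorem smul_pev (r : k) (α : F ⟶ G) (N : FGModuleCat.{u} A) (x : F.obj.obj N) :
    pev (r • α) N x = r • pev α N x := rfl

theorem sum_pev {ι : Type*} (s : Finset ι) (α : ι → (F ⟶ G)) (N : FGModuleCat.{u} A)
    (x : F.obj.obj N) : pev (∑ i ∈ s, α i) N x = ∑ i ∈ s, pev (α i) N x := by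
  induction s using Finset.cons_induction with
  | empty => rfl
  | cons a s ha ih => rw [Finset.sum_cons, Finset.sum_cons, ← ih]; rfl

theorem pev_map (α : F ⟶ G) {M N : FGModuleCat.{u} A} (f : M ⟶ N) (x : F.obj.obj M) :
    pev α N (act (F.obj.map f) x) = act (G.obj.map f) (pev α M x) := ev_map α.hom f x

theorem pev_hcomp {F' G' : ProjCat k A} (α : F ⟶ F') (β : G ⟶ G') (N : FGModuleCat.{u} A)
    (x : (F.comp G).obj.obj N) :
    pev (ProjCat.hcomp α β) N x =
      act (F'.obj.map (β.hom.app N)) (pev α (G.obj.obj N) x) := rfl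

theorem hcomp_comp {F' G' F'' G'' : ProjCat k A} (α : F ⟶ F') (β : G ⟶ G') (α' : F' ⟶ F'')
    (β' : G' ⟶ G'') :
    ProjCat.hcomp α β ≫ ProjCat.hcomp α' β' = ProjCat.hcomp (α ≫ α') (β ≫ β') :=
  pev_ext fun N x => by
    rw [pev_comp, pev_hcomp, pev_hcomp, pev_hcomp, pev_map]
    exact (congrArg (fun f => act f (pev α' _ (pev α _ x)))
      (F''.obj.map_comp (β.hom.app N) (β'.hom.app N))).symm

theorem hcomp_id (F G : ProjCat k A) : ProjCat.hcomp (𝟙 F) (𝟙 G) = 𝟙 (F.comp G) :=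
  pev_ext fun N x => by
    rw [pev_hcomp]
    exact (congrArg (fun f => act f x) (F.obj.map_id _))

end pev

variable (k A) in
/-- The functor `A ⊗ₖ -` as a `1`-morphism. -/
def free : ProjCat k A := ⟨freeFunctor k A, isProjective_free⟩

/-- The element `a ⊗ n` of `A ⊗ N`. -/
def pt (a : A) {N : FGModuleCat.{u} A} (n : N) : (free k A).obj.obj N := expand a N n

theorem smul_pt (a b : A) {N : FGModuleCat.{u} A} (n : N) :
    a • pt (k := k) b n = pt (a * b) n := rfl

theorem map_pt {M N : FGModuleCat.{u} A} (f : M ⟶ N) (a : A) (m : M) :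
    act ((free k A).obj.map f) (pt (k := k) a m) = pt a (act f m) := rfl

theorem add_pt (a b : A) {N : FGModuleCat.{u} A} (n : N) :
    pt (k := k) (a + b) n = pt a n + pt b n := expand_add a b N n

theorem pt_add (a : A) {N : FGModuleCat.{u} A} (n m : N) :
    pt (k := k) a (n + m) = pt a n + pt a m := map_add (expand a N) n m

theorem pt_sum {ι : Type*} (s : Finset ι) (a : A) {N : FGModuleCat.{u} A} (n : ι → N) :
    pt (k := k) a (∑ i ∈ s, n i) = ∑ i ∈ s, pt a (n i) := map_sum (expand a N) n s

theorem sum_pt {ι : Type*} (s : Finset ι) (a : ι → A) {N : FGModuleCat.{u} A} (n : N) :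
    pt (k := k) (∑ i ∈ s, a i) n = ∑ i ∈ s, pt (a i) n :=
  map_sum (AddMonoidHom.mk' (fun a => pt (k := k) a n) fun a b => add_pt a b n) a s

theorem smul_pt' (r : k) (a : A) {N : FGModuleCat.{u} A} (n : N) :
    pt (k := k) (r • a) n = pt a (r • n) := expand_smul' r a N n

theorem smul_pt'' (r : k) (a : A) {N : FGModuleCat.{u} A} (n : N) :
    pt (k := k) (r • a) n = r • pt a n := expand_smul r a N n

theorem pt_smul (r : k) (a : A) {N : FGModuleCat.{u} A} (n : N) :
    pt (k := k) a (r • n) = r • pt a n := by rw [← smul_pt', smul_pt'']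

theorem pt_induction {N : FGModuleCat.{u} A} {P : (free k A).obj.obj N → Prop}
    (x : (free k A).obj.obj N) (h0 : P 0) (h1 : ∀ a n, P (pt a n))
    (h2 : ∀ x y, P x → P y → P (x + y)) : P x := expand_induction x h0 h1 h2

/-- The element `a ⊗ (b ⊗ n)` of `A ⊗ (A ⊗ N)`. -/
def pt₂ (a b : A) {N : FGModuleCat.{u} A} (n : N) : ((free k A).comp (free k A)).obj.obj N :=
  pt (k := k) a (N := (free k A).obj.obj N) (pt b n)

theorem free_hom_ext {G : ProjCat k A} {α β : free k A ⟶ G}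
    (h : ∀ (N : FGModuleCat.{u} A) (n : N), pev α N (pt 1 n) = pev β N (pt 1 n)) : α = β :=
  ObjectProperty.hom_ext _ (free_ext' h)

theorem free_comp_hom_ext {G : ProjCat k A} {α β : (free k A).comp (free k A) ⟶ G}
    (h : ∀ (N : FGModuleCat.{u} A) b (n : N), pev α N (pt₂ 1 b n) = pev β N (pt₂ 1 b n)) :
    α = β :=
  ObjectProperty.hom_ext _ (free_free_ext h)

/-- The endomorphism `a ⊗ n ↦ a x ⊗ y n` of `A ⊗ₖ -`. -/
def endo (x y : A) : free k A ⟶ free k A :=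
  ObjectProperty.homMk (freeDesc (K := 𝟭 _) (G := freeFunctor k A)
    (fun N => (expand x N).comp (Algebra.lsmul k k N y)) (fun g n => by
      change expand x _ (y • act g n) = expand x _ (act g (y • n))
      rw [act_smul]))

theorem pev_endo (x y a : A) (N : FGModuleCat.{u} A) (n : N) :
    pev (endo (k := k) x y) N (pt a n) = pt (a * x) (y • n) := rfl

/-- The morphism `a ⊗ n ↦ a x n` from `A ⊗ₖ -` to the identity functor. -/
def mulMor (x : A) : free k A ⟶ ProjCat.one k A :=
  ObjectProperty.homMk (freeDesc (K := 𝟭 _) (G := 𝟭 _)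
    (fun N => Algebra.lsmul k k N x) (fun g n => (act_smul g x n).symm))

theorem pev_mulMor (x a : A) (N : FGModuleCat.{u} A) (n : N) :
    pev (mulMor (k := k) x) N (pt a n) = (a • x • n : N) := rfl

/-- The morphism `a ⊗ n ↦ a ⊗ (z ⊗ n)`. -/
def insertMor (z : A) : free k A ⟶ (free k A).comp (free k A) :=
  ObjectProperty.homMk (freeDesc (K := 𝟭 _) (G := freeFunctor k A ⋙ freeFunctor k A)
    (fun N => (expand 1 ((freeFunctor k A).obj N)).comp (expand z N)) (fun _ _ => rfl))

theorem pev_insertMor (z a : A) (N : FGModuleCat.{u} A) (n : N) :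
    pev (insertMor (k := k) z) N (pt a n) =
      pt₂ a z n := by
  change a • expand (k := k) (1 : A) ((freeFunctor k A).obj N) (expand z N n) = _
  rw [smul_expand, mul_one]; rfl

/-- The morphism `a ⊗ (b ⊗ n) ↦ φ(b) a ⊗ n`. -/
def contractMor (φ : A →ₗ[k] k) : (free k A).comp (free k A) ⟶ free k A :=
  ObjectProperty.homMk (freeDesc (K := freeFunctor k A) (G := freeFunctor k A)
    (fun N => (expand 1 N).comp (contract' φ N)) (fun {M N} g n => by
      change expand 1 N (contract φ N _) = expand (1 : A) N (act g (contract φ M n))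
      congr 1
      exact contract_natural φ g n))

theorem pev_contractMor (φ : A →ₗ[k] k) (a b : A) (N : FGModuleCat.{u} A) (n : N) :
    pev (contractMor φ) N (pt₂ a b n) =
      φ b • pt a n := by
  change a • expand (k := k) (1 : A) N (contract' φ N (expand b N n)) = _
  rw [contract'_expand, smul_expand, mul_one]
  exact pt_smul _ _ _

theorem endo_comp (x y x' y' : A) :
    endo (k := k) x y ≫ endo x' y' = endo (x * x') (y' * y) :=
  free_hom_ext fun N n => by simp only [pev_comp, pev_endo, mul_assoc, smul_smul]

theorem endo_one : endo (k := k) (1 : A) 1 = 𝟙 _ :=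
  free_hom_ext fun N n => by simp only [pev_endo, mul_one, one_smul, pev_id]

theorem endo_add_left (x x' y : A) : endo (k := k) (x + x') y = endo x y + endo x' y :=
  free_hom_ext fun N n => by simp only [add_pev, pev_endo, mul_add, add_pt]

theorem endo_add_right (x y y' : A) : endo (k := k) x (y + y') = endo x y + endo x y' :=
  free_hom_ext fun N n => by simp only [add_pev, pev_endo, add_smul, pt_add]

theorem endo_smul_left (r : k) (x y : A) : endo (k := k) (r • x) y = r • endo x y :=
  free_hom_ext fun N n => by
    simp only [smul_pev, pev_endo, one_mul]
    rw [smul_pt'']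

theorem endo_smul_right (r : k) (x y : A) : endo (k := k) x (r • y) = r • endo x y :=
  free_hom_ext fun N n => by
    simp only [smul_pev, pev_endo, one_mul]
    rw [← pt_smul, smul_assoc]

/-- `endo` as a bilinear map. -/
def endoBilin : A →ₗ[k] A →ₗ[k] (free k A ⟶ free k A) :=
  LinearMap.mk₂ k endo endo_add_left endo_smul_left endo_add_right endo_smul_right

theorem pev_hcomp_endo (x y x' y' a b : A) (N : FGModuleCat.{u} A) (n : N) :
    pev (ProjCat.hcomp (endo (k := k) x y) (endo x' y')) N (pt₂ a b n) =
      pt₂ (a * x) (y * b * x') (y' • n) := rfl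

/-- The inner coefficients `y` and `x'` meet the middle tensor factor and are absorbed by the linear
form. -/
theorem hcomp_endo_contractMor (x y x' y' : A) (φ : A →ₗ[k] k) :
    ProjCat.hcomp (endo x y) (endo x' y') ≫ contractMor φ =
      contractMor (φ.comp ((LinearMap.mulLeft k y).comp (LinearMap.mulRight k x'))) ≫
        endo x y' := free_comp_hom_ext fun N b n => by
  rw [pev_comp, pev_comp, pev_contractMor, pev_hcomp_endo, pev_contractMor, pev_ksmul, pev_endo,
    mul_assoc]
  rfl

theorem insertMor_hcomp_endo (z x y x' y' : A) :
    insertMor z ≫ ProjCat.hcomp (endo (k := k) x y) (endo x' y') =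
      endo x y' ≫ insertMor (y * z * x') := free_hom_ext fun N n => by
  rw [pev_comp, pev_comp, pev_insertMor, pev_hcomp_endo, pev_endo, pev_insertMor]

theorem insertMor_contractMor (z : A) (φ : A →ₗ[k] k) :
    insertMor z ≫ contractMor φ = φ z • 𝟙 _ := free_hom_ext fun N n => by
  rw [pev_comp, pev_insertMor, pev_contractMor]; rfl

theorem smul_pt₂ (r : k) (a b : A) (N : FGModuleCat.{u} A) (n : N) :
    pt₂ (k := k) a (r • b) n = pt₂ (r • a) b n := by
  change pt (k := k) a (pt (k := k) (r • b) n) = pt (k := k) (r • a) (pt (k := k) b n)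
  rw [smul_pt'' r b, smul_pt' r a]

theorem pt₂_sum {ι : Type*} (s : Finset ι) (a : A) (b : ι → A) (N : FGModuleCat.{u} A) (n : N) :
    pt₂ (k := k) a (∑ i ∈ s, b i) n = ∑ i ∈ s, pt₂ a (b i) n := by
  change pt (k := k) a (pt (k := k) (∑ i ∈ s, b i) n) = _
  rw [sum_pt, pt_sum]; rfl

/-- Expanding the middle factor in a basis splits A ⊗ (A ⊗ N) into copies of A ⊗ N. -/
theorem sum_contractMor_insertMor {ι : Type*} [Fintype ι] (b : Module.Basis ι k A) :
    ∑ i, contractMor (b.coord i) ≫ insertMor (b i) = 𝟙 ((free k A).comp (free k A)) :=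
  free_comp_hom_ext fun N a n => by
    rw [sum_pev, pev_id]
    conv_rhs => rw [← b.sum_repr a, pt₂_sum]
    refine Finset.sum_congr rfl fun i _ => ?_
    rw [pev_comp, pev_contractMor, ← smul_pt'', pev_insertMor, smul_pt₂]
    rfl

end TwoMorphisms

/-! ### The radical of the endomorphism algebra of A ⊗ -. -/

section IndecomposableMorphisms
variable {k : Type u} [Field k] {A : Type u} [Ring A] [Algebra k A] [FiniteDimensional k A]

/-- A Yoneda argument: an endomorphism is determined by its value in A ⊗ A at `1 ⊗ 1` over the
regular module, and that value is a sum of tensors `x ⊗ y`. -/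
theorem endo_induction {P : (free k A ⟶ free k A) → Prop} (h0 : P 0)
    (h1 : ∀ x y, P (endo x y)) (h2 : ∀ α β, P α → P β → P (α + β)) (α : free k A ⟶ free k A) :
    P α := by
  have key : ∀ w : (free k A).obj.obj (FGModuleCat.of A A), ∃ β : free k A ⟶ free k A, P β ∧
      ∀ (N : FGModuleCat.{u} A) (n : N),
        pev β N (pt 1 n) = act ((free k A).obj.map (fromReg n)) w := fun w => by
    induction w using pt_induction with
    | h0 => exact ⟨0, h0, fun N n => (map_zero _).symm⟩
    | h1 x y =>
      refine ⟨endo x y, h1 x y, fun N n => ?_⟩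
      rw [pev_endo, map_pt, act_fromReg, one_mul]
    | h2 x y hx hy =>
      obtain ⟨β, h3, h4⟩ := hx
      obtain ⟨γ, h5, h6⟩ := hy
      exact ⟨β + γ, h2 _ _ h3 h5, fun N n => by rw [act_add, add_pev, h4, h6]⟩
  obtain ⟨β, h, h'⟩ := key (pev α (FGModuleCat.of A A) (pt (N := FGModuleCat.of A A) 1 (1 : A)))
  have : α = β := free_hom_ext fun N n => by
    rw [h', ← pev_map, map_pt, act_fromReg, one_smul]
  exact this ▸ h

theorem endo_ne_zero {x y : A} (hx : x ≠ 0) (hy : y ≠ 0) : endo (k := k) x y ≠ 0 := fun h => by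
  obtain ⟨φ, hφ⟩ : ∃ φ : A →ₗ[k] k, φ x ≠ 0 := by
    by_contra hcon
    push Not at hcon
    exact hx ((Module.forall_dual_apply_eq_zero_iff k x).1 hcon)
  have h1 : pev (endo (k := k) x y) (FGModuleCat.of A A) (pt (N := FGModuleCat.of A A) 1 (1 : A))
    = 0 := by rw [h]; rfl
  rw [pev_endo, one_mul] at h1
  have h2 : φ x • (y • (1 : A)) = 0 := by
    have h3 := congrArg (contract' φ (FGModuleCat.of A A)) h1
    have h4 := (contract'_expand φ x (FGModuleCat.of A A) (y * 1 : A)).symm.trans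
      (h3.trans (map_zero _))
    rw [Algebra.smul_def]
    exact h4
  rw [smul_eq_mul, mul_one] at h2
  exact hy ((smul_eq_zero.1 h2).resolve_left hφ)

/-- The `2`-morphisms given by elements of `J^p ⊗ A`. -/
def leftRad (k : Type u) [Field k] (A : Type u) [Ring A] [Algebra k A] [FiniteDimensional k A]
    (p : ℕ) : Submodule k (free k A ⟶ free k A) :=
  Submodule.map₂ endoBilin (((Ring.jacobson A) ^ p).restrictScalars k) ⊤

/-- The `2`-morphisms given by elements of `A ⊗ J^p`. -/
def rightRad (k : Type u) [Field k] (A : Type u) [Ring A] [Algebra k A] [FiniteDimensional k A]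
    (p : ℕ) : Submodule k (free k A ⟶ free k A) :=
  Submodule.map₂ endoBilin ⊤ (((Ring.jacobson A) ^ p).restrictScalars k)

theorem mem_span_induction₂ {p q : Submodule k A} {P : (free k A ⟶ free k A) → Prop}
    (h0 : P 0) (h1 : ∀ x ∈ p, ∀ y ∈ q, P (endo x y)) (h2 : ∀ α β, P α → P β → P (α + β))
    {α : free k A ⟶ free k A} (hα : α ∈ Submodule.map₂ endoBilin p q) : P α := by
  rw [Submodule.map₂_eq_span_image2] at hα
  have h3 : ∀ (r : k) x (_ : x ∈ p) y (_ : y ∈ q), P (r • endo x y) := fun r x hx y hy => by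
    rw [← endo_smul_left]; exact h1 _ (p.smul_mem r hx) y hy
  refine Submodule.closure_induction (p := fun x _ => P x) h0 (fun x y _ _ => h2 x y) ?_ hα
  rintro r _ ⟨x, hx, y, hy, rfl⟩
  exact h3 r x hx y hy

theorem leftRad_mul {p : ℕ} {α β : End (free k A)} (hα : α ∈ leftRad k A p)
    (hβ : β ∈ leftRad k A 1) : β * α ∈ leftRad k A (p + 1) := by
  change α ≫ β ∈ _
  refine mem_span_induction₂ (P := fun α => α ≫ β ∈ leftRad k A (p + 1)) ?_ ?_ ?_ hα
  · rw [Limits.zero_comp]; exact zero_mem _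
  · intro x hx y _
    refine mem_span_induction₂ (P := fun β => endo x y ≫ β ∈ leftRad k A (p + 1)) ?_ ?_ ?_ hβ
    · rw [Limits.comp_zero]; exact zero_mem _
    · intro x' hx' y' _
      rw [endo_comp]
      refine Submodule.apply_mem_map₂ _ (m := x * x') ?_ (n := y' * y) trivial
      rw [Submodule.restrictScalars_mem] at hx hx' ⊢
      rw [Submodule.pow_one] at hx'
      rw [Submodule.pow_succ]
      exact Ideal.mul_mem_mul hx hx'
    · intro a b ha hb; rw [Preadditive.comp_add]; exact add_mem ha hb
  · intro a b ha hb; rw [Preadditive.add_comp]; exact add_mem ha hb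

theorem rightRad_mul {p : ℕ} {α β : End (free k A)} (hα : α ∈ rightRad k A p)
    (hβ : β ∈ rightRad k A 1) : α * β ∈ rightRad k A (p + 1) := by
  change β ≫ α ∈ _
  refine mem_span_induction₂ (P := fun α => β ≫ α ∈ rightRad k A (p + 1)) ?_ ?_ ?_ hα
  · rw [Limits.comp_zero]; exact zero_mem _
  · intro x _ y hy
    refine mem_span_induction₂ (P := fun β => β ≫ endo x y ∈ rightRad k A (p + 1)) ?_ ?_ ?_ hβ
    · rw [Limits.zero_comp]; exact zero_mem _
    · intro x' _ y' hy'
      rw [endo_comp]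
      refine Submodule.apply_mem_map₂ _ (m := x' * x) trivial (n := y * y') ?_
      rw [Submodule.restrictScalars_mem] at hy hy' ⊢
      rw [Submodule.pow_one] at hy'
      rw [Submodule.pow_succ]
      exact Ideal.mul_mem_mul hy hy'
    · intro a b ha hb; rw [Preadditive.add_comp]; exact add_mem ha hb
  · intro a b ha hb; rw [Preadditive.comp_add]; exact add_mem ha hb

theorem leftRad_comp {α : free k A ⟶ free k A} (hα : α ∈ leftRad k A 1)
    (β : free k A ⟶ free k A) : α ≫ β ∈ leftRad k A 1 := by
  refine mem_span_induction₂ (P := fun α => α ≫ β ∈ leftRad k A 1) ?_ ?_ ?_ hα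
  · rw [Limits.zero_comp]; exact zero_mem _
  · intro x hx y _
    refine endo_induction (P := fun β => endo x y ≫ β ∈ leftRad k A 1) ?_ ?_ ?_ β
    · rw [Limits.comp_zero]; exact zero_mem _
    · intro x' y'
      rw [endo_comp]
      refine Submodule.apply_mem_map₂ _ (m := x * x') ?_ (n := y' * y) trivial
      rw [Submodule.restrictScalars_mem, Submodule.pow_one] at hx ⊢
      exact Ideal.mul_mem_right _ _ hx
    · intro a b ha hb; rw [Preadditive.comp_add]; exact add_mem ha hb
  · intro a b ha hb; rw [Preadditive.add_comp]; exact add_mem ha hb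

theorem rightRad_comp {α : free k A ⟶ free k A} (hα : α ∈ rightRad k A 1)
    (β : free k A ⟶ free k A) : α ≫ β ∈ rightRad k A 1 := by
  refine mem_span_induction₂ (P := fun α => α ≫ β ∈ rightRad k A 1) ?_ ?_ ?_ hα
  · rw [Limits.zero_comp]; exact zero_mem _
  · intro x _ y hy
    refine endo_induction (P := fun β => endo x y ≫ β ∈ rightRad k A 1) ?_ ?_ ?_ β
    · rw [Limits.comp_zero]; exact zero_mem _
    · intro x' y'
      rw [endo_comp]
      refine Submodule.apply_mem_map₂ _ (m := x * x') trivial (n := y' * y) ?_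
      rw [Submodule.restrictScalars_mem, Submodule.pow_one] at hy ⊢
      exact Ideal.mul_mem_left _ _ hy
    · intro a b ha hb; rw [Preadditive.comp_add]; exact add_mem ha hb
  · intro a b ha hb; rw [Preadditive.add_comp]; exact add_mem ha hb

/-- Powers of `α` have left coefficients in powers of the nilpotent radical of `A`. -/
theorem isNilpotent_of_mem_leftRad {α : End (free k A)} (hα : α ∈ leftRad k A 1) :
    IsNilpotent α := by
  have h : ∀ p, α ^ (p + 1) ∈ leftRad k A (p + 1) := fun p => by
    induction p with
    | zero => rwa [zero_add, pow_one]
    | succ p ih => rw [pow_succ']; exact leftRad_mul ih hα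
  obtain ⟨m, hm⟩ := jacobson_pow_eq_zero k A
  refine ⟨m + 1, ?_⟩
  have h1 := h m
  rw [leftRad, Submodule.pow_succ, hm, Submodule.bot_mul, Submodule.restrictScalars_bot] at h1
  exact (Submodule.mem_bot k).1 ((Submodule.map₂_bot_left _ _).le h1)

theorem isNilpotent_of_mem_rightRad {α : End (free k A)} (hα : α ∈ rightRad k A 1) :
    IsNilpotent α := by
  have h : ∀ p, α ^ (p + 1) ∈ rightRad k A (p + 1) := fun p => by
    induction p with
    | zero => rwa [zero_add, pow_one]
    | succ p ih => rw [pow_succ]; exact rightRad_mul ih hα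
  obtain ⟨m, hm⟩ := jacobson_pow_eq_zero k A
  refine ⟨m + 1, ?_⟩
  have h1 := h m
  rw [rightRad, Submodule.pow_succ, hm, Submodule.bot_mul, Submodule.restrictScalars_bot] at h1
  exact (Submodule.mem_bot k).1 ((Submodule.map₂_bot_right _ _).le h1)

/-- Radical left coefficients persist under composition, so all the relevant multiples of `α` are
nilpotent. -/
theorem leftRad_le {α : End (free k A)} (hα : α ∈ leftRad k A 1) :
    α ∈ Ring.jacobson (End (free k A)) :=
  mem_jacobson_of_isNilpotent (f := 1) (mul_one α) fun β =>
    isNilpotent_of_mem_leftRad (leftRad_comp hα (1 * β))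

theorem rightRad_le {α : End (free k A)} (hα : α ∈ rightRad k A 1) :
    α ∈ Ring.jacobson (End (free k A)) :=
  mem_jacobson_of_isNilpotent (f := 1) (mul_one α) fun β =>
    isNilpotent_of_mem_rightRad (rightRad_comp hα (1 * β))

theorem endo_mem_jacobson_left {x : A} (hx : x ∈ Ring.jacobson A) (y : A) :
    End.of (endo (k := k) x y) ∈ Ring.jacobson (End (free k A)) :=
  leftRad_le (Submodule.apply_mem_map₂ _ (m := x) (by
    rw [Submodule.restrictScalars_mem, Submodule.pow_one]; exact hx) (n := y) trivial)

theorem endo_mem_jacobson_right (x : A) {y : A} (hy : y ∈ Ring.jacobson A) :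
    End.of (endo (k := k) x y) ∈ Ring.jacobson (End (free k A)) :=
  rightRad_le (Submodule.apply_mem_map₂ _ (m := x) trivial (n := y) (by
    rw [Submodule.restrictScalars_mem, Submodule.pow_one]; exact hy))

/-- Membership in the radical gives only a left inverse `z` of `1 - x`. But `z = 1 + z * x` has a
left inverse for the same reason, so the inverse is two-sided. -/
theorem isUnit_one_sub_of_mem_jacobson {R : Type*} [Ring R] {x : R} (hx : x ∈ Ring.jacobson R) :
    IsUnit (1 - x) := by
  rw [← Ideal.jacobson_bot] at hx
  have key : ∀ y : R, ∃ z, z * (1 - y * x) = 1 := fun y => by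
    obtain ⟨z, hz⟩ := Ideal.mem_jacobson_iff.1 hx (-y)
    refine ⟨z, ?_⟩
    rw [Ideal.mem_bot, sub_eq_zero] at hz
    refine Eq.trans ?_ hz; noncomm_ring
  obtain ⟨z, hz⟩ := key 1
  obtain ⟨w, hw⟩ := key (-z)
  rw [one_mul] at hz
  have h1 : 1 - -z * x = z := by
    rw [mul_sub, mul_one, sub_eq_iff_eq_add] at hz
    rw [neg_mul, sub_neg_eq_add, ← hz]
  rw [h1] at hw
  have h2 : w = 1 - x := by
    have := congrArg (w * ·) hz
    simpa only [← mul_assoc, hw, one_mul, mul_one] using this.symm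
  exact ⟨⟨1 - x, z, h2 ▸ hw, hz⟩, rfl⟩

theorem eq_zero_of_mem_jacobson {R : Type*} [Ring R] {x : R} (hx : x ∈ Ring.jacobson R)
    (h : x * x = x) : x = 0 :=
  (isUnit_one_sub_of_mem_jacobson hx).mul_left_eq_zero.1 (by rw [mul_sub, h, mul_one, sub_self])

end IndecomposableMorphisms

/-! ### The 1-morphisms F_{ij}: morphisms, locality, pairwise non-isomorphism. -/

section Generators
variable {k : Type u} [Field k] {A : Type u} [Ring A] [Algebra k A] [FiniteDimensional k A]
    {n : ℕ} {e : Fin n → A} (he : IsBasicDecomposition e)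

variable (k) in
/-- The inclusion `A eᵢ ⊗ eⱼ N ⟶ A ⊗ N`. -/
def incl (i j : Fin n) : projMor k he i j ⟶ free k A :=
  ObjectProperty.homMk
    { app := fun N => FGModuleCat.ofHom
        (TensorProduct.AlgebraTensorModule.map (Submodule.subtype _)
          (Submodule.subtype (cutModule k A (e j) N)))
      naturality := fun _ _ _ =>
        FGModuleCat.hom_ext (TensorProduct.AlgebraTensorModule.ext fun _ _ => rfl) }

theorem mul_mem_span (a f : A) : a * f ∈ Submodule.span A {f} :=
  Submodule.smul_mem _ a (Submodule.mem_span_singleton_self f)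

variable (k) in
/-- The projection `A ⊗ N ⟶ A eᵢ ⊗ eⱼ N`. -/
def proj (i j : Fin n) : free k A ⟶ projMor k he i j :=
  ObjectProperty.homMk
    { app := fun N => FGModuleCat.ofHom
        (TensorProduct.AlgebraTensorModule.map
          ((LinearMap.toSpanSingleton A A (e i)).codRestrict _ fun a => mul_mem_span a (e i))
          (Algebra.lsmul k k N (e j)).rangeRestrict)
      naturality := fun _ _ g => by
        refine FGModuleCat.hom_ext (TensorProduct.AlgebraTensorModule.ext fun a n => ?_)
        refine congrArg (fun y => _ ⊗ₜ[k] y) (Subtype.ext ?_)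
        exact (map_smul g.hom.hom (e j) n).symm }

theorem incl_proj (i j : Fin n) : incl k he i j ≫ proj k he i j = 𝟙 _ := by
  refine ObjectProperty.hom_ext _ (NatTrans.ext (funext fun N => ?_))
  refine FGModuleCat.hom_ext (TensorProduct.AlgebraTensorModule.ext ?_)
  rintro ⟨a, ha⟩ ⟨_, n, rfl⟩
  obtain ⟨c, rfl⟩ := Submodule.mem_span_singleton.1 ha
  refine congrArg₂ (fun x y => x ⊗ₜ[k] y) (Subtype.ext ?_) (Subtype.ext ?_)
  · change (c * e i) * e i = c * e i
    rw [mul_assoc, he.mul_self]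
  · change e j • (e j • n) = e j • n
    rw [smul_smul, he.mul_self]

theorem proj_incl (i j : Fin n) : proj k he i j ≫ incl k he i j = endo (e i) (e j) :=
  free_hom_ext fun N n => by
    rw [pev_endo]; rfl

theorem incl_endo (i j : Fin n) : incl k he i j ≫ endo (e i) (e j) = incl k he i j := by
  rw [← proj_incl, ← Category.assoc, incl_proj, Category.id_comp]

theorem endo_proj (i j : Fin n) : endo (e i) (e j) ≫ proj k he i j = proj k he i j := by
  rw [← proj_incl, Category.assoc, incl_proj, Category.comp_id]

/-- The `2`-morphism `F_{ij} ⟶ F_{ab}` given by `x ⊗ y`. -/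
def homMor {i j a b : Fin n} (x y : A) : projMor k he i j ⟶ projMor k he a b :=
  incl k he i j ≫ endo x y ≫ proj k he a b

theorem endo_projCat (i j : Fin n) (x y : A) :
    endo (k := k) x y ≫ proj k he i j = endo (x * e i) (e j * y) ≫ proj k he i j := by
  conv_lhs => rw [← endo_proj]
  rw [← Category.assoc, endo_comp]

theorem incl_endo' (i j : Fin n) (x y : A) :
    incl k he i j ≫ endo (k := k) x y = incl k he i j ≫ endo (e i * x) (y * e j) := by
  conv_lhs => rw [← incl_endo]
  rw [Category.assoc, endo_comp]

/-- Every such 2-morphism is cut out of an endomorphism of A ⊗ -, so it is a sum of tensors whose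
factors lie in the corners `e i * A * e a` and `e b * A * e j`. -/
theorem projMor_hom_induction {i j a b : Fin n} {P : (projMor k he i j ⟶ projMor k he a b) → Prop}
    (h0 : P 0) (h1 : ∀ x y, e i * x = x → x * e a = x → e b * y = y → y * e j = y →
      P (homMor he x y)) (h2 : ∀ α β, P α → P β → P (α + β))
    (α : projMor k he i j ⟶ projMor k he a b) : P α := by
  have h : α = incl k he i j ≫ (proj k he i j ≫ α ≫ incl k he a b) ≫ proj k he a b := by
    simp only [Category.assoc, incl_proj, Category.comp_id]
    rw [← Category.assoc, incl_proj, Category.id_comp]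
  rw [h]
  refine endo_induction (P := fun β => P (incl k he i j ≫ β ≫ proj k he a b)) ?_ ?_ ?_ _
  · simpa using h0
  · intro x y
    rw [endo_projCat, ← Category.assoc, incl_endo', Category.assoc]
    refine h1 _ _ ?_ ?_ ?_ ?_ <;> first
      | (simp only [mul_assoc, he.mul_self]; done)
      | simp only [← mul_assoc, he.mul_self]
  · intro α β hα hβ
    simpa using h2 _ _ hα hβ

theorem projMor_id_ne_zero (i j : Fin n) : 𝟙 (projMor k he i j) ≠ 0 := fun h => by
  refine endo_ne_zero (k := k) (he.ne_zero i) (he.ne_zero j) ?_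
  rw [← proj_incl he, ← Category.comp_id (proj k he i j), h]; simp

/-- The conjugate of a radical `2`-morphism. -/
def IsRadical {i j a b : Fin n} (α : projMor k he i j ⟶ projMor k he a b) : Prop :=
  End.of (proj k he i j ≫ α ≫ incl k he a b) ∈ Ring.jacobson (End (free k A))

theorem IsRadical.comp {i j a b c d : Fin n} {α : projMor k he i j ⟶ projMor k he a b}
    (hα : IsRadical he α) (β : projMor k he a b ⟶ projMor k he c d) :
    IsRadical he (α ≫ β) := by
  have h : proj k he i j ≫ (α ≫ β) ≫ incl k he c d =
    (proj k he i j ≫ α ≫ incl k he a b) ≫ (proj k he a b ≫ β ≫ incl k he c d) := by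
    simp only [Category.assoc]
    rw [← Category.assoc (incl k he a b), incl_proj, Category.id_comp]
  rw [IsRadical, h]
  exact Ideal.mul_mem_left _ (End.of (proj k he a b ≫ β ≫ incl k he c d)) hα

theorem IsRadical.add {i j a b : Fin n} {α β : projMor k he i j ⟶ projMor k he a b}
    (hα : IsRadical he α) (hβ : IsRadical he β) : IsRadical he (α + β) := by
  rw [IsRadical, Preadditive.add_comp, Preadditive.comp_add]
  exact add_mem hα hβ

theorem isRadical_zero {i j a b : Fin n} :
    IsRadical he (0 : projMor k he i j ⟶ projMor k he a b) := by
  rw [IsRadical, Limits.zero_comp, Limits.comp_zero]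
  exact zero_mem _

theorem not_isRadical_id (i j : Fin n) : ¬ IsRadical he (𝟙 (projMor k he i j)) := fun h => by
  rw [IsRadical, Category.id_comp, proj_incl] at h
  refine endo_ne_zero (k := k) (he.ne_zero i) (he.ne_zero j) (eq_zero_of_mem_jacobson h ?_)
  change endo (e i) (e j) ≫ endo (e i) (e j) = endo (e i) (e j)
  rw [endo_comp, he.mul_self, he.mul_self]

theorem isRadical_homMor_left {i j a b : Fin n} {x : A} (hx : x ∈ Ring.jacobson A) (y : A) :
    IsRadical he (homMor (k := k) he (i := i) (j := j) (a := a) (b := b) x y) := by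
  have h : proj k he i j ≫ homMor he x y ≫ incl k he a b =
      endo (e i * x * e a) (e b * y * e j) := by
    simp only [homMor, Category.assoc, proj_incl]
    rw [← Category.assoc, proj_incl, endo_comp, endo_comp, mul_assoc, mul_assoc]
  rw [IsRadical, h]
  exact endo_mem_jacobson_left (Ideal.mul_mem_right _ _ (Ideal.mul_mem_left _ _ hx)) _

theorem isRadical_homMor_right {i j a b : Fin n} (x : A) {y : A} (hy : y ∈ Ring.jacobson A) :
    IsRadical he (homMor (k := k) he (i := i) (j := j) (a := a) (b := b) x y) := by
  have h : proj k he i j ≫ homMor he x y ≫ incl k he a b =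
      endo (e i * x * e a) (e b * y * e j) := by
    simp only [homMor, Category.assoc, proj_incl]
    rw [← Category.assoc, proj_incl, endo_comp, endo_comp, mul_assoc, mul_assoc]
  rw [IsRadical, h]
  exact endo_mem_jacobson_right _ (Ideal.mul_mem_right _ _ (Ideal.mul_mem_left _ _ hy))

/-- One of the two tensor factors lies in an off-diagonal corner, hence in the radical of `A`. -/
theorem isRadical_of_ne {i j a b : Fin n} (h : ¬ (i = a ∧ j = b))
    (α : projMor k he i j ⟶ projMor k he a b) : IsRadical he α := by
  refine projMor_hom_induction he (isRadical_zero he) (fun x y h1 h2 h3 h4 => ?_)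
    (fun _ _ h h' => h.add he h') α
  by_cases hia : i = a
  · exact isRadical_homMor_right he x (corner_mem_jacobson_of_ne k he
      (fun hj => h ⟨hia, hj.symm⟩) h3 h4)
  · exact isRadical_homMor_left he (corner_mem_jacobson_of_ne k he hia h1 h2) y

theorem homMor_id (i j : Fin n) : homMor he (e i) (e j) = 𝟙 (projMor k he i j) := by
  rw [homMor, ← Category.assoc, incl_endo, incl_proj]

theorem homMor_add_left {i j a b : Fin n} (x x' y : A) :
    (homMor he (x + x') y : projMor k he i j ⟶ projMor k he a b) =
      homMor he x y + homMor he x' y := by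
  simp only [homMor, endo_add_left, Preadditive.add_comp, Preadditive.comp_add]

theorem homMor_add_right {i j a b : Fin n} (x y y' : A) :
    (homMor he x (y + y') : projMor k he i j ⟶ projMor k he a b) =
      homMor he x y + homMor he x y' := by
  simp only [homMor, endo_add_right, Preadditive.add_comp, Preadditive.comp_add]

theorem homMor_smul_left {i j a b : Fin n} (r : k) (x y : A) :
    (homMor he (r • x) y : projMor k he i j ⟶ projMor k he a b) = r • homMor he x y := by
  simp only [homMor, endo_smul_left, Linear.smul_comp, Linear.comp_smul]

theorem homMor_smul_right {i j a b : Fin n} (r : k) (x y : A) :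
    (homMor he x (r • y) : projMor k he i j ⟶ projMor k he a b) = r • homMor he x y := by
  simp only [homMor, endo_smul_right, Linear.smul_comp, Linear.comp_smul]

/-- Both tensor factors lie in diagonal corners and are scalars modulo the radical. -/
theorem exists_isRadical_sub [IsAlgClosed k] {i j : Fin n}
    (α : projMor k he i j ⟶ projMor k he i j) :
    ∃ (c : k) (ρ : projMor k he i j ⟶ projMor k he i j), IsRadical he ρ ∧ α = c • 𝟙 _ + ρ := by
  refine projMor_hom_induction he (P := fun α => ∃ (c : k) (ρ : projMor k he i j ⟶ projMor k he i j),
    IsRadical he ρ ∧ α = c • 𝟙 _ + ρ) ⟨0, 0, isRadical_zero he, by simp⟩ ?_ ?_ α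
  · intro x y h1 h2 h3 h4
    obtain ⟨c, r, hr, -, -, hx⟩ := corner_decomposition (k := k) he i h1 h2
    obtain ⟨d, s, hs, -, -, hy⟩ := corner_decomposition (k := k) he j h3 h4
    refine ⟨c * d, homMor he (c • e i) s + homMor he r y,
      (isRadical_homMor_right he _ hs).add he (isRadical_homMor_left he hr _), ?_⟩
    rw [hx, homMor_add_left, ← add_assoc]
    congr 1
    rw [hy, homMor_add_right, homMor_smul_right, homMor_smul_left, homMor_id, smul_smul,
      mul_comm]
  · rintro _ _ ⟨c, ρ, h, rfl⟩ ⟨d, σ, h', rfl⟩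
    exact ⟨c + d, ρ + σ, h.add he h', by rw [add_smul]; abel⟩

theorem isIso_of_isRadical_sub [IsAlgClosed k] {i j : Fin n} {c : k} (hc : c ≠ 0)
    {ρ : projMor k he i j ⟶ projMor k he i j} (hρ : IsRadical he ρ) :
    IsIso (c • 𝟙 _ + ρ) := by
  -- The invertible element is found in the larger algebra of endomorphisms of A ⊗ -, as one plus a
  -- radical element; it commutes with the inclusion and the projection up to `c`, so its inverse
  -- can be cut down.
  let z := End.of (proj k he i j ≫ ρ ≫ incl k he i j)
  have hz : -((c⁻¹ • 1 : End (free k A)) * z) ∈ Ring.jacobson (End (free k A)) :=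
    neg_mem (Ideal.mul_mem_left _ _ hρ)
  obtain ⟨⟨u, v, huv, hvu⟩, hu⟩ := isUnit_one_sub_of_mem_jacobson hz
  have hu' : u = 𝟙 _ + c⁻¹ • (proj k he i j ≫ ρ ≫ incl k he i j) := by
    refine hu.trans ?_
    rw [sub_neg_eq_add]
    change 𝟙 _ + (proj k he i j ≫ ρ ≫ incl k he i j) ≫ (c⁻¹ • 𝟙 _) = _
    rw [Linear.comp_smul, Category.comp_id]
  have h1 : (c • 𝟙 _ + ρ) ≫ incl k he i j = c • incl k he i j ≫ u := by
    rw [hu', Preadditive.comp_add, Linear.comp_smul, smul_add, smul_smul, mul_inv_cancel₀ hc,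
      ← Category.assoc (incl k he i j), incl_proj]
    simp
  have h2 : proj k he i j ≫ (c • 𝟙 _ + ρ) = c • u ≫ proj k he i j := by
    rw [hu', Preadditive.add_comp, Linear.smul_comp, smul_add, smul_smul, mul_inv_cancel₀ hc,
      Category.assoc, Category.assoc, incl_proj]
    simp
  have h3 : u ≫ v = 𝟙 _ := hvu
  have h4 : v ≫ u = 𝟙 _ := huv
  refine ⟨c⁻¹ • incl k he i j ≫ v ≫ proj k he i j, ?_, ?_⟩
  · rw [Linear.comp_smul, ← Category.assoc, h1, Linear.smul_comp, smul_smul, inv_mul_cancel₀ hc,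
      one_smul, Category.assoc, ← Category.assoc u, h3, Category.id_comp, incl_proj]
  · rw [Linear.smul_comp, Category.assoc, Category.assoc, h2, Linear.comp_smul, Linear.comp_smul,
      smul_smul, inv_mul_cancel₀ hc, one_smul, ← Category.assoc v, h4, Category.id_comp, incl_proj]

theorem isLocalRing_end_projMor [IsAlgClosed k] (i j : Fin n) :
    IsLocalRing (End (projMor k he i j)) := by
  rw [isLocalRing_end_iff]
  refine ⟨projMor_id_ne_zero he i j, fun f g hfg => ?_⟩
  obtain ⟨c, ρ, hρ, rfl⟩ := exists_isRadical_sub he f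
  obtain ⟨d, σ, hσ, rfl⟩ := exists_isRadical_sub he g
  by_cases hc : c = 0
  · by_cases hd : d = 0
    · subst hc hd
      simp only [zero_smul, zero_add] at hfg
      exact absurd (hfg ▸ hρ.add he hσ) (not_isRadical_id he i j)
    · exact Or.inr (isIso_of_isRadical_sub he hd hσ)
  · exact Or.inl (isIso_of_isRadical_sub he hc hρ)

theorem eq_of_projMor_iso {i j a b : Fin n} (f : projMor k he i j ≅ projMor k he a b) :
    i = a ∧ j = b := by
  by_contra h
  exact not_isRadical_id he i j (f.hom_inv_id ▸ (isRadical_of_ne he h f.hom).comp he f.inv)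

end Generators

/-! ### Decomposition of projective functors and the endomorphisms of the identity. -/

section Structure
variable {k : Type u} [Field k] {A : Type u} [Ring A] [Algebra k A] [FiniteDimensional k A]

theorem ProjCat.addClosure_one_free (F : ProjCat k A) :
    addClosure (fun G => G = ProjCat.one k A ∨ G = free k A) F := by
  obtain ⟨F, ι, _, Y, p, q, hY, h⟩ := F
  have hY' : ∀ s, isProjective k A (Y s) := fun s => le_addClosure _ (hY s)
  refine ⟨ι, inferInstance, fun s => ⟨Y s, hY' s⟩, fun s => ObjectProperty.homMk (p s),
    fun s => ObjectProperty.homMk (q s), fun s => ?_, pev_ext fun N x => ?_⟩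
  · rcases hY s with h | h
    · exact Or.inl (ObjectProperty.FullSubcategory.ext h)
    · exact Or.inr (ObjectProperty.FullSubcategory.ext h)
  · rw [sum_pev, pev_id]
    refine Eq.trans ?_ (congrArg (fun α => ev α N x) h)
    beta_reduce
    rw [sum_ev]
    rfl

theorem pev_one {G : ProjCat k A} (α : ProjCat.one k A ⟶ G) (N : FGModuleCat.{u} A)
    (n : (ProjCat.one k A).obj.obj N) :
    pev α N n = act (G.obj.map (fromReg (N := N) n)) (pev α (FGModuleCat.of A A) (1 : A)) := by
  refine Eq.trans ?_ (pev_map α (fromReg (N := N) n) (1 : A))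
  exact congrArg (pev α N) (one_smul A (show N from n)).symm

/-- The central element given by an endomorphism of the identity functor. -/
def centralElt (α : ProjCat.one k A ⟶ ProjCat.one k A) : A := pev α (FGModuleCat.of A A) (1 : A)

theorem pev_one_one (α : ProjCat.one k A ⟶ ProjCat.one k A) (N : FGModuleCat.{u} A) (n : N) :
    pev α N n = (centralElt α • n : N) := pev_one α N n

theorem centralElt_comm (α : ProjCat.one k A ⟶ ProjCat.one k A) (a : A) :
    centralElt α * a = a * centralElt α := by
  refine (pev_one_one α (FGModuleCat.of A A) a).symm.trans ?_
  refine Eq.trans ?_ (pev_smul α (FGModuleCat.of A A) a (1 : A))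
  exact congrArg (pev α (FGModuleCat.of A A)) (mul_one a).symm

theorem centralElt_comp (α β : ProjCat.one k A ⟶ ProjCat.one k A) :
    centralElt (α ≫ β) = centralElt β * centralElt α :=
  pev_one_one β (FGModuleCat.of A A) (centralElt α)

theorem one_hom_ext {α β : ProjCat.one k A ⟶ ProjCat.one k A} (h : centralElt α = centralElt β) :
    α = β := pev_ext fun N n => by
  refine (pev_one_one α N n).trans (Eq.trans ?_ (pev_one_one β N n).symm)
  rw [h]

/-- It suffices to treat the identity and A ⊗ -, and both are generated by an element over the
regular module. So 2-morphisms embed in linear maps between finite dimensional spaces. -/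
theorem eq_zero_of_pev_reg {F G : ProjCat k A} (α : F ⟶ G)
    (h : ∀ x, pev α (FGModuleCat.of A A) x = 0) : α = 0 := by
  obtain ⟨ι, _, Y, p, q, hY, hpq⟩ := F.addClosure_one_free
  have h1 : ∀ s, q s ≫ α = 0 := fun s => by
    have h2 : ∀ x, pev (q s ≫ α) (FGModuleCat.of A A) x = 0 := fun x => h _
    revert h2
    generalize q s ≫ α = β
    rcases hY s with hs | hs
    · revert β; rw [hs]
      intro β hβ
      refine pev_ext fun N x => ?_
      refine (pev_one β N x).trans ?_
      exact (congrArg (act (G.obj.map (fromReg (N := N) x))) (hβ (1 : A))).trans (map_zero _)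
    · revert β; rw [hs]
      intro β hβ
      refine free_hom_ext fun N x => ?_
      have : pt (k := k) 1 x = act ((free k A).obj.map (fromReg x))
          (pt (N := FGModuleCat.of A A) 1 (1 : A)) := by
        rw [map_pt, act_fromReg, one_smul]
      rw [this, pev_map, hβ]
      exact map_zero _
  rw [← Category.id_comp α, ← hpq, Preadditive.sum_comp]
  exact Finset.sum_eq_zero fun s _ => by rw [Category.assoc, h1, Limits.comp_zero]

theorem ProjCat.finite_hom (F G : ProjCat k A) : Module.Finite k (F ⟶ G) := by
  let Φ : (F ⟶ G) →ₗ[k] (F.obj.obj (FGModuleCat.of A A) →ₗ[k] G.obj.obj (FGModuleCat.of A A)) :=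
    { toFun := fun α =>
        { toFun := pev α _
          map_add' := pev_add α _
          map_smul' := pev_ksmul α _ }
      map_add' := fun α β => rfl
      map_smul' := fun r α => rfl }
  refine Module.Finite.of_injective Φ ((injective_iff_map_eq_zero Φ).2 fun α hα => ?_)
  exact eq_zero_of_pev_reg α fun x => LinearMap.congr_fun hα x

/-- An idempotent endomorphism of the identity functor acts by a central idempotent of `A`, which is
`0` or `1` by connectedness. -/
theorem isLocalRing_end_one (hconn : IsConnectedAlgebra A) :
    IsLocalRing (End (ProjCat.one k A)) := by
  have hnt := hconn.1
  have : FiniteDimensional k (End (ProjCat.one k A)) := ProjCat.finite_hom _ _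
  have : Nontrivial (End (ProjCat.one k A)) := ⟨0, 1, fun h =>
    zero_ne_one (α := A) (congrArg (fun α : ProjCat.one k A ⟶ ProjCat.one k A => centralElt α) h)⟩
  refine isLocalRing_of_idempotents k fun ε hε => ?_
  have h3 : IsIdempotentElem (centralElt ε) :=
    (centralElt_comp ε ε).symm.trans (congrArg centralElt hε)
  exact (hconn.2 _ h3 (centralElt_comm ε)).imp (fun h => one_hom_ext h) (fun h => one_hom_ext h)

instance : IsIdempotentComplete (ProjCat k A) := by
  have : IsNoetherianRing A := isNoetherian_of_tower k inferInstance
  exact isIdempotentComplete_of_retract _ fun _ _ r h => addClosure_of_retract r h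

/-- The action on a fixed object preserves additive closures. -/
theorem TwoRep.addClosure_app {M : Type*} [Category* M] [Preadditive M] [Linear k M]
    (ρ : TwoRep k A M) {S : ObjectProperty (ProjCat k A)} {F : ProjCat k A} (hF : addClosure S F)
    (X : M) : addClosure (fun Y => ∃ G, S G ∧ Y = ρ.app G X) (ρ.app F X) := by
  obtain ⟨ι, _, Y, p, q, hY, h⟩ := hF
  refine ⟨ι, inferInstance, fun s => ρ.app (Y s) X, fun s => (ρ.act.map (p s)).hom.app X,
    fun s => (ρ.act.map (q s)).hom.app X, fun s => ⟨Y s, hY s, rfl⟩, ?_⟩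
  have := ρ.additive
  let Φ : (F ⟶ F) →+ (ρ.app F X ⟶ ρ.app F X) :=
    AddMonoidHom.mk' (fun α => (ρ.act.map α).hom.app X) fun α β => by rw [ρ.act.map_add]; rfl
  have h1 := congrArg Φ h
  rw [map_sum] at h1
  have h2 : Φ (𝟙 F) = 𝟙 _ := by
    change (ρ.act.map (𝟙 F)).hom.app X = _
    rw [CategoryTheory.Functor.map_id]; rfl
  rw [← h2, ← h1]
  refine Finset.sum_congr rfl fun s _ => ?_
  change _ = (ρ.act.map (p s ≫ q s)).hom.app X
  rw [ρ.act.map_comp]; rfl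

end Structure

/-! ### Products of the F_{ij}, classification of indecomposables and left cells. -/

section Structure
variable {k : Type u} [Field k] {A : Type u} [Ring A] [Algebra k A] [FiniteDimensional k A]
    {n : ℕ} {e : Fin n → A} (he : IsBasicDecomposition e)

/-- The identity `1 ⊗ 1` is the sum of the orthogonal idempotents `e i ⊗ e j`. -/
theorem addClosure_projMor_free :
    addClosure (fun G => ∃ i j, G = projMor k he i j) (free k A) := by
  refine ⟨Fin n × Fin n, inferInstance, fun p => projMor k he p.1 p.2,
    fun p => proj k he p.1 p.2, fun p => incl k he p.1 p.2, fun p => ⟨_, _, rfl⟩, ?_⟩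
  simp only [proj_incl]
  rw [← endo_one, ← he.complete, Fintype.sum_prod_type]
  change _ = endoBilin _ _
  rw [map_sum endoBilin, LinearMap.sum_apply]
  refine Finset.sum_congr rfl fun i _ => ?_
  rw [map_sum]
  rfl

theorem addClosure_projMor (F : ProjCat k A) :
    addClosure (fun G => G = ProjCat.one k A ∨ ∃ i j, G = projMor k he i j) F := by
  refine addClosure_mono ?_ F.addClosure_one_free
  rintro X (h | h)
  · exact le_addClosure _ (Or.inl h)
  · exact h ▸ addClosure_mono (fun Y h => le_addClosure _ (Or.inr h)) (addClosure_projMor_free he)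

/-- The morphism `F_{ad} ⟶ F_{ab} F_{cd}` given by an element. -/
def splitMor {a b c d : Fin n} (z : A) :
    projMor k he a d ⟶ (projMor k he a b).comp (projMor k he c d) :=
  incl k he a d ≫ insertMor z ≫ ProjCat.hcomp (proj k he a b) (proj k he c d)

/-- The morphism `F_{ab} F_{cd} ⟶ F_{ad}` given by a linear form. -/
def mergeMor {a b c d : Fin n} (φ : A →ₗ[k] k) :
    (projMor k he a b).comp (projMor k he c d) ⟶ projMor k he a d :=
  ProjCat.hcomp (incl k he a b) (incl k he c d) ≫ contractMor φ ≫ proj k he a d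

theorem splitMor_mergeMor {a b c d : Fin n} (z : A) (φ : A →ₗ[k] k) :
    splitMor he (a := a) (b := b) (c := c) (d := d) z ≫ mergeMor he φ =
      φ (e b * z * e c) • 𝟙 _ := by
  rw [splitMor, mergeMor, Category.assoc, Category.assoc,
    ← Category.assoc (ProjCat.hcomp (proj k he a b) _), hcomp_comp, proj_incl, proj_incl,
    ← Category.assoc (insertMor z), insertMor_hcomp_endo, Category.assoc,
    ← Category.assoc (insertMor _), insertMor_contractMor]
  simp only [Linear.smul_comp, Linear.comp_smul, Category.id_comp]
  rw [endo_proj, incl_proj]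

theorem hcomp_incl_contractMor {a b c d : Fin n} (φ : A →ₗ[k] k) :
    ProjCat.hcomp (incl k he a b) (incl k he c d) ≫ contractMor φ ≫ endo (e a) (e d) =
      ProjCat.hcomp (incl k he a b) (incl k he c d) ≫ contractMor φ := by
  have h : ProjCat.hcomp (incl k he a b) (incl k he c d) =
      ProjCat.hcomp (incl k he a b) (incl k he c d) ≫
        ProjCat.hcomp (endo (e a) (e b)) (endo (e c) (e d)) := by
    rw [hcomp_comp, incl_endo, incl_endo]
  rw [h, Category.assoc, Category.assoc, ← Category.assoc (ProjCat.hcomp (endo _ _) _),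
    hcomp_endo_contractMor, Category.assoc, endo_comp, he.mul_self, he.mul_self]

/-- The space `e b * A * e c` between the outer factors only contributes multiplicity. A basis of
all of `A` serves as well as one of the corner, since only membership in the additive closure is
wanted. -/
theorem addClosure_projMor_comp (a b c d : Fin n) :
    addClosure (fun G => G = projMor k he a d)
      ((projMor k he a b).comp (projMor k he c d)) := by
  let B := Module.finBasis k A
  refine ⟨Fin (Module.finrank k A), inferInstance, fun _ => projMor k he a d,
    fun t => mergeMor he (B.coord t), fun t => splitMor he (B t), fun _ => rfl, ?_⟩
  have h1 : ∀ t, mergeMor he (a := a) (b := b) (c := c) (d := d) (B.coord t) ≫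
      splitMor he (B t) = ProjCat.hcomp (incl k he a b) (incl k he c d) ≫
        (contractMor (B.coord t) ≫ insertMor (B t)) ≫
          ProjCat.hcomp (proj k he a b) (proj k he c d) := fun t => by
    rw [mergeMor, splitMor, Category.assoc, Category.assoc, ← Category.assoc (proj k he a d),
      proj_incl, ← Category.assoc (contractMor _), ← Category.assoc (ProjCat.hcomp _ _),
      hcomp_incl_contractMor, Category.assoc, Category.assoc]
  simp only [h1]
  rw [← Preadditive.comp_sum, ← Preadditive.sum_comp, sum_contractMor_insertMor,
    Category.id_comp, hcomp_comp, incl_proj, incl_proj, hcomp_id]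

theorem exists_form_eq_one {a : A} (ha : a ≠ 0) : ∃ φ : A →ₗ[k] k, φ a = 1 := by
  by_contra hcon
  push Not at hcon
  refine ha ((Module.forall_dual_apply_eq_zero_iff k a).1 fun l => ?_)
  by_contra h0
  exact hcon ((l a)⁻¹ • l) (by simp [h0])

/-- `F_{ad}` is a direct summand of `F_{ab} F_{bd}`. -/
theorem nonempty_retract_projMor_comp (a b d : Fin n) :
    Nonempty (Retract (projMor k he a d) ((projMor k he a b).comp (projMor k he b d))) := by
  obtain ⟨φ, hφ⟩ := exists_form_eq_one (k := k) (he.ne_zero b)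
  refine ⟨⟨splitMor he (e b), mergeMor he φ, ?_⟩⟩
  rw [splitMor_mergeMor, he.mul_self, he.mul_self, hφ, one_smul]

theorem addClosure_comp_projMor (F : ProjCat k A) (c d : Fin n) :
    addClosure (fun G => ∃ a, G = projMor k he a d) (F.comp (projMor k he c d)) := by
  refine addClosure_mono ?_ ((TwoRep.principal k A).addClosure_app (addClosure_projMor he F)
    (projMor k he c d))
  rintro _ ⟨G, rfl | ⟨a, b, rfl⟩, rfl⟩
  · exact le_addClosure _ ⟨c, rfl⟩
  · exact addClosure_mono (fun X hX => le_addClosure _ ⟨a, hX⟩) (addClosure_projMor_comp he a b c d)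

/-- The action of an isomorphism of `1`-morphisms. -/
def TwoRep.appIso {M : Type*} [Category* M] [Preadditive M] [Linear k M] (ρ : TwoRep k A M)
    {F G : ProjCat k A} (f : F ≅ G) (X : M) : ρ.app F X ≅ ρ.app G X :=
  ((isLin k M).ι.mapIso (ρ.act.mapIso f)).app X

theorem finrank_mul_of_free_iso {N : FGModuleCat.{u} A} (f : (free k A).obj.obj N ≅ N) :
    Module.finrank k A * Module.finrank k N = Module.finrank k N := by
  rw [← Module.finrank_tensorProduct]
  exact LinearEquiv.finrank_eq
    { toFun := fun x : A ⊗[k] N => (act f.hom x : N)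
      map_add' := act_add f.hom
      map_smul' := fun r x => by
        refine Eq.trans ?_ (act_smul f.hom (algebraMap k A r) x)
        exact congrArg (act f.hom) (algebraMap_smul_tensor r N x).symm
      invFun := fun x => act f.inv x
      left_inv := fun x => congrFun (congrArg act f.hom_inv_id) x
      right_inv := fun x => congrArg (fun f => act f x) f.inv_hom_id }

theorem finrank_pos_of_nontrivial (N : FGModuleCat.{u} A) [Nontrivial N] :
    0 < Module.finrank k N := Module.finrank_pos

/-- If the identity were F_{ij}, then F_{cc} ≅ F_{ij}F_{cc} would be a summand of copies of F_{ic},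
forcing `c = i` for every `c`. So `e i = 1` and A ⊗ - is isomorphic to the identity; evaluating at
`A` gives (dim A)² = dim A, so `A` is one-dimensional and simple. -/
theorem isEmpty_one_iso_projMor [IsAlgClosed k] (hconn : IsConnectedAlgebra A)
    (hns : ¬ IsSimpleRing A) (i j : Fin n) : IsEmpty (ProjCat.one k A ≅ projMor k he i j) := by
  refine ⟨fun f => hns ?_⟩
  have hnt := hconn.1
  have h1 : ∀ c, c = i := fun c => by
    have f' : projMor k he c c ≅ (projMor k he i j).comp (projMor k he c c) :=
      (TwoRep.principal k A).appIso f (projMor k he c c)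
    obtain ⟨Y, rfl, ⟨r⟩⟩ := exists_retract_of_addClosure (isLocalRing_end_projMor he c c)
      (addClosure_of_iso f' (addClosure_projMor_comp he i j c c))
    obtain ⟨g⟩ := nonempty_iso_of_retract (fun h => projMor_id_ne_zero (k := k) he c c
      (h.eq_of_src _ _)) (isLocalRing_end_projMor he i c) r
    exact (eq_of_projMor_iso he g).1
  have h2 : e i = 1 := by
    rw [← he.complete, Finset.sum_eq_single i (fun b _ hb => absurd (h1 b) hb) (by simp)]
  have h3 : j = i := h1 j
  subst h3
  have h4 : proj k he j j ≫ incl k he j j = 𝟙 _ := by rw [proj_incl, h2, endo_one]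
  obtain ⟨N, h5, hN⟩ : ∃ N : FGModuleCat.{u} A, Nonempty ((free k A).obj.obj N ≅ N) ∧
      Nontrivial N := ⟨FGModuleCat.of A A, ⟨((isProjective k A).ι.mapIso ((⟨proj k he j j, incl k he j j, h4, incl_proj he j j⟩ :
      free k A ≅ projMor k he j j) ≪≫ f.symm)).app (FGModuleCat.of A A)⟩, hnt⟩
  have h6 := finrank_mul_of_free_iso h5.some
  have h8 : Module.finrank k A = 1 :=
    Nat.eq_of_mul_eq_mul_right (finrank_pos_of_nontrivial (k := k) N) (by rw [h6, one_mul])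
  refine ⟨⟨fun I => or_iff_not_imp_left.2 fun hI => ?_⟩⟩
  obtain ⟨x, hx, hx0⟩ : ∃ x ∈ I, x ≠ 0 := by
    by_contra hcon
    push Not at hcon
    exact hI (le_antisymm (fun x hx => (TwoSidedIdeal.mem_bot A).2 (hcon x hx)) bot_le)
  obtain ⟨c, hc⟩ := (finrank_eq_one_iff_of_nonzero' x hx0).1 h8 1
  rw [← TwoSidedIdeal.one_mem_iff, ← hc, Algebra.smul_def]
  exact I.mul_mem_left _ _ hx

/-- Left composition preserves the right index, so only the F_{ai} can occur; conversely F_{ai} is a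
summand of F_{ai}F_{ii} and F_{ii} one of F_{ia}F_{ai}. -/
theorem mem_leftCell_iff [IsAlgClosed k] (i : Fin n) (F : ProjCat k A) :
    F ∈ leftCell (projMor k he i i) ↔ ∃ a, Nonempty (F ≅ projMor k he a i) := by
  constructor
  · rintro ⟨hF, ⟨H, ⟨r⟩⟩, -⟩
    have := ProjCat.finite_hom F F
    obtain ⟨Y, ⟨a, rfl⟩, ⟨r'⟩⟩ := exists_retract_of_addClosure (isLocalRing_end_of_isIndec k hF)
      (addClosure_of_retract r (addClosure_comp_projMor he H i i))
    exact ⟨a, nonempty_iso_of_retract hF.1 (isLocalRing_end_projMor he a i) r'⟩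
  · rintro ⟨a, ⟨f⟩⟩
    refine ⟨(isIndec_of_isLocalRing (isLocalRing_end_projMor he a i)).of_iso f.symm,
      ⟨projMor k he a i, ?_⟩, ⟨projMor k he i a, ?_⟩⟩
    · obtain ⟨r⟩ := nonempty_retract_projMor_comp (k := k) he a i i
      exact ⟨(Retract.ofIso f).trans r⟩
    · obtain ⟨r⟩ := nonempty_retract_projMor_comp (k := k) he i a i
      exact ⟨r.trans ((Retract.ofIso f.symm).map (((TwoRep.principal k A).act.obj _).obj))⟩

theorem IsIndec.nonempty_iso [IsAlgClosed k] (hconn : IsConnectedAlgebra A) {F : ProjCat k A}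
    (hF : IsIndec F) :
    Nonempty (F ≅ ProjCat.one k A) ∨ ∃ i j, Nonempty (F ≅ projMor k he i j) := by
  have := ProjCat.finite_hom F F
  obtain ⟨Y, hY, ⟨r⟩⟩ := exists_retract_of_addClosure (isLocalRing_end_of_isIndec k hF)
    (addClosure_projMor he F)
  rcases hY with rfl | ⟨i, j, rfl⟩
  · exact Or.inl (nonempty_iso_of_retract hF.1 (isLocalRing_end_one hconn) r)
  · exact Or.inr ⟨i, j, nonempty_iso_of_retract hF.1 (isLocalRing_end_projMor he i j) r⟩

end Structure

/-! ### The adjunction between F_{bν(i)} and F_{ib}. -/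

section Adjunction
variable {k : Type u} [Field k] {A : Type u} [Ring A] [Algebra k A] [FiniteDimensional k A]

/-- `F` is left adjoint to `G` in the `2`-category of projective functors. -/
structure AdjointPair (F G : ProjCat k A) where
  /-- the unit -/
  unit : ProjCat.one k A ⟶ G.comp F
  /-- the counit -/
  counit : F.comp G ⟶ ProjCat.one k A
  left_triangle : ∀ N : FGModuleCat.{u} A,
    F.obj.map (unit.hom.app N) ≫ counit.hom.app (F.obj.obj N) = 𝟙 (F.obj.obj N)
  right_triangle : ∀ N : FGModuleCat.{u} A,
    unit.hom.app (G.obj.obj N) ≫ G.obj.map (counit.hom.app N) = 𝟙 (G.obj.obj N)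

variable {n : ℕ} {e : Fin n → A} {ν : Equiv.Perm (Fin n)} {i : Fin n}

/-- The Casimir element `∑ x t ⊗ y t` commutes with `a`: both sides expand with the coefficients
`form (y t * a * x s)`. This makes the unit of the adjunction `A`-linear. -/
theorem DualBases.sum_swap (d : DualBases k e ν i) (a : A) {N : FGModuleCat.{u} A} (n : N) :
    ∑ t, pt (k := k) (d.x t) (d.y t • a • n) = ∑ t, pt (k := k) (a * d.x t) (d.y t • n) := by
  have h1 : ∀ t, d.y t • a • n = ∑ s, d.form (d.y t * a * d.x s) • d.y s • n := fun t => by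
    conv_lhs => rw [smul_smul, ← d.sum_y (d.y t * a) (by rw [← mul_assoc, d.mul_y]),
      Finset.sum_smul]
    exact Finset.sum_congr rfl fun s _ => smul_assoc _ _ _
  have h2 : ∀ t, a * d.x t = ∑ s, d.form (d.y s * a * d.x t) • d.x s := fun t => by
    conv_lhs => rw [← d.sum_x (a * d.x t) (by rw [mul_assoc, d.x_mul])]
    simp only [mul_assoc]
  simp only [h1, pt_sum]
  rw [Finset.sum_comm]
  refine Finset.sum_congr rfl fun t _ => ?_
  rw [h2, sum_pt]
  exact Finset.sum_congr rfl fun s _ => (smul_pt' _ _ _).symm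

/-- The Casimir morphism. -/
def DualBases.casimir (d : DualBases k e ν i) : ProjCat.one k A ⟶ free k A :=
  ObjectProperty.homMk
    { app := fun N => FGModuleCat.ofHom
        { toFun := fun n => ∑ t, pt (k := k) (d.x t) (d.y t • n)
          map_add' := fun m n => by
            refine Eq.trans (Finset.sum_congr rfl fun t _ => ?_) (Finset.sum_add_distrib
              (f := fun t => pt (k := k) (d.x t) (d.y t • m))
              (g := fun t => pt (k := k) (d.x t) (d.y t • n)))
            exact (congrArg (pt (k := k) (d.x t)) (smul_add (d.y t) (m : N) (n : N))).trans
              (pt_add _ _ _)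
          map_smul' := fun a n => by
            refine (d.sum_swap a (N := N) n).trans ?_
            exact (Finset.smul_sum (r := a) (f := fun t => pt (k := k) (d.x t) (d.y t • n))
              (s := Finset.univ)).symm }
      naturality := fun M N f => FGModuleCat.hom_ext (LinearMap.ext fun n => by
        have h : ∀ (m : M) t, act ((free k A).obj.map f) (pt (k := k) (d.x t) (d.y t • m)) =
            pt (k := k) (d.x t) (d.y t • act f m) := fun m t => by rw [map_pt, act_smul]
        exact ((act_sum Finset.univ ((free k A).obj.map f)
          (fun t => pt (k := k) (d.x t) (d.y t • (n : M)))).trans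
            (Finset.sum_congr rfl fun t _ => h n t)).symm) }

theorem DualBases.pev_casimir (d : DualBases k e ν i) (N : FGModuleCat.{u} A) (n : N) :
    pev d.casimir N n = ∑ t, pt (k := k) (d.x t) (d.y t • n) := rfl

/-- The morphism `n ↦ ∑ xₜ ⊗ (b ⊗ yₜ n)`. -/
def DualBases.freeUnit (d : DualBases k e ν i) (b : A) :
    ProjCat.one k A ⟶ (free k A).comp (free k A) := d.casimir ≫ insertMor b

/-- The components of `freeUnit`. -/
def DualBases.unitApp (d : DualBases k e ν i) (b : A) (N : FGModuleCat.{u} A) :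
    N ⟶ (free k A).obj.obj ((free k A).obj.obj N) := (d.freeUnit b).hom.app N

theorem DualBases.unitApp_naturality (d : DualBases k e ν i) (b : A) {M N : FGModuleCat.{u} A}
    (f : M ⟶ N) : f ≫ d.unitApp b N =
      d.unitApp b M ≫ (free k A).obj.map ((free k A).obj.map f) :=
  (d.freeUnit b).hom.naturality f

theorem DualBases.act_unitApp (d : DualBases k e ν i) (b : A) (N : FGModuleCat.{u} A) (n : N) :
    act (d.unitApp b N) n = ∑ t, pt (k := k) (d.x t) (pt (k := k) b (d.y t • n)) := by
  change pev (insertMor b) N (pev d.casimir N n) = _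
  rw [d.pev_casimir]
  refine (pev_sum _ _ _ _).trans (Finset.sum_congr rfl fun t _ => ?_)
  rw [pev_insertMor]; rfl

/-- The morphism `a ⊗ (b ⊗ n) ↦ φ(b) a n`. -/
def DualBases.freeCounit (d : DualBases k e ν i) :
    (free k A).comp (free k A) ⟶ ProjCat.one k A := contractMor d.form ≫ mulMor 1

/-- The components of `freeCounit`. -/
def DualBases.counitApp (d : DualBases k e ν i) (N : FGModuleCat.{u} A) :
    (free k A).obj.obj ((free k A).obj.obj N) ⟶ N := d.freeCounit.hom.app N

theorem DualBases.counitApp_naturality (d : DualBases k e ν i) {M N : FGModuleCat.{u} A}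
    (f : M ⟶ N) : (free k A).obj.map ((free k A).obj.map f) ≫ d.counitApp N =
      d.counitApp M ≫ f := d.freeCounit.hom.naturality f

theorem DualBases.act_counitApp (d : DualBases k e ν i) (a b : A) (N : FGModuleCat.{u} A)
    (n : N) : act (d.counitApp N) (pt (k := k) a (pt (k := k) b n)) = d.form b • a • n := by
  change pev (mulMor 1) N (pev (contractMor d.form) N (pt₂ (k := k) a b n)) = _
  rw [pev_contractMor, pev_ksmul, pev_mulMor, one_smul]
  rfl

theorem free_map_ext {N M : FGModuleCat.{u} A} {f g : (free k A).obj.obj N ⟶ M}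
    (h : ∀ n, act f (pt (k := k) 1 n) = act g (pt (k := k) 1 n)) : f = g :=
  hom_ext_act fun x => by
    induction x using pt_induction with
    | h0 => exact (map_zero f.hom.hom).trans (map_zero g.hom.hom).symm
    | h1 a n =>
      have := congrArg (a • ·) (h n)
      simp only [← act_smul, smul_pt, mul_one] at this
      exact this
    | h2 x y hx hy => rw [act_add, act_add, hx, hy]

/-- The components of `endo`. -/
def endoApp (x y : A) (N : FGModuleCat.{u} A) :
    (free k A).obj.obj N ⟶ (free k A).obj.obj N := (endo x y).hom.app N

theorem act_endoApp (x y a : A) (N : FGModuleCat.{u} A) (n : N) :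
    act (endoApp (k := k) x y N) (pt a n) = pt (a * x) (y • n) := rfl

/-- Before cutting by idempotents, the triangle composite is only a tensor of coefficients; for `b =
e b'` it is the idempotent that cuts out F_{b'ν(i)}. Expanding `e (ν i)` in the basis `y t` is the
dual basis property. -/
theorem DualBases.free_left_triangle (he : IsBasicDecomposition e) (d : DualBases k e ν i) (b : A)
    (N : FGModuleCat.{u} A) :
    (free k A).obj.map (d.unitApp b N) ≫ d.counitApp ((free k A).obj.obj N) =
      endoApp b (e (ν i)) N := free_map_ext fun n => by
  rw [act_comp, map_pt, d.act_unitApp, pt_sum, act_sum]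
  simp only [d.act_counitApp]
  rw [act_endoApp, one_mul, ← d.sum_y (e (ν i)) (he.mul_self _), Finset.sum_smul, pt_sum]
  refine Finset.sum_congr rfl fun t _ => ?_
  rw [one_smul, d.form_mul he, smul_assoc, pt_smul]

theorem DualBases.free_right_triangle (he : IsBasicDecomposition e) (d : DualBases k e ν i) (b : A)
    (N : FGModuleCat.{u} A) :
    d.unitApp b ((free k A).obj.obj N) ≫ (free k A).obj.map (d.counitApp N) =
      endoApp (e i) b N := free_map_ext fun n => by
  rw [act_comp, d.act_unitApp, act_sum, act_endoApp]
  conv_rhs => rw [one_mul, ← d.sum_x (e i) (he.mul_self _), sum_pt]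
  refine Finset.sum_congr rfl fun t _ => ?_
  rw [smul_pt, map_pt, d.act_counitApp, mul_one, d.form_mul' he, smul_pt']

/-- The unit already takes values in the part cut out by the idempotents, so the truncation loses
nothing. -/
theorem DualBases.unitApp_endoApp (he : IsBasicDecomposition e) (d : DualBases k e ν i)
    (b : Fin n) (N : FGModuleCat.{u} A) :
    d.unitApp (e b) N ≫ endoApp (e i) (e b) _ = d.unitApp (e b) N := hom_ext_act fun n => by
  rw [act_comp, d.act_unitApp, act_sum]
  refine Finset.sum_congr rfl fun t _ => ?_
  rw [act_endoApp, d.x_mul, smul_pt, he.mul_self]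

theorem DualBases.unitApp_map_endoApp (he : IsBasicDecomposition e) (d : DualBases k e ν i)
    (b : Fin n) (N : FGModuleCat.{u} A) :
    d.unitApp (e b) N ≫ (free k A).obj.map (endoApp (e b) (e (ν i)) N) = d.unitApp (e b) N :=
  hom_ext_act fun n => by
  rw [act_comp, d.act_unitApp, act_sum]
  refine Finset.sum_congr rfl fun t _ => ?_
  rw [map_pt, act_endoApp, smul_smul, d.mul_y, he.mul_self]

/-- The components of `incl`. -/
def inclApp (he : IsBasicDecomposition e) (i j : Fin n) (N : FGModuleCat.{u} A) :
    (projMor k he i j).obj.obj N ⟶ (free k A).obj.obj N := (incl k he i j).hom.app N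

/-- The components of `proj`. -/
def projApp (he : IsBasicDecomposition e) (i j : Fin n) (N : FGModuleCat.{u} A) :
    (free k A).obj.obj N ⟶ (projMor k he i j).obj.obj N := (proj k he i j).hom.app N

theorem inclApp_projApp (he : IsBasicDecomposition e) (i j : Fin n) (N : FGModuleCat.{u} A) :
    inclApp (k := k) he i j N ≫ projApp he i j N = 𝟙 _ :=
  congrArg (fun α => α.hom.app N) (incl_proj (k := k) he i j)

theorem projApp_inclApp (he : IsBasicDecomposition e) (i j : Fin n) (N : FGModuleCat.{u} A) :
    projApp (k := k) he i j N ≫ inclApp he i j N = endoApp (e i) (e j) N :=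
  congrArg (fun α => α.hom.app N) (proj_incl (k := k) he i j)

theorem inclApp_naturality (he : IsBasicDecomposition e) (i j : Fin n) {M N : FGModuleCat.{u} A}
    (f : M ⟶ N) : (projMor k he i j).obj.map f ≫ inclApp he i j N =
      inclApp he i j M ≫ (free k A).obj.map f := (incl k he i j).hom.naturality f

theorem projApp_naturality (he : IsBasicDecomposition e) (i j : Fin n) {M N : FGModuleCat.{u} A}
    (f : M ⟶ N) : (free k A).obj.map f ≫ projApp he i j N =
      projApp he i j M ≫ (projMor k he i j).obj.map f := (proj k he i j).hom.naturality f

/-- `F_{b ν(i)}` is left adjoint to `F_{ib}`. -/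
def DualBases.adjointPair (he : IsBasicDecomposition e) (d : DualBases k e ν i) (b : Fin n) :
    AdjointPair (projMor k he b (ν i)) (projMor k he i b) where
  unit := d.freeUnit (e b) ≫ ProjCat.hcomp (proj k he i b) (proj k he b (ν i))
  counit := ProjCat.hcomp (incl k he b (ν i)) (incl k he i b) ≫ d.freeCounit
  left_triangle N := by
    let T := (free k A).obj
    let F := (projMor k he b (ν i)).obj
    let G := (projMor k he i b).obj
    have h1 : d.unitApp (e b) N ≫ projApp he i b (T.obj N) ≫ G.map (projApp he b (ν i) N) ≫
        inclApp he i b (F.obj N) = d.unitApp (e b) N ≫ T.map (projApp he b (ν i) N) := by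
      rw [inclApp_naturality, ← Category.assoc (projApp he i b _), projApp_inclApp,
        ← Category.assoc, d.unitApp_endoApp he]
    change F.map (d.unitApp (e b) N ≫ projApp he i b (T.obj N) ≫ G.map (projApp he b (ν i) N)) ≫
      (inclApp he b (ν i) (G.obj (F.obj N)) ≫ T.map (inclApp he i b (F.obj N))) ≫
        d.counitApp (F.obj N) = 𝟙 _
    -- Naturality moves the inclusions and projections to the ends. The triangle for A ⊗ - is left
    -- in the middle, and its idempotent becomes the identity after cutting.
    rw [Category.assoc, ← Category.assoc (F.map _), inclApp_naturality, Category.assoc,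
      ← Category.assoc (T.map _) (T.map _), ← T.map_comp, Category.assoc, Category.assoc, h1,
      T.map_comp, Category.assoc, d.counitApp_naturality, ← Category.assoc (T.map _),
      d.free_left_triangle he, ← projApp_inclApp he, Category.assoc, inclApp_projApp,
      Category.comp_id, inclApp_projApp]
  right_triangle N := by
    let T := (free k A).obj
    let F := (projMor k he b (ν i)).obj
    let G := (projMor k he i b).obj
    change (d.unitApp (e b) (G.obj N) ≫ projApp he i b (T.obj (G.obj N)) ≫
        G.map (projApp he b (ν i) (G.obj N))) ≫
      G.map ((inclApp he b (ν i) (G.obj N) ≫ T.map (inclApp he i b N)) ≫ d.counitApp N) = 𝟙 _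
    rw [Category.assoc, Category.assoc, ← G.map_comp, Category.assoc,
      ← Category.assoc (projApp he b _ _), projApp_inclApp, ← projApp_naturality, T.map_comp,
      Category.assoc, ← Category.assoc (d.unitApp _ _), d.unitApp_map_endoApp he, T.map_comp,
      Category.assoc, ← Category.assoc (d.unitApp _ _), ← d.unitApp_naturality, Category.assoc,
      ← Category.assoc (d.unitApp _ _), d.free_right_triangle he, ← projApp_inclApp he,
      Category.assoc, inclApp_projApp, Category.comp_id, inclApp_projApp]

end Adjunction

/-! ### Bilinearity of the splitting morphisms over the middle factor. -/

section Splitting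
variable {k : Type u} [Field k] {A : Type u} [Ring A] [Algebra k A] [FiniteDimensional k A]
    {n : ℕ} {e : Fin n → A} (he : IsBasicDecomposition e)

theorem insertMor_hcomp_proj {a b c d : Fin n} (z : A) :
    insertMor z ≫ ProjCat.hcomp (proj k he a b) (proj k he c d) =
      endo (e a) (e d) ≫ insertMor (e b * z * e c) ≫
        ProjCat.hcomp (proj k he a b) (proj k he c d) := by
  conv_lhs => rw [← endo_proj he a b, ← endo_proj he c d, ← hcomp_comp, ← Category.assoc,
    insertMor_hcomp_endo, Category.assoc]

theorem endo_insertMor_hcomp_proj {a b c d : Fin n} (z : A) :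
    endo (e a) (e d) ≫ insertMor z ≫ ProjCat.hcomp (proj k he a b) (proj k he c d) =
      insertMor z ≫ ProjCat.hcomp (proj k he a b) (proj k he c d) := by
  rw [insertMor_hcomp_proj, ← Category.assoc, endo_comp, he.mul_self, he.mul_self]

theorem splitMor_eq {a b c d : Fin n} (z : A) :
    splitMor (k := k) he (a := a) (b := b) (c := c) (d := d) z = splitMor he (e b * z * e c) := by
  rw [splitMor, splitMor, insertMor_hcomp_proj, ← Category.assoc, incl_endo]

/-- The outer coefficients `x`, `y'` act on F_{ad}, and the inner ones `y`, `x'` are absorbed into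
the parameter `z`. This is how coefficients are later moved across the middle. -/
theorem splitMor_hcomp {a b c d a' b' c' d' : Fin n} (z x y x' y' : A) :
    splitMor (k := k) he (a := a) (b := b) (c := c) (d := d) z ≫
        ProjCat.hcomp (homMor he (a := a') (b := b') x y) (homMor he (a := c') (b := d') x' y') =
      homMor he x y' ≫ splitMor he (y * e b * z * e c * x') := by
  have h1 : ProjCat.hcomp (proj k he a b) (proj k he c d) ≫
      ProjCat.hcomp (homMor he (a := a') (b := b') x y) (homMor he (a := c') (b := d') x' y') =
      ProjCat.hcomp (endo (e a * x) (y * e b)) (endo (e c * x') (y' * e d)) ≫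
        ProjCat.hcomp (proj k he a' b') (proj k he c' d') := by
    rw [hcomp_comp, hcomp_comp, homMor, homMor, ← Category.assoc, proj_incl, ← Category.assoc,
      ← Category.assoc (proj k he c d), proj_incl, endo_comp, ← Category.assoc (endo _ _), endo_comp]
  rw [splitMor, Category.assoc, Category.assoc, h1, ← Category.assoc (insertMor _),
    insertMor_hcomp_endo, Category.assoc]
  conv_rhs => rw [homMor, splitMor, Category.assoc, Category.assoc,
    ← Category.assoc (proj k he a' d'), proj_incl, endo_insertMor_hcomp_proj,
    ← Category.assoc, incl_endo' he a d x y', Category.assoc]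
  simp only [mul_assoc]

theorem sum_mergeMor_splitMor {ι : Type*} [Fintype ι] (B : Module.Basis ι k A) (a b c d : Fin n) :
    ∑ t, mergeMor he (B.coord t) ≫ splitMor he (B t) =
      𝟙 ((projMor k he a b).comp (projMor k he c d)) := by
  have h1 : ∀ t, mergeMor he (a := a) (b := b) (c := c) (d := d) (B.coord t) ≫
      splitMor he (B t) = ProjCat.hcomp (incl k he a b) (incl k he c d) ≫
        (contractMor (B.coord t) ≫ insertMor (B t)) ≫
          ProjCat.hcomp (proj k he a b) (proj k he c d) := fun t => by
    rw [mergeMor, splitMor, Category.assoc, Category.assoc, ← Category.assoc (proj k he a d),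
      proj_incl, ← Category.assoc (contractMor _), ← Category.assoc (ProjCat.hcomp _ _),
      hcomp_incl_contractMor, Category.assoc, Category.assoc]
  simp only [h1]
  rw [← Preadditive.comp_sum, ← Preadditive.sum_comp, sum_contractMor_insertMor,
    Category.id_comp, hcomp_comp, incl_proj, incl_proj, hcomp_id]

end Splitting

/-! ### Tensor products of categories and additive envelopes. -/

section TensorFunctors
variable {k : Type*} [Field k] {C D : Type*} [Category* C] [Preadditive C] [Linear k C]
  [Category* D] [Preadditive D] [Linear k D]

variable (k C) in
/-- The functor `X ↦ X ⊠ P`. -/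
def tensorLeft (P : D) : C ⥤ TensorCat k C D where
  obj X := ⟨X, P⟩
  map {X Y} f := TensorCat.mkHom ⟨X, P⟩ ⟨Y, P⟩ f (𝟙 P)
  map_id X := rfl
  map_comp {X Y Z} f g := by rw [TensorCat.mkHom_comp, Category.comp_id]

variable (k D) in
/-- The functor `P ↦ X ⊠ P`. -/
def tensorRight (X : C) : D ⥤ TensorCat k C D where
  obj P := ⟨X, P⟩
  map {P Q} f := TensorCat.mkHom ⟨X, P⟩ ⟨X, Q⟩ (𝟙 X) f
  map_id X := rfl
  map_comp {X Y Z} f g := by rw [TensorCat.mkHom_comp, Category.comp_id]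

instance (P : D) : (tensorLeft k C P).Additive := ⟨TensorProduct.add_tmul _ _ _⟩
instance (X : C) : (tensorRight k D X).Additive := ⟨TensorProduct.tmul_add _ _ _⟩

theorem TensorCat.addClosure {S : ObjectProperty C} {T : ObjectProperty D} {X : C} {P : D}
    (hX : addClosure S X) (hP : addClosure T P) :
    ProjFunctors.addClosure (fun Y : TensorCat k C D => S Y.fst ∧ T Y.snd) ⟨X, P⟩ :=
  addClosure_map (tensorLeft k C P) (T := fun Y : TensorCat k C D => S Y.fst ∧ T Y.snd)
    (fun X hX => addClosure_map (tensorRight k D X) (fun _ hP => le_addClosure _ ⟨hX, hP⟩) hP) hX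

/-- A linear form that is non-zero on `g` contracts the tensor to a non-zero multiple of `f`. -/
theorem TensorCat.mkHom_ne_zero {X Y : TensorCat k C D} {f : X.fst ⟶ Y.fst} {g : X.snd ⟶ Y.snd}
    (hf : f ≠ 0) (hg : g ≠ 0) : mkHom X Y f g ≠ 0 := fun h => by
  obtain ⟨φ, hφ⟩ : ∃ φ : (X.snd ⟶ Y.snd) →ₗ[k] k, φ g ≠ 0 := by
    by_contra hcon
    push Not at hcon
    exact hg ((Module.forall_dual_apply_eq_zero_iff k g).1 hcon)
  have h1 := congrArg (TensorProduct.rid k (X.fst ⟶ Y.fst) ∘ LinearMap.lTensor _ φ) h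
  have h2 : φ g • f = 0 := by
    refine Eq.trans ?_ (h1.trans ?_)
    · change _ = TensorProduct.rid k (X.fst ⟶ Y.fst) (LinearMap.lTensor _ φ (f ⊗ₜ g))
      simp
    · change TensorProduct.rid k (X.fst ⟶ Y.fst) (LinearMap.lTensor _ φ 0) = 0
      simp
  exact hf ((smul_eq_zero.1 h2).resolve_left hφ)

instance TensorCat.finite_hom (X Y : TensorCat k C D) [Module.Finite k (X.fst ⟶ Y.fst)]
    [Module.Finite k (X.snd ⟶ Y.snd)] : Module.Finite k (X ⟶ Y) :=
  inferInstanceAs (Module.Finite k ((X.fst ⟶ Y.fst) ⊗[k] (X.snd ⟶ Y.snd)))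

theorem addClosure_mat (M : Mat_ C) :
    addClosure (fun N => ∃ i, N = (Mat_.embedding C).obj (M.X i)) M := by
  refine ⟨M.ι, inferInstance, fun i => (Mat_.embedding C).obj (M.X i),
    fun i => M.isoBiproductEmbedding.hom ≫ Limits.biproduct.π (fun i => (Mat_.embedding C).obj (M.X i)) i,
    fun i => Limits.biproduct.ι (fun i => (Mat_.embedding C).obj (M.X i)) i ≫ M.isoBiproductEmbedding.inv, fun i => ⟨i, rfl⟩, ?_⟩
  have := congrArg (fun f => M.isoBiproductEmbedding.hom ≫ f ≫ M.isoBiproductEmbedding.inv)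
    (Limits.biproduct.total (f := fun i => (Mat_.embedding C).obj (M.X i)))
  rw [Category.id_comp, Iso.hom_inv_id, Preadditive.sum_comp, Preadditive.comp_sum] at this
  simpa only [Category.assoc] using this

theorem Mat_.finite_hom (hf : ∀ X Y : C, Module.Finite k (X ⟶ Y)) (M N : Mat_ C) :
    Module.Finite k (M ⟶ N) := by
  let Φ : (M ⟶ N) →ₗ[k] (∀ i j, M.X i ⟶ N.X j) :=
    { toFun := fun f => f, map_add' := fun _ _ => rfl, map_smul' := fun _ _ => rfl }
  exact Module.Finite.of_injective Φ fun f g h => h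

end TensorFunctors

/-! ### Paths in a bipartite quiver. -/

section Paths
variable {V W : Type*} (E : V → W → Prop)

theorem eq_of_path_inl {x : BipQuiver E} {v : V} (p : Quiver.Path x (Sum.inl v : V ⊕ W)) :
    ∃ h : x = (Sum.inl v : V ⊕ W), p = h ▸ Quiver.Path.nil := by
  cases p with
  | nil => exact ⟨rfl, rfl⟩
  | cons q a => rename_i z; rcases z with z | z <;> exact a.elim

theorem eq_or_of_path {x y : BipQuiver E} (p : Quiver.Path x y) :
    x = y ∨ ∃ v w, E v w ∧ x = (Sum.inl v : V ⊕ W) ∧ y = (Sum.inr w : V ⊕ W) := by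
  cases p with
  | nil => exact Or.inl rfl
  | cons q a =>
    rename_i z
    rcases z with z | z
    · obtain ⟨rfl, -⟩ := eq_of_path_inl E q
      rcases y with y | y
      · exact a.elim
      · exact Or.inr ⟨z, y, a.down, rfl, rfl⟩
    · rcases y with y | y <;> exact a.elim

theorem path_self_eq_nil {x : BipQuiver E} (p : Quiver.Path x x) : p = Quiver.Path.nil := by
  rcases x with x | x
  · obtain ⟨_, rfl⟩ := eq_of_path_inl E p
    rfl
  · cases p with
    | nil => rfl
    | cons q a =>
      rename_i z
      rcases z with z | z
      · obtain ⟨h, -⟩ := eq_of_path_inl E q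
        exact absurd h Sum.inr_ne_inl
      · exact a.elim

theorem path_eq {v : V} {w : W} (p q : Quiver.Path (show BipQuiver E from Sum.inl v)
    (show BipQuiver E from Sum.inr w)) : p = q := by
  have h : ∀ p : Quiver.Path (show BipQuiver E from Sum.inl v) (show BipQuiver E from Sum.inr w),
      ∃ a : E v w, p = Quiver.Path.cons Quiver.Path.nil
        (show (show BipQuiver E from Sum.inl v) ⟶ (show BipQuiver E from Sum.inr w) from ⟨a⟩) := by
    intro p
    cases p with
    | cons q a =>
      rename_i z
      rcases z with z | z
      · obtain ⟨h, rfl⟩ := eq_of_path_inl E q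
        cases h
        exact ⟨a.down, rfl⟩
      · exact a.elim
  obtain ⟨_, rfl⟩ := h p
  obtain ⟨_, rfl⟩ := h q
  rfl

/-- All arrows go from upper to lower vertices and there are no multiple arrows, so a path is
trivial or a single arrow. Hence Hom(P_x, P_y) has dimension at most one. -/
theorem subsingleton_path (x y : BipQuiver E) : Subsingleton (Quiver.Path x y) := by
  refine ⟨fun p q => ?_⟩
  rcases eq_or_of_path E p with rfl | ⟨v, w, -, rfl, rfl⟩
  · rw [path_self_eq_nil E p, path_self_eq_nil E q]
  · exact path_eq E p q

end Paths

/-! ### Projective modules over the path algebra. -/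

section PathAlgebra
variable (k : Type u) [Field k] {V W : Type*} (E : V → W → Prop)

theorem PathProj.exists_of {x y : V ⊕ W} (f : pathProj k E x ⟶ pathProj k E y) :
    ∃ g : (Opposite.op ((Paths.of (BipQuiver E)).obj x) ⟶
      Opposite.op ((Paths.of (BipQuiver E)).obj y)) →₀ k,
      (Mat_.embedding (CategoryTheory.Free k (Paths (BipQuiver E))ᵒᵖ)).map
        (X := CategoryTheory.Free.of k (Opposite.op ((Paths.of (BipQuiver E)).obj x)))
        (Y := CategoryTheory.Free.of k (Opposite.op ((Paths.of (BipQuiver E)).obj y))) g = f :=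
  (Mat_.embedding (CategoryTheory.Free k (Paths (BipQuiver E))ᵒᵖ)).map_surjective f

variable {k E} in
/-- The morphism given by a path. -/
def pathHom {x y : V ⊕ W} (p : Quiver.Path (show BipQuiver E from y) (show BipQuiver E from x)) :
    pathProj k E x ⟶ pathProj k E y :=
  (Mat_.embedding (CategoryTheory.Free k (Paths (BipQuiver E))ᵒᵖ)).map
    (X := CategoryTheory.Free.of k (Opposite.op ((Paths.of (BipQuiver E)).obj x)))
    (Y := CategoryTheory.Free.of k (Opposite.op ((Paths.of (BipQuiver E)).obj y)))
    (Finsupp.single (Quiver.Hom.op (show (Paths.of (BipQuiver E)).obj y ⟶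
      (Paths.of (BipQuiver E)).obj x from p)) 1)

variable {k E} in
theorem pathHom_ne_zero {x y : V ⊕ W}
    (p : Quiver.Path (show BipQuiver E from y) (show BipQuiver E from x)) :
    pathHom (k := k) p ≠ 0 := fun h => by
  have h1 := (Mat_.embedding (CategoryTheory.Free k (Paths (BipQuiver E))ᵒᵖ)).map_injective
    (h.trans (Functor.map_zero _ _ _).symm)
  exact one_ne_zero (Finsupp.single_eq_zero.1 h1)

variable {k E} in
theorem exists_eq_smul_pathHom {x y : V ⊕ W} {f : pathProj k E x ⟶ pathProj k E y} (hf : f ≠ 0) :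
    ∃ (p : Quiver.Path (show BipQuiver E from y) (show BipQuiver E from x)) (c : k),
      f = c • pathHom p := by
  obtain ⟨g, rfl⟩ := PathProj.exists_of k E f
  have hg : g ≠ 0 := fun h => hf (by rw [h]; exact Functor.map_zero _ _ _)
  obtain ⟨p, hp⟩ := Finsupp.ne_iff.1 hg
  refine ⟨p.unop, g p, ?_⟩
  have hs := subsingleton_path E y x
  have h1 : g = g p • Finsupp.single p 1 := by
    ext q
    obtain rfl : q = p := Quiver.Hom.unop_inj (hs.elim _ _)
    simp
  conv_lhs => rw [h1]
  ext i j
  rfl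

-- Spaces of morphisms between the P_x are at most one-dimensional, because paths with given ends
-- are unique.
variable {k E} in
theorem exists_eq_smul_of_ne_zero {x y : V ⊕ W} {α : pathProj k E x ⟶ pathProj k E y} (hα : α ≠ 0)
    (f : pathProj k E x ⟶ pathProj k E y) : ∃ c : k, f = c • α := by
  by_cases hf : f = 0
  · exact ⟨0, by rw [hf, zero_smul]⟩
  obtain ⟨p, c, rfl⟩ := exists_eq_smul_pathHom hf
  obtain ⟨q, d, rfl⟩ := exists_eq_smul_pathHom hα
  obtain rfl : p = q := (subsingleton_path E y x).elim _ _
  have hd : d ≠ 0 := fun h => hα (by rw [h, zero_smul])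
  exact ⟨c * d⁻¹, by rw [smul_smul, mul_assoc, inv_mul_cancel₀ hd, mul_one]⟩

variable {k E} in
theorem eq_or_of_hom_ne_zero {x y : V ⊕ W} {α : pathProj k E x ⟶ pathProj k E y} (hα : α ≠ 0) :
    x = y ∨ ∃ v w, E v w ∧ x = Sum.inr w ∧ y = Sum.inl v := by
  obtain ⟨p, -⟩ := exists_eq_smul_pathHom hα
  rcases eq_or_of_path E p with h | ⟨v, w, h, h1, h2⟩
  · exact Or.inl h.symm
  · exact Or.inr ⟨v, w, h, h2, h1⟩

theorem pathProj_id_ne_zero (x : V ⊕ W) : 𝟙 (pathProj k E x) ≠ 0 := fun h =>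
  pathHom_ne_zero (k := k) (E := E) (x := x) Quiver.Path.nil (by
    rw [← Category.id_comp (pathHom _), h, Limits.zero_comp])

variable {E} in
theorem exists_pathProj_hom_ne_zero {v : V} {w : W} (h : E v w) :
    ∃ α : pathProj k E (Sum.inr w) ⟶ pathProj k E (Sum.inl v), α ≠ 0 :=
  ⟨pathHom (Quiver.Path.cons Quiver.Path.nil
    (show (show BipQuiver E from Sum.inl v) ⟶ (show BipQuiver E from Sum.inr w) from ⟨h⟩)),
    pathHom_ne_zero _⟩

theorem PathProj.finite_hom (P Q : PathProj k E) : Module.Finite k (P ⟶ Q) := by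
  refine Mat_.finite_hom (fun X Y => ?_) P Q
  have : Finite ((show (Paths (BipQuiver E))ᵒᵖ from X) ⟶ (show (Paths (BipQuiver E))ᵒᵖ from Y)) := by
    have h := subsingleton_path E (show (Paths (BipQuiver E))ᵒᵖ from Y).unop
      (show (Paths (BipQuiver E))ᵒᵖ from X).unop
    have : Subsingleton ((show (Paths (BipQuiver E))ᵒᵖ from X) ⟶
      (show (Paths (BipQuiver E))ᵒᵖ from Y)) := ⟨fun p q => Quiver.Hom.unop_inj (h.elim _ _)⟩
    infer_instance
  exact inferInstanceAs (Module.Finite k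
    (((show (Paths (BipQuiver E))ᵒᵖ from X) ⟶ (show (Paths (BipQuiver E))ᵒᵖ from Y)) →₀ k))

theorem addClosure_pathProj (P : PathProj k E) :
    addClosure (fun Q => ∃ x, Q = pathProj k E x) P :=
  addClosure_mono (fun _ ⟨i, hi⟩ =>
    le_addClosure _ ⟨(show (Paths (BipQuiver E))ᵒᵖ from P.X i).unop, hi⟩)
    (addClosure_mat P)

end PathAlgebra

/-! ### The ambient category is Hom-finite and abelian. -/

section Ambient
variable (k : Type u) [Field k] (A : Type u) [Ring A] [Algebra k A] [FiniteDimensional k A]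
  {V W : Type*} (E : V → W → Prop)

/-- The underlying category of the inflation of the principal `2`-representation. -/
abbrev Inflated := Mat_ (TensorCat k (ProjCat k A) (PathProj k E))

theorem Inflated.finite_hom (X Y : Inflated k A E) : Module.Finite k (X ⟶ Y) :=
  Mat_.finite_hom (fun X Y => by
    have := ProjCat.finite_hom X.fst Y.fst
    have := PathProj.finite_hom k E X.snd Y.snd
    infer_instance) X Y

theorem Ambient.finite_hom (X Y : Ambient k A E) : Module.Finite k (X ⟶ Y) :=
  finite_hom_abCat k (Inflated.finite_hom k A E) X Y

variable {k A E} in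
/-- The object `G ⊠ P_x` of the inflation. -/
def inflatedObj (G : ProjCat k A) (x : V ⊕ W) : Inflated k A E :=
  (Mat_.embedding (TensorCat k (ProjCat k A) (PathProj k E))).obj ⟨G, pathProj k E x⟩

variable {k A E} in
theorem addClosure_inflatedObj {S : ObjectProperty (ProjCat k A)} (hS : ∀ F, addClosure S F)
    (X : Inflated k A E) : addClosure (fun Y => ∃ G x, S G ∧ Y = inflatedObj G x) X := by
  obtain ⟨ι, _, Y, p, q, hY, hpq⟩ := addClosure_mat X
  refine addClosure_of_sum ι Y p q (fun s => ?_) hpq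
  obtain ⟨i, hi⟩ := hY s
  rw [hi]
  refine addClosure_map (Mat_.embedding _) (fun Z hZ => ?_)
    (TensorCat.addClosure (hS (X.X i).fst) (addClosure_pathProj k E (X.X i).snd))
  obtain ⟨F, P⟩ := Z
  obtain ⟨h1, x, rfl⟩ := hZ
  exact le_addClosure _ ⟨F, x, h1, rfl⟩

variable [Finite V] [Finite W]

/-- The finite sum of all 𝟙 ⊠ P_x and (A ⊗ -) ⊠ P_x works; finiteness of the graph enters here. -/
theorem exists_isAddGenerator : ∃ P : Inflated k A E, IsAddGenerator P := by
  obtain ⟨m, ⟨φ⟩⟩ := Finite.exists_equiv_fin (Bool × (V ⊕ W))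
  let f : Fin m → Inflated k A E := fun s =>
    inflatedObj (cond (φ.symm s).1 (ProjCat.one k A) (free k A)) (φ.symm s).2
  refine ⟨Limits.biproduct f, isAddGenerator_of_addClosure fun X => ?_⟩
  obtain ⟨ι, _, Y, p, q, hY, hpq⟩ := addClosure_inflatedObj ProjCat.addClosure_one_free X
  refine addClosure_of_sum ι Y p q (fun s => ?_) hpq
  obtain ⟨G, x, hG, hs⟩ := hY s
  obtain ⟨t, ht⟩ : ∃ t, Y s = f t := by
    rcases hG with rfl | rfl
    · exact ⟨φ (true, x), by simp [f, hs]⟩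
    · exact ⟨φ (false, x), by simp [f, hs]⟩
  rw [ht]
  exact ⟨Unit, inferInstance, fun _ => Limits.biproduct f, fun _ => Limits.biproduct.ι f t,
    fun _ => Limits.biproduct.π f t, fun _ => rfl, by simp⟩

/-- An abelian category structure with a given underlying preadditive structure. -/
@[reducible]
def abelianOf {C : Type*} [Category* C] [p : Preadditive C]
    (h : ∃ a : Abelian C, a.toPreadditive = p) : Abelian C :=
  { p with
    normalMonoOfMono := by
      obtain ⟨a, rfl⟩ := h; exact a.normalMonoOfMono
    normalEpiOfEpi := by
      obtain ⟨a, rfl⟩ := h; exact a.normalEpiOfEpi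
    has_kernels := by
      obtain ⟨a, rfl⟩ := h; exact a.has_kernels
    has_cokernels := by
      obtain ⟨a, rfl⟩ := h; exact a.has_cokernels
    has_finite_products := by
      obtain ⟨a, rfl⟩ := h; exact a.has_finite_products }

/-- The preadditive structure of the quotient category is kept, so that linearity of the action and
abelian arguments refer to the same addition. -/
instance : Abelian (Ambient k A E) :=
  abelianOf (by
    obtain ⟨P, hP⟩ := exists_isAddGenerator k A E
    exact nonempty_abelian hP k (Inflated.finite_hom k A E))

end Ambient

/-! ### Local projective objects and their simple tops. -/

section SimpleTops
-- `P` becomes a retract of `Q`, and the corresponding idempotent of the local ring `End Q` is not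
-- `0`, so it is `1`.
theorem isIso_of_comp_isIso_of_isLocalRing {C : Type*} [Category* C] [Preadditive C] {P Q : C} (hP : IsLocalRing (End P))
    (hQ : IsLocalRing (End Q)) {f : P ⟶ Q} {g : Q ⟶ P} (h : IsIso (f ≫ g)) : IsIso f ∧ IsIso g := by
  let r : Retract P Q := ⟨f, g ≫ inv (f ≫ g), by
    rw [← Category.assoc, IsIso.hom_inv_id]⟩
  have hP0 : ¬ Limits.IsZero P := fun h0 => (isLocalRing_end_iff.1 hP).1 (h0.eq_of_src _ _)
  have e : IsIso f := by
    have hid : IsIdempotentElem (End.of (r.r ≫ r.i)) := by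
      change (r.r ≫ r.i) ≫ (r.r ≫ r.i) = r.r ≫ r.i
      simp
    rcases idempotent_of_isLocalRing hid with h1 | h1
    · refine absurd ((Limits.IsZero.iff_id_eq_zero P).2 ?_) hP0
      have : r.i ≫ (r.r ≫ r.i) ≫ r.r = 0 := by
        rw [show r.r ≫ r.i = 0 from h1, Limits.zero_comp, Limits.comp_zero]
      simpa using this
    · exact ⟨r.r, r.retract, h1⟩
  exact ⟨e, by
    have : g = inv f ≫ (f ≫ g) := by simp
    rw [this]; infer_instance⟩

variable {C : Type*} [Category* C] [Abelian C]

variable {P : C}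

/-- Either `f` or `𝟙 - f` is invertible, and the latter kills the non-zero `π`. -/
theorem isIso_of_comp_eq_of_ne_zero (hP : IsLocalRing (End P))
    {S : C} {π : P ⟶ S} (hπ : π ≠ 0) {f : P ⟶ P}
    (hf : f ≫ π = π) : IsIso f := by
  rcases (isLocalRing_end_iff.1 hP).2 f (𝟙 P - f) (by simp) with h | h
  · exact h
  · refine absurd ?_ hπ
    rw [← cancel_epi (𝟙 P - f), Preadditive.sub_comp, hf, Category.id_comp, sub_self,
      Limits.comp_zero]

theorem epi_of_ne_zero {X S : C} [Simple S] {f : X ⟶ S} (hf : f ≠ 0) : Epi f :=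
  CategoryTheory.epi_of_nonzero_to_simple hf

/-- A non-zero morphism from a projective object to the simple top of a local projective object
comes from an isomorphism. -/
theorem isIso_of_comp_ne_zero (hP : IsLocalRing (End P))
    [Projective P] {Q : C} [Projective Q] (hQ : IsLocalRing (End Q))
    {S : C} [Simple S] {π : P ⟶ S} {f : Q ⟶ P} (hf : f ≫ π ≠ 0) : IsIso f := by
  have hπ : π ≠ 0 := fun h => hf (by rw [h, Limits.comp_zero])
  have := epi_of_ne_zero hf
  have h1 : IsIso (Projective.factorThru π (f ≫ π) ≫ f) :=
    isIso_of_comp_eq_of_ne_zero hP hπ (by rw [Category.assoc, Projective.factorThru_comp])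
  exact (isIso_of_comp_isIso_of_isLocalRing hP hQ h1).2

theorem exists_lift_of_simple (hP : IsLocalRing (End P))
    [Projective P] {Q : C} [Projective Q] (hQ : IsLocalRing (End Q))
    {S : C} [Simple S] (π : P ⟶ S) [Epi π] {g : Q ⟶ S} (hg : g ≠ 0) :
    ∃ f : Q ⟶ P, IsIso f ∧ f ≫ π = g :=
  ⟨Projective.factorThru g π, isIso_of_comp_ne_zero hP hQ (π := π)
    (by rwa [Projective.factorThru_comp]), Projective.factorThru_comp g π⟩

theorem eq_zero_of_isEmpty_iso (hP : IsLocalRing (End P))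
    [Projective P] {Q : C} [Projective Q] (hQ : IsLocalRing (End Q))
    {S : C} [Simple S] (π : P ⟶ S) [Epi π] (h : IsEmpty (Q ≅ P)) (g : Q ⟶ S) : g = 0 := by
  by_contra hg
  obtain ⟨f, hf, -⟩ := exists_lift_of_simple hP hQ π hg
  exact h.elim (asIso f)

/-- A lift of `g` to an endomorphism of `P` is a scalar `c` plus a nilpotent. A nilpotent
endomorphism is killed by `π`, since otherwise it would be invertible. -/
theorem exists_eq_smul_of_simple (hP : IsLocalRing (End P))
    (k : Type*) [Field k] [IsAlgClosed k] [Linear k C]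
    [Module.Finite k (P ⟶ P)] [Projective P] {S : C} [Simple S] (π : P ⟶ S) [Epi π] (g : P ⟶ S) :
    ∃ c : k, g = c • π := by
  let f : P ⟶ P := Projective.factorThru g π
  have hf : f ≫ π = g := Projective.factorThru_comp g π
  have : FiniteDimensional k (End P) := ‹Module.Finite k (P ⟶ P)›
  obtain ⟨c, hc⟩ := exists_isNilpotent_sub (k := k) (End.of f)
  refine ⟨c, ?_⟩
  have h1 : (f - c • 𝟙 P) ≫ π = g - c • π := by
    rw [Preadditive.sub_comp, hf, Linear.smul_comp, Category.id_comp]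
  by_contra hne
  have h2 : IsIso (f - c • 𝟙 P) := isIso_of_comp_ne_zero hP hP (π := π) (by
    rw [h1]; exact sub_ne_zero.2 hne)
  have h3 : IsUnit (End.of f - algebraMap k (End P) c) := by
    refine ⟨⟨End.of (f - c • 𝟙 P), End.of (inv (f - c • 𝟙 P)), ?_, ?_⟩, ?_⟩
    · exact IsIso.inv_hom_id _
    · exact IsIso.hom_inv_id _
    · rw [Algebra.algebraMap_eq_smul_one]; rfl
  exact (hc.not_isUnit) h3

/-- If `ρ` did not kill the kernel of `π`, then `ρ` would lift through that kernel, giving an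
invertible endomorphism of `P` that `π` kills. So `ρ` factors through `π`, and Schur's lemma
applies. -/
theorem nonempty_iso_of_simple (hP : IsLocalRing (End P))
    [Projective P] {S T : C} [Simple S] [Simple T] (π : P ⟶ S) [Epi π]
    (ρ : P ⟶ T) [Epi ρ] : Nonempty (S ≅ T) := by
  have hS : π ≠ 0 := fun h => Simple.not_isZero S (Limits.IsZero.of_epi_eq_zero π h)
  have hT : ρ ≠ 0 := fun h => Simple.not_isZero T (Limits.IsZero.of_epi_eq_zero ρ h)
  by_cases h : Limits.kernel.ι π ≫ ρ = 0
  · let g : S ⟶ T := (Abelian.epiIsCokernelOfKernel _ (Limits.kernelIsKernel π)).desc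
      (Limits.CokernelCofork.ofπ ρ h)
    have hg : π ≫ g = ρ := (Abelian.epiIsCokernelOfKernel _ (Limits.kernelIsKernel π)).fac
      (Limits.CokernelCofork.ofπ ρ h) Limits.WalkingParallelPair.one
    have hg0 : g ≠ 0 := fun h0 => hT (by rw [← hg, h0, Limits.comp_zero])
    have := isIso_of_hom_simple hg0
    exact ⟨asIso g⟩
  · have := epi_of_ne_zero h
    have h1 : IsIso (Projective.factorThru ρ (Limits.kernel.ι π ≫ ρ) ≫ Limits.kernel.ι π) :=
      isIso_of_comp_eq_of_ne_zero hP hT (by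
        rw [Category.assoc, Projective.factorThru_comp])
    refine absurd ?_ hS
    rw [← cancel_epi (Projective.factorThru ρ (Limits.kernel.ι π ≫ ρ) ≫ Limits.kernel.ι π),
      Category.assoc, Limits.kernel.condition, Limits.comp_zero, Limits.comp_zero]

end SimpleTops

/-! ### Separating families of local projectives; existence of non-split extensions. -/

section Families
variable {C : Type*} [Category* C] [Abelian C] (k : Type*) [Field k] [Linear k C]
  {J : Type*} (P : J → C)

/-- A separating family of pairwise non-isomorphic local projective objects in a Hom-finite
category. -/
structure IsProjectiveFamily : Prop where
  finite_hom : ∀ X Y : C, Module.Finite k (X ⟶ Y)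
  projective : ∀ j, Projective (P j)
  isLocalRing : ∀ j, IsLocalRing (End (P j))
  isZero : ∀ X : C, (∀ j (f : P j ⟶ X), f = 0) → Limits.IsZero X
  eq_of_iso : ∀ i j, (P i ≅ P j) → i = j

variable {k P}

theorem IsProjectiveFamily.mono (hP : IsProjectiveFamily k P) {X Y : C} {r : X ⟶ Y}
    (h : ∀ j (f : P j ⟶ X), f ≫ r = 0 → f = 0) : Mono r := by
  refine Preadditive.mono_of_isZero_kernel r (hP.isZero _ fun j f => ?_)
  rw [← cancel_mono (Limits.kernel.ι r), Limits.zero_comp]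
  exact h j _ (by rw [Category.assoc, Limits.kernel.condition, Limits.comp_zero])

theorem IsProjectiveFamily.eq_of_comp (hP : IsProjectiveFamily k P) {X Y : C} {f g : X ⟶ Y}
    (h : ∀ j (t : P j ⟶ X), t ≫ f = t ≫ g) : f = g := by
  have h1 : Limits.IsZero (Limits.cokernel (Limits.kernel.ι (f - g))) := by
    refine hP.isZero _ fun j t => ?_
    have := hP.projective j
    rw [← Projective.factorThru_comp t (Limits.cokernel.π _)]
    have h2 : Projective.factorThru t (Limits.cokernel.π (Limits.kernel.ι (f - g))) ≫ (f - g) = 0 := by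
      rw [Preadditive.comp_sub, h, sub_self]
    rw [← Limits.kernel.lift_ι (f - g) _ h2, Category.assoc, Limits.cokernel.condition,
      Limits.comp_zero]
  have h2 : Epi (Limits.kernel.ι (f - g)) := Preadditive.epi_of_isZero_cokernel _ h1
  rw [← sub_eq_zero, ← cancel_epi (Limits.kernel.ι (f - g)), Limits.kernel.condition,
    Limits.comp_zero]

/-- A non-zero subobject receives a non-zero morphism from some `P j`. Its lift to `P i` cannot be
killed by `p`, so it is an isomorphism and the subobject is everything. -/
theorem IsProjectiveFamily.simple_of_forall (hP : IsProjectiveFamily k P) {i : J} {T : C}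
    (p : P i ⟶ T) [Epi p] (hT : ¬ Limits.IsZero T)
    (h : ∀ j (f : P j ⟶ P i), ¬ IsIso f → f ≫ p = 0) : Simple T := by
  refine ⟨fun {K} m _ => ⟨fun hm h0 => hT ?_, fun hm => ?_⟩⟩
  · rw [Limits.IsZero.iff_id_eq_zero, ← cancel_epi m, h0, Limits.zero_comp, Limits.zero_comp]
  · obtain ⟨j, t, ht⟩ : ∃ j, ∃ t : P j ⟶ K, t ≠ 0 := by
      by_contra hcon
      push Not at hcon
      exact hm ((hP.isZero K hcon).eq_of_src _ _)
    have := hP.projective j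
    have h1 := Projective.factorThru_comp (t ≫ m) p
    have h2 : IsIso (Projective.factorThru (t ≫ m) p) := by
      by_contra h2
      rw [h _ _ h2] at h1
      exact ht (by rw [← cancel_mono m, ← h1, Limits.zero_comp])
    have h3 : Epi (t ≫ m) := by rw [← h1]; infer_instance
    have := epi_of_epi t m
    exact isIso_of_mono_of_epi m

/-- The sum of the dimensions of Hom(P_j, -) serves as a length, on which the search for minimal
quotients is an induction. -/
theorem IsProjectiveFamily.finrank_lt (hP : IsProjectiveFamily k P) [Fintype J] {X Y : C} (r : X ⟶ Y)
    [Epi r] (hr : ¬ Mono r) :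
    ∑ j, Module.finrank k (P j ⟶ Y) < ∑ j, Module.finrank k (P j ⟶ X) := by
  have hs : ∀ j, Function.Surjective (Linear.rightComp k (P j) r) := fun j g => by
    have := hP.projective j
    exact ⟨Projective.factorThru g r, Projective.factorThru_comp g r⟩
  have hfin := hP.finite_hom
  refine Finset.sum_lt_sum (fun j _ => ?_) ?_
  · exact LinearMap.finrank_le_finrank_of_surjective (hs j)
  · by_contra hcon
    push Not at hcon
    refine hr (hP.mono fun j f hf => ?_)
    have h1 : Module.finrank k (P j ⟶ X) = Module.finrank k (P j ⟶ Y) :=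
      le_antisymm (hcon j (Finset.mem_univ j)) (LinearMap.finrank_le_finrank_of_surjective (hs j))
    have h2 := (LinearMap.injective_iff_surjective_of_finrank_eq_finrank h1).2 (hs j)
    exact h2 (hf.trans Limits.zero_comp.symm)

variable [Finite J]

/-- There are minimal quotients with a given property. -/
theorem IsProjectiveFamily.exists_minimal_quotient (hP : IsProjectiveFamily k P) (X : C)
    (p : ∀ Y : C, (X ⟶ Y) → Prop) (h : p X (𝟙 X)) :
    ∃ (Y : C) (q : X ⟶ Y), Epi q ∧ p Y q ∧ ∀ (Z : C) (r : Y ⟶ Z), Epi r → p Z (q ≫ r) → Mono r := by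
  have := Fintype.ofFinite J
  suffices H : ∀ (m : ℕ) (Y : C) (q : X ⟶ Y), Epi q → p Y q →
      ∑ j, Module.finrank k (P j ⟶ Y) ≤ m → ∃ (Y : C) (q : X ⟶ Y), Epi q ∧ p Y q ∧
        ∀ (Z : C) (r : Y ⟶ Z), Epi r → p Z (q ≫ r) → Mono r from
    H _ X (𝟙 X) inferInstance h le_rfl
  intro m
  induction m with
  | zero =>
    intro Y q hq hp hd
    refine ⟨Y, q, hq, hp, fun Z r hr _ => ?_⟩
    by_contra hm
    exact absurd (hP.finrank_lt r hm) (by omega)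
  | succ m ih =>
    intro Y q hq hp hd
    by_cases hmin : ∀ (Z : C) (r : Y ⟶ Z), Epi r → p Z (q ≫ r) → Mono r
    · exact ⟨Y, q, hq, hp, hmin⟩
    · push Not at hmin
      obtain ⟨Z, r, hr, hpr, hm⟩ := hmin
      have := hP.finrank_lt r hm
      exact ih Z (q ≫ r) inferInstance hpr (by omega)

theorem IsProjectiveFamily.exists_simple_quotient (hP : IsProjectiveFamily k P) {X : C}
    (hX : ¬ Limits.IsZero X) : ∃ (S : C) (q : X ⟶ S), Simple S ∧ Epi q := by
  obtain ⟨S, q, hq, hS, hmin⟩ := hP.exists_minimal_quotient X (fun Y _ => ¬ Limits.IsZero Y) hX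
  refine ⟨S, q, ⟨fun {K} m _ => ⟨fun hm h0 => hS ?_, fun hm => ?_⟩⟩, hq⟩
  · rw [Limits.IsZero.iff_id_eq_zero, ← cancel_epi m, h0, Limits.zero_comp, Limits.zero_comp]
  · have h1 : Limits.IsZero (Limits.cokernel m) := by
      by_contra h1
      have := hmin _ (Limits.cokernel.π m) inferInstance h1
      exact hm (by rw [← cancel_mono (Limits.cokernel.π m), Limits.cokernel.condition,
        Limits.zero_comp])
    have := Preadditive.epi_of_isZero_cokernel m h1
    exact isIso_of_mono_of_epi m

/-- A criterion for the existence of non-split extensions of simple objects. -/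
theorem IsProjectiveFamily.exists_nonsplit (hP : IsProjectiveFamily k P) {a b : J} (hab : a ≠ b)
    {Q : C} (κ : P b ⟶ Q) [hκ : Epi κ] (θ : P a ⟶ Q) (hθ : θ ≠ 0)
    (h : ∀ j (ρ : P j ⟶ P b) (β : P a ⟶ P j) (Y : C) (q : Q ⟶ Y), ¬ IsIso ρ →
      β ≫ ρ ≫ κ ≫ q = θ ≫ q → θ ≫ q ≠ 0 → IsIso β)
    {S T : C} [Simple S] [Simple T] (π : P a ⟶ S) [hπ : Epi π] (σ : P b ⟶ T) [hσ : Epi σ] :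
    ∃ (Y : C) (i : S ⟶ Y) (p : Y ⟶ T), IsSES i p ∧ ¬ IsSplitEpi p := by
  have hproj := hP.projective
  obtain ⟨Y, q, hq, hY, hmin⟩ := hP.exists_minimal_quotient Q (fun Y q => θ ≫ q ≠ 0) (by simpa)
  -- By minimality `θ ≫ q` dies in the cokernel of every non-zero `α`. So the image of `θ ≫ q` lies
  -- in every non-zero subobject of `Y`, and it is the simple socle.
  have hlift : ∀ {U : C} (α : U ⟶ Y), α ≠ 0 → ∃ β : P a ⟶ U, β ≫ α = θ ≫ q := by
    intro U α hα
    have h0 : (θ ≫ q) ≫ Limits.cokernel.π α = 0 := by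
      by_contra h0
      have := hmin _ (Limits.cokernel.π α) inferInstance (by simpa using h0)
      exact hα (by rw [← cancel_mono (Limits.cokernel.π α), Limits.cokernel.condition,
        Limits.zero_comp])
    have hex : (ShortComplex.mk α (Limits.cokernel.π α) (Limits.cokernel.condition α)).Exact :=
      ShortComplex.exact_cokernel α
    exact ⟨hex.liftFromProjective (θ ≫ q) h0, hex.liftFromProjective_comp _ _⟩
  let m := Limits.image.ι (θ ≫ q)
  let ε := Limits.factorThruImage (θ ≫ q)
  have hεm : ε ≫ m = θ ≫ q := Limits.image.fac _
  have hm0 : m ≠ 0 := fun h0 => hY (by rw [← hεm, h0, Limits.comp_zero])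
  have hS' : Simple (Limits.image (θ ≫ q)) := by
    refine ⟨fun {K} t _ => ⟨fun ht h0 => hm0 ?_, fun ht => ?_⟩⟩
    · rw [← cancel_epi t, h0, Limits.zero_comp, Limits.zero_comp]
    · obtain ⟨β, hβ⟩ := hlift (t ≫ m) (fun h0 => ht (by
        rw [← cancel_mono m, h0, Limits.zero_comp]))
      have h1 : β ≫ t = ε := by
        rw [← cancel_mono m, Category.assoc, hβ, hεm]
      have : Epi (β ≫ t) := by rw [h1]; infer_instance
      have := epi_of_epi β t
      exact isIso_of_mono_of_epi t
  let c := Limits.cokernel.π m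
  have hmc : m ≫ c = 0 := Limits.cokernel.condition m
  -- If `ρ ≫ κ ≫ q` is non-zero, then `θ ≫ q` factors through it by some `β`, which is invertible by
  -- hypothesis; so its image is the socle. Hence the quotient of `Y` by its socle is a simple top
  -- of `P b`.
  have hrad : ∀ j (ρ : P j ⟶ P b), ¬ IsIso ρ → ρ ≫ κ ≫ q ≫ c = 0 := by
    intro j ρ hρ
    by_cases h0 : ρ ≫ κ ≫ q = 0
    · have := congrArg (· ≫ c) h0
      simpa using this
    · obtain ⟨β, hβ⟩ := hlift _ h0
      have := h j ρ β Y q hρ hβ hY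
      rw [← cancel_epi β, Limits.comp_zero]
      have h1 := congrArg (· ≫ c) hβ
      simp only [Category.assoc] at h1
      have h2 : (ε ≫ m) ≫ c = 0 := by rw [Category.assoc, hmc, Limits.comp_zero]
      rw [h1, ← Category.assoc]
      exact (congrArg (· ≫ c) hεm.symm).trans h2
  have hPS : ∀ g : P b ⟶ Limits.image (θ ≫ q), g = 0 := fun g =>
    eq_zero_of_isEmpty_iso (hP.isLocalRing a) (hP.isLocalRing b) ε
      ⟨fun f => hab (hP.eq_of_iso _ _ f).symm⟩ g
  have hex : (ShortComplex.mk m c hmc).Exact := ShortComplex.exact_cokernel m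
  have hY0 : ¬ Limits.IsZero Y := fun h0 => hY (h0.eq_of_tgt _ _)
  have hκq : κ ≫ q ≠ 0 := fun h0 => hY0 (Limits.IsZero.of_epi_eq_zero (κ ≫ q) h0)
  have hc0 : κ ≫ q ≫ c ≠ 0 := by
    intro h0
    apply hκq
    have h1 : (κ ≫ q) ≫ c = 0 := by simpa using h0
    rw [← hex.liftFromProjective_comp (κ ≫ q) h1, hPS (hex.liftFromProjective (κ ≫ q) h1),
      Limits.zero_comp]
  have hT' : Simple (Limits.cokernel m) :=
    hP.simple_of_forall (κ ≫ q ≫ c) (fun h0 => hc0 (h0.eq_of_tgt _ _))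
      (fun j ρ hρ => hrad j ρ hρ)
  obtain ⟨f⟩ := nonempty_iso_of_simple (hP.isLocalRing a) π ε
  obtain ⟨g⟩ := nonempty_iso_of_simple (hP.isLocalRing b) (κ ≫ q ≫ c) σ
  refine ⟨Y, f.hom ≫ m, c ≫ g.hom, ⟨by
    rw [Category.assoc, ← Category.assoc m, hmc, Limits.zero_comp, Limits.comp_zero], ?_⟩, ?_⟩
  · have hse : (ShortComplex.mk m c hmc).ShortExact := { exact := hex }
    refine ShortComplex.shortExact_of_iso (ShortComplex.isoMk f.symm (Iso.refl Y) g ?_ ?_) hse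
    · simp
    · simp
  -- A section would give an endomorphism of `Y` that is the identity on the socle and has image in
  -- it. Precomposed with the epimorphism from `P b` it vanishes, as there is no non-zero morphism
  -- from `P b` to the socle.
  · intro hsplit
    let s := section_ (c ≫ g.hom)
    have hs : s ≫ c ≫ g.hom = 𝟙 T := IsSplitEpi.id _
    have h1 : (κ ≫ q ≫ (𝟙 Y - c ≫ g.hom ≫ s)) ≫ c = 0 := by
      have h2 : s ≫ c = g.inv := by
        rw [← cancel_mono g.hom, Category.assoc, hs, Iso.inv_hom_id]
      simp [Preadditive.comp_sub, Preadditive.sub_comp, h2]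
    have h2 : κ ≫ q ≫ (𝟙 Y - c ≫ g.hom ≫ s) = 0 := by
      rw [← hex.liftFromProjective_comp _ h1, hPS (hex.liftFromProjective _ h1), Limits.zero_comp]
    have h3 : 𝟙 Y - c ≫ g.hom ≫ s = 0 := by
      rw [← cancel_epi q, ← cancel_epi κ, h2, Limits.comp_zero, Limits.comp_zero]
    have h4 : m = m ≫ (𝟙 Y - c ≫ g.hom ≫ s) := by
      rw [Preadditive.comp_sub, ← Category.assoc m, hmc, Limits.zero_comp, sub_zero,
        Category.comp_id]
    exact hm0 (by rw [h4, h3, Limits.comp_zero])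

end Families

/-! ### The indecomposable projective objects of the ambient category. -/

section AmbientProjectives
variable {k : Type u} [Field k] {A : Type u} [Ring A] [Algebra k A] [FiniteDimensional k A]
  {V W : Type*} {E : V → W → Prop}

/-- The morphism `f ⊠ α` between projective objects of the abelianization. -/
def ambientHom {G G' : ProjCat k A} {x y : V ⊕ W} (f : G ⟶ G')
    (α : pathProj k E x ⟶ pathProj k E y) : ambientProj E G x ⟶ ambientProj E G' y :=
  (abelianizeFunctor _).map ((Mat_.embedding (TensorCat k (ProjCat k A) (PathProj k E))).map
    (TensorCat.mkHom ⟨G, pathProj k E x⟩ ⟨G', pathProj k E y⟩ f α))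

theorem ambientHom_comp {G G' G'' : ProjCat k A} {x y z : V ⊕ W} (f : G ⟶ G') (g : G' ⟶ G'')
    (α : pathProj k E x ⟶ pathProj k E y) (β : pathProj k E y ⟶ pathProj k E z) :
    ambientHom f α ≫ ambientHom g β = ambientHom (f ≫ g) (α ≫ β) := by
  rw [ambientHom, ambientHom, ambientHom]
  refine ((abelianizeFunctor _).map_comp _ _).symm.trans (congrArg _ ?_)
  refine ((Mat_.embedding (TensorCat k (ProjCat k A) (PathProj k E))).map_comp _ _).symm.trans
    (congrArg _ ?_)
  exact TensorCat.mkHom_comp _ _ _ _ _ _ _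

theorem ambientHom_id (G : ProjCat k A) (x : V ⊕ W) :
    ambientHom (𝟙 G) (𝟙 (pathProj k E x)) = 𝟙 (ambientProj E G x) := by
  rw [ambientHom]
  refine Eq.trans (congrArg _ ?_) ((abelianizeFunctor _).map_id _)
  exact (Mat_.embedding (TensorCat k (ProjCat k A) (PathProj k E))).map_id _

/-- `f ⊠ α`, as a bilinear map. -/
def ambientHomBilin (G G' : ProjCat k A) (x y : V ⊕ W) : (G ⟶ G') →ₗ[k]
    (pathProj k E x ⟶ pathProj k E y) →ₗ[k] (ambientProj E G x ⟶ ambientProj E G' y) :=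
  LinearMap.mk₂ k ambientHom
    (fun f f' α => by
      rw [ambientHom, ambientHom, ambientHom]
      refine Eq.trans (congrArg _ ?_) (abelianizeFunctor _).map_add
      refine Eq.trans (congrArg _ ?_)
        (Mat_.embedding (TensorCat k (ProjCat k A) (PathProj k E))).map_add
      exact TensorProduct.add_tmul f f' α)
    (fun r f α => by
      rw [ambientHom, ambientHom]
      refine Eq.trans (congrArg _ ?_) (CategoryTheory.Functor.map_smul (abelianizeFunctor
        (Mat_ (TensorCat k (ProjCat k A) (PathProj k E)))) r _)
      ext i j
      rfl)
    (fun f α α' => by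
      rw [ambientHom, ambientHom, ambientHom]
      refine Eq.trans (congrArg _ ?_) (abelianizeFunctor _).map_add
      refine Eq.trans (congrArg _ ?_)
        (Mat_.embedding (TensorCat k (ProjCat k A) (PathProj k E))).map_add
      exact TensorProduct.tmul_add f α α')
    (fun r f α => by
      rw [ambientHom, ambientHom]
      refine Eq.trans (congrArg _ ?_) (CategoryTheory.Functor.map_smul (abelianizeFunctor
        (Mat_ (TensorCat k (ProjCat k A) (PathProj k E)))) r _)
      ext i j
      exact TensorProduct.tmul_smul r f α)

theorem ambientHomBilin_apply {G G' : ProjCat k A} {x y : V ⊕ W} (f : G ⟶ G')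
    (α : pathProj k E x ⟶ pathProj k E y) : ambientHomBilin G G' x y f α = ambientHom f α := rfl

theorem ambientHom_ne_zero {G G' : ProjCat k A} {x y : V ⊕ W} {f : G ⟶ G'}
    {α : pathProj k E x ⟶ pathProj k E y} (hf : f ≠ 0) (hα : α ≠ 0) : ambientHom f α ≠ 0 :=
  fun h => by
    have h1 := (abelianizeFunctor _).map_injective (h.trans
      (Functor.map_zero (abelianizeFunctor (Inflated k A E)) _ _).symm)
    have h2 := (Mat_.embedding (TensorCat k (ProjCat k A) (PathProj k E))).map_injective
      (h1.trans (Functor.map_zero _ _ _).symm)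
    exact TensorCat.mkHom_ne_zero hf hα h2

theorem ambientHom_induction {G G' : ProjCat k A} {x y : V ⊕ W}
    {p : (ambientProj E G x ⟶ ambientProj E G' y) → Prop} (h0 : p 0)
    (h1 : ∀ f α, p (ambientHom f α)) (h2 : ∀ a b, p a → p b → p (a + b))
    (g : ambientProj E G x ⟶ ambientProj E G' y) : p g := by
  obtain ⟨g, rfl⟩ := (abelianizeFunctor _).map_surjective g
  obtain ⟨g, rfl⟩ := (Mat_.embedding (TensorCat k (ProjCat k A) (PathProj k E))).map_surjective g
  induction g using TensorCat.hom_induction with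
  | h0 =>
    refine Eq.subst ?_ h0
    refine (Eq.trans (congrArg _ ?_) ((abelianizeFunctor _).map_zero _ _)).symm
    exact (Mat_.embedding (TensorCat k (ProjCat k A) (PathProj k E))).map_zero _ _
  | h1 a b => exact h1 a b
  | h2 a b ha hb =>
    refine Eq.subst ?_ (h2 _ _ ha hb)
    refine ((abelianizeFunctor _).map_add).symm.trans (congrArg _ ?_)
    exact ((Mat_.embedding (TensorCat k (ProjCat k A) (PathProj k E))).map_add).symm

/-- As Hom(P_x, P_y) is spanned by `α`, every morphism is a pure tensor with second factor `α`. -/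
theorem exists_ambientHom_eq {G G' : ProjCat k A} {x y : V ⊕ W}
    {α : pathProj k E x ⟶ pathProj k E y} (hα : α ≠ 0)
    (g : ambientProj E G x ⟶ ambientProj E G' y) : ∃ f : G ⟶ G', g = ambientHom f α := by
  induction g using ambientHom_induction with
  | h0 => exact ⟨0, (LinearMap.map_zero₂ (ambientHomBilin G G' x y) α).symm⟩
  | h1 f β =>
    obtain ⟨c, rfl⟩ := exists_eq_smul_of_ne_zero hα β
    refine ⟨c • f, ?_⟩
    rw [← ambientHomBilin_apply, ← ambientHomBilin_apply, map_smul, LinearMap.map_smul₂]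
  | h2 a b ha hb =>
    obtain ⟨f, rfl⟩ := ha
    obtain ⟨g, rfl⟩ := hb
    exact ⟨f + g, (LinearMap.map_add₂ (ambientHomBilin G G' x y) f g α).symm⟩

theorem exists_hom_ne_zero_of_ne_zero {G G' : ProjCat k A} {x y : V ⊕ W}
    {g : ambientProj E G x ⟶ ambientProj E G' y} (hg : g ≠ 0) :
    ∃ α : pathProj k E x ⟶ pathProj k E y, α ≠ 0 := by
  by_contra hcon
  push Not at hcon
  refine hg (ambientHom_induction (p := (· = 0)) rfl (fun f α => ?_) (fun a b ha hb => ?_) g)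
  · rw [hcon α, ← ambientHomBilin_apply, map_zero]
  · rw [ha, hb, add_zero]

variable (E) in
/-- The functor `G ↦ G ⊠ P_x`. -/
def ambientFunctor (x : V ⊕ W) : ProjCat k A ⥤ Ambient k A E where
  obj G := ambientProj E G x
  map f := ambientHom f (𝟙 _)
  map_id G := ambientHom_id G x
  map_comp f g := by rw [ambientHom_comp, Category.comp_id]

instance (x : V ⊕ W) : (ambientFunctor (k := k) (A := A) E x).Additive where
  map_add {G G' f g} := LinearMap.map_add₂ (ambientHomBilin G G' x x) f g (𝟙 _)

variable (k A E) in
/-- The functor `G ↦ G ⊠ P_x` is fully faithful. -/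
def ambientFunctorFullyFaithful (x : V ⊕ W) :
    (ambientFunctor (k := k) (A := A) E x).FullyFaithful := by
  have hfaith : (ambientFunctor (k := k) (A := A) E x).Faithful := ⟨fun {G G' f g} h => by
    by_contra hne
    refine ambientHom_ne_zero (sub_ne_zero.2 hne) (pathProj_id_ne_zero k E x) ?_
    rw [← ambientHomBilin_apply, LinearMap.map_sub₂]
    exact sub_eq_zero.2 h⟩
  have hfull : (ambientFunctor (k := k) (A := A) E x).Full := ⟨fun {G G'} g => by
    obtain ⟨f, hf⟩ := exists_ambientHom_eq (pathProj_id_ne_zero k E x) g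
    exact ⟨f, hf.symm⟩⟩
  exact Functor.FullyFaithful.ofFullyFaithful _

/-- An isomorphism gives non-zero morphisms between P_x and P_y in both directions, but the quiver
has no oriented cycles. -/
theorem eq_of_ambientProj_iso {G G' : ProjCat k A} {x y : V ⊕ W} (hG : 𝟙 G ≠ 0)
    (f : ambientProj E G x ≅ ambientProj E G' y) : x = y := by
  have h0 : 𝟙 (ambientProj E G x) ≠ 0 := by
    rw [← ambientHom_id]
    exact ambientHom_ne_zero hG (pathProj_id_ne_zero k E x)
  have h1 : f.hom ≠ 0 := fun h => h0 (by rw [← f.hom_inv_id, h, Limits.zero_comp])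
  have h2 : f.inv ≠ 0 := fun h => h0 (by rw [← f.hom_inv_id, h, Limits.comp_zero])
  obtain ⟨α, hα⟩ := exists_hom_ne_zero_of_ne_zero h1
  obtain ⟨β, hβ⟩ := exists_hom_ne_zero_of_ne_zero h2
  rcases eq_or_of_hom_ne_zero hα with h | ⟨v, w, -, rfl, rfl⟩
  · exact h
  · rcases eq_or_of_hom_ne_zero hβ with h | ⟨v, w, -, h, -⟩
    · exact h.symm
    · exact absurd h Sum.inl_ne_inr

theorem isLocalRing_end_ambientProj {G : ProjCat k A} (hG : IsLocalRing (End G)) (x : V ⊕ W) :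
    IsLocalRing (End (ambientProj E G x)) :=
  isLocalRing_end_of_fullyFaithful (ambientFunctor E x) (ambientFunctorFullyFaithful k A E x) hG

theorem isZero_of_forall_ambientProj {S : ObjectProperty (ProjCat k A)} (hS : ∀ F, addClosure S F)
    {X : Ambient k A E} (h : ∀ G x (f : ambientProj E G x ⟶ X), S G → f = 0) :
    Limits.IsZero X := by
  obtain ⟨ι, _, Y, p, q, hY, hpq⟩ := addClosure_inflatedObj hS X.as.right
  have h1 : ∑ s, (abelianizeFunctor _).map (p s) ≫ (abelianizeFunctor _).map (q s) = 𝟙 _ := by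
    rw [← CategoryTheory.Functor.map_id, ← hpq, Functor.map_sum]; simp only [Functor.map_comp]
  have h2 : cover X = 0 := by
    rw [← Category.id_comp (cover X), ← h1, Preadditive.sum_comp]
    refine Finset.sum_eq_zero fun s _ => ?_
    obtain ⟨G, x, hG, hs⟩ := hY s
    have h3 : (abelianizeFunctor _).map (q s) ≫ cover X = 0 := by
      generalize (abelianizeFunctor _).map (q s) ≫ cover X = g
      revert g
      rw [hs]
      exact fun g => h G x g hG
    rw [Category.assoc, h3, Limits.comp_zero]
  exact Limits.IsZero.of_epi_eq_zero _ h2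

variable [Finite V] [Finite W]

instance (G : ProjCat k A) (x : V ⊕ W) : Projective (ambientProj E G x) := by
  obtain ⟨P, hP⟩ := exists_isAddGenerator k A E
  exact projective_abelianize hP k (Inflated.finite_hom k A E) (inflatedObj G x)

variable {n : ℕ} {e : Fin n → A} (he : IsBasicDecomposition e)

/-- The indecomposable `1`-morphisms. -/
def indMor : Option (Fin n × Fin n) → ProjCat k A
  | none => ProjCat.one k A
  | some (i, j) => projMor k he i j

variable (E) in
/-- The indecomposable projective objects. -/
def indProj (s : Option (Fin n × Fin n) × (V ⊕ W)) : Ambient k A E :=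
  ambientProj E (indMor he s.1) s.2

theorem isLocalRing_end_indMor [IsAlgClosed k] (hconn : IsConnectedAlgebra A)
    (s : Option (Fin n × Fin n)) : IsLocalRing (End (indMor (k := k) he s)) := by
  rcases s with _ | ⟨i, j⟩
  · exact isLocalRing_end_one hconn
  · exact isLocalRing_end_projMor he i j

theorem indMor_eq_of_iso [IsAlgClosed k] (hconn : IsConnectedAlgebra A) (hns : ¬ IsSimpleRing A)
    {s t : Option (Fin n × Fin n)} (f : indMor (k := k) he s ≅ indMor he t) : s = t := by
  rcases s with _ | ⟨i, j⟩ <;> rcases t with _ | ⟨a, b⟩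
  · rfl
  · exact ((isEmpty_one_iso_projMor he hconn hns a b).false f).elim
  · exact ((isEmpty_one_iso_projMor he hconn hns i j).false f.symm).elim
  · obtain ⟨rfl, rfl⟩ := eq_of_projMor_iso he f
    rfl

-- Connectedness makes 𝟙 local, and together with non-simplicity it separates 𝟙 from the F_{ij}.
-- Full faithfulness of G ↦ G ⊠ P_x carries these facts to the ambient category.
variable (E) in
theorem isProjectiveFamily_indProj [IsAlgClosed k] (hconn : IsConnectedAlgebra A)
    (hns : ¬ IsSimpleRing A) : IsProjectiveFamily k (indProj (k := k) E he) where
  finite_hom := Ambient.finite_hom k A E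
  projective _ := inferInstanceAs (Projective (ambientProj _ _ _))
  isLocalRing s := isLocalRing_end_ambientProj (isLocalRing_end_indMor he hconn s.1) s.2
  isZero X h := isZero_of_forall_ambientProj (addClosure_projMor he) (fun G x f hG => by
    rcases hG with rfl | ⟨i, j, rfl⟩
    · exact h (none, x) f
    · exact h (some (i, j), x) f)
  eq_of_iso := by
    rintro ⟨s, x⟩ ⟨t, y⟩ f
    have h1 := isLocalRing_end_indMor (k := k) he hconn s
    obtain rfl : x = y := eq_of_ambientProj_iso (isLocalRing_end_iff.1 h1).1 f
    obtain rfl : s = t :=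
      indMor_eq_of_iso he hconn hns ((ambientFunctorFullyFaithful k A E x).preimageIso f)
    rfl

end AmbientProjectives

/-! ### Adjoint 1-morphisms act by adjoint functors. -/

section Adjunction
variable {k : Type u} [Field k] {A : Type u} [Ring A] [Algebra k A] [FiniteDimensional k A]

theorem id_comp_comp_id_eq_iff {C : Type*} [Category* C] {X Y : C} {f : X ⟶ Y} {g : Y ⟶ X}
    {i : X ⟶ X} (hi : i = 𝟙 X) : (𝟙 X ≫ f) ≫ g ≫ i = 𝟙 X ↔ f ≫ g = 𝟙 X := by
  rw [hi, Category.id_comp, Category.comp_id]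

theorem comp_id_id_comp_eq_iff {C : Type*} [Category* C] {X Y : C} {f : X ⟶ Y} {g : Y ⟶ X}
    {i j : Y ⟶ Y} (hi : i = 𝟙 Y) (hj : j = 𝟙 Y) : (f ≫ i) ≫ j ≫ g = 𝟙 X ↔ f ≫ g = 𝟙 X := by
  rw [hi, hj, Category.id_comp, Category.comp_id]

theorem comp_heq {C : Type*} [Category* C] {X Y Z X' Y₁ Z' : C} {f : X ⟶ Y} {g : Y ⟶ Z}
    {f' : X' ⟶ Y₁} {g' : Y₁ ⟶ Z'} (hX : X = X') (hY : Y = Y₁) (hZ : Z = Z') (hf : HEq f f')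
    (hg : HEq g g') : HEq (f ≫ g) (f' ≫ g') := by
  subst hX hY hZ
  rw [eq_of_heq hf, eq_of_heq hg]

theorem LinEnd.hcomp_heq {M : Type*} [Category* M] [Preadditive M] [Linear k M]
    {F F' G G' F₁ F₁' G₁ G₁' : LinEnd k M} {α : F ⟶ F'} {β : G ⟶ G'} {α₁ : F₁ ⟶ F₁'} {β₁ : G₁ ⟶ G₁'}
    (h1 : F = F₁) (h2 : F' = F₁') (h3 : G = G₁) (h4 : G' = G₁') (hα : HEq α α₁) (hβ : HEq β β₁) :
    HEq (hcomp α β) (hcomp α₁ β₁) := by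
  subst h1 h2 h3 h4
  rw [eq_of_heq hα, eq_of_heq hβ]

variable {M : Type*} [Category* M] [Preadditive M] [Linear k M] (ρ : TwoRep k A M)

/-- An adjoint pair of `1`-morphisms acts by adjoint functors. -/
theorem AdjointPair.nonempty_adjunction {F G : ProjCat k A} (p : AdjointPair F G) :
    Nonempty ((ρ.act.obj F).obj ⊣ (ρ.act.obj G).obj) := by
  -- Strictness provides equalities of functors that need not be definitional. The images of unit
  -- and counit are therefore retyped up to `HEq` before the triangle identities are transported.
  obtain ⟨u, hu⟩ : ∃ u : LinEnd.one k M ⟶ (ρ.act.obj G).comp (ρ.act.obj F),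
      HEq (ρ.act.map p.unit) u := by
    rw [← ρ.act_one, ← ρ.act_comp]
    exact ⟨_, HEq.rfl⟩
  obtain ⟨c, hc⟩ : ∃ c : (ρ.act.obj F).comp (ρ.act.obj G) ⟶ LinEnd.one k M,
      HEq (ρ.act.map p.counit) c := by
    rw [← ρ.act_one, ← ρ.act_comp]
    exact ⟨_, HEq.rfl⟩
  have hid : ∀ H : ProjCat k A, HEq (ρ.act.map (𝟙 H)) (𝟙 (ρ.act.obj H)) := fun H =>
    heq_of_eq (ρ.act.map_id H)
  have l1 : HEq (ρ.act.map (ProjCat.hcomp (𝟙 F) p.unit)) (LinEnd.hcomp (𝟙 (ρ.act.obj F)) u) :=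
    (ρ.act_hcomp _ _).trans (LinEnd.hcomp_heq rfl rfl ρ.act_one (ρ.act_comp _ _) (hid F) hu)
  have l2 : HEq (ρ.act.map (ProjCat.hcomp p.counit (𝟙 F))) (LinEnd.hcomp c (𝟙 (ρ.act.obj F))) :=
    (ρ.act_hcomp _ _).trans (LinEnd.hcomp_heq (ρ.act_comp _ _) ρ.act_one rfl rfl hc (hid F))
  have l3 : (show F ⟶ F.comp (G.comp F) from ProjCat.hcomp (𝟙 F) p.unit) ≫
      (show F.comp (G.comp F) ⟶ F from ProjCat.hcomp p.counit (𝟙 F)) = 𝟙 F := by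
    refine ObjectProperty.hom_ext _ (NatTrans.ext (funext fun N => ?_))
    exact (id_comp_comp_id_eq_iff (f := F.obj.map (p.unit.hom.app N)) rfl).2 (p.left_triangle N)
  have r1 : HEq (ρ.act.map (ProjCat.hcomp p.unit (𝟙 G))) (LinEnd.hcomp u (𝟙 (ρ.act.obj G))) :=
    (ρ.act_hcomp _ _).trans (LinEnd.hcomp_heq ρ.act_one (ρ.act_comp _ _) rfl rfl hu (hid G))
  have r2 : HEq (ρ.act.map (ProjCat.hcomp (𝟙 G) p.counit)) (LinEnd.hcomp (𝟙 (ρ.act.obj G)) c) :=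
    (ρ.act_hcomp _ _).trans (LinEnd.hcomp_heq rfl rfl (ρ.act_comp _ _) ρ.act_one (hid G) hc)
  have r3 : (show G ⟶ (G.comp F).comp G from ProjCat.hcomp p.unit (𝟙 G)) ≫
      (show (G.comp F).comp G ⟶ G from ProjCat.hcomp (𝟙 G) p.counit) = 𝟙 G := by
    refine ObjectProperty.hom_ext _ (NatTrans.ext (funext fun N => ?_))
    exact (comp_id_id_comp_eq_iff (f := p.unit.hom.app (G.obj.obj N))
      ((congrArg G.obj.map (F.obj.map_id _)).trans (G.obj.map_id _)) rfl).2 (p.right_triangle N)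
  have hl : (show ρ.act.obj F ⟶ (ρ.act.obj F).comp ((ρ.act.obj G).comp (ρ.act.obj F)) from
      LinEnd.hcomp (𝟙 (ρ.act.obj F)) u) ≫
      (show (ρ.act.obj F).comp ((ρ.act.obj G).comp (ρ.act.obj F)) ⟶ ρ.act.obj F from
        LinEnd.hcomp c (𝟙 (ρ.act.obj F))) = 𝟙 _ := by
    refine eq_of_heq ((comp_heq rfl ?_ rfl l1 l2).symm.trans ?_)
    · exact (ρ.act_comp _ _).trans (congrArg _ (ρ.act_comp _ _))
    · refine heq_of_eq (Eq.trans ?_ ((congrArg ρ.act.map l3).trans (ρ.act.map_id F)))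
      exact (ρ.act.map_comp _ _).symm
  have hr : (show ρ.act.obj G ⟶ ((ρ.act.obj G).comp (ρ.act.obj F)).comp (ρ.act.obj G) from
      LinEnd.hcomp u (𝟙 (ρ.act.obj G))) ≫
      (show ((ρ.act.obj G).comp (ρ.act.obj F)).comp (ρ.act.obj G) ⟶ ρ.act.obj G from
        LinEnd.hcomp (𝟙 (ρ.act.obj G)) c) = 𝟙 _ := by
    refine eq_of_heq ((comp_heq rfl ?_ rfl r1 r2).symm.trans ?_)
    · exact (ρ.act_comp _ _).trans (congrArg (LinEnd.comp · _) (ρ.act_comp _ _))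
    · refine heq_of_eq (Eq.trans ?_ ((congrArg ρ.act.map r3).trans (ρ.act.map_id G)))
      exact (ρ.act.map_comp _ _).symm
  refine ⟨⟨u.hom, c.hom, fun X => ?_, fun Y => ?_⟩⟩
  · exact (id_comp_comp_id_eq_iff (f := (ρ.act.obj F).obj.map (u.hom.app X)) rfl).1
      (congrArg (fun f => f.hom.app X) hl)
  · exact (comp_id_id_comp_eq_iff (f := u.hom.app ((ρ.act.obj G).obj.obj Y))
      ((congrArg (ρ.act.obj G).obj.map ((ρ.act.obj F).obj.map_id _)).trans
        ((ρ.act.obj G).obj.map_id _)) rfl).1 (congrArg (fun f => f.hom.app Y) hr)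

end Adjunction

/-! ### The action on the projective objects G ⊠ P_x. -/

section Action
variable {k : Type u} [Field k] {A : Type u} [Ring A] [Algebra k A] [FiniteDimensional k A]

section Abelianization
variable {D : Type*} [Category* D] [Preadditive D] [Linear k D] (ρ : TwoRep k A D)

/-- The componentwise action on the objects of `D`. -/
def abelianizationArrowIso (F : ProjCat k A) (d : D) :
    Arrow.mk ((ρ.act.obj F).obj.map (0 : d ⟶ d)) ≅ Arrow.mk (0 : ρ.app F d ⟶ ρ.app F d) :=
  Arrow.isoMk (Iso.refl _) (Iso.refl _)
    ((Category.id_comp _).trans (((ρ.act.obj F).obj.map_zero d d).symm.trans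
      (Category.comp_id _).symm))

/-- The abelianization extends the given action. -/
def abelianizationIso (F : ProjCat k A) (d : D) :
    ρ.abelianization.app F (abelianize d) ≅ abelianize (ρ.app F d) :=
  (CategoryTheory.Quotient.functor (homotopic D)).mapIso (abelianizationArrowIso ρ F d)

theorem abelianizationIso_hom_natural (F : ProjCat k A) {d d' : D} (f : d ⟶ d') :
    (ρ.abelianization.act.obj F).obj.map (X := abelianize d) (Y := abelianize d')
        ((abelianizeFunctor D).map f) ≫ (abelianizationIso ρ F d').hom =
      (abelianizationIso ρ F d).hom ≫ (abelianizeFunctor D).map ((ρ.act.obj F).obj.map f) := by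
  have h : (ρ.act.obj F).obj.map f ≫ 𝟙 _ = 𝟙 _ ≫ (ρ.act.obj F).obj.map f := by simp
  refine ((CategoryTheory.Quotient.functor (homotopic D)).map_comp _ _).symm.trans
    (Eq.trans (congrArg _ ?_) ((CategoryTheory.Quotient.functor (homotopic D)).map_comp _ _))
  exact Arrow.hom_ext _ _ h h

theorem abelianizationIso_hom_natural' {F F' : ProjCat k A} (φ : F ⟶ F') (d : D) :
    (ρ.abelianization.act.map φ).hom.app (abelianize d) ≫ (abelianizationIso ρ F' d).hom =
      (abelianizationIso ρ F d).hom ≫ (abelianizeFunctor D).map ((ρ.act.map φ).hom.app d) := by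
  have h : (ρ.act.map φ).hom.app d ≫ 𝟙 _ = 𝟙 _ ≫ (ρ.act.map φ).hom.app d := by simp
  refine ((CategoryTheory.Quotient.functor (homotopic D)).map_comp _ _).symm.trans
    (Eq.trans (congrArg _ ?_) ((CategoryTheory.Quotient.functor (homotopic D)).map_comp _ _))
  exact Arrow.hom_ext _ _ h h

end Abelianization

section Inflation
variable {C D : Type*} [Category* C] [Preadditive C] [Linear k C] [Category* D] [Preadditive D]
  [Linear k D] (ρ : TwoRep k A C)

theorem inflation_map (F : ProjCat k A) {X Y : C} {P Q : D} (f : X ⟶ Y) (g : P ⟶ Q) :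
    ((ρ.inflation D).act.obj F).obj.map ((Mat_.embedding (TensorCat k C D)).map
      (TensorCat.mkHom ⟨X, P⟩ ⟨Y, Q⟩ f g)) = (Mat_.embedding (TensorCat k C D)).map
      (TensorCat.mkHom ⟨ρ.app F X, P⟩ ⟨ρ.app F Y, Q⟩ ((ρ.act.obj F).obj.map f) g) := rfl

theorem inflation_app {F F' : ProjCat k A} (φ : F ⟶ F') (X : C) (P : D) :
    ((ρ.inflation D).act.map φ).hom.app ((Mat_.embedding (TensorCat k C D)).obj ⟨X, P⟩) =
      (Mat_.embedding (TensorCat k C D)).map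
        (TensorCat.mkHom ⟨ρ.app F X, P⟩ ⟨ρ.app F' X, P⟩ ((ρ.act.map φ).hom.app X) (𝟙 P)) := by
  ext i j
  have h : (𝟙 ((Mat_.embedding (TensorCat k C D)).obj ⟨X, P⟩) :
      (Mat_.embedding (TensorCat k C D)).obj ⟨X, P⟩ ⟶ _) i j = 𝟙 _ := Mat_.id_apply_self _ _
  refine Eq.trans (congrArg (((tensorLift k C D).obj (ρ.act.obj F)).obj.map · ≫ _) h) ?_
  refine Eq.trans (congrArg (· ≫ _) (CategoryTheory.Functor.map_id _ _)) (Category.id_comp _)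

theorem abelianize_inflation_app {F F' : ProjCat k A} (φ : F ⟶ F') (X : C) (P : D) :
    (abelianizeFunctor (Mat_ (TensorCat k C D))).map (((ρ.inflation D).act.map φ).hom.app
      ((Mat_.embedding (TensorCat k C D)).obj ⟨X, P⟩)) =
      (abelianizeFunctor (Mat_ (TensorCat k C D))).map ((Mat_.embedding (TensorCat k C D)).map
        (TensorCat.mkHom ⟨ρ.app F X, P⟩ ⟨ρ.app F' X, P⟩ ((ρ.act.map φ).hom.app X) (𝟙 P))) :=
  congrArg _ (inflation_app ρ φ X P)

end Inflation

variable {V W : Type*} {E : V → W → Prop}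

variable (E) in
/-- `F (G ⊠ P_x) ≅ (F ∘ G) ⊠ P_x`. -/
def actProjIso (F G : ProjCat k A) (x : V ⊕ W) :
    (ambient k A E).app F (ambientProj E G x) ≅ ambientProj E (F.comp G) x :=
  abelianizationIso (inflatedPrincipal k A E) F (inflatedObj G x)

theorem principal_map (F : ProjCat k A) {G G' : ProjCat k A} (f : G ⟶ G') :
    ((TwoRep.principal k A).act.obj F).obj.map f = ProjCat.hcomp (𝟙 F) f :=
  ObjectProperty.hom_ext _ (NatTrans.ext (funext fun _ => (Category.id_comp _).symm))

theorem principal_app {F F' : ProjCat k A} (φ : F ⟶ F') (G : ProjCat k A) :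
    ((TwoRep.principal k A).act.map φ).hom.app G = ProjCat.hcomp φ (𝟙 G) :=
  ObjectProperty.hom_ext _ (NatTrans.ext (funext fun _ =>
    (Eq.trans (congrArg (_ ≫ ·) (F'.obj.map_id _)) (Category.comp_id _)).symm))

theorem actProjIso_hom_natural (F : ProjCat k A) {G G' : ProjCat k A} (f : G ⟶ G') (x : V ⊕ W) :
    ((ambient k A E).act.obj F).obj.map (ambientHom f (𝟙 (pathProj k E x))) ≫
      (actProjIso E F G' x).hom =
      (actProjIso E F G x).hom ≫ ambientHom (ProjCat.hcomp (𝟙 F) f) (𝟙 (pathProj k E x)) := by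
  have h := abelianizationIso_hom_natural ((TwoRep.principal k A).inflation (PathProj k E)) F
    ((Mat_.embedding (TensorCat k (ProjCat k A) (PathProj k E))).map
      (TensorCat.mkHom ⟨G, pathProj k E x⟩ ⟨G', pathProj k E x⟩ f (𝟙 (pathProj k E x))))
  rw [inflation_map, principal_map] at h
  refine Eq.trans (Eq.trans ?_ h) ?_
  · unfold actProjIso ambientHom ambient inflatedPrincipal ambientProj inflatedObj
    refine congr (congrArg _ ?_) ?_
    · with_reducible rfl
    · with_reducible rfl
  · refine congr (congrArg _ ?_) ?_
    · unfold actProjIso inflatedPrincipal inflatedObj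
      with_reducible rfl
    · change ambientHom (G := (TwoRep.principal k A).app F G)
        (G' := (TwoRep.principal k A).app F G') (ProjCat.hcomp (𝟙 F) f) (𝟙 (pathProj k E x)) = _
      rfl

theorem actProjIso_hom_natural' {F F' : ProjCat k A} (φ : F ⟶ F') (G : ProjCat k A) (x : V ⊕ W) :
    ((ambient k A E).act.map φ).hom.app (ambientProj E G x) ≫ (actProjIso E F' G x).hom =
      (actProjIso E F G x).hom ≫ ambientHom (ProjCat.hcomp φ (𝟙 G)) (𝟙 (pathProj k E x)) := by
  have h := abelianizationIso_hom_natural' ((TwoRep.principal k A).inflation (PathProj k E)) φ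
    ((Mat_.embedding (TensorCat k (ProjCat k A) (PathProj k E))).obj ⟨G, pathProj k E x⟩)
  refine Eq.trans (Eq.trans ?_ h) ?_
  · unfold actProjIso ambient inflatedPrincipal ambientProj inflatedObj
    refine congr (congrArg _ ?_) ?_
    · with_reducible rfl
    · with_reducible rfl
  · refine congr (congrArg _ ?_) ?_
    · unfold actProjIso inflatedPrincipal inflatedObj
      with_reducible rfl
    · have h1 := abelianize_inflation_app (TwoRep.principal k A) φ G (pathProj k E x)
      rw [h1]
      change ambientHom (G := (TwoRep.principal k A).app F G)
        (G' := (TwoRep.principal k A).app F' G)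
        (((TwoRep.principal k A).act.map φ).hom.app G) (𝟙 (pathProj k E x)) = _
      rw [principal_app]
      rfl

end Action

/-! ### Adjunction and exactness for the action of the F_{ij}. -/

section ActionOnTops
variable {k : Type u} [Field k] {A : Type u} [Ring A] [Algebra k A] [FiniteDimensional k A]
  {V W : Type*} {E : V → W → Prop} {n : ℕ} {e : Fin n → A} (he : IsBasicDecomposition e)

theorem addClosure_projMor_comp_left (a b : Fin n) (G : ProjCat k A) :
    addClosure (fun H => ∃ d, H = projMor k he a d) ((projMor k he a b).comp G) := by
  refine addClosure_map ((TwoRep.principal k A).act.obj (projMor k he a b)).obj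
    (S := fun G => G = ProjCat.one k A ∨ ∃ i j, G = projMor k he i j) ?_ (addClosure_projMor he G)
  rintro _ (rfl | ⟨i, j, rfl⟩)
  · exact le_addClosure _ ⟨b, rfl⟩
  · exact addClosure_mono (fun X hX => le_addClosure _ ⟨j, hX⟩)
      (addClosure_projMor_comp he a b i j)

theorem eq_zero_of_addClosure {S : ObjectProperty (ProjCat k A)} {G : ProjCat k A}
    (hG : addClosure S G) {x : V ⊕ W} {X : Ambient k A E}
    (h : ∀ H, S H → ∀ f : ambientProj E H x ⟶ X, f = 0) (f : ambientProj E G x ⟶ X) : f = 0 := by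
  obtain ⟨ι, _, Y, p, q, hY, hpq⟩ := hG
  have h1 : ∑ s, ambientHom (p s) (𝟙 (pathProj k E x)) ≫ ambientHom (q s) (𝟙 _) =
      𝟙 (ambientProj E G x) := by
    rw [← ambientHom_id, ← hpq]
    refine Eq.trans (Finset.sum_congr rfl fun s _ => ?_)
      (Functor.map_sum (ambientFunctor E x) (fun s => p s ≫ q s) Finset.univ).symm
    exact ((ambientFunctor E x).map_comp (p s) (q s)).symm
  rw [← Category.id_comp f, ← h1, Preadditive.sum_comp]
  exact Finset.sum_eq_zero fun s _ => by
    rw [Category.assoc, h (Y s) (hY s) (ambientHom (q s) (𝟙 _) ≫ f), Limits.comp_zero]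

variable {he}

/-- The injection `Hom(G ⊠ P_x, H X) → Hom((F ∘ G) ⊠ P_x, X)` for a left adjoint `F` of `H`. -/
theorem AdjointPair.exists_linearEquiv {F H : ProjCat k A} (p : AdjointPair F H) (G : ProjCat k A)
    (x : V ⊕ W) (X : Ambient k A E) :
    Nonempty ((ambientProj E G x ⟶ (ambient k A E).app H X) ≃ₗ[k]
      (ambientProj E (F.comp G) x ⟶ X)) := by
  obtain ⟨adj⟩ := p.nonempty_adjunction (ambient k A E)
  let φ : (ambientProj E G x ⟶ (ambient k A E).app H X) →ₗ[k]
      ((ambient k A E).app F (ambientProj E G x) ⟶ X) :=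
    (Linear.rightComp k _ (adj.counit.app X)).comp
      (((ambient k A E).act.obj F).obj.mapLinearMap k)
  have hφ : ∀ f, φ f = (adj.homEquiv _ _).symm f := fun f => by
    rw [Adjunction.homEquiv_counit]; rfl
  have hbij : Function.Bijective φ := by
    rw [show (φ : _ → _) = (adj.homEquiv _ _).symm from funext hφ]
    exact Equiv.bijective _
  exact ⟨(LinearEquiv.ofBijective φ hbij).trans
    (Linear.homCongr k (actProjIso E F G x) (Iso.refl X))⟩

variable (he)

/-- Conditions under which `F_{ij}` kills an object. -/
theorem isZero_app_projMor {ν : Equiv.Perm (Fin n)} (hd : ∀ i, Nonempty (DualBases k e ν i))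
    (i j : Fin n) {X : Ambient k A E}
    (h : ∀ d x (f : ambientProj E (projMor k he j d) x ⟶ X), f = 0) :
    Limits.IsZero ((ambient k A E).app (projMor k he i j) X) := by
  obtain ⟨d⟩ := hd i
  refine isZero_of_forall_ambientProj (S := fun _ => True) (fun F => le_addClosure _ trivial)
    fun G x f _ => ?_
  -- The left adjoint of F_{ij} is F_{jν(i)}, and F_{jν(i)}G is a sum of summands of 1-morphisms
  -- F_{jd}. So only morphisms from the F_{jd} ⊠ P_x to `X` matter.
  obtain ⟨φ⟩ := (d.adjointPair he j).exists_linearEquiv G x X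
  rw [← map_eq_zero_iff φ φ.injective]
  exact eq_zero_of_addClosure (addClosure_projMor_comp_left he j (ν i) G) (by
    rintro _ ⟨d, rfl⟩; exact h d x) _

variable {ν : Equiv.Perm (Fin n)}

/-- Since `ν` is surjective, `j` has the form `ν i'`, and F_{iν(i')} is left adjoint to F_{i'i}. So
each F_{ij} is both a left and a right adjoint, hence exact. -/
theorem isLeftAdjoint_app_projMor (hd : ∀ i, Nonempty (DualBases k e ν i)) (i j : Fin n) :
    ((ambient k A E).act.obj (projMor k he i j)).obj.IsLeftAdjoint := by
  obtain ⟨d⟩ := hd (ν.symm j)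
  obtain ⟨adj⟩ := (d.adjointPair he i).nonempty_adjunction (ambient k A E)
  rw [Equiv.apply_symm_apply] at adj
  exact ⟨_, ⟨adj⟩⟩

theorem isRightAdjoint_app_projMor (hd : ∀ i, Nonempty (DualBases k e ν i)) (i j : Fin n) :
    ((ambient k A E).act.obj (projMor k he i j)).obj.IsRightAdjoint := by
  obtain ⟨d⟩ := hd i
  obtain ⟨adj⟩ := (d.adjointPair he j).nonempty_adjunction (ambient k A E)
  exact ⟨_, ⟨adj⟩⟩

theorem shortExact_app_projMor (hd : ∀ i, Nonempty (DualBases k e ν i)) (i j : Fin n)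
    {S : ShortComplex (Ambient k A E)} (hS : S.ShortExact) :
    (S.map ((ambient k A E).act.obj (projMor k he i j)).obj).ShortExact := by
  have h1 := isLeftAdjoint_app_projMor (E := E) he hd i j
  have h2 := isRightAdjoint_app_projMor (E := E) he hd i j
  have h3 : Limits.PreservesColimitsOfSize.{0, 0}
      ((ambient k A E).act.obj (projMor k he i j)).obj := inferInstance
  have h4 : Limits.PreservesLimitsOfSize.{0, 0}
      ((ambient k A E).act.obj (projMor k he i j)).obj := inferInstance
  exact hS.map_of_exact _

end ActionOnTops

/-! ### F_{ji}L as a quotient of a local projective. -/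

section TopMap
variable {k : Type u} [Field k] {A : Type u} [Ring A] [Algebra k A] [FiniteDimensional k A]
  {V W : Type*} {E : V → W → Prop} {n : ℕ} {e : Fin n → A} (he : IsBasicDecomposition e)

theorem actProjIso_inv_natural (F : ProjCat k A) {G G' : ProjCat k A} (f : G ⟶ G') (x : V ⊕ W) :
    ambientHom (ProjCat.hcomp (𝟙 F) f) (𝟙 (pathProj k E x)) ≫ (actProjIso E F G' x).inv =
      (actProjIso E F G x).inv ≫
        ((ambient k A E).act.obj F).obj.map (ambientHom f (𝟙 (pathProj k E x))) := by
  rw [Iso.comp_inv_eq, Category.assoc, actProjIso_hom_natural, Iso.inv_hom_id_assoc]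

theorem actProjIso_inv_natural' {F F' : ProjCat k A} (φ : F ⟶ F') (G : ProjCat k A) (x : V ⊕ W) :
    ambientHom (ProjCat.hcomp φ (𝟙 G)) (𝟙 (pathProj k E x)) ≫ (actProjIso E F' G x).inv =
      (actProjIso E F G x).inv ≫ ((ambient k A E).act.map φ).hom.app (ambientProj E G x) := by
  rw [Iso.comp_inv_eq, Category.assoc, actProjIso_hom_natural', Iso.inv_hom_id_assoc]

theorem ambientHom_comp_id {G G' G'' : ProjCat k A} {x : V ⊕ W} (f : G ⟶ G') (g : G' ⟶ G'') :
    ambientHom (f ≫ g) (𝟙 (pathProj k E x)) = ambientHom f (𝟙 _) ≫ ambientHom g (𝟙 _) := by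
  rw [ambientHom_comp, Category.comp_id]

theorem ambientHom_add_left {G G' : ProjCat k A} {x y : V ⊕ W} (f g : G ⟶ G')
    (α : pathProj k E x ⟶ pathProj k E y) :
    ambientHom (f + g) α = ambientHom f α + ambientHom g α :=
  LinearMap.map_add₂ (ambientHomBilin G G' x y) f g α

theorem ambientHom_smul_left {G G' : ProjCat k A} {x y : V ⊕ W} (c : k) (f : G ⟶ G')
    (α : pathProj k E x ⟶ pathProj k E y) : ambientHom (c • f) α = c • ambientHom f α :=
  LinearMap.map_smul₂ (ambientHomBilin G G' x y) c f α

variable {i l : Fin n} {x : V ⊕ W} {L : Ambient k A E}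
  (π : ambientProj E (projMor k he i l) x ⟶ L)

/-- The morphism `(F_{jc} ∘ F_{il}) ⊠ P_x ⟶ F_{jc} L`. -/
def actMap (F : ProjCat k A) :
    ambientProj E (F.comp (projMor k he i l)) x ⟶ (ambient k A E).app F L :=
  (actProjIso E F (projMor k he i l) x).inv ≫ ((ambient k A E).act.obj F).obj.map π

/-- The morphism `F_{jl} ⊠ P_x ⟶ F_{ji} L`. -/
def topMap (j : Fin n) : ambientProj E (projMor k he j l) x ⟶
    (ambient k A E).app (projMor k he j i) L :=
  ambientHom (splitMor he (e i)) (𝟙 _) ≫ actMap he π (projMor k he j i)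

variable {he}

theorem hcomp_id_actMap (F : ProjCat k A) (f : projMor k he i l ⟶ projMor k he i l) :
    ambientHom (ProjCat.hcomp (𝟙 F) f) (𝟙 (pathProj k E x)) ≫ actMap he π F =
      actMap he (ambientHom f (𝟙 _) ≫ π) F := by
  rw [actMap, actMap, ← Category.assoc, actProjIso_inv_natural, Category.assoc,
    ← CategoryTheory.Functor.map_comp]

theorem actMap_smul (F : ProjCat k A) (c : k) : actMap he (c • π) F = c • actMap he π F := by
  rw [actMap, actMap, Functor.map_smul, Linear.comp_smul]

theorem actMap_zero (F : ProjCat k A) :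
    actMap he (0 : ambientProj E (projMor k he i l) x ⟶ L) F = 0 := by
  rw [actMap, Functor.map_zero, Limits.comp_zero]

theorem hcomp_actMap {F F' : ProjCat k A} (φ : F ⟶ F') :
    ambientHom (ProjCat.hcomp φ (𝟙 _)) (𝟙 (pathProj k E x)) ≫ actMap he π F' =
      actMap he π F ≫ ((ambient k A E).act.map φ).hom.app L := by
  rw [actMap, actMap, ← Category.assoc, actProjIso_inv_natural', Category.assoc, Category.assoc,
    ← ((ambient k A E).act.map φ).hom.naturality]

/-- The left coefficient `y` is moved to the acting 1-morphism and the right coefficient `z` to the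
projective object above `L`. -/
theorem homMor_topMap {a j : Fin n} (y z : A) :
    ambientHom (homMor he (i := a) (j := l) (a := j) (b := l) y z) (𝟙 (pathProj k E x)) ≫
        topMap he π j =
      ambientHom (splitMor he (a := a) (b := i) (c := i) (d := l) (e i)) (𝟙 _) ≫
        ambientHom (ProjCat.hcomp (homMor he (i := a) (j := i) (a := j) (b := i) y (e i))
          (homMor he (i := i) (j := l) (a := i) (b := l) (e i) z)) (𝟙 _) ≫
          actMap he π (projMor k he j i) := by
  rw [topMap, ← Category.assoc, ← Category.assoc, ← ambientHom_comp_id, ← ambientHom_comp_id,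
    splitMor_hcomp]
  simp only [he.mul_self]

/-- A morphism that changes only the left coefficient is induced by a 2-morphism between the acting
functors, so it descends to F_{ai}L → F_{ji}L. -/
theorem homMor_topMap_left {a j : Fin n} (y : A) :
    ambientHom (homMor he (i := a) (j := l) (a := j) (b := l) y (e l)) (𝟙 (pathProj k E x)) ≫
        topMap he π j =
      topMap he π a ≫ ((ambient k A E).act.map
        (homMor he (i := a) (j := i) (a := j) (b := i) y (e i))).hom.app L := by
  rw [homMor_topMap, homMor_id, hcomp_actMap, topMap, Category.assoc]

variable {π}

/-- Only isomorphisms of a local projective survive in its simple top, and a radical morphism is not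
one. -/
theorem isRadical_comp_top [IsAlgClosed k] [Finite V] [Finite W] [Simple L] {f : projMor k he i l ⟶ projMor k he i l}
    (hf : IsRadical he f) : ambientHom f (𝟙 _) ≫ π = 0 := by
  by_contra h
  have hP : IsLocalRing (End (ambientProj E (projMor k he i l) x)) :=
    isLocalRing_end_ambientProj (isLocalRing_end_projMor he i l) x
  have h1 : IsIso (ambientHom f (𝟙 (pathProj k E x))) := isIso_of_comp_ne_zero (π := π) hP hP h
  have h1' : IsIso ((ambientFunctor E x).map f) := h1
  have h2 : IsIso f := (ambientFunctorFullyFaithful k A E x).isIso_of_isIso_map f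
  exact not_isRadical_id he i l (IsIso.hom_inv_id f ▸ hf.comp he (inv f))

theorem homMor_topMap_of_mem_jacobson [IsAlgClosed k] [Finite V] [Finite W] [Simple L] {a j : Fin n} (y : A) {z : A}
    (hz : z ∈ Ring.jacobson A) :
    ambientHom (homMor he (i := a) (j := l) (a := j) (b := l) y z) (𝟙 (pathProj k E x)) ≫
        topMap he π j = 0 := by
  have h : ∀ (α : projMor k he a i ⟶ projMor k he j i) (β : projMor k he i l ⟶ projMor k he i l),
      ProjCat.hcomp α β = ProjCat.hcomp α (𝟙 _) ≫ ProjCat.hcomp (𝟙 _) β := fun α β => by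
    rw [hcomp_comp, Category.comp_id, Category.id_comp]
  rw [homMor_topMap, h, ambientHom_comp_id, Category.assoc, hcomp_id_actMap,
    isRadical_comp_top (isRadical_homMor_right he _ hz), actMap_zero, Limits.comp_zero,
    Limits.comp_zero]

/-- The parameter matters only through its corner `e i * z * e i`, which is a multiple of `e i` plus
a radical element; the latter moves into the argument `L` and dies. -/
theorem exists_splitMor_actMap [IsAlgClosed k] [Finite V] [Finite W] [Simple L] (j : Fin n) (z : A) : ∃ c : k,
    ambientHom (splitMor he (a := j) (b := i) (c := i) (d := l) z) (𝟙 (pathProj k E x)) ≫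
      actMap he π (projMor k he j i) = c • topMap he π j := by
  obtain ⟨c, r, hr, hr1, -, hz⟩ := corner_decomposition (k := k) he i (x := e i * z * e i)
    (by rw [← mul_assoc, ← mul_assoc, he.mul_self]) (by rw [mul_assoc, he.mul_self])
  refine ⟨c, ?_⟩
  have h1 : splitMor (k := k) he (a := j) (b := i) (c := i) (d := l) z =
      splitMor he (a := j) (b := i) (c := i) (d := l) (e i) ≫ ProjCat.hcomp (𝟙 _)
        (homMor he (i := i) (j := l) (a := i) (b := l) (c • e i + r) (e l)) := by
    rw [← homMor_id he j i, splitMor_hcomp, homMor_id, Category.id_comp, splitMor_eq he z, hz]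
    simp only [he.mul_self, mul_add, mul_smul_comm, hr1]
  have h2 : ambientHom (homMor he (i := i) (j := l) (a := i) (b := l) (c • e i + r) (e l))
      (𝟙 (pathProj k E x)) ≫ π = c • π := by
    rw [homMor_add_left, homMor_smul_left, homMor_id]
    rw [ambientHom_add_left, ambientHom_smul_left, ambientHom_id, Preadditive.add_comp,
      Linear.smul_comp, isRadical_comp_top (isRadical_homMor_left he hr _), add_zero,
      Category.id_comp]
  rw [h1, ambientHom_comp_id, Category.assoc, hcomp_id_actMap, h2, actMap_smul, Linear.comp_smul]
  rfl

/-- F_{ji} preserves the epimorphism onto `L`. Its source F_{ji}F_{il} ⊠ P_x splits into copies of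
F_{jl} ⊠ P_x, on each of which the map is a multiple of `topMap`, so it factors through `topMap`. -/
theorem epi_topMap [IsAlgClosed k] [Finite V] [Finite W] [Simple L] {ν : Equiv.Perm (Fin n)}
    (hd : ∀ i, Nonempty (DualBases k e ν i)) [Epi π] (j : Fin n) : Epi (topMap he π j) := by
  have h1 := isLeftAdjoint_app_projMor (E := E) he hd j i
  have h2 : Epi (actMap he π (projMor k he j i)) := by
    rw [actMap]
    have := ((ambient k A E).act.obj (projMor k he j i)).obj.map_epi π
    exact epi_comp _ _
  let B := Module.finBasis k A
  choose c hc using fun t => exists_splitMor_actMap (he := he) (π := π) j (B t)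
  have h3 : (∑ t, c t • ambientHom (mergeMor he (B.coord t)) (𝟙 (pathProj k E x))) ≫
      topMap he π j = actMap he π (projMor k he j i) := by
    rw [Preadditive.sum_comp]
    have h4 : ∑ t, ambientHom (mergeMor he (B.coord t)) (𝟙 (pathProj k E x)) ≫
        ambientHom (splitMor he (B t)) (𝟙 (pathProj k E x)) =
        𝟙 (ambientProj E ((projMor k he j i).comp (projMor k he i l)) x) := by
      rw [← ambientHom_id, ← sum_mergeMor_splitMor he B j i i l]
      refine Eq.trans (Finset.sum_congr rfl fun t _ => ?_)
        (Functor.map_sum (ambientFunctor E x)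
          (fun t => mergeMor he (B.coord t) ≫ splitMor he (B t)) Finset.univ).symm
      exact ((ambientFunctor E x).map_comp _ _).symm
    rw [← Category.id_comp (actMap he π _), ← h4, Preadditive.sum_comp]
    refine Finset.sum_congr rfl fun t _ => ?_
    rw [Category.assoc, hc, Linear.smul_comp, Linear.comp_smul]
  exact epi_of_epi_fac h3

end TopMap

/-! ### Projective families in Hom-finite abelian categories. -/

section HomFinite
variable {C : Type*} [Category* C] [Abelian C] (k : Type*) [Field k] [Linear k C]

/-- Precomposition with an epimorphism is injective on the finite dimensional endomorphism algebra,
hence surjective, and this produces a one-sided inverse. -/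
theorem isIso_of_epi_of_finite {X : C} [Module.Finite k (X ⟶ X)] (f : X ⟶ X) [Epi f] : IsIso f := by
  have h1 : Function.Injective (Linear.leftComp k X f) := fun g g' hg => (cancel_epi f).1 hg
  obtain ⟨g, hg⟩ := LinearMap.injective_iff_surjective.1 h1 (𝟙 X)
  have : Mono f := mono_of_mono_fac (show f ≫ g = 𝟙 X from hg)
  exact isIso_of_mono_of_epi f

variable {k} {J : Type*} {P : J → C}

theorem IsProjectiveFamily.eq_zero_of_ne (hP : IsProjectiveFamily k P) {s t : J} (h : s ≠ t) {S : C}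
    [Simple S] (π : P t ⟶ S) [hπ : Epi π] (g : P s ⟶ S) : g = 0 := by
  have := hP.projective s
  have := hP.projective t
  exact eq_zero_of_isEmpty_iso (hP.isLocalRing t) (hP.isLocalRing s) π
    ⟨fun f => h (hP.eq_of_iso _ _ f)⟩ g

theorem IsProjectiveFamily.exists_eq_smul [IsAlgClosed k] (hP : IsProjectiveFamily k P) {t : J}
    {S : C} [Simple S] (π : P t ⟶ S) [hπ : Epi π] (g : P t ⟶ S) : ∃ c : k, g = c • π := by
  have := hP.projective t
  have := hP.finite_hom (P t) (P t)
  exact exists_eq_smul_of_simple (hP.isLocalRing t) k π g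

theorem IsProjectiveFamily.isLocalRing_of_epi (hP : IsProjectiveFamily k P) {t : J} {Q : C}
    (π : P t ⟶ Q) [hπ : Epi π] (hQ : ¬ Limits.IsZero Q) : IsLocalRing (End Q) := by
  have := hP.projective t
  have := hP.finite_hom Q Q
  exact isLocalRing_end_of_epi (hP.isLocalRing t) π
    (fun h => hQ ((Limits.IsZero.iff_id_eq_zero Q).2 h)) fun f _ => isIso_of_epi_of_finite k f

theorem IsProjectiveFamily.isIso_or_pow_eq_zero (hP : IsProjectiveFamily k P) {t : J}
    (f : P t ⟶ P t) : IsIso f ∨ IsNilpotent (End.of f) := by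
  have : FiniteDimensional k (End (P t)) := hP.finite_hom (P t) (P t)
  have := hP.isLocalRing t
  rw [← isUnit_iff_isIso]
  exact isUnit_or_isNilpotent k (End.of f)

theorem ne_zero_of_epi_simple {X S : C} [Simple S] (π : X ⟶ S) [Epi π] : π ≠ 0 := fun h =>
  Simple.not_isZero S (Limits.IsZero.of_epi_eq_zero π h)

end HomFinite

/-! ### Morphisms from projectives to F_{ji}L. -/

section SimpleTops
variable {k : Type u} [Field k] {A : Type u} [Ring A] [Algebra k A]
  [FiniteDimensional k A] {V W : Type*} [Finite V] [Finite W] {E : V → W → Prop} {n : ℕ}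
  {e : Fin n → A} {he : IsBasicDecomposition e}

theorem hom_projMor_eq_zero (hP : IsProjectiveFamily k (indProj (k := k) E he)) {a b i l : Fin n}
    {x y : V ⊕ W} {L : Ambient k A E} [Simple L]
    (π : ambientProj E (projMor k he i l) x ⟶ L) [hπ : Epi π] (h : (a, b, y) ≠ (i, l, x))
    (g : ambientProj E (projMor k he a b) y ⟶ L) : g = 0 :=
  hP.eq_zero_of_ne (s := (some (a, b), y)) (t := (some (i, l), x)) (by simpa using h)
    (hπ := hπ) π g

variable {ν : Equiv.Perm (Fin n)}

/-- By adjunction these are morphisms from F_{iν(j)} ⊠ P_y to the top of F_{iν(i)} ⊠ P_x, and `ν` is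
injective. -/
theorem hom_one_app_eq_zero (hP : IsProjectiveFamily k (indProj (k := k) E he))
    (hd : ∀ i, Nonempty (DualBases k e ν i)) {i j : Fin n} {x y : V ⊕ W} {L : Ambient k A E}
    [Simple L] (π : ambientProj E (projMor k he i (ν i)) x ⟶ L) [Epi π] (h : (j, y) ≠ (i, x))
    (g : ambientProj E (ProjCat.one k A) y ⟶ (ambient k A E).app (projMor k he j i) L) :
    g = 0 := by
  obtain ⟨d⟩ := hd j
  obtain ⟨φ⟩ := (d.adjointPair he i).exists_linearEquiv (ProjCat.one k A) y L
  rw [← map_eq_zero_iff φ φ.injective]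
  exact hom_projMor_eq_zero hP π (by simpa using h) (φ g)

/-- By adjunction these are morphisms to `L` from F_{iν(j)}F_{ab} ⊠ P_y, a summand of copies of
F_{ib} ⊠ P_y. -/
theorem hom_projMor_app_eq_zero (hP : IsProjectiveFamily k (indProj (k := k) E he))
    (hd : ∀ i, Nonempty (DualBases k e ν i)) {i l a b j : Fin n} {x y : V ⊕ W}
    {L : Ambient k A E} [Simple L] (π : ambientProj E (projMor k he i l) x ⟶ L) [Epi π]
    (h : (b, y) ≠ (l, x))
    (g : ambientProj E (projMor k he a b) y ⟶ (ambient k A E).app (projMor k he j i) L) :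
    g = 0 := by
  obtain ⟨d⟩ := hd j
  obtain ⟨φ⟩ := (d.adjointPair he i).exists_linearEquiv (projMor k he a b) y L
  rw [← map_eq_zero_iff φ φ.injective]
  refine eq_zero_of_addClosure (addClosure_projMor_comp he i (ν j) a b) ?_ _
  rintro _ rfl g'
  exact hom_projMor_eq_zero hP π (fun h' => h (congrArg Prod.snd h')) g'

variable [IsAlgClosed k]

/-- The right coefficient is a scalar plus a radical element. The radical part is killed by
`topMap`, and the rest is a left coefficient, which descends. -/
theorem exists_comp_topMap {i l : Fin n} {x : V ⊕ W} {L : Ambient k A E} [Simple L]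
    (π : ambientProj E (projMor k he i l) x ⟶ L) {a j : Fin n}
    (f : projMor k he a l ⟶ projMor k he j l) :
    ∃ R : (ambient k A E).app (projMor k he a i) L ⟶ (ambient k A E).app (projMor k he j i) L,
      ambientHom f (𝟙 _) ≫ topMap he π j = topMap he π a ≫ R := by
  refine projMor_hom_induction he (P := fun f =>
    ∃ R, ambientHom f (𝟙 _) ≫ topMap he π j = topMap he π a ≫ R) ⟨0, ?_⟩ ?_ ?_ f
  · rw [← ambientHomBilin_apply, LinearMap.map_zero₂, Limits.zero_comp, Limits.comp_zero]
  · intro y z _ _ h3 h4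
    obtain ⟨c, r, hr, -, -, rfl⟩ := corner_decomposition (k := k) he l h3 h4
    refine ⟨((ambient k A E).act.map
      (homMor he (i := a) (j := i) (a := j) (b := i) (c • y) (e i))).hom.app L, ?_⟩
    rw [homMor_add_right, homMor_smul_right, ← homMor_smul_left, ambientHom_add_left,
      Preadditive.add_comp, homMor_topMap_left, homMor_topMap_of_mem_jacobson _ hr, add_zero]
  · rintro g g' ⟨R, hR⟩ ⟨R', hR'⟩
    exact ⟨R + R', by
      rw [ambientHom_add_left, Preadditive.add_comp, Preadditive.comp_add, hR, hR']⟩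

/-- The adjunction identifies this space with the morphisms from F_{iν(i)} ⊠ P_x to its simple top,
which form a line. -/
theorem exists_hom_one_app (hP : IsProjectiveFamily k (indProj (k := k) E he))
    (hd : ∀ i, Nonempty (DualBases k e ν i)) {i : Fin n} {x : V ⊕ W} {L : Ambient k A E}
    [Simple L] (π : ambientProj E (projMor k he i (ν i)) x ⟶ L) [hπ : Epi π] :
    ∃ θ : ambientProj E (ProjCat.one k A) x ⟶ (ambient k A E).app (projMor k he i i) L,
      θ ≠ 0 ∧ ∀ g, ∃ c : k, g = c • θ := by
  obtain ⟨d⟩ := hd i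
  obtain ⟨φ⟩ : Nonempty ((ambientProj E (ProjCat.one k A) x ⟶
      (ambient k A E).app (projMor k he i i) L) ≃ₗ[k]
        (ambientProj E (projMor k he i (ν i)) x ⟶ L)) :=
    (d.adjointPair he i).exists_linearEquiv (ProjCat.one k A) x L
  refine ⟨φ.symm π, fun h => ne_zero_of_epi_simple π ?_, fun g => ?_⟩
  · rwa [map_eq_zero_iff φ.symm φ.symm.injective] at h
  · obtain ⟨c, hc⟩ := hP.exists_eq_smul (t := (some (i, ν i), x)) (hπ := hπ) π (φ g)
    exact ⟨c, by rw [← map_smul, LinearEquiv.eq_symm_apply]; exact hc⟩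

/-- F_{ii} is a summand of F_{ij}F_{ji}, and F_{ii}L is non-zero because it receives a non-zero
morphism from 𝟙 ⊠ P_x. -/
theorem not_isZero_app (hP : IsProjectiveFamily k (indProj (k := k) E he))
    (hd : ∀ i, Nonempty (DualBases k e ν i)) {i j : Fin n} {x : V ⊕ W} {L : Ambient k A E}
    [Simple L] (π : ambientProj E (projMor k he i (ν i)) x ⟶ L) [Epi π] :
    ¬ Limits.IsZero ((ambient k A E).app (projMor k he j i) L) := fun h => by
  obtain ⟨θ, hθ, -⟩ := exists_hom_one_app hP hd π
  obtain ⟨r⟩ := nonempty_retract_projMor_comp (k := k) he i j i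
  have h1 : Limits.IsZero ((ambient k A E).app ((projMor k he i j).comp (projMor k he j i)) L) := by
    rw [TwoRep.app, (ambient k A E).act_comp]
    exact ((ambient k A E).act.obj (projMor k he i j)).obj.map_isZero h
  have r' : Retract ((ambient k A E).app (projMor k he i i) L)
      ((ambient k A E).app ((projMor k he i j).comp (projMor k he j i)) L) :=
    (r.map ((ambient k A E).act ⋙ (isLin k _).ι)).map ((evaluation _ _).obj L)
  refine hθ ?_
  rw [← Category.comp_id θ, ← r'.retract, h1.eq_of_tgt r'.i 0, Limits.zero_comp, Limits.comp_zero]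

theorem isLocalRing_end_app (hP : IsProjectiveFamily k (indProj (k := k) E he))
    (hd : ∀ i, Nonempty (DualBases k e ν i)) {i : Fin n} (j : Fin n) {x : V ⊕ W}
    {L : Ambient k A E} [Simple L] (π : ambientProj E (projMor k he i (ν i)) x ⟶ L) [Epi π] :
    IsLocalRing (End ((ambient k A E).app (projMor k he j i) L)) := by
  have h := epi_topMap (he := he) (π := π) hd j
  exact hP.isLocalRing_of_epi (t := (some (j, ν i), x)) (hπ := h) (topMap he π j)
    (not_isZero_app hP hd π)

end SimpleTops

/-! ### Existence of the non-split extensions ∇(i,x) and N_{(v,w)}. -/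

section Extensions
variable {k : Type u} [Field k] {A : Type u} [Ring A] [Algebra k A]
  [FiniteDimensional k A] {V W : Type*} {E : V → W → Prop} {n : ℕ}
  {e : Fin n → A} {he : IsBasicDecomposition e} {ν : Equiv.Perm (Fin n)}

/-- `R` is nilpotent, being induced by `f` along an epimorphism, so an eigenvector of `R` has
eigenvalue zero. -/
theorem comp_eq_zero_of_isNilpotent {C : Type*} [Category* C] [Preadditive C] [Linear k C]
    {P Q X : C} {f : P ⟶ P} (hf : IsNilpotent (End.of f)) {κ : P ⟶ Q} [Epi κ] {R : Q ⟶ Q}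
    (hR : f ≫ κ = κ ≫ R) {θ : X ⟶ Q} (hθ : ∃ c : k, θ ≫ R = c • θ) : θ ≫ R = 0 := by
  obtain ⟨m, hm⟩ := hf
  obtain ⟨c, hc⟩ := hθ
  have h1 : ∀ m : ℕ, ((End.of f) ^ m : End P).asHom ≫ κ = κ ≫ ((End.of R) ^ m : End Q).asHom := by
    intro m
    induction m with
    | zero => exact (Category.id_comp κ).trans (Category.comp_id κ).symm
    | succ m ih =>
      rw [pow_succ', pow_succ']
      change (_ ≫ f) ≫ κ = κ ≫ (_ ≫ R)
      rw [Category.assoc, hR, ← Category.assoc, ih, Category.assoc]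
  have h2 : ∀ m : ℕ, θ ≫ ((End.of R) ^ m : End Q).asHom = c ^ m • θ := by
    intro m
    induction m with
    | zero => exact (Category.comp_id θ).trans (by rw [pow_zero, one_smul])
    | succ m ih =>
      rw [pow_succ']
      change θ ≫ (_ ≫ R) = _
      rw [← Category.assoc, ih, Linear.smul_comp, hc, smul_smul, pow_succ]
  have h3 : ((End.of R) ^ m : End Q).asHom = 0 := by
    rw [← cancel_epi κ, ← h1, hm, Limits.comp_zero]
    exact Limits.zero_comp
  have h4 := h2 m
  rw [h3, Limits.comp_zero] at h4
  by_cases hc0 : c = 0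
  · rw [hc, hc0, zero_smul]
  · rw [(smul_eq_zero.1 h4.symm).resolve_left (pow_ne_zero m hc0), Limits.zero_comp]

variable [IsAlgClosed k]

/-- In the local ring of endomorphisms of 𝟙, either `f ≫ g` is invertible, and then so are both
factors, or `𝟙 - f ≫ g` is invertible while the hypothesis says that it kills the morphism. -/
theorem eq_zero_or_isIso_of_comp_eq (hconn : IsConnectedAlgebra A) {x y : V ⊕ W}
    {α : pathProj k E x ⟶ pathProj k E y} {s : Option (Fin n × Fin n)}
    {f : ProjCat.one k A ⟶ indMor he s} {g : indMor he s ⟶ ProjCat.one k A} {Y : Ambient k A E}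
    {q : ambientProj E (ProjCat.one k A) y ⟶ Y}
    (h : ambientHom (f ≫ g) α ≫ q = ambientHom (𝟙 _) α ≫ q) :
    ambientHom (𝟙 _) α ≫ q = 0 ∨ IsIso f ∧ IsIso g := by
  have hloc : IsLocalRing (End (ProjCat.one k A)) := isLocalRing_end_one hconn
  rcases (isLocalRing_end_iff.1 hloc).2 (f ≫ g) (𝟙 _ - f ≫ g) (by abel) with h1 | h1
  · exact Or.inr (isIso_of_comp_isIso_of_isLocalRing hloc (isLocalRing_end_indMor he hconn s) h1)
  · left
    have h2 : ambientHom (𝟙 _ - f ≫ g) (𝟙 _) ≫ ambientHom (𝟙 _) α ≫ q = 0 := by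
      rw [← Category.assoc, ambientHom_comp, Category.comp_id, Category.id_comp,
        ← ambientHomBilin_apply, LinearMap.map_sub₂, Preadditive.sub_comp, ambientHomBilin_apply,
        ambientHomBilin_apply, h, sub_self]
    have h3 : IsIso (ambientHom (𝟙 _ - f ≫ g) (𝟙 (pathProj k E x))) :=
      inferInstanceAs (IsIso ((ambientFunctor E x).map (𝟙 _ - f ≫ g)))
    rw [← cancel_epi (ambientHom (𝟙 _ - f ≫ g) (𝟙 (pathProj k E x))), h2, Limits.comp_zero]

variable [Finite V] [Finite W]

/-- The extension is found as a quotient of F_{ii}L, which is covered by F_{iν(i)} ⊠ P_x and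
receives exactly one line of morphisms from 𝟙 ⊠ P_x. -/
theorem exists_nabla (hP : IsProjectiveFamily k (indProj (k := k) E he))
    (hd : ∀ i, Nonempty (DualBases k e ν i)) {i : Fin n} {x : V ⊕ W} {S L : Ambient k A E}
    [Simple S] [Simple L] (σ : ambientProj E (ProjCat.one k A) x ⟶ S) [hσ : Epi σ]
    (π : ambientProj E (projMor k he i (ν i)) x ⟶ L) [hπ : Epi π] :
    ∃ (Y : Ambient k A E) (ι : S ⟶ Y) (p : Y ⟶ L), IsSES ι p ∧ ¬ IsSplitEpi p := by
  obtain ⟨θ, hθ, hθ'⟩ := exists_hom_one_app hP hd π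
  have hκ := epi_topMap (he := he) (π := π) hd i
  -- A factorization through 𝟙 ⊠ P_x itself: `ρ ≫ topMap` is a multiple `c • θ`, so `c • β` fixes a
  -- non-zero morphism and is invertible.
  have hone : ∀ (ρ : ambientProj E (ProjCat.one k A) x ⟶ ambientProj E (projMor k he i (ν i)) x)
      (β : ambientProj E (ProjCat.one k A) x ⟶ ambientProj E (ProjCat.one k A) x)
      (Y : Ambient k A E) (q : (ambient k A E).app (projMor k he i i) L ⟶ Y),
      β ≫ ρ ≫ topMap he π i ≫ q = θ ≫ q → θ ≫ q ≠ 0 → IsIso β := fun ρ β Y q h1 h2 => by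
    obtain ⟨c, hc⟩ := hθ' (ρ ≫ topMap he π i)
    have h3 : (c • β) ≫ (θ ≫ q) = θ ≫ q := by
      rw [← Category.assoc ρ, hc, Linear.smul_comp, Linear.comp_smul] at h1
      rw [Linear.smul_comp, h1]
    have h4 := isIso_of_comp_eq_of_ne_zero (hP.isLocalRing (none, x)) h2 h3
    have hc0 : c ≠ 0 := fun h0 => h2 (by rw [← h3, h0, zero_smul, Limits.zero_comp])
    have h5 : β = (c⁻¹ • 𝟙 _) ≫ (c • β) := by
      rw [Linear.smul_comp, Category.id_comp, smul_smul, inv_mul_cancel₀ hc0, one_smul]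
    have h6 : IsIso (c⁻¹ • 𝟙 (ambientProj E (ProjCat.one k A) x)) :=
      ⟨c • 𝟙 _, by simp [smul_smul, hc0], by simp [smul_smul, hc0]⟩
    rw [h5]
    exact IsIso.comp_isIso' h6 h4
  -- A factorization through F_{aν(i)} ⊠ P_x cannot occur. For `a ≠ i` there is no non-zero morphism
  -- from 𝟙 ⊠ P_x to F_{ai}L. For `a = i` a non-isomorphism `ρ` induces a nilpotent endomorphism of
  -- F_{ii}L, which kills the line of `θ`.
  have hproj : ∀ (a : Fin n)
      (ρ : ambientProj E (projMor k he a (ν i)) x ⟶ ambientProj E (projMor k he i (ν i)) x)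
      (β : ambientProj E (ProjCat.one k A) x ⟶ ambientProj E (projMor k he a (ν i)) x),
      ¬ IsIso ρ → β ≫ ρ ≫ topMap he π i = 0 := fun a ρ β hρ => by
    obtain ⟨f, hf⟩ := exists_ambientHom_eq (pathProj_id_ne_zero k E x) ρ
    obtain ⟨R, hR⟩ := exists_comp_topMap π f
    rw [← hf] at hR
    by_cases ha : a = i
    · subst ha
      obtain ⟨c, hc⟩ := hθ' (β ≫ topMap he π a)
      have hnil : IsNilpotent (End.of ρ) :=
        (hP.isIso_or_pow_eq_zero (t := (some (a, ν a), x)) ρ).resolve_left hρ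
      have h4 := comp_eq_zero_of_isNilpotent hnil hR (hθ' (θ ≫ R))
      rw [hR, ← Category.assoc, hc, Linear.smul_comp, h4, smul_zero]
    · rw [hR, ← Category.assoc, hom_one_app_eq_zero hP hd π (by simpa using ha) (β ≫ _),
        Limits.zero_comp]
  refine hP.exists_nonsplit (a := (none, x)) (b := (some (i, ν i), x)) (by simp)
    (topMap he π i) (hκ := hκ) θ hθ ?_ σ (hπ := hσ) π (hσ := hπ)
  rintro ⟨s, y⟩ ρ β Y q hρ h1 h2
  have hz : β ≫ ρ ≫ topMap he π i ≠ 0 := fun h => h2 <| h1.symm.trans <| by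
    have haux : ∀ {X₁ X₂ X₃ X₄ X₅ : Ambient k A E} (f : X₁ ⟶ X₂) (g : X₂ ⟶ X₃) (h : X₃ ⟶ X₄)
        (q : X₄ ⟶ X₅), f ≫ g ≫ h = 0 → f ≫ g ≫ h ≫ q = 0 := fun f g h q h0 => by
      rw [← Category.assoc g, ← Category.assoc, h0, Limits.zero_comp]
    exact haux _ _ _ _ h
  rcases s with _ | ⟨a, b⟩
  · by_cases hy : y = x
    · subst hy
      exact hone ρ β Y q h1 h2
    · refine absurd (Eq.trans (congrArg (β ≫ ·) ?_) Limits.comp_zero) hz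
      exact hom_one_app_eq_zero hP hd π (by simpa using hy) _
  · refine absurd ?_ hz
    by_cases hb : (b, y) = (ν i, x)
    · obtain ⟨rfl, rfl⟩ := Prod.mk.injEq _ _ _ _ ▸ hb
      exact hproj a ρ β hρ
    · exact Eq.trans (congrArg (β ≫ ·) (hom_projMor_app_eq_zero hP hd π hb _)) Limits.comp_zero

/-- Here the extension is a quotient of 𝟙 ⊠ P_v itself, and its socle is reached through the arrow
from `v` to `w`. -/
theorem exists_edgeExtension (hconn : IsConnectedAlgebra A)
    (hP : IsProjectiveFamily k (indProj (k := k) E he)) {v : V} {w : W} (hvw : E v w)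
    {S T : Ambient k A E} [Simple S] [Simple T]
    (σ : ambientProj E (ProjCat.one k A) (Sum.inr w) ⟶ S) [hσ : Epi σ]
    (π : ambientProj E (ProjCat.one k A) (Sum.inl v) ⟶ T) [hπ : Epi π] :
    ∃ (Y : Ambient k A E) (ι : S ⟶ Y) (p : Y ⟶ T), IsSES ι p ∧ ¬ IsSplitEpi p := by
  obtain ⟨α, hα⟩ := exists_pathProj_hom_ne_zero k hvw
  have hone : 𝟙 (ProjCat.one k A) ≠ 0 := (isLocalRing_end_iff.1 (isLocalRing_end_one hconn)).1
  have hkey : ∀ {s : Option (Fin n × Fin n)} {f : ProjCat.one k A ⟶ indMor he s}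
      {g : indMor he s ⟶ ProjCat.one k A} {Y : Ambient k A E} {y : V ⊕ W}
      {q : ambientProj E (ProjCat.one k A) (Sum.inl v) ⟶ Y}
      {β : pathProj k E (Sum.inr w) ⟶ pathProj k E y}
      {γ : pathProj k E y ⟶ pathProj k E (Sum.inl v)}, β ≫ γ = α →
      ambientHom f β ≫ ambientHom g γ ≫ q = ambientHom (𝟙 (ProjCat.one k A)) α ≫ q →
      ambientHom (𝟙 (ProjCat.one k A)) α ≫ q ≠ 0 →
      IsIso ((ambientFunctor E (Sum.inr w)).map f) ∧
        IsIso ((ambientFunctor E (Sum.inl v)).map g) := by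
    intro s f g Y y q β γ hα h1 h2
    rw [← Category.assoc, ambientHom_comp, hα] at h1
    obtain ⟨_, _⟩ := (eq_zero_or_isIso_of_comp_eq hconn h1).resolve_left h2
    exact ⟨inferInstance, inferInstance⟩
  refine hP.exists_nonsplit (a := (none, Sum.inr w)) (b := (none, Sum.inl v)) (by simp)
    (𝟙 _) (ambientHom (𝟙 _) α) (ambientHom_ne_zero hone hα) ?_ σ (hπ := hσ) π (hσ := hπ)
  rintro ⟨s, y⟩ ρ β Y q hρ h1 h2
  rw [Category.id_comp] at h1
  have hβ0 : β ≠ 0 := fun h => h2 (by rw [← h1, h, Limits.zero_comp])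
  have hρ0 : ρ ≠ 0 := fun h => h2 (by rw [← h1, h, Limits.zero_comp, Limits.comp_zero])
  obtain ⟨b, hb⟩ := exists_hom_ne_zero_of_ne_zero hβ0
  obtain ⟨c, hc⟩ := exists_hom_ne_zero_of_ne_zero hρ0
  -- Non-zero morphisms P_w → P_y → P_v exist only if `y` is one of the ends, as paths have length
  -- at most one.
  have hcases : y = Sum.inr w ∨ y = Sum.inl v := by
    rcases eq_or_of_hom_ne_zero hb with h | ⟨v', w', -, -, hy⟩
    · exact Or.inl h.symm
    · rcases eq_or_of_hom_ne_zero hc with h | ⟨_, _, -, hy', -⟩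
      · exact Or.inr h
      · exact nomatch hy.symm.trans hy'
  rcases hcases with rfl | rfl
  · obtain ⟨f, rfl⟩ := exists_ambientHom_eq (pathProj_id_ne_zero k E _) β
    obtain ⟨g, rfl⟩ := exists_ambientHom_eq hα ρ
    exact (hkey (Category.id_comp α) h1 h2).1
  · exfalso
    obtain ⟨f, rfl⟩ := exists_ambientHom_eq hα β
    obtain ⟨g, rfl⟩ := exists_ambientHom_eq (pathProj_id_ne_zero k E _) ρ
    exact hρ (hkey (Category.comp_id α) h1 h2).2

end Extensions

/-! ### Sums, pullbacks and pushouts of short exact sequences. -/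

section ShortExactSequences
variable {C : Type*} [Category* C] [Abelian C]

theorem isSES_of_lift {X Y Z : C} {i : X ⟶ Y} {p : Y ⟶ Z} [Mono i] [Epi p] (h : i ≫ p = 0)
    (hl : ∀ {T : C} (t : T ⟶ Y), t ≫ p = 0 → ∃ l, l ≫ i = t) : IsSES i p :=
  ⟨h, { exact := ShortComplex.exact_of_f_is_kernel _ (Limits.KernelFork.IsLimit.ofι' i h
          fun t ht => ⟨(hl t ht).choose, (hl t ht).choose_spec⟩)
        mono_f := ‹_›
        epi_g := ‹_› }⟩

theorem isSES_of_desc {X Y Z : C} {i : X ⟶ Y} {p : Y ⟶ Z} [Mono i] [Epi p] (h : i ≫ p = 0)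
    (hl : ∀ {T : C} (t : Y ⟶ T), i ≫ t = 0 → ∃ l, p ≫ l = t) : IsSES i p :=
  ⟨h, { exact := ShortComplex.exact_of_g_is_cokernel _ (Limits.CokernelCofork.IsColimit.ofπ' p h
          fun t ht => ⟨(hl t ht).choose, (hl t ht).choose_spec⟩)
        mono_f := ‹_›
        epi_g := ‹_› }⟩

variable {X Y Z : C} {i : X ⟶ Y} {p : Y ⟶ Z}

theorem IsSES.zero (h : IsSES i p) : i ≫ p = 0 := h.1

theorem IsSES.mono (h : IsSES i p) : Mono i := h.2.mono_f

theorem IsSES.epi (h : IsSES i p) : Epi p := h.2.epi_g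

theorem IsSES.exists_lift (h : IsSES i p) {T : C} (t : T ⟶ Y) (ht : t ≫ p = 0) :
    ∃ l, l ≫ i = t := by
  have := h.mono
  exact ⟨h.2.exact.lift t ht, h.2.exact.lift_f t ht⟩

theorem IsSES.exists_desc (h : IsSES i p) {T : C} (t : Y ⟶ T) (ht : i ≫ t = 0) :
    ∃ l, p ≫ l = t := by
  have := h.epi
  exact ⟨h.2.exact.desc t ht, h.2.exact.g_desc t ht⟩

theorem isSES_biproduct_map [Limits.HasFiniteBiproducts C] {J : Type*} [Finite J] {X Y Z : J → C} {i : ∀ j, X j ⟶ Y j}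
    {p : ∀ j, Y j ⟶ Z j} (h : ∀ j, IsSES (i j) (p j)) :
    IsSES (Limits.biproduct.map i) (Limits.biproduct.map p) := by
  have := fun j => (h j).mono
  have := fun j => (h j).epi
  refine isSES_of_lift ?_ fun t ht => ?_
  · ext j
    simp [(h j).zero]
  · have h1 : ∀ j, (t ≫ Limits.biproduct.π Y j) ≫ p j = 0 := fun j => by
      rw [Category.assoc, ← Limits.biproduct.map_π, ← Category.assoc, ht, Limits.zero_comp]
    choose l hl using fun j => (h j).exists_lift _ (h1 j)
    exact ⟨Limits.biproduct.lift l, by ext j; simp [hl]⟩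

theorem IsSES.pullback (h : IsSES i p) {T : C} (d : T ⟶ Z) :
    ∃ (N : C) (j : X ⟶ N) (q : N ⟶ T) (f : N ⟶ Y), IsSES j q ∧ j ≫ f = i ∧ f ≫ p = q ≫ d := by
  have := h.mono
  have := h.epi
  let j : X ⟶ Limits.pullback p d := Limits.pullback.lift i 0 (by rw [h.zero, Limits.zero_comp])
  have hj : j ≫ Limits.pullback.fst p d = i := Limits.pullback.lift_fst _ _ _
  have hj' : j ≫ Limits.pullback.snd p d = 0 := Limits.pullback.lift_snd _ _ _
  have : Mono j := mono_of_mono_fac hj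
  refine ⟨Limits.pullback p d, j, Limits.pullback.snd p d, Limits.pullback.fst p d,
    isSES_of_lift hj' fun t ht => ?_, hj, Limits.pullback.condition⟩
  obtain ⟨l, hl⟩ := h.exists_lift (t ≫ Limits.pullback.fst p d) (by
    rw [Category.assoc, Limits.pullback.condition, ← Category.assoc, ht, Limits.zero_comp])
  exact ⟨l, Limits.pullback.hom_ext (by rw [Category.assoc, hj, hl])
    (by rw [Category.assoc, hj', ht, Limits.comp_zero])⟩

theorem IsSES.pushout (h : IsSES i p) {T : C} (d : X ⟶ T) :
    ∃ (M : C) (j : T ⟶ M) (q : M ⟶ Z) (f : Y ⟶ M), IsSES j q ∧ i ≫ f = d ≫ j ∧ f ≫ q = p := by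
  have := h.mono
  have := h.epi
  let q : Limits.pushout i d ⟶ Z := Limits.pushout.desc p 0 (by rw [h.zero, Limits.comp_zero])
  have hq : Limits.pushout.inl i d ≫ q = p := Limits.pushout.inl_desc _ _ _
  have hq' : Limits.pushout.inr i d ≫ q = 0 := Limits.pushout.inr_desc _ _ _
  have : Epi q := epi_of_epi_fac hq
  refine ⟨Limits.pushout i d, Limits.pushout.inr i d, q, Limits.pushout.inl i d,
    isSES_of_desc hq' fun t ht => ?_, Limits.pushout.condition, hq⟩
  obtain ⟨l, hl⟩ := h.exists_desc (Limits.pushout.inl i d ≫ t) (by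
    rw [← Category.assoc, Limits.pushout.condition, Category.assoc, ht, Limits.comp_zero])
  exact ⟨l, Limits.pushout.hom_ext (by rw [← Category.assoc, hq, hl])
    (by rw [← Category.assoc, hq', ht, Limits.zero_comp])⟩

end ShortExactSequences

/-! ### Existence of simple tops and of the gluing data. -/

section Existence
variable {k : Type u} [Field k] {A : Type u} [Ring A] [Algebra k A]
  [FiniteDimensional k A] {V W : Type*} [Finite V] [Finite W] {E : V → W → Prop} {n : ℕ}
  {e : Fin n → A} {he : IsBasicDecomposition e} {ν : Equiv.Perm (Fin n)}

theorem exists_isTop (hP : IsProjectiveFamily k (indProj (k := k) E he))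
    (s : Option (Fin n × Fin n)) (x : V ⊕ W) : ∃ L, IsTop E L (indMor (k := k) he s) x := by
  have h : ¬ Limits.IsZero (indProj (k := k) E he (s, x)) := fun h0 =>
    (isLocalRing_end_iff.1 (hP.isLocalRing (s, x))).1 (h0.eq_of_src _ _)
  obtain ⟨S, q, hS, hq⟩ := hP.exists_simple_quotient h
  exact ⟨S, hS, q, hq⟩

theorem nonempty_gluingData [IsAlgClosed k] (hconn : IsConnectedAlgebra A)
    (hP : IsProjectiveFamily k (indProj (k := k) E he))
    (hd : ∀ i, Nonempty (DualBases k e ν i)) (η : ∀ v w, E v w → Fin n) :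
    Nonempty (GluingData k he ν E η) := by
  have : Limits.HasFiniteBiproducts (Ambient k A E) := Abelian.hasFiniteBiproducts
  choose L₀ hL₀ using fun x => exists_isTop hP none x
  choose L hL using fun i j x => exists_isTop hP (some (i, j)) x
  have hnabla : ∀ i x, ∃ (Y : Ambient k A E) (ι : L₀ x ⟶ Y) (p : Y ⟶ L i (ν i) x),
      IsSES ι p ∧ ¬ IsSplitEpi p := fun i x => by
    obtain ⟨_, σ, hσ⟩ := hL₀ x
    obtain ⟨_, π, hπ⟩ := hL i (ν i) x
    exact exists_nabla hP hd σ (hσ := hσ) π (hπ := hπ)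
  have hedge : ∀ v w (_ : E v w), ∃ (Y : Ambient k A E) (ι : L₀ (Sum.inr w) ⟶ Y)
      (p : Y ⟶ L₀ (Sum.inl v)), IsSES ι p ∧ ¬ IsSplitEpi p := fun v w h => by
    obtain ⟨_, σ, hσ⟩ := hL₀ (Sum.inr w)
    obtain ⟨_, π, hπ⟩ := hL₀ (Sum.inl v)
    exact exists_edgeExtension hconn hP h σ (hσ := hσ) π (hπ := hπ)
  choose nabla nablaι nablaπ hn hn' using hnabla
  choose Ne Neι Neπ hN hN' using hedge
  have hY := fun v => isSES_biproduct_map (J := {w // E v w})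
    fun w => hn (η v w.1 w.2) (Sum.inr w.1)
  have hNe := fun v => isSES_biproduct_map (J := {w // E v w}) fun w => hN v w.1 w.2
  -- If `v` has no neighbours, the sums are zero objects and N_v is an extension of L_{0,v} by zero;
  -- no separate case is needed.
  choose N Nι Nπ f hSES hf hf' using fun v =>
    (hNe v).pullback (Limits.biproduct.lift fun _ => 𝟙 (L₀ (Sum.inl v)))
  choose M Mι Mπ YM hM hM₁ hM₂ using fun v => (hY v).pushout (Nι v)
  exact ⟨{
    L₀ := L₀
    L := L
    isTop_L₀ := hL₀
    isTop_L := hL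
    nabla := nabla
    nablaι := nablaι
    nablaπ := nablaπ
    nabla_exact := hn
    nabla_nonsplit := hn'
    Nedge := Ne
    Nedgeι := Neι
    Nedgeπ := Neπ
    Nedge_exact := hN
    Nedge_nonsplit := hN'
    X := fun v => Limits.biproduct.bicone _
    Y := fun v => Limits.biproduct.bicone _
    Z := fun v => Limits.biproduct.bicone _
    isBilimit_X := fun v => ⟨Limits.biproduct.isBilimit _⟩
    isBilimit_Y := fun v => ⟨Limits.biproduct.isBilimit _⟩
    isBilimit_Z := fun v => ⟨Limits.biproduct.isBilimit _⟩
    XY := fun v => Limits.biproduct.map fun w => nablaι (η v w.1 w.2) (Sum.inr w.1)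
    YZ := fun v => Limits.biproduct.map fun w => nablaπ (η v w.1 w.2) (Sum.inr w.1)
    XY_π := fun v w => Limits.biproduct.map_π _ _
    YZ_π := fun v w => Limits.biproduct.map_π _ _
    N := N
    Nι := Nι
    Nπ := Nπ
    N_exact := hSES
    Nproj := fun v w => f v ≫ Limits.biproduct.π _ w
    Nι_proj := fun v w => by
      rw [← Category.assoc, hf]
      exact Limits.biproduct.map_π _ _
    Nproj_π := fun v w => by
      have h1 := congrArg (· ≫ Limits.biproduct.π _ w) (hf' v)
      simpa using h1
    M := M
    Mι := Mι
    Mπ := Mπ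
    M_exact := hM
    YM := YM
    XY_YM := hM₁
    YM_π := hM₂ }⟩

end Existence

/-! ### Non-split extensions with simple subobject. -/

section NonSplit
variable {C : Type*} [Category* C] [Abelian C]

/-- The image of `ρ` is the kernel of its cokernel `q`. If it does not contain the simple `S`, it
meets `S` trivially and maps isomorphically to `T`, which splits the sequence. -/
theorem IsSES.epi_of_not_isSplitEpi {S Y T P : C} [Simple S] {i : S ⟶ Y} {p : Y ⟶ T}
    (h : IsSES i p) (hns : ¬ IsSplitEpi p) {ρ : P ⟶ Y} (hρ : Epi (ρ ≫ p)) : Epi ρ := by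
  let q := Limits.cokernel.π ρ
  have hq : ρ ≫ q = 0 := Limits.cokernel.condition ρ
  by_cases h0 : i ≫ q = 0
  · obtain ⟨l, hl⟩ := h.exists_desc q h0
    have h1 : l = 0 := by
      rw [← cancel_epi (ρ ≫ p), Category.assoc, hl, hq, Limits.comp_zero]
    refine Preadditive.epi_of_isZero_cokernel ρ (Limits.IsZero.of_epi_eq_zero q ?_)
    rw [← hl, h1, Limits.comp_zero]
  · have hm : Mono (i ≫ q) := mono_of_nonzero_from_simple h0
    have hmono : Mono (Limits.kernel.ι q ≫ p) := by
      refine Preadditive.mono_of_cancel_zero _ fun g hg => ?_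
      obtain ⟨l, hl⟩ := h.exists_lift (g ≫ Limits.kernel.ι q) (by rw [Category.assoc, hg])
      have h1 : l = 0 := by
        rw [← cancel_mono (i ≫ q), ← Category.assoc, hl, Category.assoc,
          Limits.kernel.condition, Limits.comp_zero, Limits.zero_comp]
      rw [← cancel_mono (Limits.kernel.ι q), ← hl, h1, Limits.zero_comp, Limits.zero_comp]
    have hepi : Epi (Limits.kernel.ι q ≫ p) := by
      refine epi_of_epi_fac (f := Limits.kernel.lift q ρ hq) (h := ρ ≫ p) ?_
      rw [← Category.assoc, Limits.kernel.lift_ι]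
    have := isIso_of_mono_of_epi (Limits.kernel.ι q ≫ p)
    refine absurd ⟨⟨inv (Limits.kernel.ι q ≫ p) ≫ Limits.kernel.ι q, ?_⟩⟩ hns
    rw [Category.assoc, IsIso.inv_hom_id]

theorem bicone_hom_ext {J : Type*} {F : J → C} {b : Limits.Bicone F} (hb : Nonempty b.IsBilimit)
    {T : C} {f g : T ⟶ b.pt} (h : ∀ j, f ≫ b.π j = g ≫ b.π j) : f = g := by
  obtain ⟨hb⟩ := hb
  exact hb.isLimit.hom_ext fun ⟨j⟩ => h j

theorem bicone_hom_ext' {J : Type*} {F : J → C} {b : Limits.Bicone F} (hb : Nonempty b.IsBilimit)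
    {T : C} {f g : b.pt ⟶ T} (h : ∀ j, b.ι j ≫ f = b.ι j ≫ g) : f = g := by
  obtain ⟨hb⟩ := hb
  exact hb.isColimit.hom_ext fun ⟨j⟩ => h j

end NonSplit

/-! ### Composition factors of N_v and M_v. -/

namespace GluingData
variable {k : Type u} [Field k] {A : Type u} [Ring A] [Algebra k A]
  [FiniteDimensional k A] {V W : Type*} [Finite V] [Finite W] {E : V → W → Prop} {n : ℕ}
  {e : Fin n → A} {he : IsBasicDecomposition e} {ν : Equiv.Perm (Fin n)}
  {η : ∀ v w, E v w → Fin n} (c : GluingData k he ν E η)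

/-- The projection of `𝟙 ⊠ P_x` onto its simple top. -/
def top₀ (x : V ⊕ W) : indProj (k := k) E he (none, x) ⟶ c.L₀ x := (c.isTop_L₀ x).2.choose

/-- The projection of `F_{ij} ⊠ P_x` onto its simple top. -/
def top (i j : Fin n) (x : V ⊕ W) : indProj (k := k) E he (some (i, j), x) ⟶ c.L i j x :=
  (c.isTop_L i j x).2.choose

instance (x : V ⊕ W) : Epi (c.top₀ x) := (c.isTop_L₀ x).2.choose_spec

instance (i j : Fin n) (x : V ⊕ W) : Epi (c.top i j x) := (c.isTop_L i j x).2.choose_spec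

instance (x : V ⊕ W) : Simple (c.L₀ x) := (c.isTop_L₀ x).1

instance (i j : Fin n) (x : V ⊕ W) : Simple (c.L i j x) := (c.isTop_L i j x).1

variable {c}

theorem hom_X_eq_zero (hP : IsProjectiveFamily k (indProj (k := k) E he))
    {v : V} {s : Option (Fin n × Fin n) × (V ⊕ W)}
    (hs : ∀ w, E v w → s ≠ (none, Sum.inr w)) (g : indProj (k := k) E he s ⟶ (c.X v).pt) :
    g = 0 :=
  bicone_hom_ext (c.isBilimit_X v) fun w => by
    rw [Limits.zero_comp, hP.eq_zero_of_ne (hs w.1 w.2) (c.top₀ _) (g ≫ _)]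

theorem hom_Z_eq_zero (hP : IsProjectiveFamily k (indProj (k := k) E he))
    {v : V} {s : Option (Fin n × Fin n) × (V ⊕ W)}
    (hs : ∀ w h, s ≠ (some (η v w h, ν (η v w h)), Sum.inr w))
    (g : indProj (k := k) E he s ⟶ (c.Z v).pt) : g = 0 :=
  bicone_hom_ext (c.isBilimit_Z v) fun w => by
    rw [Limits.zero_comp, hP.eq_zero_of_ne (hs w.1 w.2) (c.top _ _ _) (g ≫ _)]

theorem hom_N_eq_zero (hP : IsProjectiveFamily k (indProj (k := k) E he))
    {v : V} {s : Option (Fin n × Fin n) × (V ⊕ W)}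
    (hs : ∀ w, E v w → s ≠ (none, Sum.inr w)) (hs' : s ≠ (none, Sum.inl v))
    (g : indProj (k := k) E he s ⟶ c.N v) : g = 0 := by
  obtain ⟨l, rfl⟩ := (c.N_exact v).exists_lift g (hP.eq_zero_of_ne hs' (c.top₀ _) _)
  rw [hom_X_eq_zero hP hs l, Limits.zero_comp]

theorem hom_M_eq_zero (hP : IsProjectiveFamily k (indProj (k := k) E he))
    {v : V} {s : Option (Fin n × Fin n) × (V ⊕ W)}
    (hs : ∀ w, E v w → s ≠ (none, Sum.inr w)) (hs' : s ≠ (none, Sum.inl v))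
    (hs'' : ∀ w h, s ≠ (some (η v w h, ν (η v w h)), Sum.inr w))
    (g : indProj (k := k) E he s ⟶ c.M v) : g = 0 := by
  obtain ⟨l, rfl⟩ := (c.M_exact v).exists_lift g (hom_Z_eq_zero hP hs'' _)
  rw [hom_N_eq_zero hP hs hs' l, Limits.zero_comp]

variable (c)

theorem exists_hom_N (hP : IsProjectiveFamily k (indProj (k := k) E he))
    (v : V) : ∃ u : indProj (k := k) E he (none, Sum.inl v) ⟶ c.N v,
    u ≫ c.Nπ v = c.top₀ (Sum.inl v) := by
  have := hP.projective (none, Sum.inl v)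
  have := (c.N_exact v).epi
  exact ⟨Projective.factorThru (c.top₀ _) (c.Nπ v), Projective.factorThru_comp _ _⟩

variable {c}

/-- The simple object L_{0,v} occurs only once in N_v, since X has composition factors at lower
vertices only. -/
theorem hom_N_eq_smul [IsAlgClosed k]
    (hP : IsProjectiveFamily k (indProj (k := k) E he))
    {v : V} {u : indProj (k := k) E he (none, Sum.inl v) ⟶ c.N v}
    (hu : u ≫ c.Nπ v = c.top₀ (Sum.inl v)) (g : indProj (k := k) E he (none, Sum.inl v) ⟶ c.N v) :
    ∃ r : k, g = r • u := by
  obtain ⟨r, hr⟩ := hP.exists_eq_smul (c.top₀ _) (g ≫ c.Nπ v)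
  refine ⟨r, sub_eq_zero.1 ?_⟩
  obtain ⟨l, hl⟩ := (c.N_exact v).exists_lift (g - r • u)
    (by rw [Preadditive.sub_comp, Linear.smul_comp, hu, hr, sub_self])
  rw [← hl, hom_X_eq_zero hP (by simp) l, Limits.zero_comp]

theorem hom_M_eq_smul [IsAlgClosed k]
    (hP : IsProjectiveFamily k (indProj (k := k) E he))
    {v : V} {u : indProj (k := k) E he (none, Sum.inl v) ⟶ c.N v}
    (hu : u ≫ c.Nπ v = c.top₀ (Sum.inl v)) (g : indProj (k := k) E he (none, Sum.inl v) ⟶ c.M v) :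
    ∃ r : k, g = r • (u ≫ c.Mι v) := by
  obtain ⟨l, rfl⟩ := (c.M_exact v).exists_lift g (hom_Z_eq_zero hP (by simp) _)
  obtain ⟨r, rfl⟩ := hom_N_eq_smul hP hu l
  exact ⟨r, by rw [Linear.smul_comp]⟩

theorem comp_Mι_ne_zero {v : V} {u : indProj (k := k) E he (none, Sum.inl v) ⟶ c.N v}
    (hu : u ≫ c.Nπ v = c.top₀ (Sum.inl v)) : u ≫ c.Mι v ≠ 0 := fun h => by
  have := (c.M_exact v).mono
  have h1 : u = 0 := by rw [← cancel_mono (c.Mι v), h, Limits.zero_comp]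
  exact ne_zero_of_epi_simple (c.top₀ (Sum.inl v)) (by rw [← hu, h1, Limits.zero_comp])

theorem hom_X_eq_smul [IsAlgClosed k]
    (hP : IsProjectiveFamily k (indProj (k := k) E he))
    {v : V} (w : {w // E v w})
    (g : indProj (k := k) E he (none, Sum.inr w.1) ⟶ (c.X v).pt) :
    ∃ r : k, g = r • (c.top₀ _ ≫ (c.X v).ι w) := by
  obtain ⟨r, hr⟩ := hP.exists_eq_smul (c.top₀ _) (g ≫ (c.X v).π w)
  refine ⟨r, bicone_hom_ext (c.isBilimit_X v) fun w' => ?_⟩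
  rw [Linear.smul_comp, Category.assoc]
  by_cases hw : w = w'
  · subst hw
    rw [Limits.bicone_ι_π_self, Category.comp_id, hr]
  · rw [Limits.bicone_ι_π_ne _ hw, Limits.comp_zero, smul_zero]
    exact hP.eq_zero_of_ne (t := (none, Sum.inr w'.1))
      (by simpa [Subtype.ext_iff] using hw) (c.top₀ _) _

/-- The image of `L_{0,w}` in `M_v` is in the image of `𝟙 ⊠ P_v`. -/
theorem exists_comp_eq [IsAlgClosed k]
    (hP : IsProjectiveFamily k (indProj (k := k) E he))
    {v : V} (w : {w // E v w})
    {u : indProj (k := k) E he (none, Sum.inl v) ⟶ c.N v}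
    (hu : u ≫ c.Nπ v = c.top₀ (Sum.inl v)) :
    ∃ r, r ≫ u = c.top₀ (Sum.inr w.1) ≫ (c.X v).ι w ≫ c.Nι v := by
  -- Non-splitness of N_{(v,w)}: a morphism that reaches its top reaches everything. So the
  -- embedding of L_{0,w} lifts to a morphism `r` between projectives.
  have h1 : Epi (u ≫ c.Nproj v w) := by
    refine (c.Nedge_exact v w.1 w.2).epi_of_not_isSplitEpi (c.Nedge_nonsplit _ _ _) ?_
    rw [Category.assoc, c.Nproj_π, hu]
    infer_instance
  have := hP.projective (none, Sum.inr w.1)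
  let r := Projective.factorThru (c.top₀ (Sum.inr w.1) ≫ c.Nedgeι v w.1 w.2) (u ≫ c.Nproj v w)
  have hr : r ≫ u ≫ c.Nproj v w = c.top₀ (Sum.inr w.1) ≫ c.Nedgeι v w.1 w.2 :=
    Projective.factorThru_comp _ _
  -- There is no non-zero morphism from 𝟙 ⊠ P_w to L_{0,v}, so `r ≫ u` lands in X. As the w are
  -- distinct, it lands in the summand L_{0,w}, up to a scalar `d`.
  obtain ⟨l, hl⟩ := (c.N_exact v).exists_lift (r ≫ u)
    (hP.eq_zero_of_ne (by simp) (c.top₀ (Sum.inl v)) _)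
  obtain ⟨d, hd⟩ := hom_X_eq_smul hP w l
  have hd1 : d • (c.top₀ (Sum.inr w.1) ≫ c.Nedgeι v w.1 w.2) =
      c.top₀ (Sum.inr w.1) ≫ c.Nedgeι v w.1 w.2 := by
    conv_rhs => rw [← hr, ← Category.assoc, ← hl, hd]
    simp only [Linear.smul_comp, Category.assoc, c.Nι_proj]
    rw [← Category.assoc ((c.X v).ι w), Limits.bicone_ι_π_self, Category.id_comp]
  have hne : c.top₀ (Sum.inr w.1) ≫ c.Nedgeι v w.1 w.2 ≠ 0 := fun h0 => by
    have := (c.Nedge_exact v w.1 w.2).mono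
    refine ne_zero_of_epi_simple (c.top₀ (Sum.inr w.1)) ?_
    rw [← cancel_mono (c.Nedgeι v w.1 w.2), h0, Limits.zero_comp]
  -- The scalar is read off after projecting to N_{(v,w)}, where `r` was chosen to give exactly the
  -- embedding of L_{0,w}.
  have hd2 : d = 1 := by
    rw [← sub_eq_zero]
    refine (smul_eq_zero.1 ?_).resolve_right hne
    rw [sub_smul, hd1, one_smul, sub_self]
  refine ⟨r, ?_⟩
  rw [← hl, hd, hd2, one_smul, Category.assoc]

theorem nablaι_Yι {v : V} (w : {w // E v w}) :
    c.nablaι (η v w.1 w.2) (Sum.inr w.1) ≫ (c.Y v).ι w = (c.X v).ι w ≫ c.XY v :=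
  bicone_hom_ext (c.isBilimit_Y v) fun w' => by
    rw [Category.assoc, Category.assoc, c.XY_π]
    by_cases hw : w = w'
    · subst hw
      rw [Limits.bicone_ι_π_self, Limits.bicone_ι_π_self_assoc, Category.comp_id]
    · rw [Limits.bicone_ι_π_ne _ hw, Limits.bicone_ι_π_ne_assoc _ hw, Limits.comp_zero,
        Limits.zero_comp]

theorem Yι_YZ {v : V} (w : {w // E v w}) :
    (c.Y v).ι w ≫ c.YZ v = c.nablaπ (η v w.1 w.2) (Sum.inr w.1) ≫ (c.Z v).ι w :=
  bicone_hom_ext (c.isBilimit_Z v) fun w' => by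
    rw [Category.assoc, Category.assoc, c.YZ_π]
    by_cases hw : w = w'
    · subst hw
      rw [Limits.bicone_ι_π_self, Limits.bicone_ι_π_self_assoc, Category.comp_id]
    · rw [Limits.bicone_ι_π_ne _ hw, Limits.bicone_ι_π_ne_assoc _ hw, Limits.comp_zero,
        Limits.zero_comp]

end GluingData

/-! ### Indecomposability and pairwise non-isomorphism of the M_v and Q_{j,w}. -/

namespace GluingData
variable {k : Type u} [Field k] {A : Type u} [Ring A] [Algebra k A]
  [FiniteDimensional k A] {V W : Type*} [Finite V] [Finite W] {E : V → W → Prop} {n : ℕ}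
  {e : Fin n → A} {he : IsBasicDecomposition e} {ν : Equiv.Perm (Fin n)}
  {η : ∀ v w, E v w → Fin n} {c : GluingData k he ν E η}

theorem comp_top₀_ne_zero {v : V} (w : {w // E v w}) :
    c.top₀ (Sum.inr w.1) ≫ (c.X v).ι w ≫ c.Nι v ≫ c.Mι v ≠ 0 := fun h => by
  have := (c.M_exact v).mono
  have := (c.N_exact v).mono
  refine ne_zero_of_epi_simple (c.top₀ (Sum.inr w.1)) ?_
  have h1 : c.top₀ (Sum.inr w.1) ≫ (c.X v).ι w = 0 := by
    rw [← cancel_mono (c.Nι v ≫ c.Mι v), Category.assoc, h, Limits.zero_comp]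
  rw [← Category.comp_id (c.top₀ (Sum.inr w.1)), ← Limits.bicone_ι_π_self (c.X v) w,
    ← Category.assoc, h1, Limits.zero_comp]

/-- L_{i,ν(i),w} is a composition factor of M_v once, through the image of ∇. Any morphism from its
projective cover to M_v is a multiple of the one through ∇, and the latter does not factor through
the simple top because ∇ does not split. -/
theorem comp_Zι_eq_zero [IsAlgClosed k]
    (hP : IsProjectiveFamily k (indProj (k := k) E he)) {v : V} (w : {w // E v w})
    (g : c.L (η v w.1 w.2) (ν (η v w.1 w.2)) (Sum.inr w.1) ⟶ c.M v) : g = 0 := by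
  let i := η v w.1 w.2
  let p : indProj (k := k) E he (some (i, ν i), Sum.inr w.1) ⟶ c.L i (ν i) (Sum.inr w.1) :=
    c.top i (ν i) (Sum.inr w.1)
  have hM := (c.M_exact v).mono
  have hep := (c.nabla_exact i (Sum.inr w.1)).epi
  have hproj := hP.projective (some (i, ν i), Sum.inr w.1)
  have hproj' := hP.projective (none, Sum.inr w.1)
  let ρ := Projective.factorThru p (c.nablaπ i (Sum.inr w.1))
  have hρ : ρ ≫ c.nablaπ i (Sum.inr w.1) = p := Projective.factorThru_comp _ _
  have hρ' : Epi ρ := by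
    refine (c.nabla_exact i (Sum.inr w.1)).epi_of_not_isSplitEpi (c.nabla_nonsplit _ _) ?_
    rw [hρ]
    exact inferInstanceAs (Epi (c.top i (ν i) (Sum.inr w.1)))
  -- Non-splitness makes the projective cover surject onto ∇. So some `r` reaches L_{0,w} inside it:
  -- `r` dies in the top, but `r ≫ m` is the non-zero embedding of L_{0,w} in M_v.
  let r := Projective.factorThru (c.top₀ (Sum.inr w.1) ≫ c.nablaι i (Sum.inr w.1)) ρ
  have hr : r ≫ ρ = c.top₀ (Sum.inr w.1) ≫ c.nablaι i (Sum.inr w.1) :=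
    Projective.factorThru_comp _ _
  let m := ρ ≫ (c.Y v).ι w ≫ c.YM v
  have hm : m ≫ c.Mπ v = p ≫ (c.Z v).ι w := by
    simp only [m, Category.assoc, c.YM_π]
    rw [Yι_YZ, ← Category.assoc]
    exact congrArg (· ≫ _) hρ
  obtain ⟨d, hd⟩ : ∃ d : k, p ≫ g = d • m := by
    obtain ⟨d, hd⟩ := hP.exists_eq_smul p (hπ := inferInstanceAs (Epi (c.top _ _ _)))
      ((p ≫ g) ≫ c.Mπ v ≫ (c.Z v).π w)
    have h1 : (p ≫ g - d • m) ≫ c.Mπ v = 0 := by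
      refine bicone_hom_ext (c.isBilimit_Z v) fun w' => ?_
      rw [Limits.zero_comp]
      by_cases hw : w = w'
      · subst hw
        rw [Category.assoc, Preadditive.sub_comp, hd, Linear.smul_comp, ← Category.assoc m, hm,
          Category.assoc, Limits.bicone_ι_π_self, Category.comp_id, sub_self]
      · refine hP.eq_zero_of_ne (t := (some (η v w'.1 w'.2, ν (η v w'.1 w'.2)), Sum.inr w'.1))
          (fun h => hw (Subtype.ext (Sum.inr_injective (congrArg Prod.snd h)))) (c.top _ _ _) _
    obtain ⟨l, hl⟩ := (c.M_exact v).exists_lift _ h1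
    refine ⟨d, sub_eq_zero.1 ?_⟩
    rw [← hl, hom_N_eq_zero hP (by simp) (by simp) l, Limits.zero_comp]
  have hrm : r ≫ m = c.top₀ (Sum.inr w.1) ≫ (c.X v).ι w ≫ c.Nι v ≫ c.Mι v := by
    rw [← c.XY_YM, ← Category.assoc ((c.X v).ι w), ← nablaι_Yι, ← Category.assoc r, hr]
    simp only [Category.assoc]
    rfl
  have hrp : r ≫ p = 0 := by
    rw [← hρ, ← Category.assoc, hr, Category.assoc, (c.nabla_exact i _).zero, Limits.comp_zero]
  have hd0 : d = 0 := by
    refine (smul_eq_zero.1 ?_).resolve_right (hrm ▸ comp_top₀_ne_zero (c := c) w)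
    rw [← Linear.comp_smul, ← hd, ← Category.assoc, hrp, Limits.zero_comp]
  have hpe : Epi p := inferInstanceAs (Epi (c.top _ _ _))
  rw [← cancel_epi p, hd, hd0, zero_smul, Limits.comp_zero]

/-- The image of `u` contains every L_{0,w} and covers L_{0,v}, so `f` vanishes on N_v. It then
factors through Z, and Z has no non-zero morphism to M_v. -/
theorem eq_zero_of_comp [IsAlgClosed k]
    (hP : IsProjectiveFamily k (indProj (k := k) E he)) {v : V}
    {u : indProj (k := k) E he (none, Sum.inl v) ⟶ c.N v}
    (hu : u ≫ c.Nπ v = c.top₀ (Sum.inl v)) {f : c.M v ⟶ c.M v} (hf : u ≫ c.Mι v ≫ f = 0) :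
    f = 0 := by
  have h1 : c.Nι v ≫ c.Mι v ≫ f = 0 := by
    refine bicone_hom_ext' (c.isBilimit_X v) fun w => ?_
    obtain ⟨r, hr⟩ := exists_comp_eq hP w hu
    rw [← cancel_epi (c.top₀ _), Limits.comp_zero, Limits.comp_zero]
    have h2 := congrArg (· ≫ c.Mι v ≫ f) hr
    simp only [Category.assoc] at h2
    rw [← h2, hf, Limits.comp_zero]
  have h2 : c.Mι v ≫ f = 0 := by
    obtain ⟨l, hl⟩ := (c.N_exact v).exists_desc _ h1
    have h3 : l = 0 := by
      rw [← cancel_epi (c.top₀ _), ← hu, Category.assoc, hl, hf, Limits.comp_zero]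
    rw [← hl, h3, Limits.comp_zero]
  obtain ⟨l, hl⟩ := (c.M_exact v).exists_desc _ h2
  have h3 : l = 0 := bicone_hom_ext' (c.isBilimit_Z v) fun w => by
    rw [Limits.comp_zero, comp_Zι_eq_zero hP w ((c.Z v).ι w ≫ l)]
  rw [← hl, h3, Limits.comp_zero]

/-- Morphisms from 𝟙 ⊠ P_v to M_v form a line, so an endomorphism agrees with a scalar on the image
of `u`, and then everywhere. -/
theorem isLocalRing_end_M [IsAlgClosed k]
    (hP : IsProjectiveFamily k (indProj (k := k) E he)) (v : V) :
    IsLocalRing (End (c.M v)) := by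
  obtain ⟨u, hu⟩ := exists_hom_N hP (c := c) v
  have hne := comp_Mι_ne_zero hu
  have hs : ∀ f : c.M v ⟶ c.M v, ∃ r : k, f = r • 𝟙 _ := fun f => by
    obtain ⟨r, hr⟩ := hom_M_eq_smul hP hu (u ≫ c.Mι v ≫ f)
    refine ⟨r, sub_eq_zero.1 (eq_zero_of_comp hP hu ?_)⟩
    rw [Preadditive.comp_sub, Preadditive.comp_sub, hr, Linear.comp_smul, Category.comp_id,
      Linear.comp_smul, sub_self]
  have hid : 𝟙 (c.M v) ≠ 0 := fun h => hne (by
    rw [← Category.comp_id (u ≫ c.Mι v), h, Limits.comp_zero])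
  refine isLocalRing_end_iff.2 ⟨hid, fun f g hfg => ?_⟩
  have hiso : ∀ r : k, r ≠ 0 → IsIso (r • 𝟙 (c.M v)) := fun r hr =>
    ⟨r⁻¹ • 𝟙 _, by simp [smul_smul, hr], by simp [smul_smul, hr]⟩
  obtain ⟨r, rfl⟩ := hs f
  obtain ⟨t, rfl⟩ := hs g
  by_cases hr : r = 0
  · refine Or.inr (hiso t fun ht => hid ?_)
    rw [← hfg, hr, ht, zero_smul, add_zero]
  · exact Or.inl (hiso r hr)

/-- Among the upper vertices only `v` gives a composition factor L_{0,v} of M_v. -/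
theorem eq_of_iso_M (hP : IsProjectiveFamily k (indProj (k := k) E he)) {v v' : V}
    (f : c.M v ≅ c.M v') : v = v' := by
  by_contra hv
  obtain ⟨u, hu⟩ := exists_hom_N hP (c := c) v
  refine comp_Mι_ne_zero hu ?_
  rw [← cancel_mono f.hom, Limits.zero_comp]
  exact hom_M_eq_zero hP (by simp) (by simpa using hv) (by simp) _

/-- Q_{j,w} receives no non-zero morphism from 𝟙 ⊠ P_v, because `v` is an upper vertex and `w` a
lower one. -/
theorem isEmpty_iso_M_Q (hP : IsProjectiveFamily k (indProj (k := k) E he))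
    (hd : ∀ i, Nonempty (DualBases k e ν i)) (θ : W → Fin n) (v : V) (j : Fin n) (w : W) :
    IsEmpty (c.M v ≅ c.Q θ j w) := ⟨fun f => by
  obtain ⟨u, hu⟩ := exists_hom_N hP (c := c) v
  obtain ⟨-, π, hπ⟩ := c.isTop_L (θ w) (ν (θ w)) (Sum.inr w)
  refine comp_Mι_ne_zero hu ?_
  rw [← cancel_mono f.hom, Limits.zero_comp]
  exact hom_one_app_eq_zero hP hd π (by simp) _⟩

/-- Q_{j,w} is a non-zero quotient of a projective at `w`, and such projectives have only zero
morphisms to Q_{j',w'} for `w' ≠ w`. -/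
theorem eq_of_iso_Q [IsAlgClosed k] (hP : IsProjectiveFamily k (indProj (k := k) E he))
    (hd : ∀ i, Nonempty (DualBases k e ν i)) (θ : W → Fin n) {j j' : Fin n} {w w' : W}
    (f : c.Q θ j w ≅ c.Q θ j' w') : w = w' := by
  by_contra hw
  obtain ⟨-, π, hπ⟩ := c.isTop_L (θ w) (ν (θ w)) (Sum.inr w)
  obtain ⟨-, π', hπ'⟩ := c.isTop_L (θ w') (ν (θ w')) (Sum.inr w')
  have h1 := epi_topMap (he := he) (π := π) hd j
  refine not_isZero_app hP hd π (j := j) (Limits.IsZero.of_epi_eq_zero (topMap he π j) ?_)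
  let g : (ambient k A E).app (projMor k he j (θ w)) (c.L (θ w) (ν (θ w)) (Sum.inr w)) ≅
    (ambient k A E).app (projMor k he j' (θ w')) (c.L (θ w') (ν (θ w')) (Sum.inr w')) := f
  rw [← cancel_mono g.hom, Limits.zero_comp]
  exact hom_projMor_app_eq_zero hP hd π' (fun h => hw (Sum.inr_injective (congrArg Prod.snd h))) _

theorem isLocalRing_end_Q [IsAlgClosed k] (hP : IsProjectiveFamily k (indProj (k := k) E he))
    (hd : ∀ i, Nonempty (DualBases k e ν i)) (θ : W → Fin n) (j : Fin n) (w : W) :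
    IsLocalRing (End (c.Q θ j w)) := by
  obtain ⟨-, π, hπ⟩ := c.isTop_L (θ w) (ν (θ w)) (Sum.inr w)
  exact isLocalRing_end_app hP hd j π

end GluingData

/-! ### Zero objects and finite direct sums in additive closures. -/

section AddClosure
variable {C : Type*} [Category* C] [Preadditive C]

theorem addClosure_of_isZero (S : ObjectProperty C) {X : C} (h : Limits.IsZero X) :
    addClosure S X :=
  ⟨Empty, inferInstance, fun _ => X, fun _ => 𝟙 X, fun _ => 𝟙 X, fun s => s.elim,
    h.eq_of_src _ _⟩

theorem addClosure_bicone {J : Type*} [Finite J] {F : J → C} {b : Limits.Bicone F}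
    (hb : Nonempty b.IsBilimit) : addClosure (fun X => ∃ j, X = F j) b.pt := by
  obtain ⟨hb⟩ := hb
  obtain ⟨m, ⟨f⟩⟩ := Finite.exists_equiv_fin J
  have := Fintype.ofFinite J
  refine ⟨Fin m, inferInstance, fun s => F (f.symm s), fun s => b.π _, fun s => b.ι _,
    fun s => ⟨_, rfl⟩, ?_⟩
  rw [Equiv.sum_comp f.symm (fun j => b.π j ≫ b.ι j)]
  exact Limits.IsBilimit.total hb

end AddClosure

/-! ### Functoriality of the action on retracts and additive closures. -/

section Action
variable {k : Type u} [Field k] {A : Type u} [Ring A] [Algebra k A]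
  [FiniteDimensional k A] {M : Type*} [Category* M] [Preadditive M] [Linear k M]
  (ρ : TwoRep k A M)

theorem TwoRep.app_comp (F G : ProjCat k A) (X : M) : ρ.app (F.comp G) X = ρ.app F (ρ.app G X) := by
  simp only [TwoRep.app]
  rw [ρ.act_comp]
  rfl

theorem TwoRep.app_one (X : M) : ρ.app (ProjCat.one k A) X = X := by
  simp only [TwoRep.app]
  rw [ρ.act_one]
  rfl

/-- The action of a retract of `1`-morphisms. -/
def TwoRep.appRetract {F G : ProjCat k A} (r : Retract F G) (X : M) :
    Retract (ρ.app F X) (ρ.app G X) :=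
  (r.map (ρ.act ⋙ (isLin k M).ι)).map ((evaluation _ _).obj X)

theorem TwoRep.addClosure_app_obj (F : ProjCat k A) {S T : ObjectProperty M}
    (h : ∀ X, S X → addClosure T (ρ.app F X)) {X : M} (hX : addClosure S X) :
    addClosure T (ρ.app F X) :=
  addClosure_map (ρ.act.obj F).obj h hX

end Action

/-! ### The action of the F_{ab} on the M_v and Q_{j,w}. -/

namespace GluingData
variable {k : Type u} [Field k] {A : Type u} [Ring A] [Algebra k A]
  [FiniteDimensional k A] {V W : Type*} {E : V → W → Prop} {n : ℕ}
  {e : Fin n → A} {he : IsBasicDecomposition e} {ν : Equiv.Perm (Fin n)}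
  {η : ∀ v w, E v w → Fin n} {c : GluingData k he ν E η} {θ : W → Fin n}

theorem addClosure_app_Q (a b j : Fin n) (w : W) :
    addClosure (fun X => X = c.Q θ a w) ((ambient k A E).app (projMor k he a b) (c.Q θ j w)) := by
  rw [Q, Q, ← TwoRep.app_comp]
  refine addClosure_mono ?_ ((ambient k A E).addClosure_app
    (addClosure_projMor_comp he a b j (θ w)) (c.L (θ w) (ν (θ w)) (Sum.inr w)))
  rintro _ ⟨G, rfl, rfl⟩
  exact le_addClosure _ rfl

theorem isSummand_app_Q (a j : Fin n) (w : W) :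
    IsSummand (c.Q θ a w) ((ambient k A E).app (projMor k he a j) (c.Q θ j w)) := by
  rw [Q, Q, ← TwoRep.app_comp]
  obtain ⟨r⟩ := nonempty_retract_projMor_comp (k := k) he a j (θ w)
  exact ⟨(ambient k A E).appRetract r _⟩

variable [Finite V] [Finite W]

/-- F_{ab} is exact and kills N_v, whose composition factors are all of the form L_{0,x}. -/
theorem nonempty_iso_app_M (hP : IsProjectiveFamily k (indProj (k := k) E he))
    (hd : ∀ i, Nonempty (DualBases k e ν i)) (a b : Fin n) (v : V) :
    Nonempty ((ambient k A E).app (projMor k he a b) (c.M v) ≅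
      (ambient k A E).app (projMor k he a b) (c.Z v).pt) := by
  have hN : Limits.IsZero ((ambient k A E).app (projMor k he a b) (c.N v)) :=
    isZero_app_projMor he hd a b fun d x f =>
      hom_N_eq_zero hP (s := (some (b, d), x)) (by simp) (by simp) f
  obtain ⟨h0, hM⟩ := c.M_exact v
  have h2 := (shortExact_app_projMor he hd a b hM).isIso_g_iff.2 hN
  exact ⟨@asIso _ _ _ _ _ h2⟩

/-- After replacing M_v by Z, the summand L_{i,ν(i),w} is killed by F_{ab} unless `b = i`; if `b =
i` it gives Q_{a,w} by definition. -/
theorem addClosure_app_M (hP : IsProjectiveFamily k (indProj (k := k) E he))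
    (hd : ∀ i, Nonempty (DualBases k e ν i)) (hθ : ∀ v w (h : E v w), θ w = η v w h)
    (a b : Fin n) (v : V) :
    addClosure (fun X => ∃ w, E v w ∧ θ w = b ∧ X = c.Q θ a w)
      ((ambient k A E).app (projMor k he a b) (c.M v)) := by
  obtain ⟨f⟩ := nonempty_iso_app_M (c := c) hP hd a b v
  refine addClosure_of_iso f (TwoRep.addClosure_app_obj _ _ ?_
    (addClosure_bicone (c.isBilimit_Z v)))
  rintro _ ⟨⟨w, hw⟩, rfl⟩
  dsimp only
  rw [← hθ v w hw]
  by_cases hb : θ w = b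
  · subst hb
    exact le_addClosure _ ⟨w, hw, rfl, rfl⟩
  · refine addClosure_of_isZero _ (isZero_app_projMor he hd a b fun d x f => ?_)
    exact hP.eq_zero_of_ne (s := (some (b, d), x)) (by simpa using fun h => (hb h.symm).elim)
      (c.top _ _ _) f

theorem isSummand_app_M (hP : IsProjectiveFamily k (indProj (k := k) E he))
    (hd : ∀ i, Nonempty (DualBases k e ν i)) (hθ : ∀ v w (h : E v w), θ w = η v w h)
    (a : Fin n) {v : V} {w : W} (hw : E v w) :
    IsSummand (c.Q θ a w) ((ambient k A E).app (projMor k he a (θ w)) (c.M v)) := by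
  obtain ⟨f⟩ := nonempty_iso_app_M (c := c) hP hd a (θ w) v
  have r : Retract (c.L (η v w hw) (ν (η v w hw)) (Sum.inr w)) (c.Z v).pt :=
    ⟨(c.Z v).ι ⟨w, hw⟩, (c.Z v).π ⟨w, hw⟩, Limits.bicone_ι_π_self _ _⟩
  rw [← hθ v w hw] at r
  have r' : Retract (c.Q θ a w) ((ambient k A E).app (projMor k he a (θ w)) (c.Z v).pt) :=
    r.map ((ambient k A E).act.obj (projMor k he a (θ w))).obj
  exact ⟨r'.trans (.ofIso f.symm)⟩

end GluingData

/-! ### Hasse diagrams of bipartite orders. -/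

section BipartiteOrder
variable {V W : Type*} (E : V → W → Prop)

/-- The partial order on the vertices of a bipartite graph. -/
def bipLE (x y : V ⊕ W) : Prop := x = y ∨ ∃ v w, x = Sum.inl v ∧ y = Sum.inr w ∧ E v w

variable {E} in
-- An element strictly between two others would be both a lower and an upper vertex. So strict
-- relations are covering relations.
theorem nonempty_bipGraph_iso {P : Type*} [PartialOrder P] (φ : V ⊕ W ≃ P)
    (h : ∀ x y, φ x ≤ φ y ↔ bipLE E x y) :
    ∃ f : bipGraph E ≃g SimpleGraph.hasse P, ∀ x, f x = φ x := by
  have hlt : ∀ x y, φ x < φ y ↔ ∃ v w, x = Sum.inl v ∧ y = Sum.inr w ∧ E v w := fun x y => by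
    rw [lt_iff_le_and_ne, h, φ.injective.ne_iff]
    constructor
    · rintro ⟨h1 | h1, h2⟩
      · exact absurd h1 h2
      · exact h1
    · rintro ⟨v, w, rfl, rfl, hE⟩
      exact ⟨Or.inr ⟨v, w, rfl, rfl, hE⟩, by simp⟩
  have hcov : ∀ x y, φ x ⋖ φ y ↔ ∃ v w, x = Sum.inl v ∧ y = Sum.inr w ∧ E v w := fun x y => by
    refine ⟨fun h1 => (hlt x y).1 h1.1, fun h1 => ⟨(hlt x y).2 h1, fun c h2 h3 => ?_⟩⟩
    obtain ⟨z, rfl⟩ := φ.surjective c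
    obtain ⟨_, w, -, rfl, -⟩ := (hlt _ _).1 h2
    obtain ⟨v, _, h4, -, -⟩ := (hlt _ _).1 h3
    exact nomatch h4
  refine ⟨⟨φ, fun {x y} => ?_⟩, fun x => rfl⟩
  rw [SimpleGraph.hasse_adj, hcov, hcov, bipGraph, SimpleGraph.fromRel_adj]
  refine ⟨fun h1 => ⟨?_, h1⟩, fun h1 => h1.2⟩
  rintro rfl
  rcases h1 with ⟨v, w, h1, h2, -⟩ | ⟨v, w, h1, h2, -⟩ <;> exact nomatch h1.symm.trans h2

end BipartiteOrder

/-! ### Additive closures of local objects are finitary. -/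

section FullSubcategories
variable {k : Type*} [Field k] {C : Type*} [Category* C] [Preadditive C] [Linear k C]

theorem finite_hom_fullSubcategory (hf : ∀ X Y : C, Module.Finite k (X ⟶ Y))
    (S : ObjectProperty C) (X Y : S.FullSubcategory) : Module.Finite k (X ⟶ Y) := by
  have := hf X.obj Y.obj
  exact Module.Finite.of_injective (S.ι.mapLinearMap k (X := X) (Y := Y))
    fun f g h => S.ι.map_injective h

variable [IsIdempotentComplete C]

theorem isIdempotentComplete_addClosure (S : ObjectProperty C) :
    IsIdempotentComplete (addClosure S).FullSubcategory :=
  isIdempotentComplete_of_retract _ fun _ _ r h => addClosure_of_retract r h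

/-- The additive closure is closed under retracts, so idempotents split in it and an indecomposable
object is local. It is then a retract of one generator, hence isomorphic to it. -/
theorem exists_iso_of_isIndec (hf : ∀ X Y : C, Module.Finite k (X ⟶ Y)) {S : ObjectProperty C}
    (hS : ∀ X, S X → IsLocalRing (End X)) {X : (addClosure S).FullSubcategory} (hX : IsIndec X) :
    IsLocalRing (End X.obj) ∧ ∃ Y, S Y ∧ Nonempty (X.obj ≅ Y) := by
  have := isIdempotentComplete_addClosure S
  have := finite_hom_fullSubcategory hf (addClosure S) X X
  have h1 : IsLocalRing (End X.obj) := isLocalRing_end_of_fullyFaithful (addClosure S).ι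
    (addClosure S).fullyFaithfulι (isLocalRing_end_of_isIndec k hX)
  obtain ⟨Y, hY, ⟨r⟩⟩ := exists_retract_of_addClosure h1 X.property
  exact ⟨h1, Y, hY, nonempty_iso_of_retract
    (fun h => (isLocalRing_end_iff.1 h1).1 (h.eq_of_src _ _)) (hS Y hY) r⟩

theorem isFinitary_addClosure [Limits.HasFiniteBiproducts C]
    (hf : ∀ X Y : C, Module.Finite k (X ⟶ Y)) {S : ObjectProperty C}
    (hS : ∀ X, S X → IsLocalRing (End X)) {J : Type*} [Finite J] (G : J → C)
    (hG : ∀ X, S X → ∃ j, X = G j) (hG' : ∀ j, S (G j)) :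
    IsFinitary k (addClosure S).FullSubcategory := by
  have h1 := isIdempotentComplete_addClosure S
  have h2 := hasFiniteBiproducts_addClosure S
  refine ⟨h2, h1, exists_krullSchmidt k (finite_hom_fullSubcategory hf _), ?_,
    finite_hom_fullSubcategory hf _⟩
  obtain ⟨m, ⟨f⟩⟩ := Finite.exists_equiv_fin J
  refine ⟨m, fun s => ⟨G (f.symm s), le_addClosure _ (hG' _)⟩, fun X hX => ?_⟩
  obtain ⟨-, Y, hY, ⟨e⟩⟩ := exists_iso_of_isIndec hf hS hX
  obtain ⟨j, rfl⟩ := hG Y hY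
  refine ⟨f j, ⟨(addClosure S).fullyFaithfulι.preimageIso (e.trans (eqToIso ?_))⟩⟩
  change G j = G (f.symm (f j))
  rw [f.symm_apply_apply]

end FullSubcategories

/-! ### Labelling objects by vertices of the graph. -/

section Shapes
variable {C : Type*} [Category* C] {V W : Type*} {n : ℕ} (M : V → C) (Q : Fin n → W → C)

/-- The members of the family. -/
def familyProp : ObjectProperty C := fun X => (∃ v, X = M v) ∨ ∃ j w, X = Q j w

/-- `X` is isomorphic to a member of the family with index `x`. -/
def HasShape (X : C) (x : V ⊕ W) : Prop :=
  match x with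
  | Sum.inl v => Nonempty (X ≅ M v)
  | Sum.inr w => ∃ j, Nonempty (X ≅ Q j w)

variable {M Q}

theorem HasShape.of_iso {X Y : C} (f : X ≅ Y) {x : V ⊕ W} (h : HasShape M Q Y x) :
    HasShape M Q X x := by
  rcases x with v | w
  · obtain ⟨g⟩ := h
    exact ⟨f.trans g⟩
  · obtain ⟨j, ⟨g⟩⟩ := h
    exact ⟨j, ⟨f.trans g⟩⟩

theorem exists_hasShape {X : C} (hX : familyProp M Q X) : ∃ x, HasShape M Q X x := by
  rcases hX with ⟨v, rfl⟩ | ⟨j, w, rfl⟩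
  · exact ⟨Sum.inl v, ⟨Iso.refl _⟩⟩
  · exact ⟨Sum.inr w, j, ⟨Iso.refl _⟩⟩

end Shapes

/-! ### Families of objects on which the action follows a bipartite graph. -/

section BipartiteFamily
variable {k : Type u} [Field k] {A : Type u} [Ring A] [Algebra k A] [FiniteDimensional k A]
  {C : Type*} [Category* C] [Preadditive C] [Linear k C] (ρ : TwoRep k A C)
  {V W : Type*} (E : V → W → Prop) {n : ℕ} {e : Fin n → A} (he : IsBasicDecomposition e)
  (θ : W → Fin n) (M : V → C) (Q : Fin n → W → C)

/-- A family of pairwise non-equivalent local objects on which the action is given by a bipartite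
graph. -/
structure IsBipartiteFamily : Prop where
  isLocalRing_M : ∀ v, IsLocalRing (End (M v))
  isLocalRing_Q : ∀ j w, IsLocalRing (End (Q j w))
  eq_of_iso_M : ∀ v v', (M v ≅ M v') → v = v'
  isEmpty_iso : ∀ v j w, IsEmpty (M v ≅ Q j w)
  eq_of_iso_Q : ∀ j j' w w', (Q j w ≅ Q j' w') → w = w'
  addClosure_app_M : ∀ a b v, addClosure (fun X => ∃ w, E v w ∧ θ w = b ∧ X = Q a w)
    (ρ.app (projMor k he a b) (M v))
  isSummand_app_M : ∀ a v w, E v w → IsSummand (Q a w) (ρ.app (projMor k he a (θ w)) (M v))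
  addClosure_app_Q : ∀ a b j w, addClosure (fun X => X = Q a w)
    (ρ.app (projMor k he a b) (Q j w))
  isSummand_app_Q : ∀ a j w, IsSummand (Q a w) (ρ.app (projMor k he a j) (Q j w))

variable {ρ E he θ M Q}

namespace IsBipartiteFamily
theorem isLocalRing (h : IsBipartiteFamily ρ E he θ M Q) {X : C} (hX : familyProp M Q X) :
    IsLocalRing (End X) := by
  rcases hX with ⟨v, rfl⟩ | ⟨j, w, rfl⟩
  · exact h.isLocalRing_M v
  · exact h.isLocalRing_Q j w

theorem shape_eq (h : IsBipartiteFamily ρ E he θ M Q) {X : C} {x y : V ⊕ W}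
    (hx : HasShape M Q X x) (hy : HasShape M Q X y) : x = y := by
  rcases x with v | w <;> rcases y with v' | w'
  · exact congrArg _ (h.eq_of_iso_M _ _ (hx.some.symm.trans hy.some))
  · obtain ⟨j, ⟨g⟩⟩ := hy
    exact ((h.isEmpty_iso v j w').false (hx.some.symm.trans g)).elim
  · obtain ⟨j, ⟨g⟩⟩ := hx
    exact ((h.isEmpty_iso v' j w).false (hy.some.symm.trans g)).elim
  · obtain ⟨j, ⟨g⟩⟩ := hx
    obtain ⟨j', ⟨g'⟩⟩ := hy
    exact congrArg _ (h.eq_of_iso_Q _ _ _ _ (g.symm.trans g'))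

/-- The action on a member of the family only involves members above it. -/
theorem addClosure_app (h : IsBipartiteFamily ρ E he θ M Q) (F : ProjCat k A) {X : C} {x : V ⊕ W}
    (hX : HasShape M Q X x) :
    addClosure (fun Y => Y = X ∨ familyProp M Q Y ∧ ∃ y, HasShape M Q Y y ∧ bipLE E x y)
      (ρ.app F X) := by
  refine addClosure_mono ?_ (ρ.addClosure_app (addClosure_projMor he F) X)
  rintro _ ⟨_, rfl | ⟨a, b, rfl⟩, rfl⟩
  · exact le_addClosure _ (Or.inl (ρ.app_one X))
  · rcases x with v | w
    · obtain ⟨g⟩ := hX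
      refine addClosure_of_iso ((ρ.act.obj (projMor k he a b)).obj.mapIso g)
        (addClosure_mono ?_ (h.addClosure_app_M a b v))
      rintro _ ⟨w, hw, -, rfl⟩
      exact le_addClosure _ (Or.inr ⟨Or.inr ⟨a, w, rfl⟩, Sum.inr w, ⟨a, ⟨Iso.refl _⟩⟩,
        Or.inr ⟨v, w, rfl, rfl, hw⟩⟩)
    · obtain ⟨j, ⟨g⟩⟩ := hX
      refine addClosure_of_iso ((ρ.act.obj (projMor k he a b)).obj.mapIso g)
        (addClosure_mono ?_ (h.addClosure_app_Q a b j w))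
      rintro _ rfl
      exact le_addClosure _ (Or.inr ⟨Or.inr ⟨a, w, rfl⟩, Sum.inr w, ⟨a, ⟨Iso.refl _⟩⟩,
        Or.inl rfl⟩)

theorem isStable (h : IsBipartiteFamily ρ E he θ M Q) :
    ρ.IsStable (addClosure (familyProp M Q)) := fun F X hX => by
  refine ρ.addClosure_app_obj F (fun Y hY => ?_) hX
  obtain ⟨y, hy⟩ := exists_hasShape hY
  refine addClosure_mono ?_ (h.addClosure_app F hy)
  rintro Z (rfl | ⟨hZ, -⟩)
  · exact le_addClosure _ hY
  · exact le_addClosure _ hZ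

theorem isSummand_of_bipLE (h : IsBipartiteFamily ρ E he θ M Q) {X Y : C} {x y : V ⊕ W}
    (hX : HasShape M Q X x) (hY : HasShape M Q Y y) (hxy : bipLE E x y) :
    ∃ F : ProjCat k A, IsSummand Y (ρ.app F X) := by
  rcases hxy with rfl | ⟨v, w, rfl, rfl, hE⟩
  · rcases x with v | w
    · obtain ⟨f⟩ := hX
      obtain ⟨g⟩ := hY
      exact ⟨ProjCat.one k A, by rw [ρ.app_one]; exact ⟨.ofIso (g.trans f.symm)⟩⟩
    · obtain ⟨j, ⟨f⟩⟩ := hX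
      obtain ⟨a, ⟨g⟩⟩ := hY
      obtain ⟨r⟩ := h.isSummand_app_Q a j w
      exact ⟨projMor k he a j, ⟨(Retract.ofIso g).trans (r.trans
        (.ofIso ((ρ.act.obj (projMor k he a j)).obj.mapIso f.symm)))⟩⟩
  · obtain ⟨f⟩ := hX
    obtain ⟨a, ⟨g⟩⟩ := hY
    obtain ⟨r⟩ := h.isSummand_app_M a v w hE
    exact ⟨projMor k he a (θ w), ⟨(Retract.ofIso g).trans (r.trans
      (.ofIso ((ρ.act.obj (projMor k he a (θ w))).obj.mapIso f.symm)))⟩⟩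

/-- The local summand `Y` is isomorphic to one of the members that the action on `X` can produce,
and the label of an object is unique. -/
theorem bipLE_of_isSummand (h : IsBipartiteFamily ρ E he θ M Q) {F : ProjCat k A} {X Y : C}
    {x y : V ⊕ W} (hX : HasShape M Q X x) (hY : HasShape M Q Y y) (hX' : IsLocalRing (End X))
    (hY' : IsLocalRing (End Y)) (hs : IsSummand Y (ρ.app F X)) : bipLE E x y := by
  obtain ⟨r⟩ := hs
  obtain ⟨Z, hZ, ⟨r'⟩⟩ := exists_retract_of_addClosure hY'
    (addClosure_of_retract r (h.addClosure_app F hX))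
  have h0 : ¬ Limits.IsZero Y := fun h0 => (isLocalRing_end_iff.1 hY').1 (h0.eq_of_src _ _)
  rcases hZ with rfl | ⟨hZ, z, hz, hxz⟩
  · obtain ⟨f⟩ := nonempty_iso_of_retract h0 hX' r'
    exact Or.inl (h.shape_eq hX (hY.of_iso f.symm))
  · obtain ⟨f⟩ := nonempty_iso_of_retract h0 (h.isLocalRing hZ) r'
    rwa [← h.shape_eq hz (hY.of_iso f.symm)]

end IsBipartiteFamily
end BipartiteFamily

/-! ### The diagram and its decoration. -/

section Diagram
variable {k : Type u} [Field k] {A : Type u} [Ring A] [Algebra k A] [FiniteDimensional k A]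
  {C : Type*} [Category* C] [Preadditive C] [Linear k C] {ρ : TwoRep k A C}
  {V W : Type*} {E : V → W → Prop} {n : ℕ} {e : Fin n → A} {he : IsBasicDecomposition e}
  {θ : W → Fin n} {M : V → C} {Q : Fin n → W → C}

theorem TwoRep.isSummand_restrict {S : ObjectProperty C} (hS : ρ.IsStable S) (F : ProjCat k A)
    (X Y : S.FullSubcategory) :
    IsSummand Y ((ρ.restrict S hS).app F X) ↔ IsSummand Y.obj (ρ.app F X.obj) :=
  ⟨fun ⟨r⟩ => ⟨r.map S.ι⟩, fun ⟨r⟩ => ⟨⟨ObjectProperty.homMk r.i, ObjectProperty.homMk r.r,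
    ObjectProperty.hom_ext _ r.retract⟩⟩⟩

theorem isIndec_fullSubcategory {S : ObjectProperty C} {X : C} (hX : S X)
    (h : IsLocalRing (End X)) : IsIndec (⟨X, hX⟩ : S.FullSubcategory) :=
  isIndec_of_isLocalRing (isLocalRing_end_of_fullyFaithful' S.ι S.fullyFaithfulι h)

namespace IsBipartiteFamily

/-- The indecomposable objects given by the members of the family. -/
def ind (h : IsBipartiteFamily ρ E he θ M Q) {X : C} (hX : familyProp M Q X) :
    (ρ.restrict (addClosure (familyProp M Q)) h.isStable).Ind :=
  ⟨⟨X, le_addClosure _ hX⟩, isIndec_fullSubcategory _ (h.isLocalRing hX)⟩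

variable [IsIdempotentComplete C]

theorem exists_shape (hf : ∀ X Y : C, Module.Finite k (X ⟶ Y))
    (h : IsBipartiteFamily ρ E he θ M Q)
    (X : (ρ.restrict (addClosure (familyProp M Q)) h.isStable).Ind) :
    IsLocalRing (End X.1.obj) ∧ ∃ x, HasShape M Q X.1.obj x := by
  obtain ⟨h1, Y, hY, ⟨f⟩⟩ := exists_iso_of_isIndec hf (fun X hX => h.isLocalRing hX) X.2
  obtain ⟨x, hx⟩ := exists_hasShape hY
  exact ⟨h1, x, hx.of_iso f⟩

theorem le_iff (hf : ∀ X Y : C, Module.Finite k (X ⟶ Y)) (h : IsBipartiteFamily ρ E he θ M Q)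
    {X Y : (ρ.restrict (addClosure (familyProp M Q)) h.isStable).Ind} {x y : V ⊕ W}
    (hX : HasShape M Q X.1.obj x) (hY : HasShape M Q Y.1.obj y) : X ≤ Y ↔ bipLE E x y := by
  constructor
  · rintro ⟨F, hF⟩
    rw [TwoRep.isSummand_restrict] at hF
    exact h.bipLE_of_isSummand hX hY (h.exists_shape hf X).1 (h.exists_shape hf Y).1 hF
  · intro hxy
    obtain ⟨F, hF⟩ := h.isSummand_of_bipLE hX hY hxy
    exact ⟨F, (TwoRep.isSummand_restrict _ _ _ _).2 hF⟩

theorem vertex_eq_iff (hf : ∀ X Y : C, Module.Finite k (X ⟶ Y))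
    (h : IsBipartiteFamily ρ E he θ M Q)
    {X Y : (ρ.restrict (addClosure (familyProp M Q)) h.isStable).Ind} {x y : V ⊕ W}
    (hX : HasShape M Q X.1.obj x) (hY : HasShape M Q Y.1.obj y) :
    TwoRep.vertex _ X = TwoRep.vertex _ Y ↔ x = y := by
  rw [le_antisymm_iff, TwoRep.vertex, TwoRep.vertex,
    toAntisymmetrization_le_toAntisymmetrization_iff,
    toAntisymmetrization_le_toAntisymmetrization_iff]
  constructor
  · rintro ⟨h1, h2⟩
    rcases (h.le_iff hf hX hY).1 h1 with h1 | ⟨v, w, rfl, rfl, -⟩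
    · exact h1
    · rcases (h.le_iff hf hY hX).1 h2 with h2 | ⟨_, _, h2, -, -⟩
      · exact h2.symm
      · exact nomatch h2
  · rintro rfl
    exact ⟨(h.le_iff hf hX hY).2 (Or.inl rfl), (h.le_iff hf hY hX).2 (Or.inl rfl)⟩

/-- The diagram is the given bipartite graph. -/
theorem exists_iso (hf : ∀ X Y : C, Module.Finite k (X ⟶ Y))
    (h : IsBipartiteFamily ρ E he θ M Q) :
    ∃ φ : bipGraph E ≃g (ρ.restrict (addClosure (familyProp M Q)) h.isStable).diagram,
      (∀ x y, φ x ≤ φ y ↔ bipLE E x y) ∧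
      ∀ x (X : (ρ.restrict (addClosure (familyProp M Q)) h.isStable).Ind),
        HasShape M Q X.1.obj x ↔ φ x = TwoRep.vertex _ X := by
  have hrep : ∀ x : V ⊕ W, ∃ X : (ρ.restrict (addClosure (familyProp M Q)) h.isStable).Ind,
      HasShape M Q X.1.obj x := by
    rintro (v | w)
    · exact ⟨h.ind (Or.inl ⟨v, rfl⟩), ⟨Iso.refl _⟩⟩
    · exact ⟨h.ind (Or.inr ⟨θ w, w, rfl⟩), θ w, ⟨Iso.refl _⟩⟩
  choose rep hrep using hrep
  let φ : V ⊕ W ≃ (ρ.restrict (addClosure (familyProp M Q)) h.isStable).Vertex :=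
    Equiv.ofBijective (fun x => TwoRep.vertex _ (rep x))
      ⟨fun x y hxy => (h.vertex_eq_iff hf (hrep x) (hrep y)).1 hxy, fun Y => by
        induction Y using Antisymmetrization.ind with
        | _ Y =>
          obtain ⟨-, y, hy⟩ := h.exists_shape hf Y
          exact ⟨y, (h.vertex_eq_iff hf (hrep y) hy).2 rfl⟩⟩
  have hφ : ∀ x y, φ x ≤ φ y ↔ bipLE E x y := fun x y => h.le_iff hf (hrep x) (hrep y)
  obtain ⟨ψ, hψ⟩ : ∃ ψ : bipGraph E ≃g
      (ρ.restrict (addClosure (familyProp M Q)) h.isStable).diagram, ∀ x, ψ x = φ x :=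
    nonempty_bipGraph_iso φ hφ
  refine ⟨ψ, fun x y => by rw [hψ, hψ, hφ], fun x X => ?_⟩
  rw [hψ]
  obtain ⟨-, y, hy⟩ := h.exists_shape hf X
  change _ ↔ TwoRep.vertex _ (rep x) = _
  rw [h.vertex_eq_iff hf (hrep x) hy]
  constructor
  · exact fun hx => h.shape_eq hx hy
  · rintro rfl
    exact hy

/-- F_{ab}M_v contains an object of class `w` only if `θ w = b`, while `a` is arbitrary. So exactly
the F_{aθ(w)} occur, and these form the left cell. -/
theorem decoration_eq [IsAlgClosed k] (hconn : IsConnectedAlgebra A)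
    (hf : ∀ X Y : C, Module.Finite k (X ⟶ Y)) (h : IsBipartiteFamily ρ E he θ M Q)
    {σ τ : (ρ.restrict (addClosure (familyProp M Q)) h.isStable).Vertex} {v : V} {w : W}
    (hE : E v w)
    (hσ : ∀ X : (ρ.restrict (addClosure (familyProp M Q)) h.isStable).Ind,
      HasShape M Q X.1.obj (Sum.inl v) ↔ σ = TwoRep.vertex _ X)
    (hτ : ∀ X : (ρ.restrict (addClosure (familyProp M Q)) h.isStable).Ind,
      HasShape M Q X.1.obj (Sum.inr w) ↔ τ = TwoRep.vertex _ X) :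
    TwoRep.decoration _ σ τ = leftCell (projMor k he (θ w) (θ w)) := by
  ext F
  rw [mem_leftCell_iff he (θ w) F]
  constructor
  · rintro ⟨hF, X, Y, hX, hY, hs⟩
    rw [TwoRep.isSummand_restrict] at hs
    have hX' := (hσ X).2 hX.symm
    have hY' := (hτ Y).2 hY.symm
    obtain ⟨r⟩ := hs
    have hXloc := (h.exists_shape hf X).1
    have hYloc := (h.exists_shape hf Y).1
    have h0 : ¬ Limits.IsZero Y.1.obj := fun h0 =>
      (isLocalRing_end_iff.1 hYloc).1 (h0.eq_of_src _ _)
    -- The identity cannot occur: it would make an object of class `v` isomorphic to one of class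
    -- `w`.
    rcases hF.nonempty_iso he hconn with ⟨⟨f⟩⟩ | ⟨a, b, ⟨f⟩⟩
    · have r' : Retract Y.1.obj X.1.obj := r.trans (.ofIso ((ρ.appIso f X.1.obj).trans
        (eqToIso (ρ.app_one X.1.obj))))
      obtain ⟨g⟩ := nonempty_iso_of_retract h0 hXloc r'
      exact nomatch h.shape_eq hX' (hY'.of_iso g.symm)
    · obtain ⟨g⟩ := hX'
      have r' : Retract Y.1.obj (ρ.app (projMor k he a b) (M v)) :=
        r.trans (.ofIso ((ρ.appIso f X.1.obj).trans
          ((ρ.act.obj (projMor k he a b)).obj.mapIso g)))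
      obtain ⟨Z, ⟨w', hw', hb, rfl⟩, ⟨s⟩⟩ := exists_retract_of_addClosure hYloc
        (addClosure_of_retract r' (h.addClosure_app_M a b v))
      obtain ⟨g'⟩ := nonempty_iso_of_retract h0 (h.isLocalRing_Q a w') s
      have hw : Sum.inr w = (Sum.inr w' : V ⊕ W) := h.shape_eq hY' ⟨a, ⟨g'⟩⟩
      obtain rfl := Sum.inr_injective hw
      exact ⟨a, ⟨hb ▸ f⟩⟩
  · rintro ⟨a, ⟨f⟩⟩
    refine ⟨(isIndec_of_isLocalRing (isLocalRing_end_projMor he a (θ w))).of_iso f.symm,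
      h.ind (Or.inl ⟨v, rfl⟩), h.ind (Or.inr ⟨a, w, rfl⟩), ((hσ _).1 ⟨Iso.refl _⟩).symm,
      ((hτ _).1 ⟨a, ⟨Iso.refl _⟩⟩).symm, ?_⟩
    rw [TwoRep.isSummand_restrict]
    obtain ⟨r⟩ := h.isSummand_app_M a v w hE
    exact ⟨r.trans (.ofIso (ρ.appIso f.symm (M v)))⟩

/-- The action on the additive closure of the family. -/
theorem exists_diagram_iso [IsAlgClosed k] [Limits.HasFiniteBiproducts C] [Finite V] [Finite W]
    (hconn : IsConnectedAlgebra A) (hf : ∀ X Y : C, Module.Finite k (X ⟶ Y))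
    (h : IsBipartiteFamily ρ E he θ M Q) {S : ObjectProperty C}
    (hS : S = addClosure (familyProp M Q)) :
    ∃ hS : ρ.IsStable S, IsFinitary k S.FullSubcategory ∧
      ∃ φ : bipGraph E ≃g (ρ.restrict S hS).diagram,
        (∀ v, ∃ X : (ρ.restrict S hS).Ind,
          Nonempty (X.1.obj ≅ M v) ∧ φ (Sum.inl v) = TwoRep.vertex _ X) ∧
        (∀ w j, ∃ X : (ρ.restrict S hS).Ind,
          Nonempty (X.1.obj ≅ Q j w) ∧ φ (Sum.inr w) = TwoRep.vertex _ X) ∧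
        ∀ v w, E v w → φ (Sum.inl v) ≤ φ (Sum.inr w) ∧
          TwoRep.decoration _ (φ (Sum.inl v)) (φ (Sum.inr w)) =
            leftCell (projMor k he (θ w) (θ w)) := by
  subst hS
  obtain ⟨φ, hle, hφ⟩ := h.exists_iso hf
  refine ⟨h.isStable, ?_, φ, fun v => ?_, fun w j => ?_, fun v w hE => ⟨?_, ?_⟩⟩
  · exact isFinitary_addClosure (J := V ⊕ (Fin n × W)) hf (fun X hX => h.isLocalRing hX)
      (Sum.elim M fun p => Q p.1 p.2)
      (by rintro _ (⟨v, rfl⟩ | ⟨j, w, rfl⟩); exacts [⟨Sum.inl v, rfl⟩, ⟨Sum.inr (j, w), rfl⟩])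
      (by rintro (v | ⟨j, w⟩); exacts [Or.inl ⟨v, rfl⟩, Or.inr ⟨j, w, rfl⟩])
  · exact ⟨h.ind (Or.inl ⟨v, rfl⟩), ⟨Iso.refl _⟩, (hφ _ _).1 ⟨Iso.refl _⟩⟩
  · exact ⟨h.ind (Or.inr ⟨j, w, rfl⟩), ⟨Iso.refl _⟩, (hφ _ _).1 ⟨j, ⟨Iso.refl _⟩⟩⟩
  · exact (hle _ _).2 (Or.inr ⟨v, w, rfl, rfl, hE⟩)
  · exact h.decoration_eq hconn hf hE (hφ _) (hφ _)

end IsBipartiteFamily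
end Diagram

/-! ### The glued objects form a bipartite family. -/

section GluingData
variable {k : Type u} [Field k] [IsAlgClosed k] {A : Type u} [Ring A] [Algebra k A]
  [FiniteDimensional k A] {V W : Type*} [Finite V] [Finite W] {E : V → W → Prop} {n : ℕ}
  {e : Fin n → A} {he : IsBasicDecomposition e} {ν : Equiv.Perm (Fin n)}
  {η : ∀ v w, E v w → Fin n} {c : GluingData k he ν E η} {θ : W → Fin n}

theorem GluingData.isBipartiteFamily (hP : IsProjectiveFamily k (indProj (k := k) E he))
    (hd : ∀ i, Nonempty (DualBases k e ν i)) (hθ : ∀ v w (h : E v w), θ w = η v w h) :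
    IsBipartiteFamily (ambient k A E) E he θ c.M (c.Q θ) where
  isLocalRing_M := isLocalRing_end_M hP
  isLocalRing_Q := isLocalRing_end_Q hP hd θ
  eq_of_iso_M _ _ := eq_of_iso_M hP
  isEmpty_iso := isEmpty_iso_M_Q hP hd θ
  eq_of_iso_Q _ _ _ _ := eq_of_iso_Q hP hd θ
  addClosure_app_M := addClosure_app_M hP hd hθ
  isSummand_app_M a _ _ := isSummand_app_M hP hd hθ a
  addClosure_app_Q := addClosure_app_Q
  isSummand_app_Q := isSummand_app_Q

end GluingData

end ProjFunctors
end

theorem proposition91 {k : Type u} [Field k] [IsAlgClosed k] {A : Type u} [Ring A] [Algebra k A]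
    [FiniteDimensional k A] (hconn : IsConnectedAlgebra A) (hns : ¬ IsSimpleRing A)
    (hinj : Module.Injective A A) {n : ℕ} (e : Fin n → A) (he : IsBasicDecomposition e)
    {V W : Type*} [Finite V] [Finite W] (E : V → W → Prop) (η : ∀ v w, E v w → Fin n)
    (hη : ∀ v₁ v₂ w (h₁ : E v₁ w) (h₂ : E v₂ w), η v₁ w h₁ = η v₂ w h₂) :
    ∃ ν : Equiv.Perm (Fin n), IsNakayamaPermutation e ν ∧
      (∃ θ : W → Fin n, ∀ v w (h : E v w), θ w = η v w h) ∧
      Nonempty (GluingData k he ν E η) ∧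
      ∀ (θ : W → Fin n), (∀ v w (h : E v w), θ w = η v w h) →
      ∀ c : GluingData k he ν E η,
        ∃ hS : (ambient k A E).IsStable (c.𝒳 θ),
          IsFinitary k (c.𝒳 θ).FullSubcategory ∧
          ∃ φ : bipGraph E ≃g ((ambient k A E).restrict (c.𝒳 θ) hS).diagram,
            (∀ v, ∃ X : ((ambient k A E).restrict (c.𝒳 θ) hS).Ind,
              Nonempty (X.1.obj ≅ c.M v) ∧ φ (Sum.inl v) = TwoRep.vertex _ X) ∧
            (∀ w j, ∃ X : ((ambient k A E).restrict (c.𝒳 θ) hS).Ind,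
              Nonempty (X.1.obj ≅ c.Q θ j w) ∧ φ (Sum.inr w) = TwoRep.vertex _ X) ∧
            ∀ v w (h : E v w), φ (Sum.inl v) ≤ φ (Sum.inr w) ∧
              TwoRep.decoration _ (φ (Sum.inl v)) (φ (Sum.inr w)) =
                leftCell (projMor k he (η v w h) (η v w h)) := by
  classical
  have hP := isProjectiveFamily_indProj E he (k := k) hconn hns
  obtain ⟨ν, s, hs, hess⟩ := exists_nakayama (k := k) hinj he
  have hd := nonempty_dualBases (k := k) he ν s hs hess
  have : Limits.HasFiniteBiproducts (Ambient k A E) := Abelian.hasFiniteBiproducts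
  -- Needed for the values of `θ` at isolated lower vertices; the unit of `A` is an empty sum if `n
  -- = 0`.
  have hn : Nonempty (Fin n) := by
    have := hconn.1
    by_contra hn
    rw [not_nonempty_iff] at hn
    exact one_ne_zero (α := A) (by rw [← he.complete, Finset.univ_eq_empty, Finset.sum_empty])
  refine ⟨ν, fun i => ⟨s i, (hs i).1, ?_, (hs i).2.2.2⟩, ?_, nonempty_gluingData hconn hP hd η,
    fun θ hθ c => ?_⟩
  · rw [(hs i).2.1, (hs i).2.2.1]
  · refine ⟨fun w => if h : ∃ v, E v w then η h.choose w h.choose_spec else hn.some,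
      fun v w h => ?_⟩
    have h' : ∃ v, E v w := ⟨v, h⟩
    dsimp only
    rw [dif_pos h']
    exact hη _ _ _ _ _
  · obtain ⟨hS, hfin, φ, h1, h2, h3⟩ := (c.isBipartiteFamily hP hd hθ).exists_diagram_iso hconn
      (Ambient.finite_hom k A E) (S := c.𝒳 θ) rfl
    refine ⟨hS, hfin, φ, h1, h2, fun v w h => ?_⟩
    rw [← hθ v w h]
    exact h3 v w h
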